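/- **Setting.** Let $\mathbf k$ be an algebraically closed field of characteristic $0$, let $p\in\mathbf k^\times$ with $p\neq\pm1$, and let $I\subset\mathbf k^\times$ be a subset with $1,-1\notin I$ that is stable under $z\mapsto z^{\pm1}p^{2n}$ for all $n\in\mathbb Z$. Let $\Gamma$ be the quiver with vertex set $I$ and exactly one arrow $p^2i\to i$ for each $i\in I$, and let $\theta(i)=i^{-1}$. For $i,j\in I$ let $h_{i,j}$ be the number of arrows from $i$ to $j$. Put $Q_{i,i}(u,v)=0$ and $Q_{i,j}(u,v)=(-1)^{h_{i,j}}(u-v)^{h_{i,j}+h_{j,i}}$ for $i\ne j$. Let $m\geq1$. For $m>1$ and $0\le k\le m-1$ the simple reflection $s_k$ acts on $\{1-m,\dots,m-1,m\}$ as follows: for $k\ge1$ it exchanges $k$ with $k+1$ and $1-k$ with $-k$; $s_0$ exchanges $0$ with $2$ and $1$ with $-1$; all other elements are fixed. So $s_k(k)=k+1$ for $k\geq1$ and $s_0(0)=2$. For $m=1$ there are no $s_k$ (and below no $\sigma_k$, $T_k$). **The algebra ${}^\circ\mathbf R_m$.** Let $\nu\in\mathbb N I$ be $\theta$-invariant with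 $|\nu|=2m$. Let ${}^\theta I^\nu$ be the set of sequences $\mathbf i=(i_{1-m},\dots,i_m)$ in $I$ with $\theta(i_l)=i_{1-l}$ and $\sum_l i_l=\nu$, with $s_k\mathbf i=\mathbf i\circ s_k^{-1}$. Let ${}^\circ\mathbf R_\nu$ be the unital $\mathbf k$-algebra generated by $1_{\mathbf i}$ ($\mathbf i\in{}^\theta I^\nu$), $\varkappa_l$ ($1\le l\le m$), $\sigma_k$ ($0\le k\le m-1$), where $\varkappa_{1-l}:=-\varkappa_l$, with defining relations * $1_{\mathbf i}1_{\mathbf i'}=\delta_{\mathbf i,\mathbf i'}1_{\mathbf i}$, $\sum_{\mathbf i}1_{\mathbf i}=1$, $\sigma_k1_{\mathbf i}=1_{s_k\mathbf i}\sigma_k$, $\varkappa_l1_{\mathbf i}=1_{\mathbf i}\varkappa_l$, $\varkappa_l\varkappa_{l'}=\varkappa_{l'}\varkappa_l$; * $\sigma_k^21_{\mathbf i}=Q_{i_k,i_{s_k(k)}}(\varkappa_{s_k(k)},\varkappa_k)1_{\mathbf i}$; * $\sigma_k\sigma_{k'}=\sigma_{k'}\sigma_k$ if $1\le k<k'-1$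 or $0=k<k'\ne2$; * if $k':=s_k(k)\le m-1$, then $(\sigma_{k'}\sigma_k\sigma_{k'}-\sigma_k\sigma_{k'}\sigma_k)1_{\mathbf i}$ equals $\dfrac{Q_{i_k,i_{k'}}(\varkappa_{k'},\varkappa_k)-Q_{i_k,i_{k'}}(\varkappa_{k'},\varkappa_{k'+1})}{\varkappa_k-\varkappa_{k'+1}}1_{\mathbf i}$ if $i_k=i_{k'+1}$, and $0$ otherwise; * if $i_k=i_{s_k(k)}$, then $(\sigma_k\varkappa_k-\varkappa_{s_k(k)}\sigma_k)1_{\mathbf i}=-1_{\mathbf i}$ and $(\sigma_k\varkappa_{s_k(k)}-\varkappa_k\sigma_k)1_{\mathbf i}=1_{\mathbf i}$; and $(\sigma_k\varkappa_l-\varkappa_{s_k(l)}\sigma_k)1_{\mathbf i}=0$ if $i_k\ne i_{s_k(k)}$ (all $l$) or if $l\notin\{k,\,s_k(k),\,1-k,\,1-s_k(k)\}$. Let ${}^\circ\mathbf R_m=\bigoplus_\nu{}^\circ\mathbf R_\nu$, an algebra that may have no unit. Let ${}^\circ\mathbf R_m\text{-}\mathbf{Mod}_0$ be the category of (non-graded)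 ${}^\circ\mathbf R_m$-modules $M$ with $M=\bigoplus_{\mathbf i}1_{\mathbf i}M$ on which $\varkappa_1,\dots,\varkappa_m$ act locally nilpotently. **The affine Hecke algebra.** Let $\mathbf H_m$ be the affine Hecke algebra of $SO(2m)$: the unital $\mathbf k$-algebra generated by $T_k$ ($0\le k\le m-1$) and $X_l^{\pm1}$ ($1\le l\le m$), where $X_{1-l}:=X_l^{-1}$, with defining relations $X_lX_{l'}=X_{l'}X_l$; $T_kT_{k'}T_k=T_{k'}T_kT_{k'}$ if $k'=s_k(k)\leq m-1$; $T_kT_{k'}=T_{k'}T_k$ if $1\le k<k'-1$ or $k=0$, $k'\neq2$; $(T_k-p)(T_k+p^{-1})=0$; $T_kX_kT_k=X_{s_k(k)}$; $T_kX_l=X_lT_k$ if $l\notin\{k,s_k(k),1-k,1-s_k(k)\}$. Let $\mathbf H_m\text{-}\mathbf{Mod}_I$ be the category of $\mathbf H_m$-modules on which the action of $X_1,\dots,X_m$ is locally finite with eigenvalues in $I$. **Theorem 2.6.** Let $f(\varkappa)\in\mathbf k[[\varkappa]]$ with $f(\varkappa)\equiv1+\varkappa$ modulo $(\varkappa^2)$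 and, if $m>1$, with $f(\varkappa)f(-\varkappa)=1$. There is an equivalence of categories $${}^\circ\mathbf R_m\text{-}\mathbf{Mod}_0\to\mathbf H_m\text{-}\mathbf{Mod}_I,\qquad M\mapsto M,$$ which is the identity on underlying $\mathbf k$-vector spaces and linear maps (up to natural isomorphism), and is given as follows. (a) $X_l$ acts on $1_{\mathbf i}M$ by $i_l^{-1}f(\varkappa_l)$ for $l=1,\dots,m$. (b) If $m>1$ and $0\le k\le m-1$, write $k'=s_k(k)$. Then $T_k$ acts on $1_{\mathbf i}M$ by $$\frac{(pf(\varkappa_k)-p^{-1}f(\varkappa_{k'}))(\varkappa_k-\varkappa_{k'})}{f(\varkappa_k)-f(\varkappa_{k'})}\,\sigma_k+p\qquad\text{if } i_{k'}=i_k,$$ $$\frac{f(\varkappa_k)-f(\varkappa_{k'})}{(p^{-1}f(\varkappa_k)-pf(\varkappa_{k'}))(\varkappa_k-\varkappa_{k'})}\,\sigma_k+\frac{(p^{-2}-1)f(\varkappa_{k'})}{pf(\varkappa_k)-p^{-1}f(\varkappa_{k'})}\qquad\text{if } i_{k'}=p^2i_k,$$ $$\frac{pi_kf(\varkappa_k)-p^{-1}i_{k'}f(\varkappa_{k'})}{i_kf(\varkappa_k)-i_{k'}f(\varkappa_{k'})}\,\sigma_k+\frac{(p^{-1}-p)i_kf(\varkappa_{k'})}{i_{k'}f(\varkappa_k)-i_kf(\varkappa_{k'})}\qquad\text{if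 } i_{k'}\ne i_k,\,p^2i_k,$$ where the quotients are power series in the two variables $\varkappa_k,\varkappa_{k'}$. -/

import Mathlib

open CategoryTheory
open scoped ModuleCat

universe u w

namespace TypeD

/-! ### Signed positions and the simple reflections of type `D` -/

/-- The set `{1 - m, …, m - 1, m}` of signed positions. -/
abbrev Pos (m : ℕ) : Type := {l : ℤ // 1 - (m : ℤ) ≤ l ∧ l ≤ m}

noncomputable instance (m : ℕ) : Fintype (Pos m) :=
  Fintype.subtype (Finset.Icc (1 - (m : ℤ)) m) fun _ => Finset.mem_Icc

/-- The involution `l ↦ 1 - l` of the set of signed positions. -/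
def Pos.neg {m : ℕ} (l : Pos m) : Pos m := ⟨1 - l.1, by have := l.2; omega⟩

/-- The indices `k = 0, 1, …, m - 1` of the simple reflections; there are none unless `m > 1`. -/
abbrev Ref (m : ℕ) : Type := {k : ℕ // 1 < m ∧ k < m}

/-- The index `k` of a simple reflection, viewed as a signed position. -/
def Ref.lo {m : ℕ} (k : Ref m) : Pos m := ⟨(k.1 : ℤ), by have := k.2; omega⟩

/-- The signed position `s_k(k)`: it is `2` for `k = 0` and `k + 1` for `k ≥ 1`. -/
def Ref.hi {m : ℕ} (k : Ref m) : Pos m :=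
  ⟨if k.1 = 0 then 2 else (k.1 : ℤ) + 1, by have := k.2; split_ifs <;> omega⟩

/-- The simple reflection `s_k` acting on the signed positions. For `k ≥ 1` it exchanges
`k, k + 1` and `1 - k, -k`; and `s_0 = ε_1 s_1 ε_1` exchanges `0, 2` and `1, -1`. -/
def refl {m : ℕ} (k : Ref m) : Equiv.Perm (Pos m) :=
  Equiv.swap k.lo k.hi * Equiv.swap k.lo.neg k.hi.neg

theorem refl_lo {m : ℕ} (k : Ref m) : refl k k.lo = k.hi := by
  have h1 : k.lo ≠ k.lo.neg := by
    intro h; have := congrArg Subtype.val h; simp only [Ref.lo, Pos.neg] at this; omega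
  have h2 : k.lo ≠ k.hi.neg := by
    intro h; have := congrArg Subtype.val h
    simp only [Ref.lo, Ref.hi, Pos.neg] at this; split_ifs at this <;> omega
  simp [refl, Equiv.swap_apply_of_ne_of_ne h1 h2]

theorem refl_neg {m : ℕ} (k : Ref m) (l : Pos m) : refl k l.neg = (refl k l).neg := by
  have hk := k.2
  have hl := l.2
  apply Subtype.ext
  simp only [refl, Equiv.Perm.mul_apply, Equiv.swap_apply_def, Pos.neg, Ref.lo, Ref.hi,
    Subtype.ext_iff, apply_ite Subtype.val]
  grind

theorem refl_refl {m : ℕ} (k : Ref m) : (refl k)⁻¹ = refl k := by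
  rw [inv_eq_iff_mul_eq_one]
  ext l
  have hk := k.2
  have hl := l.2
  simp only [refl, Equiv.Perm.mul_apply, Equiv.swap_apply_def, Pos.neg, Ref.lo, Ref.hi,
    Subtype.ext_iff, apply_ite Subtype.val, Equiv.Perm.one_apply]
  grind

/-! ### Dimension vectors and sequences -/

section Quiver

variable {V : Type u} (θ : V → V)

/-- The `θ`-invariant dimension vectors `ν ∈ ℕ V` with `|ν| = 2m`. -/
abbrev DimVec (m : ℕ) : Type u :=
  {ν : V →₀ ℕ // (∀ i, ν (θ i) = ν i) ∧ (ν.sum fun _ n => n) = 2 * m}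

/-- The sequences `(i_{1-m}, …, i_m)` of vertices with `θ(i_l) = i_{1-l}` and `∑_l i_l = ν`. -/
abbrev Seq (m : ℕ) (ν : V →₀ ℕ) : Type u :=
  {i : Pos m → V // (∀ l, θ (i l) = i l.neg) ∧ ∑ l, Finsupp.single (i l) 1 = ν}

variable {θ}

/-- There are only finitely many sequences with a given dimension vector. -/
theorem finite_seq (m : ℕ) (ν : V →₀ ℕ) : Finite (Seq θ m ν) := by
  refine Finite.of_injective
    (fun (i : Seq θ m ν) (l : Pos m) => (⟨i.1 l, ?_⟩ : ν.support)) ?_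
  · have h := DFunLike.congr_fun i.2.2 (i.1 l)
    rw [Finsupp.mem_support_iff, ← h, Finsupp.finsetSum_apply]
    refine (Finset.sum_pos' (fun _ _ => Nat.zero_le _) ⟨l, Finset.mem_univ _, ?_⟩).ne'
    simp
  · intro i j hij
    apply Subtype.ext
    funext l
    exact congrArg Subtype.val (congrFun hij l)

/-- The action `s_k(𝐢) = 𝐢 ∘ s_k⁻¹` of the simple reflections on sequences. -/
def Seq.act {m : ℕ} {ν : V →₀ ℕ} (k : Ref m) (i : Seq θ m ν) : Seq θ m ν :=
  ⟨i.1 ∘ ⇑(refl k)⁻¹, by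
    refine ⟨fun l => ?_, ?_⟩
    · simp only [Function.comp, refl_refl, refl_neg]
      exact i.2.1 _
    · exact (Equiv.sum_comp (refl k)⁻¹ fun l => Finsupp.single (i.1 l) 1).trans i.2.2⟩

end Quiver

/-! ### The algebra attached to a quiver with involution

The quiver enters only through its set `V` of vertices, the involution `θ` of `V`, and the number
`h i j` of arrows from `i` to `j`. -/

section KLR

open Classical in
/-- `Q_{i,j}(a, b) = (-1)^{h_{i,j}} (a - b)^{-i·j}` for `i ≠ j`, where `-i·j = h_{i,j} + h_{j,i}`,
and `Q_{i,i}(a, b) = 0`. -/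
noncomputable def Q {V : Type*} (h : V → V → ℕ) {A : Type*} [Ring A] (i j : V) (a b : A) : A :=
  if i = j then 0 else (-1) ^ h i j * (a - b) ^ (h i j + h j i)

open Classical in
/-- The polynomial `(Q_{i,j}(a, b) - Q_{i,j}(a, c)) / (b - c)`, written out. -/
noncomputable def QDiff {V : Type*} (h : V → V → ℕ) {A : Type*} [Ring A] (i j : V)
    (a b c : A) : A :=
  if i = j then 0 else
    -((-1) ^ h i j *
      ∑ r ∈ Finset.range (h i j + h j i), (a - b) ^ r * (a - c) ^ (h i j + h j i - 1 - r))

/-- `QDiff` is the quotient that it is said to be. -/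
theorem QDiff_mul {V : Type*} (h : V → V → ℕ) {A : Type*} [CommRing A] (i j : V) (a b c : A) :
    QDiff h i j a b c * (b - c) = Q h i j a b - Q h i j a c := by
  unfold QDiff Q
  split_ifs
  · simp
  · have := (Commute.all (a - b) (a - c)).geom_sum₂_mul (h i j + h j i)
    linear_combination (-1) ^ h i j * this

/-- The generators `1_𝐢`, `ϰ_l`, `σ_k`. -/
inductive RGen {V : Type u} (θ : V → V) (m : ℕ) (ν : V →₀ ℕ) : Type u
  | idem (i : Seq θ m ν)
  | kap (l : Pos m)
  | sig (k : Ref m)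

variable (𝕜 : Type u) [Field 𝕜] {V : Type u} (θ : V → V) (h : V → V → ℕ) (m : ℕ) (ν : V →₀ ℕ)

/-- `1_𝐢` in the free algebra. -/
abbrev e1 {θ : V → V} {m : ℕ} {ν : V →₀ ℕ} (i : Seq θ m ν) : FreeAlgebra 𝕜 (RGen θ m ν) :=
  FreeAlgebra.ι 𝕜 (RGen.idem i)

/-- `ϰ_l` in the free algebra. -/
abbrev eκ (l : Pos m) : FreeAlgebra 𝕜 (RGen θ m ν) := FreeAlgebra.ι 𝕜 (RGen.kap l)

/-- `σ_k` in the free algebra. -/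
abbrev eσ (k : Ref m) : FreeAlgebra 𝕜 (RGen θ m ν) := FreeAlgebra.ι 𝕜 (RGen.sig k)

/-- The defining relations. The symbols `ϰ_l` with `l ≤ 0` stand for `-ϰ_{1-l}` (`kap_neg`). -/
inductive RRel : FreeAlgebra 𝕜 (RGen θ m ν) → FreeAlgebra 𝕜 (RGen θ m ν) → Prop
  | one : RRel (∑ᶠ i : Seq θ m ν, e1 𝕜 i) 1
  | idem_self (i : Seq θ m ν) : RRel (e1 𝕜 i * e1 𝕜 i) (e1 𝕜 i)
  | idem_ne (i j : Seq θ m ν) (hij : i ≠ j) : RRel (e1 𝕜 i * e1 𝕜 j) 0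
  | sig_idem (k : Ref m) (i : Seq θ m ν) :
      RRel (eσ 𝕜 θ m ν k * e1 𝕜 i) (e1 𝕜 (i.act k) * eσ 𝕜 θ m ν k)
  | kap_idem (l : Pos m) (i : Seq θ m ν) :
      RRel (eκ 𝕜 θ m ν l * e1 𝕜 i) (e1 𝕜 i * eκ 𝕜 θ m ν l)
  | kap_neg (l : Pos m) : RRel (eκ 𝕜 θ m ν l.neg) (-eκ 𝕜 θ m ν l)
  | kap_comm (l l' : Pos m) :
      RRel (eκ 𝕜 θ m ν l * eκ 𝕜 θ m ν l') (eκ 𝕜 θ m ν l' * eκ 𝕜 θ m ν l)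
  | sig_sq (k : Ref m) (i : Seq θ m ν) :
      RRel (eσ 𝕜 θ m ν k ^ 2 * e1 𝕜 i)
        (Q h (i.1 k.lo) (i.1 k.hi) (eκ 𝕜 θ m ν k.hi) (eκ 𝕜 θ m ν k.lo) * e1 𝕜 i)
  | sig_comm (k k' : Ref m)
      (hk : (1 ≤ k.1 ∧ k.1 + 1 < k'.1) ∨ (k.1 = 0 ∧ 0 < k'.1 ∧ k'.1 ≠ 2)) :
      RRel (eσ 𝕜 θ m ν k * eσ 𝕜 θ m ν k') (eσ 𝕜 θ m ν k' * eσ 𝕜 θ m ν k)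
  /- Here `k' = s_k(k)`, and `k'.hi = s_k(k) + 1`. -/
  | braid_eq (k k' : Ref m) (hk : k'.lo = k.hi) (i : Seq θ m ν) (hi : i.1 k.lo = i.1 k'.hi) :
      RRel
        ((eσ 𝕜 θ m ν k' * eσ 𝕜 θ m ν k * eσ 𝕜 θ m ν k'
          - eσ 𝕜 θ m ν k * eσ 𝕜 θ m ν k' * eσ 𝕜 θ m ν k) * e1 𝕜 i)
        (QDiff h (i.1 k.lo) (i.1 k.hi)
          (eκ 𝕜 θ m ν k.hi) (eκ 𝕜 θ m ν k.lo) (eκ 𝕜 θ m ν k'.hi) * e1 𝕜 i)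
  | braid_ne (k k' : Ref m) (hk : k'.lo = k.hi) (i : Seq θ m ν) (hi : i.1 k.lo ≠ i.1 k'.hi) :
      RRel
        ((eσ 𝕜 θ m ν k' * eσ 𝕜 θ m ν k * eσ 𝕜 θ m ν k'
          - eσ 𝕜 θ m ν k * eσ 𝕜 θ m ν k' * eσ 𝕜 θ m ν k) * e1 𝕜 i) 0
  | sig_kap_lo (k : Ref m) (i : Seq θ m ν) (hi : i.1 k.lo = i.1 k.hi) :
      RRel ((eσ 𝕜 θ m ν k * eκ 𝕜 θ m ν k.lo - eκ 𝕜 θ m ν k.hi * eσ 𝕜 θ m ν k) * e1 𝕜 i)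
        (-e1 𝕜 i)
  | sig_kap_hi (k : Ref m) (i : Seq θ m ν) (hi : i.1 k.lo = i.1 k.hi) :
      RRel ((eσ 𝕜 θ m ν k * eκ 𝕜 θ m ν k.hi - eκ 𝕜 θ m ν k.lo * eσ 𝕜 θ m ν k) * e1 𝕜 i)
        (e1 𝕜 i)
  | sig_kap_ne (k : Ref m) (i : Seq θ m ν) (hi : i.1 k.lo ≠ i.1 k.hi) (l : Pos m) :
      RRel ((eσ 𝕜 θ m ν k * eκ 𝕜 θ m ν l - eκ 𝕜 θ m ν (refl k l) * eσ 𝕜 θ m ν k) * e1 𝕜 i) 0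
  | sig_kap_else (k : Ref m) (i : Seq θ m ν) (l : Pos m)
      (hl : l ≠ k.lo ∧ l ≠ k.hi ∧ l ≠ k.lo.neg ∧ l ≠ k.hi.neg) :
      RRel ((eσ 𝕜 θ m ν k * eκ 𝕜 θ m ν l - eκ 𝕜 θ m ν (refl k l) * eσ 𝕜 θ m ν k) * e1 𝕜 i) 0

/-- The algebra `°R(Γ)_ν`, for `|ν| = 2m` and `m ≥ 1`. For `m = 1` there are no `σ_k`, and it is
`𝕜[ϰ_1] 1_𝐢 ⊕ 𝕜[ϰ_1] 1_{θ(𝐢)}`. -/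
abbrev RNu : Type u := RingQuot (RRel 𝕜 θ h m ν)

/-- The direct sum `°R_m = ⨁_ν °R(Γ)_ν` over all dimension vectors with `|ν| = 2m`: the families
with finitely many nonzero components, an algebra that need not have a unit. -/
def RTot : NonUnitalSubalgebra 𝕜 (∀ ν : DimVec θ m, RNu 𝕜 θ h m ν.1) where
  carrier := {a : ∀ ν : DimVec θ m, RNu 𝕜 θ h m ν.1 | {ν | a ν ≠ 0}.Finite}
  add_mem' {a b} (ha : {ν | a ν ≠ 0}.Finite) (hb : {ν | b ν ≠ 0}.Finite) :=
    (ha.union hb).subset fun ν (hν : a ν + b ν ≠ 0) => by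
      by_contra h0
      simp only [Set.mem_union, Set.mem_ofPred_eq, not_or, not_not] at h0
      exact hν (by rw [h0.1, h0.2, add_zero])
  zero_mem' := by
    change {ν : DimVec θ m | (0 : RNu 𝕜 θ h m ν.1) ≠ 0}.Finite
    simp
  mul_mem' {a b} (ha : {ν | a ν ≠ 0}.Finite) _ :=
    ha.subset fun ν (hν : a ν * b ν ≠ 0) (h0 : a ν = 0) => hν (by rw [h0, zero_mul])
  smul_mem' c {a} (ha : {ν | a ν ≠ 0}.Finite) :=
    ha.subset fun ν (hν : c • a ν ≠ 0) (h0 : a ν = 0) => hν (by rw [h0, smul_zero])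

/-- Modules over the algebra `°R_m`, which need not have a unit, are the same as (unital) modules
over its unitization `𝕜 ⊕ °R_m`. -/
abbrev RUnit : Type u := Unitization 𝕜 (RTot 𝕜 θ h m)

open Classical in
/-- The element of `°R_m` given by an element of the summand `°R(Γ)_ν`. -/
noncomputable def inSum (ν : DimVec θ m) (a : RNu 𝕜 θ h m ν.1) : RUnit 𝕜 θ h m :=
  Unitization.inr ⟨Pi.single ν a,
    by
      refine (Set.finite_singleton ν).subset fun μ hμ => ?_
      by_contra h0
      exact hμ (by rw [Pi.single_eq_of_ne h0])⟩

/-- The element `1_𝐢` of `°R_m`. -/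
noncomputable def r1 (ν : DimVec θ m) (i : Seq θ m ν.1) : RUnit 𝕜 θ h m :=
  inSum 𝕜 θ h m ν (RingQuot.mkAlgHom 𝕜 _ (e1 𝕜 i))

/-- The component `ϰ_l ∈ °R(Γ)_ν` of `ϰ_l`. -/
noncomputable def rκ (ν : DimVec θ m) (l : Pos m) : RUnit 𝕜 θ h m :=
  inSum 𝕜 θ h m ν (RingQuot.mkAlgHom 𝕜 _ (eκ 𝕜 θ m ν.1 l))

/-- The component `σ_k ∈ °R(Γ)_ν` of `σ_k`. -/
noncomputable def rσ (ν : DimVec θ m) (k : Ref m) : RUnit 𝕜 θ h m :=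
  inSum 𝕜 θ h m ν (RingQuot.mkAlgHom 𝕜 _ (eσ 𝕜 θ m ν.1 k))

/-- The modules `M` over `°R_m` with `M = ⨁_𝐢 1_𝐢 M` on which `ϰ_1, …, ϰ_m` act locally
nilpotently. -/
def IsMod0 : ObjectProperty (ModuleCat.{w} (RUnit 𝕜 θ h m)) := fun M =>
  (∀ x : M, x ∈ AddSubgroup.closure
    {y : M | ∃ (ν : DimVec θ m) (i : Seq θ m ν.1), r1 𝕜 θ h m ν i • y = y}) ∧
  ∀ (ν : DimVec θ m) (l : Pos m), 1 ≤ l.1 → ∀ x : M, ∃ n : ℕ, rκ 𝕜 θ h m ν l ^ n • x = 0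

/-- The category `°R_m-Mod_0`. -/
abbrev Mod0 := (IsMod0.{u, w} 𝕜 θ h m).FullSubcategory

end KLR

/-! ### The affine Hecke algebra of `SO(2m)` -/

section Hecke

variable {𝕜 : Type u} [Field 𝕜] (p : 𝕜ˣ) (m : ℕ)

/-- The generators `T_k`, and `X_1^{±1}, …, X_m^{±1}`, where `X_l^{-1}` is written `X_{1-l}`. -/
inductive HGen (m : ℕ) : Type
  | X (l : Pos m)
  | T (k : Ref m)

variable (𝕜) in
/-- `X_l` in the free algebra. -/
abbrev eX {m : ℕ} (l : Pos m) : FreeAlgebra 𝕜 (HGen m) := FreeAlgebra.ι 𝕜 (HGen.X l)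

variable (𝕜) in
/-- `T_k` in the free algebra. -/
abbrev eT {m : ℕ} (k : Ref m) : FreeAlgebra 𝕜 (HGen m) := FreeAlgebra.ι 𝕜 (HGen.T k)

/-- The defining relations of the affine Hecke algebra. -/
inductive HRel : FreeAlgebra 𝕜 (HGen m) → FreeAlgebra 𝕜 (HGen m) → Prop
  | X_inv (l : Pos m) : HRel (eX 𝕜 l * eX 𝕜 l.neg) 1
  | X_comm (l l' : Pos m) : HRel (eX 𝕜 l * eX 𝕜 l') (eX 𝕜 l' * eX 𝕜 l)
  | braid (k k' : Ref m) (hk : k'.lo = k.hi) :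
      HRel (eT 𝕜 k * eT 𝕜 k' * eT 𝕜 k) (eT 𝕜 k' * eT 𝕜 k * eT 𝕜 k')
  | T_comm (k k' : Ref m) (hk : (1 ≤ k.1 ∧ k.1 + 1 < k'.1) ∨ (k.1 = 0 ∧ k'.1 ≠ 2)) :
      HRel (eT 𝕜 k * eT 𝕜 k') (eT 𝕜 k' * eT 𝕜 k)
  | quad (k : Ref m) :
      HRel ((eT 𝕜 k - algebraMap 𝕜 _ (p : 𝕜)) * (eT 𝕜 k + algebraMap 𝕜 _ (p : 𝕜)⁻¹)) 0
  /- `T_k X_k T_k = X_{s_k(k)}`; for `k = 0` this is `T_0 X_1⁻¹ T_0 = X_2`. -/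
  | TXT (k : Ref m) : HRel (eT 𝕜 k * eX 𝕜 k.lo * eT 𝕜 k) (eX 𝕜 k.hi)
  | TX (k : Ref m) (l : Pos m)
      (hl : l ≠ k.lo ∧ l ≠ k.hi ∧ l ≠ k.lo.neg ∧ l ≠ k.hi.neg) :
      HRel (eT 𝕜 k * eX 𝕜 l) (eX 𝕜 l * eT 𝕜 k)

/-- The affine Hecke algebra `H_m` of type `D_m`, for `m ≥ 1`. For `m = 1` there are no `T_k`, and
it is `𝕜[X_1^{±1}]`. -/
abbrev Hecke : Type u := RingQuot (HRel p m)

/-- `X_l` in `H_m`. -/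
noncomputable def hX (l : Pos m) : Hecke p m := RingQuot.mkAlgHom 𝕜 _ (eX 𝕜 l)

/-- `T_k` in `H_m`. -/
noncomputable def hT (k : Ref m) : Hecke p m := RingQuot.mkAlgHom 𝕜 _ (eT 𝕜 k)

/-- The modules over `H_m` on which the action of `X_1, …, X_m` is locally finite (each vector lies
in a finite dimensional subspace stable under all of them) with eigenvalues in `I`. -/
def IsModI (I : Set 𝕜ˣ) : ObjectProperty (ModuleCat.{w} (Hecke p m)) := fun M =>
  (∀ x : M, ∃ N : Submodule 𝕜 M, FiniteDimensional 𝕜 N ∧ x ∈ N ∧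
    ∀ l : Pos m, 1 ≤ l.1 → ∀ y ∈ N, hX p m l • y ∈ N) ∧
  ∀ l : Pos m, 1 ≤ l.1 → ∀ (c : 𝕜) (x : M), x ≠ 0 → hX p m l • x = c • x →
    ∃ z ∈ I, (z : 𝕜) = c

/-- The category `H_m-Mod_I`. -/
abbrev ModI (I : Set 𝕜ˣ) := (IsModI.{u, w} p m I).FullSubcategory

end Hecke

/-! ### The quiver with involution attached to `I` and `p` -/

section Specific

variable {𝕜 : Type u} [Field 𝕜]

/-- `I` is stable under the action `(n, ε) : z ↦ z^ε p^{2n}` of `ℤ ⋊ {±1}`. -/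
def Invariant (p : 𝕜ˣ) (I : Set 𝕜ˣ) : Prop :=
  ∀ z ∈ I, ∀ n : ℤ, z * p ^ (2 * n) ∈ I ∧ z⁻¹ * p ^ (2 * n) ∈ I

/-- The involution `θ(i) = i⁻¹` of the set of vertices `I`. -/
def theta {p : 𝕜ˣ} {I : Set 𝕜ˣ} (hI : Invariant p I) (i : I) : I :=
  ⟨(i : 𝕜ˣ)⁻¹, by simpa using (hI i i.2 0).2⟩

open Classical in
/-- There is exactly one arrow `p² i → i` for every vertex `i`, and there are no other arrows. -/
noncomputable def arrows (p : 𝕜ˣ) (I : Set 𝕜ˣ) (i j : I) : ℕ :=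
  if (i : 𝕜ˣ) = p ^ 2 * j then 1 else 0

end Specific

/-! ### Power series in locally nilpotent operators -/

section Series

variable {𝕜 : Type u} [Field 𝕜]

/-- `g(a) x` for a power series `g` and an element `a` of an algebra that acts locally nilpotently.
The sum is finite. -/
noncomputable def ev1 {A : Type*} [Ring A] [Algebra 𝕜 A] {M : Type*} [AddCommGroup M] [Module A M]
    (g : PowerSeries 𝕜) (a : A) (x : M) : M :=
  ∑ᶠ n : ℕ, (PowerSeries.coeff n g • a ^ n) • x

/-- `g(a, b) x` for a power series `g` in two variables and two commuting elements `a`, `b` of an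
algebra that act locally nilpotently. The sum is finite. -/
noncomputable def ev2 {A : Type*} [Ring A] [Algebra 𝕜 A] {M : Type*} [AddCommGroup M] [Module A M]
    (g : MvPowerSeries (Fin 2) 𝕜) (a b : A) (x : M) : M :=
  ∑ᶠ d : Fin 2 →₀ ℕ, (MvPowerSeries.coeff d g • (a ^ d 0 * b ^ d 1)) • x

/-- The power series `f(u)` in two variables `u`, `v`. -/
noncomputable def fu (f : PowerSeries 𝕜) : MvPowerSeries (Fin 2) 𝕜 :=
  f.subst (MvPowerSeries.X 0 : MvPowerSeries (Fin 2) 𝕜)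

/-- The power series `f(v)` in two variables `u`, `v`. -/
noncomputable def fv (f : PowerSeries 𝕜) : MvPowerSeries (Fin 2) 𝕜 :=
  f.subst (MvPowerSeries.X 1 : MvPowerSeries (Fin 2) 𝕜)

/-- The power series `(f(u) - f(v)) / (u - v)` in two variables `u`, `v`. -/
noncomputable def fdd (f : PowerSeries 𝕜) : MvPowerSeries (Fin 2) 𝕜 :=
  fun d => PowerSeries.coeff (d 0 + d 1 + 1) f

/-- `fdd` is the quotient that it is said to be. -/
theorem fdd_mul (f : PowerSeries 𝕜) :
    fdd f * (MvPowerSeries.X 0 - MvPowerSeries.X 1) = fu f - fv f := by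
  classical
  have hs : ∀ (s : Fin 2) (d : Fin 2 →₀ ℕ), MvPowerSeries.coeff d (fdd f * MvPowerSeries.X s) =
      if d s = 0 then 0 else PowerSeries.coeff (d 0 + d 1) f := by
    intro s d
    have hle : Finsupp.single s 1 ≤ d ↔ d s ≠ 0 := by
      rw [Finsupp.single_le_iff]; omega
    rw [MvPowerSeries.X, MvPowerSeries.coeff_mul_monomial]
    by_cases h0 : d s = 0
    · rw [if_neg (by rw [hle]; simpa using h0), if_pos h0]
    · rw [if_pos (hle.2 h0), if_neg h0, mul_one]
      have h2 : (d - Finsupp.single s 1 : Fin 2 →₀ ℕ) 0 + (d - Finsupp.single s 1 : Fin 2 →₀ ℕ) 1 + 1 =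
          d 0 + d 1 := by
        obtain rfl | rfl : s = 0 ∨ s = 1 := by omega
        all_goals
          simp only [Finsupp.tsub_apply, Finsupp.single_apply]
          simp
          omega
      exact congrArg (fun n => PowerSeries.coeff n f) h2
  have hd : ∀ (s : Fin 2) (d : Fin 2 →₀ ℕ), (d = Finsupp.single s (d s)) ↔
      d (1 - s) = 0 := by
    intro s d
    constructor
    · intro h
      rw [h]
      fin_cases s <;> simp
    · intro h
      ext t
      fin_cases s <;> fin_cases t <;> simp_all
  ext d
  rw [mul_sub, map_sub, map_sub, hs, hs, fu, fv, PowerSeries.coeff_subst_single,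
    PowerSeries.coeff_subst_single]
  simp only [hd]
  by_cases h0 : d 0 = 0 <;> by_cases h1 : d 1 = 0 <;> simp [h0, h1]

open Classical in
/-- The coefficient of `σ_k` in the action of `T_k` on `1_𝐢 M`, as a power series in `u = ϰ_k` and
`v = ϰ_{s_k(k)}`; here `i = i_k` and `j = i_{s_k(k)}`. Every inverse is that of a power series with
nonzero constant term. -/
noncomputable def coefSigma (p : 𝕜ˣ) (f : PowerSeries 𝕜) (i j : 𝕜ˣ) : MvPowerSeries (Fin 2) 𝕜 :=
  let P : 𝕜 := p
  if j = i then (P • fu f - P⁻¹ • fv f) * (fdd f)⁻¹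
  else if j = p ^ 2 * i then fdd f * (P⁻¹ • fu f - P • fv f)⁻¹
  else ((P * i) • fu f - (P⁻¹ * j) • fv f) * ((i : 𝕜) • fu f - (j : 𝕜) • fv f)⁻¹

open Classical in
/-- The term without `σ_k` in the action of `T_k` on `1_𝐢 M`, with the same conventions. -/
noncomputable def coefOne (p : 𝕜ˣ) (f : PowerSeries 𝕜) (i j : 𝕜ˣ) : MvPowerSeries (Fin 2) 𝕜 :=
  let P : 𝕜 := p
  if j = i then MvPowerSeries.C P
  else if j = p ^ 2 * i then ((P ^ (-2 : ℤ) - 1) • fv f) * (P • fu f - P⁻¹ • fv f)⁻¹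
  else (((P⁻¹ - P) * i) • fv f) * ((j : 𝕜) • fu f - (i : 𝕜) • fv f)⁻¹

end Series

end TypeD

/-! Both algebras are compared through one commutative ring `Fun`, the product over all weights 𝐢 of
the power series in ϰ_1, …, ϰ_m. An object of either category is a vector space with a smooth action
ρ of `Fun`: every vector is killed by the functions that vanish to high order at finitely many
weights. For °R_m this action comes from the idempotents and the locally nilpotent ϰ_l
(`exists_isRAction`). For H_m it comes from the joint generalized eigenspaces of the X_l; the
compositional inverse of f − 1 recovers ϰ_l from X_l = i_l⁻¹ f(ϰ_l) (`exists_isHAction`).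

It remains to compare σ_k with T_k. Both obey a twisted Leibniz rule D h = s_k(h) D + G (h − s_k(h))
with a rational function G. Write k' = s_k(k). For σ_k it is `ratG`, which is −1/(ϰ_k − ϰ_{k'}) on
the weights with i_k = i_{k'} and 0 elsewhere; for T_k it is `ratX`, which is G' = (p − p⁻¹)
X_{k'}/(X_{k'} − X_k). The coefficients A, B of the theorem are made so that G' = A G + B
(`xFun_sub_mul_ratX`), and A is invertible. So D ↦ A D + B and its inverse exchange the two Leibniz
rules.

For the other relations put, formally, τ = D − G. Then τ h = s(h) τ, and A D + B has A τ in place of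
τ. If G + s(G) = c, the relation D² = c D + e says that τ² = e + G s(G). It therefore turns into D'²
= c' D' + e' as soon as A s(A) (e + G s(G)) = e' + G' s(G'); for e = Q and e' = 1 this is
`aFun_mul_aFun`. If moreover G₁G₂ = G₁₃(G₁ + G₂ − c), where G₁₃ belongs to the outer two of three
positions, then the braid relation with error term G₁₃(e₁ − e₂) says that τ₁τ₂τ₁ = τ₂τ₁τ₂. This
survives the transformation, because both sides acquire the factor A₁A₁₃A₂. The functional equation
is a partial fraction identity for both functions (`ratG_mul_ratG`, `ratX_mul_ratX`). Rational
functions do not act on modules, so `IsDemazure.quad_affine` and `IsDemazure.braid_affine` compare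
coefficients instead of using τ. Commuting reflections only need A and B of one to be fixed by the
other; for s_0 and s_1 this rests on f(ϰ)f(−ϰ) = 1.

Hence the relations pass in both directions (`IsSigmaFamily.hecke`, `IsHeckeFamily.sigma`) on the
same vector space. A linear map that commutes with one algebra commutes with ρ, by density of the
polynomials in the generators concerned (`IsSmooth.eq_zero`, `IsSmooth.eq_zero_of_xFun`), and then
with the other algebra. So the functor that keeps spaces and maps is fully faithful, and the inverse
construction makes it essentially surjective. -/

namespace TypeD

/-! ### Power series of high order -/

section Order

variable {𝕜 : Type*} [Field 𝕜] {ι : Type*}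

/-- The ideal of power series of order at least `n`. -/
noncomputable def ordIdeal (𝕜 : Type*) [Field 𝕜] (ι : Type*) (n : ℕ) :
    Ideal (MvPowerSeries ι 𝕜) where
  carrier := {h | (n : ℕ∞) ≤ h.order}
  add_mem' ha hb := (le_min ha hb).trans MvPowerSeries.min_order_le_add
  zero_mem' := by simp
  smul_mem' c h hh := by
    change (n : ℕ∞) ≤ (c * h).order
    exact le_trans (le_add_left hh) MvPowerSeries.le_order_mul

theorem mem_ordIdeal {n : ℕ} {h : MvPowerSeries ι 𝕜} :
    h ∈ ordIdeal 𝕜 ι n ↔ (n : ℕ∞) ≤ h.order := Iff.rfl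

theorem mem_ordIdeal_iff_coeff {n : ℕ} {h : MvPowerSeries ι 𝕜} :
    h ∈ ordIdeal 𝕜 ι n ↔ ∀ d : ι →₀ ℕ, d.degree < n → MvPowerSeries.coeff d h = 0 := by
  constructor
  · intro hh d hd
    exact MvPowerSeries.coeff_of_lt_order (lt_of_lt_of_le (by exact_mod_cast hd) hh)
  · intro hh
    exact MvPowerSeries.nat_le_order hh

theorem ordIdeal_anti {n n' : ℕ} (h : n ≤ n') : ordIdeal 𝕜 ι n' ≤ ordIdeal 𝕜 ι n :=
  fun _ hx => le_trans (by exact_mod_cast h) (mem_ordIdeal.1 hx)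

theorem monomial_mem_ordIdeal {n : ℕ} {d : ι →₀ ℕ} (hd : n ≤ d.degree) (c : 𝕜) :
    MvPowerSeries.monomial d c ∈ ordIdeal 𝕜 ι n := by
  classical
  rw [mem_ordIdeal_iff_coeff]
  intro d' hd'
  rw [MvPowerSeries.coeff_monomial, if_neg]
  rintro rfl
  omega

theorem pow_mem_ordIdeal {n : ℕ} {h : MvPowerSeries ι 𝕜}
    (h0 : MvPowerSeries.constantCoeff h = 0) : h ^ n ∈ ordIdeal 𝕜 ι n :=
  MvPowerSeries.le_order_pow_of_constantCoeff_eq_zero n h0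

/-- Over a field the order of a product is the sum of the orders, so division by a series of order
one costs exactly one degree. -/
theorem mem_ordIdeal_of_mul_mem {n : ℕ} {δ h : MvPowerSeries ι 𝕜} (hδ : δ.order = 1)
    (hh : δ * h ∈ ordIdeal 𝕜 ι (n + 1)) : h ∈ ordIdeal 𝕜 ι n := by
  rw [mem_ordIdeal] at hh ⊢
  rw [MvPowerSeries.order_mul, hδ, add_comm (1 : ℕ∞)] at hh
  push_cast at hh
  exact (ENat.add_le_add_iff_right (by simp)).1 hh

theorem subst_mem_ordIdeal {τ : Type*} [Finite ι] {n : ℕ} {a : ι → MvPowerSeries τ 𝕜}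
    (ha : ∀ l, MvPowerSeries.constantCoeff (a l) = 0) {h : MvPowerSeries ι 𝕜}
    (hh : h ∈ ordIdeal 𝕜 ι n) : MvPowerSeries.subst a h ∈ ordIdeal 𝕜 τ n := by
  rw [mem_ordIdeal] at hh ⊢
  refine le_trans ?_ (MvPowerSeries.le_order_subst
    (MvPowerSeries.hasSubst_of_constantCoeff_zero ha) h)
  refine hh.trans (ENat.self_le_mul_left _ ?_)
  have : (1 : ℕ∞) ≤ ⨅ l, (a l).order :=
    le_iInf fun l => MvPowerSeries.one_le_order_iff_constCoeff_eq_zero.2 (ha l)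
  intro h0
  rw [h0] at this
  simp at this

/-- The exponents of degree less than `n`. -/
noncomputable def lowExp (ι : Type*) [Finite ι] (n : ℕ) : Finset (ι →₀ ℕ) :=
  (Finsupp.finite_of_degree_lt n).toFinset

theorem mem_lowExp [Finite ι] {n : ℕ} {d : ι →₀ ℕ} : d ∈ lowExp ι n ↔ d.degree < n := by
  simp [lowExp]

theorem sub_sum_mem_ordIdeal [Finite ι] (n : ℕ) (h : MvPowerSeries ι 𝕜) :
    h - ∑ d ∈ lowExp ι n, MvPowerSeries.monomial d (MvPowerSeries.coeff d h) ∈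
      ordIdeal 𝕜 ι n := by
  classical
  rw [mem_ordIdeal_iff_coeff]
  intro d hd
  rw [map_sub, map_sum, Finset.sum_eq_single d]
  · simp
  · intro d' _ hne
    rw [MvPowerSeries.coeff_monomial, if_neg (Ne.symm hne)]
  · intro h'
    exact absurd (mem_lowExp.2 hd) h'

/-- A linear map on power series that vanishes on monomials and on all series of high order is
zero. -/
theorem eq_zero_of_monomial [Finite ι] {V : Type*} [AddCommGroup V] [Module 𝕜 V]
    (L : MvPowerSeries ι 𝕜 →ₗ[𝕜] V) (n : ℕ) (hn : ∀ h ∈ ordIdeal 𝕜 ι n, L h = 0)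
    (hm : ∀ d, L (MvPowerSeries.monomial d 1) = 0) (h : MvPowerSeries ι 𝕜) : L h = 0 := by
  have h1 := hn _ (sub_sum_mem_ordIdeal n h)
  rw [map_sub, map_sum, Finset.sum_eq_zero, sub_zero] at h1
  · exact h1
  · intro d _
    have : MvPowerSeries.monomial d (MvPowerSeries.coeff d h) =
        MvPowerSeries.coeff d h • MvPowerSeries.monomial (R := 𝕜) d 1 := by
      rw [← map_smul, smul_eq_mul, mul_one]
    rw [this, map_smul, hm, smul_zero]

/-- Division by a linear form `δ`: if `δ ∣ x - s(x)` for all variables `x`, then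
`δ ∣ h - s(h)` for all power series `h`. -/
theorem dvd_sub_of_dvd_X [Finite ι] {δ : MvPowerSeries ι 𝕜} (hδ : δ.order = 1)
    (s : MvPowerSeries ι 𝕜 →ₐ[𝕜] MvPowerSeries ι 𝕜)
    (hs : ∀ n, ∀ h ∈ ordIdeal 𝕜 ι n, s h ∈ ordIdeal 𝕜 ι n)
    (hX : ∀ l, δ ∣ MvPowerSeries.X l - s (MvPowerSeries.X l)) (h : MvPowerSeries ι 𝕜) :
    δ ∣ h - s h := by
  classical
  have hδ1 : δ ∈ ordIdeal 𝕜 ι 1 := by rw [mem_ordIdeal, hδ]; rfl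
  have hm : ∀ d : ι →₀ ℕ, δ ∣ MvPowerSeries.monomial d (1 : 𝕜) - s (MvPowerSeries.monomial d 1) := by
    intro d
    -- Modulo δ the claim is an equality of two ring homomorphisms, which on polynomials can be
    -- checked on the variables.
    have hq : ∀ a : MvPowerSeries ι 𝕜, (δ ∣ a - s a) ↔
        Ideal.Quotient.mk (Ideal.span {δ}) a = Ideal.Quotient.mk (Ideal.span {δ}) (s a) := by
      intro a
      rw [Ideal.Quotient.eq, Ideal.mem_span_singleton]
    have hp : ∀ p : MvPolynomial ι 𝕜, δ ∣ (p : MvPowerSeries ι 𝕜) - s p := by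
      intro p
      induction p using MvPolynomial.induction_on with
      | C a =>
        have : s (MvPowerSeries.C a) = MvPowerSeries.C a := s.commutes a
        rw [MvPolynomial.coe_C, this, sub_self]
        exact dvd_zero _
      | add p q hp hq =>
        rw [MvPolynomial.coe_add, map_add, add_sub_add_comm]
        exact dvd_add hp hq
      | mul_X p l hp =>
        have h1 := (hq _).1 hp
        have h2 := (hq _).1 (hX l)
        rw [MvPolynomial.coe_mul, MvPolynomial.coe_X, hq, map_mul, map_mul, map_mul, h1, h2]
    have := hp (MvPolynomial.monomial d 1)
    rwa [MvPolynomial.coe_monomial] at this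
  choose D hD using hm
  have hDord : ∀ d : ι →₀ ℕ, ∀ n, n + 1 ≤ d.degree → D d ∈ ordIdeal 𝕜 ι n := by
    intro d n hn
    refine mem_ordIdeal_of_mul_mem hδ ?_
    rw [← hD]
    exact sub_mem (monomial_mem_ordIdeal hn 1) (hs _ _ (monomial_mem_ordIdeal hn 1))
  have hfin : ∀ (e : ι →₀ ℕ) (g : MvPowerSeries ι 𝕜),
      (Function.support fun d => MvPowerSeries.coeff d g * MvPowerSeries.coeff e (D d)) ⊆
        (lowExp ι (e.degree + 2) : Set (ι →₀ ℕ)) := by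
    intro e g d hd
    rw [Finset.mem_coe, mem_lowExp]
    by_contra hcon
    refine hd ?_
    have := mem_ordIdeal_iff_coeff.1 (hDord d (e.degree + 1) (by omega)) e (by omega)
    simp [this]
  -- The quotient is the series ∑ g_d D_d. Since D_d has order at least deg d − 1, its coefficient
  -- at e involves only d of degree below deg e + 2.
  let E : MvPowerSeries ι 𝕜 →ₗ[𝕜] MvPowerSeries ι 𝕜 :=
    { toFun := fun g e => ∑ d ∈ lowExp ι (e.degree + 2),
        MvPowerSeries.coeff d g * MvPowerSeries.coeff e (D d)
      map_add' := fun a b => by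
        funext e
        simp only [map_add, add_mul, Finset.sum_add_distrib]
        rfl
      map_smul' := fun c a => by
        funext e
        simp only [MvPowerSeries.coeff_smul, mul_assoc, ← Finset.mul_sum]
        rfl }
  have hE : ∀ (g : MvPowerSeries ι 𝕜) (e : ι →₀ ℕ), MvPowerSeries.coeff e (E g) =
      ∑ d ∈ lowExp ι (e.degree + 2), MvPowerSeries.coeff d g * MvPowerSeries.coeff e (D d) :=
    fun _ _ => rfl
  have hEord : ∀ n, ∀ g ∈ ordIdeal 𝕜 ι (n + 1), E g ∈ ordIdeal 𝕜 ι n := by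
    intro n g hg
    rw [mem_ordIdeal_iff_coeff] at hg ⊢
    intro e he
    rw [hE]
    refine Finset.sum_eq_zero fun d _ => ?_
    by_cases hdn : d.degree < n + 1
    · rw [hg d hdn, zero_mul]
    · have := mem_ordIdeal_iff_coeff.1 (hDord d n (by omega)) e he
      rw [this, mul_zero]
  have hEm : ∀ d, E (MvPowerSeries.monomial d 1) = D d := by
    intro d
    ext e
    rw [hE]
    by_cases hdn : d ∈ lowExp ι (e.degree + 2)
    · rw [Finset.sum_eq_single d]
      · simp
      · intro d' _ hne
        rw [MvPowerSeries.coeff_monomial, if_neg hne, zero_mul]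
      · exact fun h' => absurd hdn h'
    · have := mem_ordIdeal_iff_coeff.1 (hDord d (e.degree + 1)
        (by rw [mem_lowExp] at hdn; omega)) e (by omega)
      rw [this]
      refine Finset.sum_eq_zero fun d' hd' => ?_
      rw [MvPowerSeries.coeff_monomial, if_neg, zero_mul]
      rintro rfl
      exact hdn hd'
  refine ⟨E h, ?_⟩
  ext e
  let Lc : MvPowerSeries ι 𝕜 →ₗ[𝕜] 𝕜 := (MvPowerSeries.coeff e).comp
    (LinearMap.id - s.toLinearMap - (LinearMap.mulLeft 𝕜 δ).comp E)
  have hL := eq_zero_of_monomial Lc (e.degree + 1) ?_ ?_ h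
  · simp only [Lc, LinearMap.comp_apply, LinearMap.sub_apply, LinearMap.id_apply,
      AlgHom.toLinearMap_apply, LinearMap.mulLeft_apply, map_sub] at hL
    rw [map_sub]
    exact sub_eq_zero.1 hL
  · intro g hg
    have h1 : g - s g - δ * E g ∈ ordIdeal 𝕜 ι (e.degree + 1) := by
      refine sub_mem (sub_mem hg (hs _ _ hg)) ?_
      have h2 := hEord _ g hg
      rw [mem_ordIdeal] at h2 hδ1 ⊢
      refine le_trans ?_ MvPowerSeries.le_order_mul
      rw [add_comm δ.order]
      push_cast
      exact add_le_add h2 (by exact_mod_cast hδ1)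
    exact mem_ordIdeal_iff_coeff.1 h1 e (by omega)
  · intro d
    simp only [Lc, LinearMap.comp_apply, LinearMap.sub_apply, LinearMap.id_apply,
      AlgHom.toLinearMap_apply, LinearMap.mulLeft_apply, hEm, ← hD, sub_self, map_zero]

end Order

/-! ### Power series in commuting locally nilpotent operators -/

section Eval

variable {𝕜 : Type*} [Field 𝕜] {ι : Type*} {V : Type*} [AddCommGroup V] [Module 𝕜 V]

/-- Polynomials in commuting operators. -/
theorem exists_polyEval (κ : ι → Module.End 𝕜 V) (hc : ∀ l l', Commute (κ l) (κ l')) :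
    ∃ P : MvPolynomial ι 𝕜 →ₐ[𝕜] Module.End 𝕜 V, ∀ l, P (MvPolynomial.X l) = κ l := by
  -- `MvPolynomial.aeval` needs a commutative target, so the evaluation takes place in the
  -- subalgebra generated by the operators.
  have := Algebra.isMulCommutative_adjoin 𝕜 (s := Set.range κ) (by
    rintro _ ⟨l, rfl⟩ _ ⟨l', rfl⟩
    exact hc l l')
  let : CommRing (Algebra.adjoin 𝕜 (Set.range κ)) :=
    { mul_comm := fun a b => this.is_comm.comm a b }
  refine ⟨(Algebra.adjoin 𝕜 (Set.range κ)).val.comp (MvPolynomial.aeval fun l =>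
    (⟨κ l, Algebra.subset_adjoin ⟨l, rfl⟩⟩ : Algebra.adjoin 𝕜 (Set.range κ))), fun l => ?_⟩
  simp

/-- Monomials of high degree in commuting locally nilpotent operators kill any given vector. -/
theorem exists_monomial_apply_eq_zero [Finite ι] {κ : ι → Module.End 𝕜 V}
    (P : MvPolynomial ι 𝕜 →ₐ[𝕜] Module.End 𝕜 V) (hP : ∀ l, P (MvPolynomial.X l) = κ l)
    (hn : ∀ l v, ∃ n : ℕ, (κ l ^ n) v = 0) (v : V) :
    ∃ n : ℕ, ∀ d : ι →₀ ℕ, n ≤ d.degree → P (MvPolynomial.monomial d 1) v = 0 := by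
  classical
  have := Fintype.ofFinite ι
  choose N hN using fun l => hn l v
  -- Pigeonhole: a degree beyond ∑ N_l forces some exponent d_l to reach N_l.
  refine ⟨∑ l, N l + 1, fun d hd => ?_⟩
  obtain ⟨l, hl⟩ : ∃ l, N l ≤ d l := by
    by_contra hcon
    push Not at hcon
    have h1 : d.degree ≤ ∑ l, N l := by
      rw [Finsupp.degree_eq_sum]
      exact Finset.sum_le_sum fun l _ => (hcon l).le
    omega
  have hd' : d = (d - Finsupp.single l (N l)) + Finsupp.single l (N l) := by
    rw [tsub_add_cancel_of_le]
    rwa [Finsupp.single_le_iff]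
  have h2 : (MvPolynomial.monomial d (1 : 𝕜)) =
      MvPolynomial.monomial (d - Finsupp.single l (N l)) 1 * MvPolynomial.X l ^ N l := by
    conv_lhs => rw [hd']
    rw [MvPolynomial.X_pow_eq_monomial, MvPolynomial.monomial_mul, one_mul]
  rw [h2, map_mul, map_pow, hP, Module.End.mul_apply, hN, map_zero]

/-- Evaluation of power series at commuting locally nilpotent operators. -/
theorem exists_seriesEval [Finite ι] (κ : ι → Module.End 𝕜 V)
    (hc : ∀ l l', Commute (κ l) (κ l')) (hn : ∀ l v, ∃ n : ℕ, (κ l ^ n) v = 0) :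
    ∃ P : MvPowerSeries ι 𝕜 →ₐ[𝕜] Module.End 𝕜 V, (∀ l, P (MvPowerSeries.X l) = κ l) ∧
      ∀ v, ∃ n : ℕ, ∀ h ∈ ordIdeal 𝕜 ι n, P h v = 0 := by
  classical
  obtain ⟨P0, hP0⟩ := exists_polyEval κ hc
  choose N hN using exists_monomial_apply_eq_zero P0 hP0 hn
  -- The cut-off depends on the vector. By `hev` any admissible cut-off gives the same sum, which is
  -- what makes the result linear in v.
  let ev : MvPowerSeries ι 𝕜 → V → V := fun h v =>
    ∑ d ∈ lowExp ι (N v), MvPowerSeries.coeff d h • P0 (MvPolynomial.monomial d 1) v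
  have hev : ∀ (h : MvPowerSeries ι 𝕜) (v : V) (n : ℕ),
      (∀ d : ι →₀ ℕ, n ≤ d.degree → P0 (MvPolynomial.monomial d 1) v = 0) →
      ev h v = ∑ d ∈ lowExp ι n, MvPowerSeries.coeff d h • P0 (MvPolynomial.monomial d 1) v := by
    intro h v n hv
    have aux : ∀ a b : ℕ, a ≤ b →
        (∀ d : ι →₀ ℕ, a ≤ d.degree → P0 (MvPolynomial.monomial d 1) v = 0) →
        ∑ d ∈ lowExp ι a, MvPowerSeries.coeff d h • P0 (MvPolynomial.monomial d 1) v =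
        ∑ d ∈ lowExp ι b, MvPowerSeries.coeff d h • P0 (MvPolynomial.monomial d 1) v := by
      intro a b hab ha
      refine Finset.sum_subset (fun d hd => ?_) (fun d _ hd => ?_)
      · rw [mem_lowExp] at hd ⊢
        omega
      · rw [mem_lowExp] at hd
        rw [ha d (by omega), smul_zero]
    change ∑ d ∈ lowExp ι (N v), _ = _
    rw [aux (N v) (max (N v) n) (le_max_left _ _) (hN v),
      aux n (max (N v) n) (le_max_right _ _) hv]
  let evL : MvPowerSeries ι 𝕜 → Module.End 𝕜 V := fun h =>
    { toFun := ev h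
      map_add' := fun v v' => by
        have ha : ∀ d : ι →₀ ℕ, max (N v) (N v') ≤ d.degree →
            P0 (MvPolynomial.monomial d 1) v = 0 :=
          fun d hd => hN v d (le_trans (le_max_left _ _) hd)
        have hb : ∀ d : ι →₀ ℕ, max (N v) (N v') ≤ d.degree →
            P0 (MvPolynomial.monomial d 1) v' = 0 :=
          fun d hd => hN v' d (le_trans (le_max_right _ _) hd)
        rw [hev h v _ ha, hev h v' _ hb, hev h (v + v') (max (N v) (N v'))
          (fun d hd => by rw [map_add, ha d hd, hb d hd, add_zero]), ← Finset.sum_add_distrib]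
        simp only [map_add, smul_add]
      map_smul' := fun c v => by
        rw [RingHom.id_apply, hev h (c • v) (N v) (fun d hd => by rw [map_smul, hN v d hd,
          smul_zero]), hev h v (N v) (hN v), Finset.smul_sum]
        simp only [map_smul, smul_comm c] }
  have hevL : ∀ h v, evL h v = ev h v := fun _ _ => rfl
  have hord : ∀ v, ∀ h ∈ ordIdeal 𝕜 ι (N v), evL h v = 0 := by
    intro v h hh
    rw [hevL]
    refine Finset.sum_eq_zero fun d hd => ?_
    rw [mem_ordIdeal_iff_coeff.1 hh d (mem_lowExp.1 hd), zero_smul]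
  have hmon : ∀ d, evL (MvPowerSeries.monomial d 1) = P0 (MvPolynomial.monomial d 1) := by
    intro d
    ext v
    rw [hevL, hev _ v (max (N v) (d.degree + 1)) (fun d hd => hN v d (by omega)),
      Finset.sum_eq_single d]
    · simp
    · intro d' _ hne
      rw [MvPowerSeries.coeff_monomial, if_neg hne, zero_smul]
    · intro hd
      rw [mem_lowExp] at hd
      omega
  have hadd : ∀ h h', evL (h + h') = evL h + evL h' := by
    intro h h'
    ext v
    simp only [LinearMap.add_apply, hevL, ev, map_add, add_smul, Finset.sum_add_distrib]
  have hsmul : ∀ (c : 𝕜) h, evL (c • h) = c • evL h := by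
    intro c h
    ext v
    simp only [LinearMap.smul_apply, hevL, ev, MvPowerSeries.coeff_smul, mul_smul,
      Finset.smul_sum]
  let EL : MvPowerSeries ι 𝕜 →ₗ[𝕜] Module.End 𝕜 V := ⟨⟨evL, hadd⟩, hsmul⟩
  have hEL : ∀ h, EL h = evL h := fun _ => rfl
  have hone : evL 1 = 1 := by
    have := hmon 0
    rw [show MvPolynomial.monomial (0 : ι →₀ ℕ) (1 : 𝕜) = 1 from rfl, map_one P0] at this
    exact this
  have hmul1 : ∀ d h, evL (MvPowerSeries.monomial d 1 * h) =
      evL (MvPowerSeries.monomial d 1) * evL h := by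
    intro d h
    ext v
    have := eq_zero_of_monomial ((LinearMap.applyₗ v).comp
      (EL.comp (LinearMap.mulLeft 𝕜 (MvPowerSeries.monomial d (1 : 𝕜))) -
        (LinearMap.mulLeft 𝕜 (evL (MvPowerSeries.monomial d (1 : 𝕜)))).comp EL)) (N v) ?_ ?_ h
    · simpa [sub_eq_zero, hEL] using this
    · intro g hg
      simp [hEL, hord v g hg, hord v _ (Ideal.mul_mem_left _ (MvPowerSeries.monomial d 1) hg)]
    · intro d'
      have : evL (MvPowerSeries.monomial d 1 * MvPowerSeries.monomial d' 1) =
          evL (MvPowerSeries.monomial d 1) * evL (MvPowerSeries.monomial d' 1) := by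
        rw [MvPowerSeries.monomial_mul_monomial, one_mul, hmon, hmon, hmon, ← map_mul,
          MvPolynomial.monomial_mul, one_mul]
      simp [hEL, this]
  -- Both sides are linear in g, agree on monomials by `hmul1`, and vanish for g of high order; the
  -- cut-off must serve both v and `evL h v`.
  have hmul : ∀ g h, evL (g * h) = evL g * evL h := by
    intro g h
    ext v
    have := eq_zero_of_monomial ((LinearMap.applyₗ v).comp
      (EL.comp (LinearMap.mulRight 𝕜 h) -
        (LinearMap.mulRight 𝕜 (evL h)).comp EL)) (max (N v) (N (evL h v))) ?_ ?_ g
    · simpa [sub_eq_zero, hEL] using this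
    · intro g hg
      have h1 := hord v _ (Ideal.mul_mem_right h _ (ordIdeal_anti (le_max_left _ _) hg))
      have h2 := hord (evL h v) _ (ordIdeal_anti (le_max_right _ _) hg)
      simp [hEL, h1, h2]
    · intro d
      simp [hEL, hmul1]
  refine ⟨AlgHom.ofLinearMap EL hone hmul, fun l => ?_, fun v => ⟨N v, hord v⟩⟩
  rw [← hP0]
  exact hmon _

end Eval

/-! ### Demazure operators and their affine transformations

`F` is a commutative ring of functions with automorphisms `s`, sitting in a larger ring `K` of
rational functions. A Demazure operator `D` for the rational function `G` satisfies
`D h = s(h) D + G (h - s(h))`. -/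

section Demazure

variable {F K R : Type*} [CommRing F] [CommRing K] [Ring R]

/-- The operator `D` satisfies the twisted Leibniz rule `D h = s(h) D + d(h)`, where
`d(h) = G (h - s(h))` in the ring of rational functions. -/
structure IsDemazure (j : F →+* K) (ρ : F →+* R) (s : F →+* F) (G : K) (d : F → F) (D : R) :
    Prop where
  diff : ∀ h, j (d h) = G * (j h - j (s h))
  leibniz : ∀ h, D * ρ h = ρ (s h) * D + ρ (d h)

variable {j : F →+* K} {ρ : F →+* R}

/-- Multiplication by B obeys B h = s(h) B + B (h − s(h)), so it is itself a Demazure operator with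
coefficient B. Hence the coefficient G undergoes the same affine transformation as D. -/
theorem IsDemazure.affine {s : F →+* F} {G : K} {d : F → F} {D : R}
    (hD : IsDemazure j ρ s G d D) (A B : F) :
    IsDemazure j ρ s (j A * G + j B) (fun h => A * d h + B * (h - s h)) (ρ A * D + ρ B) where
  diff h := by
    simp only [map_add, map_mul, map_sub, hD.diff]
    ring
  leibniz h := by
    have h1 : (ρ A * D + ρ B) * ρ h = ρ A * (D * ρ h) + ρ B * ρ h := by noncomm_ring
    have h2 : ρ (s h) * (ρ A * D + ρ B) = ρ (A * s h) * D + ρ (B * s h) := by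
      rw [mul_comm A, mul_comm B, map_mul, map_mul]
      noncomm_ring
    rw [h1, hD.leibniz, h2]
    simp only [map_add, map_mul, map_sub]
    noncomm_ring

/-- The quadratic relation after an affine transformation. -/
theorem IsDemazure.quad_affine (hj : Function.Injective j) {s : F →+* F} {t : K →+* K}
    (ht : ∀ h, t (j h) = j (s h)) {G : K} {d : F → F} {D : R}
    (hD : IsDemazure j ρ s G d D) {c e c' e' A B : F}
    (hq : D * D = ρ c * D + ρ e) (hG : G + t G = j c)
    (hG' : (j A * G + j B) + t (j A * G + j B) = j c')
    (he : j A * j (s A) * (j e + G * t G) =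
      j e' + (j A * G + j B) * t (j A * G + j B)) :
    (ρ A * D + ρ B) * (ρ A * D + ρ B) = ρ c' * (ρ A * D + ρ B) + ρ e' := by
  have h1 : (ρ A * D + ρ B) * (ρ A * D + ρ B) =
      ρ A * (D * ρ A) * D + ρ A * (D * ρ B) + ρ B * ρ A * D + ρ B * ρ B := by noncomm_ring
  have h2 : ρ A * (ρ (s A) * D + ρ (d A)) * D =
      ρ A * ρ (s A) * (D * D) + ρ A * ρ (d A) * D := by noncomm_ring
  rw [h1, hD.leibniz, hD.leibniz, h2, hq]
  -- The coefficients of D and of 1 are compared in `e1` and `e2`. In terms of τ = D − G with τ² = e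
  -- + G t(G), hypothesis `he` says that (Aτ)² = e' + G' t(G') for G' = A G + B.
  have e1 : A * s A * c + A * d A + A * s B + B * A = c' * A := by
    apply hj
    simp only [map_add, map_mul, hD.diff, ht] at hG hG' ⊢
    linear_combination j A * hG' - j A * j (s A) * hG
  have e2 : A * s A * e + A * d B + B * B = c' * B + e' := by
    apply hj
    simp only [map_add, map_mul, hD.diff, ht] at hG hG' he ⊢
    linear_combination he + j B * hG'
  have h3 : ρ A * ρ (s A) * (ρ c * D + ρ e) + ρ A * ρ (d A) * D +
      ρ A * (ρ (s B) * D + ρ (d B)) + ρ B * ρ A * D + ρ B * ρ B =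
      ρ (A * s A * c + A * d A + A * s B + B * A) * D + ρ (A * s A * e + A * d B + B * B) := by
    simp only [map_add, map_mul]
    noncomm_ring
  rw [h3, e1, e2]
  simp only [map_add, map_mul]
  noncomm_ring

/-- Expansion of a triple product of affine transforms of Demazure operators. -/
theorem IsDemazure.triple {s₁ s₂ : F →+* F} {G₁ G₂ : K} {d₁ d₂ : F → F} {D₁ D₂ : R}
    (h₁ : IsDemazure j ρ s₁ G₁ d₁ D₁) (h₂ : IsDemazure j ρ s₂ G₂ d₂ D₂) {c e₁ : F}
    (hq : D₁ * D₁ = ρ c * D₁ + ρ e₁) (A₁ B₁ A₂ B₂ α β γ δ : F)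
    (hα : A₂ * s₂ A₁ = α) (hβ : A₂ * d₂ A₁ + B₂ * A₁ = β) (hγ : A₂ * s₂ B₁ = γ)
    (hδ : A₂ * d₂ B₁ + B₂ * B₁ = δ) :
    (ρ A₁ * D₁ + ρ B₁) * ((ρ A₂ * D₂ + ρ B₂) * (ρ A₁ * D₁ + ρ B₁)) =
      ρ (A₁ * s₁ α) * (D₁ * (D₂ * D₁)) + ρ (A₁ * d₁ α + B₁ * α) * (D₂ * D₁) +
      ρ (A₁ * s₁ γ) * (D₁ * D₂) +
      ρ (A₁ * (s₁ β * c + d₁ β + s₁ δ) + B₁ * β) * D₁ + ρ (A₁ * d₁ γ + B₁ * γ) * D₂ +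
      ρ (A₁ * (s₁ β * e₁ + d₁ δ) + B₁ * δ) := by
  have h3 : (ρ A₂ * D₂ + ρ B₂) * (ρ A₁ * D₁ + ρ B₁) =
      ρ α * (D₂ * D₁) + ρ β * D₁ + ρ γ * D₂ + ρ δ := by
    have : (ρ A₂ * D₂ + ρ B₂) * (ρ A₁ * D₁ + ρ B₁) =
        ρ A₂ * (D₂ * ρ A₁) * D₁ + ρ A₂ * (D₂ * ρ B₁) + ρ B₂ * ρ A₁ * D₁ + ρ B₂ * ρ B₁ := by
      noncomm_ring
    rw [this, h₂.leibniz, h₂.leibniz, ← hα, ← hβ, ← hγ, ← hδ]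
    simp only [map_add, map_mul]
    noncomm_ring
  have h4 : (ρ A₁ * D₁ + ρ B₁) * (ρ α * (D₂ * D₁) + ρ β * D₁ + ρ γ * D₂ + ρ δ) =
      ρ A₁ * ((D₁ * ρ α) * (D₂ * D₁) + (D₁ * ρ β) * D₁ + (D₁ * ρ γ) * D₂ + D₁ * ρ δ) +
      ρ B₁ * (ρ α * (D₂ * D₁) + ρ β * D₁ + ρ γ * D₂ + ρ δ) := by
    noncomm_ring
  have h5 : (ρ (s₁ β) * D₁ + ρ (d₁ β)) * D₁ =
      ρ (s₁ β) * (ρ c * D₁ + ρ e₁) + ρ (d₁ β) * D₁ := by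
    rw [← hq]; noncomm_ring
  rw [h3, h4, h₁.leibniz α, h₁.leibniz β, h₁.leibniz γ, h₁.leibniz δ, h5]
  simp only [map_add, map_mul]
  noncomm_ring

/-- The braid relation after affine transformations. -/
theorem IsDemazure.braid_affine (hj : Function.Injective j) {s₁ s₂ : F →+* F} {t₁ t₂ : K →+* K}
    (ht₁ : ∀ h, t₁ (j h) = j (s₁ h)) (ht₂ : ∀ h, t₂ (j h) = j (s₂ h))
    {G₁ G₂ G₁₃ : K} {d₁ d₂ : F → F} {D₁ D₂ : R}
    (h₁ : IsDemazure j ρ s₁ G₁ d₁ D₁) (h₂ : IsDemazure j ρ s₂ G₂ d₂ D₂)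
    {c e₁ e₂ r c' e₁' e₂' r' A₁ B₁ A₂ B₂ A₁₃ B₁₃ : F}
    (hq₁ : D₁ * D₁ = ρ c * D₁ + ρ e₁) (hq₂ : D₂ * D₂ = ρ c * D₂ + ρ e₂)
    (hG₁ : G₁ + t₁ G₁ = j c) (hG₂ : G₂ + t₂ G₂ = j c)
    (hY : G₁ * G₂ = G₁₃ * (G₁ + G₂ - j c))
    (hr : j r = G₁₃ * (j e₁ - j e₂))
    (hA₁ : s₁ A₂ = A₁₃) (hA₂ : s₂ A₁ = A₁₃) (hA₃ : s₁ A₁₃ = A₂) (hA₄ : s₂ A₁₃ = A₁)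
    (hB₁ : s₁ B₂ = B₁₃) (hB₂ : s₂ B₁ = B₁₃) (hB₃ : s₁ B₁₃ = B₂) (hB₄ : s₂ B₁₃ = B₁)
    (hG₃ : t₁ G₂ = G₁₃) (hG₄ : t₂ G₁ = G₁₃)
    (hG₁' : (j A₁ * G₁ + j B₁) + t₁ (j A₁ * G₁ + j B₁) = j c')
    (hG₂' : (j A₂ * G₂ + j B₂) + t₂ (j A₂ * G₂ + j B₂) = j c')
    (hY' : (j A₁ * G₁ + j B₁) * (j A₂ * G₂ + j B₂) =
      (j A₁₃ * G₁₃ + j B₁₃) * ((j A₁ * G₁ + j B₁) + (j A₂ * G₂ + j B₂) - j c'))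
    (he₁ : j A₁ * j (s₁ A₁) * (j e₁ + G₁ * t₁ G₁) =
      j e₁' + (j A₁ * G₁ + j B₁) * t₁ (j A₁ * G₁ + j B₁))
    (he₂ : j A₂ * j (s₂ A₂) * (j e₂ + G₂ * t₂ G₂) =
      j e₂' + (j A₂ * G₂ + j B₂) * t₂ (j A₂ * G₂ + j B₂))
    (hr' : j r' = (j A₁₃ * G₁₃ + j B₁₃) * (j e₁' - j e₂'))
    (hbr : D₁ * D₂ * D₁ - D₂ * D₁ * D₂ = ρ r) :
    (ρ A₁ * D₁ + ρ B₁) * (ρ A₂ * D₂ + ρ B₂) * (ρ A₁ * D₁ + ρ B₁) -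
      (ρ A₂ * D₂ + ρ B₂) * (ρ A₁ * D₁ + ρ B₁) * (ρ A₂ * D₂ + ρ B₂) = ρ r' := by
  have hbr' : D₁ * (D₂ * D₁) = D₂ * (D₁ * D₂) + ρ r := by
    rw [← hbr]; noncomm_ring
  rw [mul_assoc, mul_assoc,
    h₁.triple h₂ hq₁ A₁ B₁ A₂ B₂ _ _ _ _ rfl rfl rfl rfl,
    h₂.triple h₁ hq₂ A₂ B₂ A₁ B₁ _ _ _ _ rfl rfl rfl rfl, hbr']
  simp only [map_add, map_mul, ht₁, ht₂] at hG₁' hG₂' he₁ he₂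
  -- With D₁D₂D₁ replaced by D₂D₁D₂ + r, the six identities `k1` to `k6` compare the coefficients of
  -- D₂D₁D₂, D₂D₁, D₁D₂, D₁, D₂ and 1. The functional equations `hY`, `hY'` enter for D₁ and D₂; the
  -- quadratic data enter for the constant term.
  have k1 : A₁ * s₁ (A₂ * s₂ A₁) = A₂ * s₂ (A₁ * s₁ A₂) := by
    simp only [map_mul, hA₁, hA₂, hA₃, hA₄]; ring
  have k2 : A₁ * d₁ (A₂ * s₂ A₁) + B₁ * (A₂ * s₂ A₁) = A₂ * s₂ (A₁ * s₁ B₂) := by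
    apply hj
    simp only [map_add, map_mul, h₁.diff, hA₁, hA₂, hA₃, hB₁, hB₄]
    ring
  have k3 : A₂ * d₂ (A₁ * s₁ A₂) + B₂ * (A₁ * s₁ A₂) = A₁ * s₁ (A₂ * s₂ B₁) := by
    apply hj
    simp only [map_add, map_mul, h₂.diff, hA₁, hA₂, hA₄, hB₂, hB₃]
    ring
  have js1 : ∀ h, j (s₁ (d₂ h)) = G₁₃ * (j (s₁ h) - j (s₁ (s₂ h))) := by
    intro h
    rw [← ht₁, h₂.diff, map_mul, map_sub, ht₁, ht₁, hG₃]
  have js2 : ∀ h, j (s₂ (d₁ h)) = G₁₃ * (j (s₂ h) - j (s₂ (s₁ h))) := by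
    intro h
    rw [← ht₂, h₁.diff, map_mul, map_sub, ht₂, ht₂, hG₄]
  have k4 : A₁ * (s₁ (A₂ * d₂ A₁ + B₂ * A₁) * c + d₁ (A₂ * d₂ A₁ + B₂ * A₁) +
      s₁ (A₂ * d₂ B₁ + B₂ * B₁)) + B₁ * (A₂ * d₂ A₁ + B₂ * A₁) =
      A₂ * d₂ (A₁ * s₁ B₂) + B₂ * (A₁ * s₁ B₂) := by
    apply hj
    simp only [map_add, map_mul, h₁.diff, h₂.diff, js1, hA₁, hA₂, hA₃, hB₁, hB₂, hB₃, hB₄]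
    linear_combination j A₁ * (j A₁₃ * G₁₃ + j B₁₃) * (hG₁' - j (s₁ A₁) * hG₁) + j A₁ * hY' -
      j A₁ * j A₁₃ * j A₂ * hY
  have k5 : A₂ * (s₂ (A₁ * d₁ A₂ + B₁ * A₂) * c + d₂ (A₁ * d₁ A₂ + B₁ * A₂) +
      s₂ (A₁ * d₁ B₂ + B₁ * B₂)) + B₂ * (A₁ * d₁ A₂ + B₁ * A₂) =
      A₁ * d₁ (A₂ * s₂ B₁) + B₁ * (A₂ * s₂ B₁) := by
    apply hj
    simp only [map_add, map_mul, h₁.diff, h₂.diff, js2, hA₁, hA₂, hA₄, hB₁, hB₂, hB₃, hB₄]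
    linear_combination j A₂ * (j A₁₃ * G₁₃ + j B₁₃) * (hG₂' - j (s₂ A₂) * hG₂) + j A₂ * hY' -
      j A₁ * j A₁₃ * j A₂ * hY
  have k6 : A₁ * (s₁ (A₂ * d₂ A₁ + B₂ * A₁) * e₁ + d₁ (A₂ * d₂ B₁ + B₂ * B₁)) +
      B₁ * (A₂ * d₂ B₁ + B₂ * B₁) + A₁ * s₁ (A₂ * s₂ A₁) * r -
      (A₂ * (s₂ (A₁ * d₁ A₂ + B₁ * A₂) * e₂ + d₂ (A₁ * d₁ B₂ + B₁ * B₂)) +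
      B₂ * (A₁ * d₁ B₂ + B₁ * B₂)) = r' := by
    apply hj
    simp only [map_add, map_sub, map_mul, h₁.diff, h₂.diff, js1, js2, hA₁, hA₂, hA₃, hA₄, hB₁,
      hB₂, hB₃, hB₄, hr, hr']
    linear_combination (j A₁₃ * G₁₃ + j B₁₃) * (he₁ - he₂ + j B₁ * hG₁' - j B₂ * hG₂') +
      (j B₁ - j B₂) * hY'
  rw [← k6, k2, ← k3, k4, ← k5, k1]
  simp only [map_add, map_sub, map_mul]
  noncomm_ring

end Demazure

/-! ### The ring of functions on weights -/

/-- The positive positions `1, …, m`. -/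
abbrev PPos (m : ℕ) : Type := {l : Pos m // 1 ≤ l.1}

instance (m : ℕ) : Finite (PPos m) := inferInstance

theorem Pos.neg_neg {m : ℕ} (l : Pos m) : l.neg.neg = l := by
  apply Subtype.ext
  simp only [Pos.neg]
  omega

theorem Pos.one_le_neg {m : ℕ} {l : Pos m} : 1 ≤ l.neg.1 ↔ ¬ 1 ≤ l.1 := by
  simp only [Pos.neg]
  omega

section Functions

variable (𝕜 : Type*) [Field 𝕜] {Γ : Type*} (θ : Γ → Γ) (m : ℕ)

/-- The power series in `ϰ_1, …, ϰ_m`. -/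
abbrev Ser : Type _ := MvPowerSeries (PPos m) 𝕜

/-- The weights, i.e. the sequences `(i_{1-m}, …, i_m)` with `θ(i_l) = i_{1-l}`. -/
abbrev Wt : Type _ := {i : Pos m → Γ // ∀ l, θ (i l) = i l.neg}

/-- The power series attached to each weight. -/
abbrev Fun : Type _ := Wt θ m → Ser 𝕜 m

variable {θ m}

/-- The simple reflections act on weights. -/
def Wt.act (k : Ref m) (i : Wt θ m) : Wt θ m :=
  ⟨i.1 ∘ refl k, fun l => by simp only [Function.comp, refl_neg]; exact i.2 _⟩

theorem refl_apply_refl (k : Ref m) (l : Pos m) : refl k (refl k l) = l := by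
  have := refl_refl k
  rw [inv_eq_iff_mul_eq_one] at this
  exact Equiv.ext_iff.1 this l

theorem refl_hi (k : Ref m) : refl k k.hi = k.lo := by
  rw [← refl_lo, refl_apply_refl]

theorem Wt.act_act (k : Ref m) (i : Wt θ m) : (i.act k).act k = i := by
  apply Subtype.ext
  funext l
  simp [Wt.act, refl_apply_refl]

theorem Wt.act_lo (k : Ref m) (i : Wt θ m) : (i.act k).1 k.lo = i.1 k.hi := by
  simp [Wt.act, refl_lo]

theorem Wt.act_hi (k : Ref m) (i : Wt θ m) : (i.act k).1 k.hi = i.1 k.lo := by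
  simp [Wt.act, refl_hi]

theorem refl_else (k : Ref m) {l : Pos m}
    (hl : l ≠ k.lo ∧ l ≠ k.hi ∧ l ≠ k.lo.neg ∧ l ≠ k.hi.neg) : refl k l = l := by
  rw [refl, Equiv.Perm.mul_apply, Equiv.swap_apply_of_ne_of_ne hl.2.2.1 hl.2.2.2,
    Equiv.swap_apply_of_ne_of_ne hl.1 hl.2.1]

/-- The positions moved by s_k are k, s_k(k) and their negatives, and θ carries the equality of
entries from the first pair to the second. This lets the divided difference act inside a single
weight. -/
theorem Wt.act_eq_self (k : Ref m) (i : Wt θ m) (hi : i.1 k.lo = i.1 k.hi) : i.act k = i := by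
  apply Subtype.ext
  funext l
  simp only [Wt.act, Function.comp]
  by_cases h1 : l = k.lo
  · rw [h1, refl_lo, hi]
  by_cases h2 : l = k.hi
  · rw [h2, refl_hi, hi]
  by_cases h3 : l = k.lo.neg
  · rw [h3, refl_neg, refl_lo, ← i.2, ← i.2, hi]
  by_cases h4 : l = k.hi.neg
  · rw [h4, refl_neg, refl_hi, ← i.2, ← i.2, hi]
  rw [refl_else k ⟨h1, h2, h3, h4⟩]

variable {𝕜}

open Classical in
variable (𝕜) in
/-- The power series `ϰ_l`, where `ϰ_{1-l} = -ϰ_l`. -/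
noncomputable def kap (l : Pos m) : Ser 𝕜 m :=
  if h : 1 ≤ l.1 then MvPowerSeries.X ⟨l, h⟩ else -MvPowerSeries.X ⟨l.neg, Pos.one_le_neg.2 h⟩

theorem kap_coe (l : PPos m) : kap 𝕜 l.1 = MvPowerSeries.X l := by
  rw [kap, dif_pos l.2]

theorem kap_neg (l : Pos m) : kap 𝕜 l.neg = -kap 𝕜 l := by
  by_cases h : 1 ≤ l.1
  · rw [kap, kap, dif_pos h, dif_neg (by rw [Pos.one_le_neg]; simpa using h)]
    simp only [Pos.neg_neg]
  · rw [kap, kap, dif_neg h, dif_pos (Pos.one_le_neg.2 h), neg_neg]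

theorem constantCoeff_kap (l : Pos m) : MvPowerSeries.constantCoeff (kap 𝕜 l) = 0 := by
  rw [kap]
  split_ifs <;> simp

theorem kap_mem_ordIdeal (l : Pos m) : kap 𝕜 l ∈ ordIdeal 𝕜 (PPos m) 1 :=
  MvPowerSeries.one_le_order_iff_constCoeff_eq_zero.2 (constantCoeff_kap l)

theorem hasSubst_refl (k : Ref m) :
    MvPowerSeries.HasSubst fun l : PPos m => kap 𝕜 (refl k l.1) :=
  MvPowerSeries.hasSubst_of_constantCoeff_zero fun _ => constantCoeff_kap _

variable (𝕜) in
/-- The action of the simple reflections on power series. -/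
noncomputable def reflSer (k : Ref m) : Ser 𝕜 m →ₐ[𝕜] Ser 𝕜 m :=
  MvPowerSeries.substAlgHom (hasSubst_refl (𝕜 := 𝕜) k)

theorem reflSer_kap (k : Ref m) (l : Pos m) : reflSer 𝕜 k (kap 𝕜 l) = kap 𝕜 (refl k l) := by
  have hX : ∀ l : PPos m, reflSer 𝕜 k (MvPowerSeries.X l) = kap 𝕜 (refl k l.1) := fun l =>
    MvPowerSeries.substAlgHom_X _ l
  by_cases h : 1 ≤ l.1
  · have := hX ⟨l, h⟩
    rwa [← kap_coe] at this
  · have := hX ⟨l.neg, Pos.one_le_neg.2 h⟩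
    rw [← kap_coe, kap_neg, refl_neg, kap_neg, map_neg] at this
    exact neg_injective this

theorem reflSer_mem_ordIdeal (k : Ref m) {n : ℕ} {h : Ser 𝕜 m}
    (hh : h ∈ ordIdeal 𝕜 (PPos m) n) : reflSer 𝕜 k h ∈ ordIdeal 𝕜 (PPos m) n := by
  rw [reflSer, MvPowerSeries.substAlgHom_apply]
  exact subst_mem_ordIdeal (fun _ => constantCoeff_kap _) hh

/-- Substitution into signed variables commutes with reflections. -/
theorem reflSer_subst {τ : Type*} [Finite τ] (k : Ref m) (a : τ → Pos m) (g : MvPowerSeries τ 𝕜) :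
    reflSer 𝕜 k (MvPowerSeries.subst (fun t => kap 𝕜 (a t)) g) =
      MvPowerSeries.subst (fun t => kap 𝕜 (refl k (a t))) g := by
  rw [reflSer, MvPowerSeries.substAlgHom_apply, MvPowerSeries.subst_comp_subst_apply
    (MvPowerSeries.hasSubst_of_constantCoeff_zero fun _ => constantCoeff_kap _) (hasSubst_refl k)]
  congr 1
  funext t
  rw [← MvPowerSeries.substAlgHom_apply (hasSubst_refl k)]
  exact reflSer_kap k (a t)

theorem reflSer_reflSer (k : Ref m) (h : Ser 𝕜 m) : reflSer 𝕜 k (reflSer 𝕜 k h) = h := by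
  have h1 : MvPowerSeries.subst (fun l : PPos m => kap 𝕜 l.1) h = h := by
    simp only [kap_coe]
    exact congrFun MvPowerSeries.subst_self h
  conv_lhs => rw [← h1, reflSer_subst, reflSer_subst]
  simp only [refl_apply_refl, h1]

/-- The action of the simple reflections on functions. -/
noncomputable def reflFun (k : Ref m) : Fun 𝕜 θ m →ₐ[𝕜] Fun 𝕜 θ m :=
  AlgHom.pi fun i => (reflSer 𝕜 k).comp (Pi.evalAlgHom 𝕜 _ (i.act k))

theorem reflFun_apply (k : Ref m) (h : Fun 𝕜 θ m) (i : Wt θ m) :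
    reflFun k h i = reflSer 𝕜 k (h (i.act k)) := rfl

theorem reflFun_reflFun (k : Ref m) (h : Fun 𝕜 θ m) : reflFun k (reflFun k h) = h := by
  funext i
  rw [reflFun_apply, reflFun_apply, reflSer_reflSer, Wt.act_act]

theorem Ref.lo_ne_hi (k : Ref m) : k.lo ≠ k.hi := by
  intro h
  have := congrArg Subtype.val h
  simp only [Ref.lo, Ref.hi] at this
  split_ifs at this <;> omega

theorem Ref.lo_ne_hi_neg (k : Ref m) : k.lo ≠ k.hi.neg := by
  intro h
  have := congrArg Subtype.val h
  simp only [Ref.lo, Ref.hi, Pos.neg] at this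
  split_ifs at this <;> omega

/-- Distinct signed variables are different. -/
theorem order_kap_sub_kap {l l' : Pos m} (h1 : l ≠ l') (h2 : l ≠ l'.neg) :
    (kap 𝕜 l - kap 𝕜 l').order = 1 := by
  classical
  refine le_antisymm ?_ (by
    have := sub_mem (kap_mem_ordIdeal (𝕜 := 𝕜) l) (kap_mem_ordIdeal l')
    rwa [mem_ordIdeal, Nat.cast_one] at this)
  have key : ∀ a b : PPos m, a ≠ b →
      MvPowerSeries.coeff (Finsupp.single a 1) (MvPowerSeries.X b : Ser 𝕜 m) = 0 := by
    intro a b hab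
    rw [MvPowerSeries.coeff_X, if_neg]
    intro h
    exact hab ((Finsupp.single_left_injective one_ne_zero) h)
  have key2 : ∀ a : PPos m,
      MvPowerSeries.coeff (Finsupp.single a 1) (MvPowerSeries.X a : Ser 𝕜 m) = 1 := fun a =>
    MvPowerSeries.coeff_index_single_self_X a
  have hdeg : ∀ a : PPos m, (((Finsupp.single a 1 : PPos m →₀ ℕ).degree : ℕ) : ℕ∞) = 1 := by
    intro a
    simp
  have hnn : ∀ l l' : Pos m, l.neg = l'.neg → l = l' := fun l l' h => by
    rw [← Pos.neg_neg l, h, Pos.neg_neg]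
  by_cases hl : 1 ≤ l.1
  · rw [← hdeg ⟨l, hl⟩]
    apply MvPowerSeries.order_le
    rw [map_sub, kap, dif_pos hl, key2, kap]
    split_ifs with h'
    · rw [key _ _ (by simpa using h1)]; simp
    · rw [map_neg, key _ _ (by simpa using h2)]; simp
  · rw [← hdeg ⟨l.neg, Pos.one_le_neg.2 hl⟩]
    apply MvPowerSeries.order_le
    rw [map_sub, kap, dif_neg hl, map_neg, key2, kap]
    split_ifs with h'
    · rw [key _ _ (by
        intro h
        exact h2 (by rw [← Pos.neg_neg l]; exact congrArg Pos.neg (congrArg Subtype.val h)))]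
      simp
    · rw [map_neg, key _ _ (by
        intro h
        exact h1 (hnn _ _ (congrArg Subtype.val h)))]
      simp

theorem kap_lo_sub_kap_hi_ne_zero (k : Ref m) : kap 𝕜 k.lo - kap 𝕜 k.hi ≠ 0 := by
  intro h
  have := order_kap_sub_kap (𝕜 := 𝕜) k.lo_ne_hi k.lo_ne_hi_neg
  rw [h] at this
  simp at this

/-- Modulo ϰ_k − ϰ_{s_k(k)} the reflection fixes every variable, so `dvd_sub_of_dvd_X` applies.
Variables at negated positions contribute the same difference up to sign. -/
theorem dvd_sub_reflSer (k : Ref m) (h : Ser 𝕜 m) :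
    kap 𝕜 k.lo - kap 𝕜 k.hi ∣ h - reflSer 𝕜 k h := by
  refine dvd_sub_of_dvd_X (order_kap_sub_kap k.lo_ne_hi k.lo_ne_hi_neg) (reflSer 𝕜 k)
    (fun n h hh => reflSer_mem_ordIdeal k hh) (fun l => ?_) h
  rw [← kap_coe, reflSer_kap]
  by_cases h1 : l.1 = k.lo
  · rw [h1, refl_lo]
  by_cases h2 : l.1 = k.hi
  · rw [h2, refl_hi]
    exact ⟨-1, by ring⟩
  by_cases h3 : l.1 = k.lo.neg
  · rw [h3, refl_neg, refl_lo, kap_neg, kap_neg]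
    exact ⟨-1, by ring⟩
  by_cases h4 : l.1 = k.hi.neg
  · rw [h4, refl_neg, refl_hi, kap_neg, kap_neg]
    exact ⟨1, by ring⟩
  rw [refl_else k ⟨h1, h2, h3, h4⟩, sub_self]
  exact dvd_zero _

/-- The quotient `(h - s_k(h)) / (ϰ_k - ϰ_{s_k(k)})`. -/
noncomputable def divDiff (k : Ref m) (h : Ser 𝕜 m) : Ser 𝕜 m := (dvd_sub_reflSer k h).choose

theorem mul_divDiff (k : Ref m) (h : Ser 𝕜 m) :
    (kap 𝕜 k.lo - kap 𝕜 k.hi) * divDiff k h = h - reflSer 𝕜 k h :=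
  (dvd_sub_reflSer k h).choose_spec.symm

theorem divDiff_mem_ordIdeal (k : Ref m) {n : ℕ} {h : Ser 𝕜 m}
    (hh : h ∈ ordIdeal 𝕜 (PPos m) (n + 1)) : divDiff k h ∈ ordIdeal 𝕜 (PPos m) n := by
  refine mem_ordIdeal_of_mul_mem (order_kap_sub_kap (𝕜 := 𝕜) k.lo_ne_hi k.lo_ne_hi_neg) ?_
  rw [mul_divDiff]
  exact sub_mem hh (reflSer_mem_ordIdeal k hh)

/-- Functions attached to a vector space: `ρ` is smooth if each vector is killed by all functions
that vanish to high order at finitely many weights. -/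
def IsSmooth {V : Type*} [AddCommGroup V] [Module 𝕜 V] (L : Fun 𝕜 θ m →ₗ[𝕜] V) : Prop :=
  ∃ (Ω : Finset (Wt θ m)) (n : ℕ), ∀ h : Fun 𝕜 θ m,
    (∀ i ∈ Ω, h i ∈ ordIdeal 𝕜 (PPos m) n) → L h = 0

/-! ### Smooth linear maps and the construction of smooth actions. -/

section Smooth

variable {V : Type*} [AddCommGroup V] [Module 𝕜 V]

theorem IsSmooth.add {L L' : Fun 𝕜 θ m →ₗ[𝕜] V} (hL : IsSmooth L) (hL' : IsSmooth L') :
    IsSmooth (L + L') := by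
  classical
  obtain ⟨Ω, n, h⟩ := hL
  obtain ⟨Ω', n', h'⟩ := hL'
  refine ⟨Ω ∪ Ω', max n n', fun g hg => ?_⟩
  rw [LinearMap.add_apply, h g fun i hi => ordIdeal_anti (le_max_left _ _)
    (hg i (Finset.mem_union_left _ hi)), h' g fun i hi => ordIdeal_anti (le_max_right _ _)
    (hg i (Finset.mem_union_right _ hi)), add_zero]

theorem IsSmooth.comp {W : Type*} [AddCommGroup W] [Module 𝕜 W] {L : Fun 𝕜 θ m →ₗ[𝕜] V}
    (hL : IsSmooth L) (φ : V →ₗ[𝕜] W) : IsSmooth (φ.comp L) := by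
  obtain ⟨Ω, n, h⟩ := hL
  exact ⟨Ω, n, fun g hg => by rw [LinearMap.comp_apply, h g hg, map_zero]⟩

theorem IsSmooth.sub {L L' : Fun 𝕜 θ m →ₗ[𝕜] V} (hL : IsSmooth L) (hL' : IsSmooth L') :
    IsSmooth (L - L') := by
  have := hL.add (hL'.comp (-LinearMap.id))
  convert this using 1
  ext h
  simp [sub_eq_add_neg]

theorem IsSmooth.comp_mul {L : Fun 𝕜 θ m →ₗ[𝕜] V} (hL : IsSmooth L) (a : Fun 𝕜 θ m) :
    IsSmooth (L.comp (LinearMap.mulLeft 𝕜 a)) := by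
  obtain ⟨Ω, n, h⟩ := hL
  refine ⟨Ω, n, fun g hg => h _ fun i hi => ?_⟩
  exact Ideal.mul_mem_left _ _ (hg i hi)

theorem IsSmooth.comp_reflFun {L : Fun 𝕜 θ m →ₗ[𝕜] V} (hL : IsSmooth L) (k : Ref m) :
    IsSmooth (L.comp (reflFun k).toLinearMap) := by
  classical
  obtain ⟨Ω, n, h⟩ := hL
  refine ⟨Ω.image (Wt.act k), n, fun g hg => h _ fun i hi => ?_⟩
  exact reflSer_mem_ordIdeal k (hg _ (Finset.mem_image_of_mem _ hi))

/-- A smooth linear map that vanishes on monomials is zero. -/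
theorem IsSmooth.eq_zero [DecidableEq (Wt θ m)] {L : Fun 𝕜 θ m →ₗ[𝕜] V} (hL : IsSmooth L)
    (hm : ∀ i d, L (Pi.single i (MvPowerSeries.monomial d 1)) = 0) (h : Fun 𝕜 θ m) : L h = 0 := by
  obtain ⟨Ω, n, hΩ⟩ := hL
  have h1 : ∀ i g, L (Pi.single i g) = 0 := by
    intro i g
    refine eq_zero_of_monomial (L.comp (LinearMap.single 𝕜 (fun _ : Wt θ m => Ser 𝕜 m) i)) n
      (fun g hg => hΩ _ fun i' _ => ?_) (fun d => hm i d) g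
    rw [LinearMap.single_apply]
    by_cases hi : i' = i
    · subst hi
      rwa [Pi.single_eq_same]
    · rw [Pi.single_eq_of_ne hi]
      exact zero_mem _
  have h2 := hΩ (h - ∑ i ∈ Ω, Pi.single i (h i)) fun i hi => by
    rw [Pi.sub_apply, Finset.sum_apply, Finset.sum_eq_single i]
    · rw [Pi.single_eq_same, sub_self]
      exact zero_mem _
    · intro i' _ hne
      exact Pi.single_eq_of_ne (Ne.symm hne) _
    · intro h'
      exact absurd hi h'
  rw [map_sub, map_sum, Finset.sum_eq_zero fun i _ => h1 i _, sub_zero] at h2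
  exact h2

theorem monomial_mem_subalgebra {ι : Type*} (A : Subalgebra 𝕜 (MvPowerSeries ι 𝕜))
    (hX : ∀ l, MvPowerSeries.X l ∈ A) (d : ι →₀ ℕ) : MvPowerSeries.monomial d 1 ∈ A := by
  have h : ∀ p : MvPolynomial ι 𝕜, (p : MvPowerSeries ι 𝕜) ∈ A := by
    intro p
    induction p using MvPolynomial.induction_on with
    | C a => rw [MvPolynomial.coe_C]; exact A.algebraMap_mem a
    | add p q hp hq => rw [MvPolynomial.coe_add]; exact A.add_mem hp hq
    | mul_X p l hp =>
      rw [MvPolynomial.coe_mul, MvPolynomial.coe_X]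
      exact A.mul_mem hp (hX l)
  have := h (MvPolynomial.monomial d 1)
  rwa [MvPolynomial.coe_monomial] at this

/-- A subalgebra of functions that contains the functions `1_𝐢` and `ϰ_l 1_𝐢` contains all
monomials. -/
theorem single_monomial_mem [DecidableEq (Wt θ m)] (A : Subalgebra 𝕜 (Fun 𝕜 θ m))
    (h1 : ∀ i, Pi.single i 1 ∈ A) (hX : ∀ i l, Pi.single i (MvPowerSeries.X l : Ser 𝕜 m) ∈ A)
    (i : Wt θ m) (d : PPos m →₀ ℕ) : Pi.single i (MvPowerSeries.monomial d 1) ∈ A := by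
  refine monomial_mem_subalgebra
    { carrier := {g | Pi.single i g ∈ A}
      mul_mem' := fun {a b} ha hb => by
        change Pi.single i (a * b) ∈ A
        rw [Pi.single_mul]
        exact A.mul_mem ha hb
      add_mem' := fun {a b} ha hb => by
        change Pi.single i (a + b) ∈ A
        rw [Pi.single_add]
        exact A.add_mem ha hb
      algebraMap_mem' := fun r => by
        change Pi.single i (algebraMap 𝕜 (Ser 𝕜 m) r) ∈ A
        rw [Algebra.algebraMap_eq_smul_one, Pi.single_smul]
        exact A.smul_mem (h1 i) r } (fun l => hX i l) d

/-- The linear map `h ↦ h v` attached to an action of functions. -/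
noncomputable def orbit (ρ : Fun 𝕜 θ m →ₐ[𝕜] Module.End 𝕜 V) (v : V) : Fun 𝕜 θ m →ₗ[𝕜] V :=
  (LinearMap.applyₗ v).comp ρ.toLinearMap

theorem orbit_apply (ρ : Fun 𝕜 θ m →ₐ[𝕜] Module.End 𝕜 V) (v : V) (h : Fun 𝕜 θ m) :
    orbit ρ v h = ρ h v := rfl

/-- An action of functions on `V` given by orthogonal projections and commuting locally nilpotent
operators. -/
theorem exists_action [DecidableEq (Wt θ m)] (e : Wt θ m → Module.End 𝕜 V)
    (κ : Wt θ m → PPos m → Module.End 𝕜 V)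
    (he : ∀ i, e i * e i = e i) (hne : ∀ i j, i ≠ j → e i * e j = 0)
    (hfin : ∀ v, {i | e i v ≠ 0}.Finite) (hsum : ∀ v, ∑ᶠ i, e i v = v)
    (hc : ∀ i l l', Commute (κ i l) (κ i l')) (hec : ∀ i l, Commute (e i) (κ i l))
    (hn : ∀ i l v, ∃ n : ℕ, (κ i l ^ n) v = 0) :
    ∃ ρ : Fun 𝕜 θ m →ₐ[𝕜] Module.End 𝕜 V, (∀ v, IsSmooth (orbit ρ v)) ∧
      (∀ i, ρ (Pi.single i 1) = e i) ∧
      ∀ i l, ρ (Pi.single i (MvPowerSeries.X l)) = κ i l * e i := by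
  classical
  choose P hPX hPn using fun i => exists_seriesEval (κ i) (hc i) (hn i)
  -- Commutation passes from the variables to monomials through the centralizer, and to all series
  -- because a given vector sees only finitely many degrees.
  have hPe : ∀ i g, Commute (e i) (P i g) := by
    intro i g
    have hmon : ∀ d, Commute (e i) (P i (MvPowerSeries.monomial d 1)) := fun d =>
      monomial_mem_subalgebra ((Subalgebra.centralizer 𝕜 {e i}).comap (P i))
        (fun l => by
          rw [Subalgebra.mem_comap, hPX, Subalgebra.mem_centralizer_iff]
          rintro _ rfl
          exact hec i l) d (e i) rfl
    ext v
    obtain ⟨n1, h1⟩ := hPn i v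
    obtain ⟨n2, h2⟩ := hPn i (e i v)
    have := eq_zero_of_monomial ((LinearMap.applyₗ v).comp
      ((LinearMap.mulLeft 𝕜 (e i)).comp (P i).toLinearMap -
        (LinearMap.mulRight 𝕜 (e i)).comp (P i).toLinearMap)) (max n1 n2)
      (fun g hg => by
        simp [h1 g (ordIdeal_anti (le_max_left _ _) hg),
          h2 g (ordIdeal_anti (le_max_right _ _) hg)])
      (fun d => by
        have := LinearMap.congr_fun (hmon d) v
        simp only [Module.End.mul_apply] at this
        simp [this]) g
    simpa [sub_eq_zero] using this
  have hfin' : ∀ (h : Fun 𝕜 θ m) v, (Function.support fun i => P i (h i) (e i v)) ⊆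
      {i | e i v ≠ 0} := by
    intro h v i hi h0
    exact hi (by simp only [h0, map_zero])
  have hf : ∀ (h : Fun 𝕜 θ m) v, (Function.support fun i => P i (h i) (e i v)).Finite :=
    fun h v => (hfin v).subset (hfin' h v)
  let ρ0 : Fun 𝕜 θ m → Module.End 𝕜 V := fun h =>
    { toFun := fun v => ∑ᶠ i, P i (h i) (e i v)
      map_add' := fun v v' => by
        rw [← finsum_add_distrib (hf h v) (hf h v')]
        simp only [map_add]
      map_smul' := fun c v => by
        rw [RingHom.id_apply, smul_finsum' c (hf h v)]
        simp only [map_smul] }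
  have hρ0 : ∀ h v, ρ0 h v = ∑ᶠ i, P i (h i) (e i v) := fun _ _ => rfl
  -- The projection to the i-th component commutes with the action; multiplicativity of ρ then
  -- follows one component at a time.
  have heρ : ∀ i h v, e i (ρ0 h v) = P i (h i) (e i v) := by
    intro i h v
    rw [hρ0, map_finsum _ (hf h v), finsum_eq_single _ i]
    · have := LinearMap.congr_fun (hPe i (h i)) (e i v)
      simp only [Module.End.mul_apply] at this
      have h2 := LinearMap.congr_fun (he i) v
      rw [Module.End.mul_apply] at h2
      rw [this, h2]
    · intro i' hi'
      have h1 := LinearMap.congr_fun (hPe i' (h i')) v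
      simp only [Module.End.mul_apply] at h1
      rw [← h1, ← Module.End.mul_apply, hne i i' hi'.symm, LinearMap.zero_apply]
  let ρ : Fun 𝕜 θ m →ₐ[𝕜] Module.End 𝕜 V := AlgHom.ofLinearMap
    { toFun := ρ0
      map_add' := fun h h' => by
        ext v
        rw [LinearMap.add_apply, hρ0, hρ0, hρ0, ← finsum_add_distrib (hf h v) (hf h' v)]
        simp only [Pi.add_apply, map_add, LinearMap.add_apply]
      map_smul' := fun c h => by
        ext v
        rw [RingHom.id_apply, LinearMap.smul_apply, hρ0, hρ0, smul_finsum' c (hf h v)]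
        simp only [Pi.smul_apply, map_smul, LinearMap.smul_apply] }
    (by
      ext v
      change ρ0 1 v = v
      rw [hρ0]
      simp only [Pi.one_apply, map_one, Module.End.one_apply]
      exact hsum v)
    (by
      intro h h'
      ext v
      change ρ0 (h * h') v = ρ0 h (ρ0 h' v)
      rw [hρ0, hρ0]
      refine finsum_congr fun i => ?_
      rw [heρ, Pi.mul_apply, map_mul, Module.End.mul_apply])
  have hρ : ∀ h v, ρ h v = ∑ᶠ i, P i (h i) (e i v) := fun _ _ => rfl
  have hρs : ∀ i g v, ρ (Pi.single i g) v = P i g (e i v) := by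
    intro i g v
    rw [hρ, finsum_eq_single _ i, Pi.single_eq_same]
    intro i' hi'
    rw [Pi.single_eq_of_ne hi', map_zero, LinearMap.zero_apply]
  refine ⟨ρ, fun v => ?_, fun i => ?_, fun i l => ?_⟩
  · choose N hN using fun i => hPn i (e i v)
    refine ⟨(hfin v).toFinset, (hfin v).toFinset.sup N, fun h hh => ?_⟩
    rw [orbit_apply, hρ]
    refine finsum_eq_zero_of_forall_eq_zero fun i => ?_
    by_cases hi : i ∈ (hfin v).toFinset
    · exact hN i _ (ordIdeal_anti (Finset.le_sup hi) (hh i hi))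
    · have : e i v = 0 := by simpa using hi
      rw [this, map_zero]
  · ext v
    rw [hρs, map_one, Module.End.one_apply]
  · ext v
    rw [hρs, hPX, Module.End.mul_apply]

end Smooth

end Functions

/-! ### The functions `X_l` and their density -/

section Density

variable {𝕜 : Type*} [Field 𝕜] {p : 𝕜ˣ} {I : Set 𝕜ˣ} (hI : Invariant p I) {m : ℕ}
  (f : PowerSeries 𝕜)

/-- The power series `f(ϰ_l)` for `l ≥ 1`, and `f(ϰ_{1-l})⁻¹` otherwise. -/
noncomputable def fSer (l : Pos m) : Ser 𝕜 m :=
  if 1 ≤ l.1 then f.subst (kap 𝕜 l) else (f.subst (kap 𝕜 l.neg))⁻¹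

/-- The function `X_l`, equal to `i_l⁻¹ f(ϰ_l)` at the weight `𝐢`. -/
noncomputable def xFun (l : Pos m) : Fun 𝕜 (theta hI) m :=
  fun i => MvPowerSeries.C ((i.1 l : 𝕜ˣ) : 𝕜)⁻¹ * fSer f l

variable {f}

theorem hasSubst_kap (l : Pos m) : PowerSeries.HasSubst (kap 𝕜 l) :=
  PowerSeries.HasSubst.of_constantCoeff_zero (constantCoeff_kap l)

theorem constantCoeff_subst_kap (hf0 : PowerSeries.coeff 0 f = 1) (l : Pos m) :
    MvPowerSeries.constantCoeff (f.subst (kap 𝕜 l)) = 1 := by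
  have h1 : f = PowerSeries.C 1 + (f - 1) := by simp
  have hs := hasSubst_kap (𝕜 := 𝕜) l
  rw [h1, PowerSeries.subst_add hs, PowerSeries.subst_C, map_add,
    PowerSeries.constantCoeff_subst_eq_zero (constantCoeff_kap l)]
  · simp
  · rw [map_sub, map_one, ← PowerSeries.coeff_zero_eq_constantCoeff_apply, hf0, sub_self]

theorem constantCoeff_fSer (hf0 : PowerSeries.coeff 0 f = 1) (l : Pos m) :
    MvPowerSeries.constantCoeff (fSer f l) = 1 := by
  rw [fSer]
  split_ifs
  · exact constantCoeff_subst_kap hf0 l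
  · rw [MvPowerSeries.constantCoeff_inv, constantCoeff_subst_kap hf0, inv_one]

/-- The inverse is built into `fSer` at nonpositive positions, so no relation between f(ϰ) and f(−ϰ)
is needed. This is what covers m = 1. -/
theorem fSer_mul_fSer_neg (hf0 : PowerSeries.coeff 0 f = 1) (l : Pos m) :
    fSer f l * fSer f l.neg = 1 := by
  have h := constantCoeff_subst_kap (𝕜 := 𝕜) (m := m) hf0
  by_cases hl : 1 ≤ l.1
  · rw [fSer, fSer, if_pos hl, if_neg (by rw [Pos.one_le_neg]; simpa using hl), Pos.neg_neg,
      MvPowerSeries.mul_inv_cancel _ (by rw [h]; exact one_ne_zero)]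
  · rw [fSer, fSer, if_neg hl, if_pos (Pos.one_le_neg.2 hl),
      MvPowerSeries.inv_mul_cancel _ (by rw [h]; exact one_ne_zero)]

theorem theta_coe (i : I) : ((theta hI i : I) : 𝕜ˣ) = (i : 𝕜ˣ)⁻¹ := rfl

theorem Wt.coe_neg (i : Wt (theta hI) m) (l : Pos m) :
    ((i.1 l.neg : I) : 𝕜ˣ) = ((i.1 l : I) : 𝕜ˣ)⁻¹ := by
  rw [← i.2 l, theta_coe]

theorem xFun_mul_xFun_neg (hf0 : PowerSeries.coeff 0 f = 1) (l : Pos m) :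
    xFun hI f l * xFun hI f l.neg = 1 := by
  funext i
  have h1 := fSer_mul_fSer_neg (m := m) hf0 l
  have h2 : (MvPowerSeries.C ((i.1 l : 𝕜ˣ) : 𝕜)⁻¹ : Ser 𝕜 m) *
      MvPowerSeries.C ((i.1 l.neg : 𝕜ˣ) : 𝕜)⁻¹ = 1 := by
    rw [← map_mul, Wt.coe_neg]
    simp
  simp only [Pi.mul_apply, xFun, Pi.one_apply]
  linear_combination fSer f l * fSer f l.neg * h2 + h1

theorem subst_neg_kap (hf : f * PowerSeries.rescale (-1) f = 1) (l : Pos m) :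
    f.subst (kap 𝕜 l) * f.subst (kap 𝕜 l.neg) = 1 := by
  have hs := hasSubst_kap (𝕜 := 𝕜) l
  have h1 := congrArg (PowerSeries.subst (kap 𝕜 l)) hf
  have h2 : PowerSeries.HasSubst ((-1 : 𝕜) • PowerSeries.X : PowerSeries 𝕜) :=
    PowerSeries.HasSubst.smul_X' _
  rw [PowerSeries.subst_mul hs, PowerSeries.rescale_eq_subst,
    PowerSeries.subst_comp_subst_apply h2 hs, PowerSeries.subst_smul hs, PowerSeries.subst_X hs,
    ← PowerSeries.coe_substAlgHom hs, map_one, PowerSeries.coe_substAlgHom, neg_one_smul,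
    ← kap_neg] at h1
  exact h1

/-- Since f(−ϰ) = f(ϰ)⁻¹ and ϰ_{1−l} = −ϰ_l, the two branches of `fSer` agree. The uniform formula
is what makes reflections permute the functions X_l. -/
theorem fSer_eq (hf0 : PowerSeries.coeff 0 f = 1) (hf : f * PowerSeries.rescale (-1) f = 1)
    (l : Pos m) : fSer f l = f.subst (kap 𝕜 l) := by
  rw [fSer]
  split_ifs
  · rfl
  · rw [MvPowerSeries.inv_eq_iff_mul_eq_one
      (by rw [constantCoeff_subst_kap hf0]; exact one_ne_zero)]
    exact subst_neg_kap hf l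

theorem reflSer_powerSeries_subst (k : Ref m) (l : Pos m) :
    reflSer 𝕜 k (f.subst (kap 𝕜 l)) = f.subst (kap 𝕜 (refl k l)) :=
  reflSer_subst k (fun _ : Unit => l) f

theorem reflFun_xFun (hf0 : PowerSeries.coeff 0 f = 1) (hf : f * PowerSeries.rescale (-1) f = 1)
    (k : Ref m) (l : Pos m) : reflFun k (xFun hI f l) = xFun hI f (refl k l) := by
  funext i
  rw [reflFun_apply, xFun, map_mul, fSer_eq hf0 hf, reflSer_powerSeries_subst, xFun,
    fSer_eq hf0 hf]
  congr 1
  exact (reflSer 𝕜 k).commutes _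

theorem Wt.exists_ne {i j : Wt (theta hI) m} (h : i ≠ j) : ∃ l : PPos m, i.1 l.1 ≠ j.1 l.1 := by
  by_contra hcon
  push Not at hcon
  apply h
  apply Subtype.ext
  funext l
  by_cases hl : 1 ≤ l.1
  · exact hcon ⟨l, hl⟩
  · have := hcon ⟨l.neg, Pos.one_le_neg.2 hl⟩
    rw [← Pos.neg_neg l, ← i.2, ← j.2, this]

/-- The functions that are limits of elements of a subalgebra. -/
def closureSub {Γ : Type*} {θ : Γ → Γ} (A : Subalgebra 𝕜 (Fun 𝕜 θ m)) :
    Subalgebra 𝕜 (Fun 𝕜 θ m) where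
  carrier := {h | ∀ (Ω : Finset (Wt θ m)) (n : ℕ), ∃ a ∈ A, ∀ i ∈ Ω,
    h i - a i ∈ ordIdeal 𝕜 (PPos m) n}
  mul_mem' {h h'} hh hh' Ω n := by
    obtain ⟨a, ha, h1⟩ := hh Ω n
    obtain ⟨a', ha', h1'⟩ := hh' Ω n
    refine ⟨a * a', A.mul_mem ha ha', fun i hi => ?_⟩
    have : (h * h') i - (a * a') i = h' i * (h i - a i) + a i * (h' i - a' i) := by
      simp only [Pi.mul_apply]; ring
    rw [this]
    exact add_mem (Ideal.mul_mem_left _ _ (h1 i hi)) (Ideal.mul_mem_left _ _ (h1' i hi))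
  add_mem' {h h'} hh hh' Ω n := by
    obtain ⟨a, ha, h1⟩ := hh Ω n
    obtain ⟨a', ha', h1'⟩ := hh' Ω n
    refine ⟨a + a', A.add_mem ha ha', fun i hi => ?_⟩
    have : (h + h') i - (a + a') i = (h i - a i) + (h' i - a' i) := by
      simp only [Pi.add_apply]; ring
    rw [this]
    exact add_mem (h1 i hi) (h1' i hi)
  algebraMap_mem' c _ _ := ⟨_, A.algebraMap_mem c, fun i _ => by rw [sub_self]; exact zero_mem _⟩

theorem constantCoeff_C_mul_fSer_sub (hf0 : PowerSeries.coeff 0 f = 1) (c d : 𝕜) (l : Pos m) :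
    MvPowerSeries.constantCoeff (MvPowerSeries.C c * fSer f l - MvPowerSeries.C d) = c - d := by
  rw [map_sub, map_mul, constantCoeff_fSer hf0]
  simp

/-- A Chinese remainder argument. For each other weight j in Ω choose a position where i and j
differ; the product q of the powers (X_{l_j} − c_j)^n vanishes to order n at all these j and has a
nonzero constant term a at i. Then 1 − (1 − q/a)^n is divisible by q and is congruent to 1 modulo
order n at i. -/
theorem single_one_mem_closureSub [DecidableEq (Wt (theta hI) m)]
    (hf0 : PowerSeries.coeff 0 f = 1) (A : Subalgebra 𝕜 (Fun 𝕜 (theta hI) m))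
    (hA : ∀ l : PPos m, xFun hI f l.1 ∈ A) (i : Wt (theta hI) m) :
    Pi.single i 1 ∈ closureSub A := by
  intro Ω n
  -- Without positive positions there is only one weight, and the constant function 1 already
  -- approximates the indicator.
  by_cases hne : Nonempty (PPos m)
  swap
  · refine ⟨1, A.one_mem, fun j _ => ?_⟩
    have : j = i := by
      by_contra h
      obtain ⟨l, -⟩ := Wt.exists_ne hI h
      exact hne ⟨l⟩
    subst this
    rw [Pi.single_eq_same, Pi.one_apply, sub_self]
    exact zero_mem _
  choose! l hl using fun j (h : i ≠ j) => Wt.exists_ne hI h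
  let c : Wt (theta hI) m → 𝕜 := fun j => ((j.1 (l j).1 : 𝕜ˣ) : 𝕜)⁻¹
  let q : Fun 𝕜 (theta hI) m :=
    ∏ j ∈ Ω.erase i, (xFun hI f (l j).1 - algebraMap 𝕜 _ (c j)) ^ n
  have hq : q ∈ A := A.prod_mem fun j _ => A.pow_mem (A.sub_mem (hA _) (A.algebraMap_mem _)) _
  have hqj : ∀ j, q j = ∏ j' ∈ Ω.erase i,
      (MvPowerSeries.C ((j.1 (l j').1 : 𝕜ˣ) : 𝕜)⁻¹ * fSer f (l j').1 -
        MvPowerSeries.C (c j')) ^ n := by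
    intro j
    simp only [q, Finset.prod_apply, Pi.pow_apply, Pi.sub_apply]
    rfl
  let a : 𝕜 := MvPowerSeries.constantCoeff (q i)
  have ha : a ≠ 0 := by
    simp only [a, hqj, map_prod, map_pow, constantCoeff_C_mul_fSer_sub hf0]
    refine Finset.prod_ne_zero_iff.2 fun j hj => pow_ne_zero _ ?_
    rw [sub_ne_zero]
    intro h
    refine hl j (Finset.ne_of_mem_erase hj).symm ?_
    exact Subtype.ext (Units.ext (inv_injective h))
  refine ⟨1 - (1 - a⁻¹ • q) ^ n, A.sub_mem A.one_mem (A.pow_mem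
    (A.sub_mem A.one_mem (A.smul_mem hq _)) _), fun j hj => ?_⟩
  simp only [Pi.sub_apply, Pi.one_apply, Pi.pow_apply, Pi.smul_apply]
  by_cases hij : j = i
  · subst hij
    rw [Pi.single_eq_same, sub_sub_cancel]
    refine pow_mem_ordIdeal ?_
    rw [map_sub, map_one, MvPowerSeries.constantCoeff_smul]
    change 1 - a⁻¹ * a = 0
    rw [inv_mul_cancel₀ ha, sub_self]
  · rw [Pi.single_eq_of_ne hij, zero_sub]
    refine neg_mem (Ideal.mem_of_dvd _ (?_ : a⁻¹ • q j ∣ _) ?_)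
    · have := sub_dvd_pow_sub_pow (1 : Ser 𝕜 m) (1 - a⁻¹ • q j) n
      rwa [one_pow, sub_sub_cancel] at this
    · rw [MvPowerSeries.smul_eq_C_mul]
      refine Ideal.mul_mem_left _ _ ?_
      rw [hqj, ← Finset.prod_erase_mul _ _ (Finset.mem_erase.2 ⟨hij, hj⟩)]
      refine Ideal.mul_mem_left _ _ (pow_mem_ordIdeal ?_)
      rw [constantCoeff_C_mul_fSer_sub hf0, sub_self]

/-- The series f − 1 has no constant term and linear coefficient 1, so it has a two-sided
compositional inverse g. One identity recovers ϰ_l from X_l, the other serves the change of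
variables in `exists_xFun_action`. -/
theorem exists_subst_inv (hf0 : PowerSeries.coeff 0 f = 1) (hf1 : PowerSeries.coeff 1 f = 1) :
    ∃ g : PowerSeries 𝕜, PowerSeries.constantCoeff g = 0 ∧ g.subst (f - 1) = PowerSeries.X ∧
      f.subst g = 1 + PowerSeries.X := by
  have hc : PowerSeries.constantCoeff (f - 1) = 0 := by
    rw [map_sub, map_one, ← PowerSeries.coeff_zero_eq_constantCoeff_apply, hf0, sub_self]
  have h1 : PowerSeries.coeff 1 (f - 1) = 1 := by
    rw [map_sub, hf1, PowerSeries.coeff_one]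
    simp
  have hu : IsUnit (PowerSeries.coeff 1 (f - 1)) := by rw [h1]; exact isUnit_one
  have hg0 := PowerSeries.constantCoeff_substInvOfIsUnit (f - 1) hu
  refine ⟨(f - 1).substInvOfIsUnit hu, hg0,
    PowerSeries.subst_substInvOfIsUnit_left _ hc hu, ?_⟩
  have h2 := PowerSeries.subst_substInvOfIsUnit_right (f - 1) hc hu
  have hs : PowerSeries.HasSubst ((f - 1).substInvOfIsUnit hu) :=
    PowerSeries.HasSubst.of_constantCoeff_zero' hg0
  rw [PowerSeries.subst_sub hs] at h2
  have h3 : PowerSeries.subst ((f - 1).substInvOfIsUnit hu) (1 : PowerSeries 𝕜) = 1 := by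
    rw [← PowerSeries.coe_substAlgHom hs, map_one]
  rw [h3] at h2
  rw [← h2]
  ring

/-- At the weight i one has ϰ_l = g(i_l X_l − 1) with g inverse to f − 1. Truncating g at degree n
gives a polynomial in X_l, and an approximate indicator function of i removes the other weights. -/
theorem single_X_mem_closureSub [DecidableEq (Wt (theta hI) m)]
    (hf0 : PowerSeries.coeff 0 f = 1) (hf1 : PowerSeries.coeff 1 f = 1)
    (A : Subalgebra 𝕜 (Fun 𝕜 (theta hI) m))
    (hA : ∀ l : PPos m, xFun hI f l.1 ∈ A) (i : Wt (theta hI) m) (l : PPos m) :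
    Pi.single i (MvPowerSeries.X l : Ser 𝕜 m) ∈ closureSub A := by
  intro Ω n
  obtain ⟨a, ha, h1⟩ := single_one_mem_closureSub hI hf0 A hA i Ω n
  obtain ⟨g, hg0, hg, -⟩ := exists_subst_inv hf0 hf1
  let y : Fun 𝕜 (theta hI) m := algebraMap 𝕜 _ ((i.1 l.1 : 𝕜ˣ) : 𝕜) * xFun hI f l.1 - 1
  have hy : y ∈ A := A.sub_mem (A.mul_mem (A.algebraMap_mem _) (hA l)) A.one_mem
  have hyi : y i = (f - 1).subst (kap 𝕜 l.1) := by
    rw [PowerSeries.subst_sub (hasSubst_kap _)]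
    have h3 : PowerSeries.subst (kap 𝕜 l.1) (1 : PowerSeries 𝕜) = 1 := by
      rw [← PowerSeries.coe_substAlgHom (hasSubst_kap _), map_one]
    rw [h3]
    simp only [y, Pi.sub_apply, Pi.mul_apply, Pi.one_apply, xFun, fSer, if_pos l.2]
    have h4 : (algebraMap 𝕜 (Fun 𝕜 (theta hI) m) ((i.1 l.1 : 𝕜ˣ) : 𝕜)) i =
      MvPowerSeries.C ((i.1 l.1 : 𝕜ˣ) : 𝕜) := rfl
    rw [h4, ← mul_assoc, ← map_mul, mul_inv_cancel₀ (Units.ne_zero _), map_one, one_mul]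
  have hy0 : MvPowerSeries.constantCoeff (y i) = 0 := by
    rw [hyi]
    refine PowerSeries.constantCoeff_subst_eq_zero (constantCoeff_kap _) _ ?_
    rw [map_sub, map_one, ← PowerSeries.coeff_zero_eq_constantCoeff_apply, hf0, sub_self]
  have hys : PowerSeries.HasSubst (y i) := PowerSeries.HasSubst.of_constantCoeff_zero hy0
  have hf1s : PowerSeries.HasSubst (f - 1) := PowerSeries.HasSubst.of_constantCoeff_zero' (by
    rw [map_sub, map_one, ← PowerSeries.coeff_zero_eq_constantCoeff_apply, hf0, sub_self])
  have hgy : g.subst (y i) = MvPowerSeries.X l := by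
    rw [hyi, ← PowerSeries.subst_comp_subst_apply hf1s (hasSubst_kap _), hg,
      PowerSeries.subst_X (hasSubst_kap _), kap_coe]
  obtain ⟨r, hr⟩ : (PowerSeries.X : PowerSeries 𝕜) ^ n ∣ g - (PowerSeries.trunc n g : PowerSeries 𝕜) := by
    rw [PowerSeries.X_pow_dvd_iff]
    intro k hk
    rw [map_sub, Polynomial.coeff_coe, PowerSeries.coeff_trunc, if_pos hk, sub_self]
  refine ⟨Polynomial.aeval y (PowerSeries.trunc n g) * a,
    A.mul_mem (Algebra.adjoin_le (Set.singleton_subset_iff.2 hy)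
    (Polynomial.aeval_mem_adjoin_singleton 𝕜 y)) ha, fun j hj => ?_⟩
  rw [Pi.mul_apply]
  by_cases hij : j = i
  · subst hij
    have h2 := h1 j hj
    rw [Pi.single_eq_same] at h2 ⊢
    have h5 : Polynomial.aeval y (PowerSeries.trunc n g) j =
        Polynomial.aeval (y j) (PowerSeries.trunc n g) :=
      (Polynomial.aeval_algHom_apply (Pi.evalAlgHom 𝕜 (fun _ : Wt (theta hI) m => Ser 𝕜 m) j)
        y _).symm
    have h6 : MvPowerSeries.X l - Polynomial.aeval (y j) (PowerSeries.trunc n g) ∈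
        ordIdeal 𝕜 (PPos m) n := by
      rw [← hgy, ← PowerSeries.subst_coe hys, ← PowerSeries.subst_sub hys, hr,
        PowerSeries.subst_mul hys, PowerSeries.subst_pow hys, PowerSeries.subst_X hys]
      exact Ideal.mul_mem_right _ _ (pow_mem_ordIdeal hy0)
    rw [h5]
    have h7 : MvPowerSeries.X l - Polynomial.aeval (y j) (PowerSeries.trunc n g) * a j =
        (MvPowerSeries.X l - Polynomial.aeval (y j) (PowerSeries.trunc n g)) +
          Polynomial.aeval (y j) (PowerSeries.trunc n g) * (1 - a j) := by ring
    rw [h7]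
    exact add_mem h6 (Ideal.mul_mem_left _ _ h2)
  · have h2 := h1 j hj
    rw [Pi.single_eq_of_ne hij, zero_sub] at h2 ⊢
    rw [← mul_neg]
    exact Ideal.mul_mem_left _ _ h2

/-- A smooth linear map that vanishes on a subalgebra containing the functions `X_l` is zero. -/
theorem IsSmooth.eq_zero_of_xFun {V : Type*} [AddCommGroup V] [Module 𝕜 V]
    (hf0 : PowerSeries.coeff 0 f = 1) (hf1 : PowerSeries.coeff 1 f = 1)
    {L : Fun 𝕜 (theta hI) m →ₗ[𝕜] V} (hL : IsSmooth L) (A : Subalgebra 𝕜 (Fun 𝕜 (theta hI) m))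
    (hA : ∀ l : PPos m, xFun hI f l.1 ∈ A) (hLA : ∀ a ∈ A, L a = 0)
    (h : Fun 𝕜 (theta hI) m) : L h = 0 := by
  classical
  refine hL.eq_zero (fun i d => ?_) h
  obtain ⟨Ω, n, hΩ⟩ := hL
  obtain ⟨a, ha, h1⟩ := single_monomial_mem (closureSub A)
    (single_one_mem_closureSub hI hf0 A hA) (single_X_mem_closureSub hI hf0 hf1 A hA) i d Ω n
  have := hΩ (Pi.single i (MvPowerSeries.monomial d 1) - a) h1
  rwa [map_sub, hLA a ha, sub_zero] at this

end Density

/-! ### Rational functions -/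

section Rational

variable {𝕜 : Type*} [Field 𝕜] {Γ : Type*} {θ : Γ → Γ} {m : ℕ}

variable (𝕜 θ m) in
/-- The ring of rational functions. -/
abbrev Rat : Type _ := FractionRing (Fun 𝕜 θ m)

variable (𝕜 θ m) in
/-- The inclusion of functions into rational functions. -/
noncomputable abbrev toRat : Fun 𝕜 θ m →+* Rat 𝕜 θ m := algebraMap _ _

theorem toRat_injective : Function.Injective (toRat 𝕜 θ m) := IsFractionRing.injective _ _

/-- The ring of functions is a product of domains, so a function that is nonzero at every weight is
regular. This admits ϰ_a − ϰ_b and X_b − X_a as denominators, although `Fun` has zero divisors. -/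
theorem mem_nonZeroDivisors_of_forall_ne {h : Fun 𝕜 θ m} (hh : ∀ i, h i ≠ 0) :
    h ∈ nonZeroDivisors (Fun 𝕜 θ m) := by
  rw [mem_nonZeroDivisors_iff_right]
  intro x hx
  funext i
  have := congrFun hx i
  exact (mul_eq_zero.1 this).resolve_right (hh i)

theorem isUnit_toRat {h : Fun 𝕜 θ m} (hh : ∀ i, h i ≠ 0) : IsUnit (toRat 𝕜 θ m h) :=
  IsLocalization.map_units (Rat 𝕜 θ m) ⟨h, mem_nonZeroDivisors_of_forall_ne hh⟩

/-- The action of the simple reflections on rational functions. -/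
noncomputable def reflRat (k : Ref m) : Rat 𝕜 θ m →+* Rat 𝕜 θ m :=
  IsLocalization.map (M := nonZeroDivisors (Fun 𝕜 θ m)) (T := nonZeroDivisors (Fun 𝕜 θ m))
    (Rat 𝕜 θ m) (reflFun k : Fun 𝕜 θ m →ₐ[𝕜] Fun 𝕜 θ m).toRingHom (by
      intro x hx
      rw [mem_nonZeroDivisors_iff_right] at hx
      rw [Submonoid.mem_comap, mem_nonZeroDivisors_iff_right]
      intro y hy
      have h1 := congrArg (reflFun k) hy
      change reflFun k (y * reflFun k x) = _ at h1
      rw [map_mul, reflFun_reflFun, map_zero] at h1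
      have h2 := congrArg (reflFun k) (hx _ h1)
      rwa [reflFun_reflFun, map_zero] at h2)

theorem reflRat_toRat (k : Ref m) (h : Fun 𝕜 θ m) :
    reflRat k (toRat 𝕜 θ m h) = toRat 𝕜 θ m (reflFun k h) :=
  IsLocalization.map_eq _ _

/-- The difference `ϰ_l - ϰ_{l'}`. -/
noncomputable def del (l l' : Pos m) : Fun 𝕜 θ m := fun _ => kap 𝕜 l - kap 𝕜 l'

open Classical in
/-- The indicator function of `i_l = i_{l'}`. -/
noncomputable def eps (l l' : Pos m) : Fun 𝕜 θ m := fun i => if i.1 l = i.1 l' then 1 else 0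

/-- Positions `l, l'` that are different up to the involution `l ↦ 1 - l`. -/
def IsPair (l l' : Pos m) : Prop := l ≠ l' ∧ l ≠ l'.neg

theorem IsPair.symm {l l' : Pos m} (h : IsPair l l') : IsPair l' l :=
  ⟨h.1.symm, fun h' => h.2 (by rw [h', Pos.neg_neg])⟩

theorem IsPair.refl {l l' : Pos m} (h : IsPair l l') (k : Ref m) :
    IsPair (TypeD.refl k l) (TypeD.refl k l') :=
  ⟨fun h' => h.1 ((TypeD.refl k).injective h'), fun h' => h.2 (by
    rw [← refl_neg] at h'
    exact (TypeD.refl k).injective h')⟩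

theorem Ref.isPair (k : Ref m) : IsPair k.lo k.hi := ⟨k.lo_ne_hi, k.lo_ne_hi_neg⟩

theorem del_ne_zero {l l' : Pos m} (h : IsPair l l') (i : Wt θ m) :
    (del l l' : Fun 𝕜 θ m) i ≠ 0 := by
  intro h0
  have := order_kap_sub_kap (𝕜 := 𝕜) h.1 h.2
  change kap 𝕜 l - kap 𝕜 l' = 0 at h0
  rw [h0] at this
  simp at this

theorem reflFun_del (k : Ref m) (l l' : Pos m) :
    reflFun k (del l l' : Fun 𝕜 θ m) = del (refl k l) (refl k l') := by
  funext i
  simp only [reflFun_apply, del, map_sub, reflSer_kap]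

theorem reflFun_eps (k : Ref m) (l l' : Pos m) :
    reflFun k (eps l l' : Fun 𝕜 θ m) = eps (refl k l) (refl k l') := by
  funext i
  by_cases h : i.1 (refl k l) = i.1 (refl k l')
  · have h' : (i.act k).1 l = (i.act k).1 l' := h
    rw [reflFun_apply, eps, eps, if_pos h', if_pos h, map_one]
  · have h' : ¬(i.act k).1 l = (i.act k).1 l' := h
    rw [reflFun_apply, eps, eps, if_neg h', if_neg h, map_zero]

/-- The rational function `-1/(ϰ_l - ϰ_{l'})` on the weights with `i_l = i_{l'}`. -/
noncomputable def ratG (l l' : Pos m) : Rat 𝕜 θ m :=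
  -toRat 𝕜 θ m (eps l l') * Ring.inverse (toRat 𝕜 θ m (del l l'))

theorem ratG_mul_del {l l' : Pos m} (h : IsPair l l') :
    (ratG l l' : Rat 𝕜 θ m) * toRat 𝕜 θ m (del l l') = -toRat 𝕜 θ m (eps l l') := by
  rw [ratG, mul_assoc, Ring.inverse_mul_cancel _ (isUnit_toRat (del_ne_zero h)), mul_one]

theorem eq_of_mul_del {l l' : Pos m} (h : IsPair l l') {a b : Rat 𝕜 θ m}
    (hab : a * toRat 𝕜 θ m (del l l') = b * toRat 𝕜 θ m (del l l')) : a = b :=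
  (isUnit_toRat (del_ne_zero h)).mul_right_cancel hab

theorem reflRat_ratG (k : Ref m) {l l' : Pos m} (h : IsPair l l') :
    reflRat k (ratG l l' : Rat 𝕜 θ m) = ratG (refl k l) (refl k l') := by
  apply eq_of_mul_del (h.refl k)
  rw [ratG_mul_del (h.refl k), ← reflFun_del, ← reflFun_eps, ← reflRat_toRat, ← reflRat_toRat,
    ← map_mul, ratG_mul_del h, map_neg]

theorem del_symm (l l' : Pos m) : (del l' l : Fun 𝕜 θ m) = -del l l' := by
  funext i
  simp [del]

theorem eps_symm (l l' : Pos m) : (eps l' l : Fun 𝕜 θ m) = eps l l' := by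
  funext i
  by_cases h : i.1 l = i.1 l'
  · rw [eps, eps, if_pos h, if_pos h.symm]
  · rw [eps, eps, if_neg h, if_neg (Ne.symm h)]

theorem eps_mul_eps_left (a b c : Pos m) :
    (eps a b : Fun 𝕜 θ m) * eps b c = eps a c * eps a b := by
  funext i
  simp only [eps, Pi.mul_apply]
  grind

theorem eps_mul_eps_right (a b c : Pos m) :
    (eps a b : Fun 𝕜 θ m) * eps b c = eps a c * eps b c := by
  funext i
  simp only [eps, Pi.mul_apply]
  grind

theorem ratG_symm {l l' : Pos m} (h : IsPair l l') :
    (ratG l l' : Rat 𝕜 θ m) + ratG l' l = 0 := by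
  apply eq_of_mul_del h
  have h1 := ratG_mul_del (𝕜 := 𝕜) (θ := θ) h
  have h2 := ratG_mul_del (𝕜 := 𝕜) (θ := θ) h.symm
  rw [del_symm, eps_symm, map_neg] at h2
  linear_combination h1 - h2

/-- Partial fractions 1/(xy) = (1/x + 1/y)/(x + y), together with the fact that any two of the
equalities i_a = i_b, i_b = i_c, i_a = i_c imply the third. This is the functional equation of the
braid relation with c = 0. -/
theorem ratG_mul_ratG {a b c : Pos m} (hab : IsPair a b) (hbc : IsPair b c) (hac : IsPair a c) :
    (ratG a b : Rat 𝕜 θ m) * ratG b c = ratG a c * (ratG a b + ratG b c) := by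
  apply eq_of_mul_del hab
  apply eq_of_mul_del hbc
  apply eq_of_mul_del hac
  have h1 := ratG_mul_del (𝕜 := 𝕜) (θ := θ) hab
  have h2 := ratG_mul_del (𝕜 := 𝕜) (θ := θ) hbc
  have h3 := ratG_mul_del (𝕜 := 𝕜) (θ := θ) hac
  have h4 : (del a c : Fun 𝕜 θ m) = del a b + del b c := by
    funext i
    simp [del]
  have h5 := eps_mul_eps_left (𝕜 := 𝕜) (θ := θ) a b c
  have h6 := eps_mul_eps_right (𝕜 := 𝕜) (θ := θ) a b c
  replace h4 := congrArg (toRat 𝕜 θ m) h4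
  replace h5 := congrArg (toRat 𝕜 θ m) h5
  replace h6 := congrArg (toRat 𝕜 θ m) h6
  simp only [map_mul, map_add] at h4 h5 h6
  set x := toRat 𝕜 θ m (del a b)
  set y := toRat 𝕜 θ m (del b c)
  set z := toRat 𝕜 θ m (del a c)
  set ea := toRat 𝕜 θ m (eps a b)
  set eb := toRat 𝕜 θ m (eps b c)
  set ec := toRat 𝕜 θ m (eps a c)
  have k1 : (ratG a b : Rat 𝕜 θ m) * ratG b c * x * y * z = ea * eb * z := by
    linear_combination (ratG b c * y * z) * h1 - ea * z * h2
  have k2 : (ratG a c : Rat 𝕜 θ m) * (ratG a b + ratG b c) * x * y * z =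
      ec * ea * y + ec * eb * x := by
    linear_combination (ratG a b + ratG b c) * x * y * h3 - ec * y * h1 - ec * x * h2
  rw [k1, k2, ← h5, ← h6, h4]
  ring

/-- The operation `h ↦ G (h - s_k(h))`, where `G = -1/(ϰ_k - ϰ_{s_k(k)})` on the weights with
`i_k = i_{s_k(k)}`. -/
noncomputable def demazure (k : Ref m) (h : Fun 𝕜 θ m) : Fun 𝕜 θ m :=
  fun i => -(eps k.lo k.hi : Fun 𝕜 θ m) i * divDiff k (h i)

/-- Where the indicator is nonzero, s_k fixes the weight (`Wt.act_eq_self`), so h − s_k(h) is a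
single power series minus its reflection. At the other weights both sides vanish. -/
theorem toRat_demazure (k : Ref m) (h : Fun 𝕜 θ m) :
    toRat 𝕜 θ m (demazure k h) =
      ratG k.lo k.hi * (toRat 𝕜 θ m h - toRat 𝕜 θ m (reflFun k h)) := by
  apply eq_of_mul_del k.isPair
  have h1 := ratG_mul_del (𝕜 := 𝕜) (θ := θ) k.isPair
  have h2 : demazure k h * del k.lo k.hi = -eps k.lo k.hi * (h - reflFun k h) := by
    funext i
    simp only [demazure, Pi.mul_apply, Pi.sub_apply, Pi.neg_apply]
    by_cases hi : i.1 k.lo = i.1 k.hi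
    · have h3 := mul_divDiff k (h i)
      rw [reflFun_apply, Wt.act_eq_self k i hi]
      simp only [del]
      linear_combination -(eps k.lo k.hi : Fun 𝕜 θ m) i * h3
    · have : (eps k.lo k.hi : Fun 𝕜 θ m) i = 0 := by rw [eps, if_neg hi]
      rw [this]
      ring
  replace h2 := congrArg (toRat 𝕜 θ m) h2
  simp only [map_mul, map_neg, map_sub] at h2
  rw [h2]
  linear_combination -(toRat 𝕜 θ m h - toRat 𝕜 θ m (reflFun k h)) * h1

end Rational

/-! ### The coefficients of `T_k` -/

section Coefficients

variable {𝕜 : Type*} [Field 𝕜] {m : ℕ}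

theorem hasSubst_pair (a b : Pos m) :
    MvPowerSeries.HasSubst fun t : Fin 2 => kap 𝕜 (![a, b] t) :=
  MvPowerSeries.hasSubst_of_constantCoeff_zero fun _ => constantCoeff_kap _

/-- Substitution of `ϰ_a`, `ϰ_b` for the variables. -/
noncomputable def pairSubst (a b : Pos m) : MvPowerSeries (Fin 2) 𝕜 →ₐ[𝕜] Ser 𝕜 m :=
  MvPowerSeries.substAlgHom (hasSubst_pair a b)

theorem pairSubst_X0 (a b : Pos m) :
    pairSubst a b (MvPowerSeries.X 0 : MvPowerSeries (Fin 2) 𝕜) = kap 𝕜 a := by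
  rw [pairSubst, MvPowerSeries.substAlgHom_X]; rfl

theorem pairSubst_X1 (a b : Pos m) :
    pairSubst a b (MvPowerSeries.X 1 : MvPowerSeries (Fin 2) 𝕜) = kap 𝕜 b := by
  rw [pairSubst, MvPowerSeries.substAlgHom_X]; rfl

theorem pairSubst_powerSeries (a b : Pos m) (t : Fin 2) (f : PowerSeries 𝕜) :
    pairSubst a b (f.subst (MvPowerSeries.X t : MvPowerSeries (Fin 2) 𝕜)) =
      f.subst (kap 𝕜 (![a, b] t)) := by
  rw [pairSubst, MvPowerSeries.substAlgHom_apply, PowerSeries.subst, PowerSeries.subst,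
    MvPowerSeries.subst_comp_subst_apply
      (MvPowerSeries.hasSubst_of_constantCoeff_zero fun _ => by simp) (hasSubst_pair a b)]
  congr 1
  funext _
  rw [MvPowerSeries.subst_X (hasSubst_pair a b)]

theorem pairSubst_fu (a b : Pos m) (f : PowerSeries 𝕜) :
    pairSubst a b (fu f) = f.subst (kap 𝕜 a) := pairSubst_powerSeries a b 0 f

theorem pairSubst_fv (a b : Pos m) (f : PowerSeries 𝕜) :
    pairSubst a b (fv f) = f.subst (kap 𝕜 b) := pairSubst_powerSeries a b 1 f

theorem pairSubst_fdd (a b : Pos m) (f : PowerSeries 𝕜) :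
    pairSubst a b (fdd f) * (kap 𝕜 a - kap 𝕜 b) = f.subst (kap 𝕜 a) - f.subst (kap 𝕜 b) := by
  have := congrArg (pairSubst a b) (fdd_mul f)
  rwa [map_mul, map_sub, map_sub, pairSubst_X0, pairSubst_X1, pairSubst_fu, pairSubst_fv] at this

theorem constantCoeff_pairSubst (a b : Pos m) (g : MvPowerSeries (Fin 2) 𝕜) :
    MvPowerSeries.constantCoeff (pairSubst a b g) = MvPowerSeries.constantCoeff g := by
  have h1 : g = MvPowerSeries.C (MvPowerSeries.constantCoeff g) +
      (g - MvPowerSeries.C (MvPowerSeries.constantCoeff g)) := by ring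
  have h2 : pairSubst a b (MvPowerSeries.C (MvPowerSeries.constantCoeff g)) =
      MvPowerSeries.C (MvPowerSeries.constantCoeff g) := (pairSubst a b).commutes _
  conv_lhs => rw [h1]
  rw [map_add, h2, map_add, pairSubst, MvPowerSeries.substAlgHom_apply,
    MvPowerSeries.constantCoeff_subst_eq_zero (hasSubst_pair a b)
      (fun _ => constantCoeff_kap _)]
  · simp
  · simp

theorem reflSer_pairSubst (k : Ref m) (a b : Pos m) (g : MvPowerSeries (Fin 2) 𝕜) :
    reflSer 𝕜 k (pairSubst a b g) = pairSubst (refl k a) (refl k b) g := by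
  rw [pairSubst, pairSubst, MvPowerSeries.substAlgHom_apply, MvPowerSeries.substAlgHom_apply,
    reflSer_subst]
  congr 1
  funext t
  fin_cases t <;> rfl

variable {f : PowerSeries 𝕜}

theorem constantCoeff_fu (hf0 : PowerSeries.coeff 0 f = 1) :
    MvPowerSeries.constantCoeff (fu f) = 1 := by
  classical
  rw [fu, ← MvPowerSeries.coeff_zero_eq_constantCoeff_apply, PowerSeries.coeff_subst_single]
  simpa using hf0

theorem constantCoeff_fv (hf0 : PowerSeries.coeff 0 f = 1) :
    MvPowerSeries.constantCoeff (fv f) = 1 := by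
  classical
  rw [fv, ← MvPowerSeries.coeff_zero_eq_constantCoeff_apply, PowerSeries.coeff_subst_single]
  simpa using hf0

theorem constantCoeff_fdd (hf1 : PowerSeries.coeff 1 f = 1) :
    MvPowerSeries.constantCoeff (fdd f) = 1 := by
  rw [← MvPowerSeries.coeff_zero_eq_constantCoeff_apply]
  exact hf1

theorem constantCoeff_comb (hf0 : PowerSeries.coeff 0 f = 1) (c d : 𝕜) :
    MvPowerSeries.constantCoeff (c • fu f - d • fv f) = c - d := by
  rw [map_sub, MvPowerSeries.constantCoeff_smul, MvPowerSeries.constantCoeff_smul,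
    constantCoeff_fu hf0, constantCoeff_fv hf0, smul_eq_mul, smul_eq_mul, mul_one, mul_one]

variable {p : 𝕜ˣ}

theorem sub_inv_ne_zero (hp1 : p ≠ 1) (hp2 : p ≠ -1) : (p : 𝕜) - (p : 𝕜)⁻¹ ≠ 0 := by
  intro h
  have h0 : (p : 𝕜) ≠ 0 := p.ne_zero
  have h1 : ((p : 𝕜) - 1) * (p + 1) = 0 := by
    have : (p : 𝕜) * ((p : 𝕜) - (p : 𝕜)⁻¹) = 0 := by rw [h, mul_zero]
    rw [mul_sub, mul_inv_cancel₀ h0] at this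
    linear_combination this
  rcases mul_eq_zero.1 h1 with h2 | h2
  · exact hp1 (Units.ext (by simpa using sub_eq_zero.1 h2))
  · exact hp2 (Units.ext (by simpa using eq_neg_of_add_eq_zero_left h2))

/-- The equations that characterize `coefSigma`. -/
theorem coefSigma_spec (hf0 : PowerSeries.coeff 0 f = 1) (hf1 : PowerSeries.coeff 1 f = 1)
    (hp1 : p ≠ 1) (hp2 : p ≠ -1) (i j : 𝕜ˣ) :
    (j = i → coefSigma p f i j * fdd f = (p : 𝕜) • fu f - (p : 𝕜)⁻¹ • fv f) ∧
    (j ≠ i → j = p ^ 2 * i →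
      coefSigma p f i j * ((p : 𝕜)⁻¹ • fu f - (p : 𝕜) • fv f) = fdd f) ∧
    (j ≠ i → j ≠ p ^ 2 * i → coefSigma p f i j * ((i : 𝕜) • fu f - (j : 𝕜) • fv f) =
      ((p : 𝕜) * i) • fu f - ((p : 𝕜)⁻¹ * j) • fv f) := by
  refine ⟨fun h => ?_, fun h1 h2 => ?_, fun h1 h2 => ?_⟩
  · rw [coefSigma, if_pos h, mul_assoc, MvPowerSeries.inv_mul_cancel _
      (by rw [constantCoeff_fdd hf1]; exact one_ne_zero), mul_one]
  · rw [coefSigma, if_neg h1, if_pos h2, mul_assoc, MvPowerSeries.inv_mul_cancel, mul_one]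
    rw [constantCoeff_comb hf0, ← neg_sub, neg_ne_zero]
    exact sub_inv_ne_zero hp1 hp2
  · rw [coefSigma, if_neg h1, if_neg h2, mul_assoc, MvPowerSeries.inv_mul_cancel, mul_one]
    rw [constantCoeff_comb hf0, sub_ne_zero]
    exact fun h => h1 (Units.ext h.symm)

/-- The equations that characterize `coefOne`. -/
theorem coefOne_spec (hf0 : PowerSeries.coeff 0 f = 1)
    (hp1 : p ≠ 1) (hp2 : p ≠ -1) (i j : 𝕜ˣ) :
    (j = i → coefOne p f i j = MvPowerSeries.C (p : 𝕜)) ∧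
    (j ≠ i → j = p ^ 2 * i →
      coefOne p f i j * ((p : 𝕜) • fu f - (p : 𝕜)⁻¹ • fv f) =
        ((p : 𝕜)⁻¹ ^ 2 - 1) • fv f) ∧
    (j ≠ i → j ≠ p ^ 2 * i → coefOne p f i j * ((j : 𝕜) • fu f - (i : 𝕜) • fv f) =
      (((p : 𝕜)⁻¹ - p) * i) • fv f) := by
  refine ⟨fun h => ?_, fun h1 h2 => ?_, fun h1 h2 => ?_⟩
  · rw [coefOne, if_pos h]
  · have : ((p : 𝕜) ^ (-2 : ℤ)) = (p : 𝕜)⁻¹ ^ 2 := by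
      rw [zpow_neg, inv_pow]
      norm_cast
    rw [coefOne, if_neg h1, if_pos h2, mul_assoc, MvPowerSeries.inv_mul_cancel, mul_one, this]
    rw [constantCoeff_comb hf0]
    exact sub_inv_ne_zero hp1 hp2
  · rw [coefOne, if_neg h1, if_neg h2, mul_assoc, MvPowerSeries.inv_mul_cancel, mul_one]
    rw [constantCoeff_comb hf0, sub_ne_zero]
    exact fun h => h1 (Units.ext h)

/-- The constant terms in the three cases are p − p⁻¹, (p⁻¹ − p)⁻¹ and (pi − p⁻¹j)/(i − j), the last
one nonzero because j ≠ p²i. So the coefficient of σ_k is invertible and σ_k can be recovered from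
T_k. -/
theorem constantCoeff_coefSigma_ne_zero (hf0 : PowerSeries.coeff 0 f = 1)
    (hf1 : PowerSeries.coeff 1 f = 1) (hp1 : p ≠ 1) (hp2 : p ≠ -1) (i j : 𝕜ˣ) :
    MvPowerSeries.constantCoeff (coefSigma p f i j) ≠ 0 := by
  obtain ⟨h1, h2, h3⟩ := coefSigma_spec hf0 hf1 hp1 hp2 i j
  intro h0
  by_cases hij : j = i
  · have := congrArg MvPowerSeries.constantCoeff (h1 hij)
    rw [map_mul, h0, zero_mul, constantCoeff_comb hf0] at this
    exact sub_inv_ne_zero hp1 hp2 this.symm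
  by_cases hij' : j = p ^ 2 * i
  · have := congrArg MvPowerSeries.constantCoeff (h2 hij hij')
    rw [map_mul, h0, zero_mul, constantCoeff_fdd hf1] at this
    exact zero_ne_one this
  · have := congrArg MvPowerSeries.constantCoeff (h3 hij hij')
    rw [map_mul, h0, zero_mul, constantCoeff_comb hf0] at this
    apply hij'
    have h0 : (p : 𝕜) ≠ 0 := p.ne_zero
    apply Units.ext
    push_cast
    field_simp at this
    linear_combination this

end Coefficients

/-! ### Power series identities for the coefficients of T_k. -/

section Identities

variable {𝕜 : Type*} [Field 𝕜] {m : ℕ} {p : 𝕜ˣ} {f : PowerSeries 𝕜}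

theorem pairSubst_C (a b : Pos m) (c : 𝕜) :
    pairSubst a b (MvPowerSeries.C c) = MvPowerSeries.C c := (pairSubst a b).commutes c

/-- The image of `coefSigma` under substitution. -/
theorem pairSubst_coefSigma (hf0 : PowerSeries.coeff 0 f = 1) (hf1 : PowerSeries.coeff 1 f = 1)
    (hp1 : p ≠ 1) (hp2 : p ≠ -1) (a b : Pos m) (i j : 𝕜ˣ) :
    let S := pairSubst a b (coefSigma p f i j)
    let U := f.subst (kap 𝕜 a)
    let W := f.subst (kap 𝕜 b)
    let D := pairSubst a b (fdd f)
    let P : Ser 𝕜 m := MvPowerSeries.C (p : 𝕜)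
    let P' : Ser 𝕜 m := MvPowerSeries.C (p : 𝕜)⁻¹
    let i' : Ser 𝕜 m := MvPowerSeries.C (i : 𝕜)
    let j' : Ser 𝕜 m := MvPowerSeries.C (j : 𝕜)
    (j = i → S * D = P * U - P' * W) ∧
    (j ≠ i → j = p ^ 2 * i → S * (P' * U - P * W) = D) ∧
    (j ≠ i → j ≠ p ^ 2 * i → S * (i' * U - j' * W) = P * i' * U - P' * j' * W) := by
  obtain ⟨h1, h2, h3⟩ := coefSigma_spec hf0 hf1 hp1 hp2 i j
  refine ⟨fun h => ?_, fun h h' => ?_, fun h h' => ?_⟩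
  · simpa only [map_mul, map_sub, map_smul, pairSubst_fu, pairSubst_fv,
      MvPowerSeries.smul_eq_C_mul, pairSubst_C] using congrArg (pairSubst a b) (h1 h)
  · simpa only [map_mul, map_sub, map_smul, pairSubst_fu, pairSubst_fv,
      MvPowerSeries.smul_eq_C_mul, pairSubst_C] using congrArg (pairSubst a b) (h2 h h')
  · simpa only [map_mul, map_sub, map_smul, pairSubst_fu, pairSubst_fv,
      MvPowerSeries.smul_eq_C_mul, pairSubst_C] using congrArg (pairSubst a b) (h3 h h')

/-- The image of `coefOne` under substitution. -/
theorem pairSubst_coefOne (hf0 : PowerSeries.coeff 0 f = 1)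
    (hp1 : p ≠ 1) (hp2 : p ≠ -1) (a b : Pos m) (i j : 𝕜ˣ) :
    let S := pairSubst a b (coefOne p f i j)
    let U := f.subst (kap 𝕜 a)
    let W := f.subst (kap 𝕜 b)
    let P : Ser 𝕜 m := MvPowerSeries.C (p : 𝕜)
    let P' : Ser 𝕜 m := MvPowerSeries.C (p : 𝕜)⁻¹
    let i' : Ser 𝕜 m := MvPowerSeries.C (i : 𝕜)
    let j' : Ser 𝕜 m := MvPowerSeries.C (j : 𝕜)
    (j = i → S = P) ∧
    (j ≠ i → j = p ^ 2 * i → S * (P * U - P' * W) = (P' ^ 2 - 1) * W) ∧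
    (j ≠ i → j ≠ p ^ 2 * i → S * (j' * U - i' * W) = (P' - P) * i' * W) := by
  obtain ⟨h1, h2, h3⟩ := coefOne_spec hf0 hp1 hp2 i j
  refine ⟨fun h => ?_, fun h h' => ?_, fun h h' => ?_⟩
  · exact (congrArg (pairSubst a b) (h1 h)).trans ((pairSubst a b).commutes _)
  · simpa only [map_mul, map_sub, map_smul, pairSubst_fu, pairSubst_fv,
      MvPowerSeries.smul_eq_C_mul, map_pow, map_one, pairSubst_C] using congrArg (pairSubst a b) (h2 h h')
  · simpa only [map_mul, map_sub, map_smul, pairSubst_fu, pairSubst_fv,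
      MvPowerSeries.smul_eq_C_mul, pairSubst_C] using congrArg (pairSubst a b) (h3 h h')

theorem C_mul_C_inv (c : 𝕜ˣ) :
    (MvPowerSeries.C (c : 𝕜) : Ser 𝕜 m) * MvPowerSeries.C (c : 𝕜)⁻¹ = 1 := by
  rw [← map_mul, mul_inv_cancel₀ c.ne_zero, map_one]

theorem C_sq_mul {i j : 𝕜ˣ} (h : j = p ^ 2 * i) :
    (MvPowerSeries.C (j : 𝕜) : Ser 𝕜 m) =
      MvPowerSeries.C (p : 𝕜) ^ 2 * MvPowerSeries.C (i : 𝕜) := by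
  rw [h, ← map_pow, ← map_mul]
  push_cast
  rfl

theorem pairSubst_fdd_symm {a b : Pos m} (h : IsPair a b) :
    pairSubst b a (fdd f) = pairSubst a b (fdd f) := by
  have h1 := pairSubst_fdd a b f
  have h2 := pairSubst_fdd b a f
  have h3 : kap 𝕜 a - kap 𝕜 b ≠ 0 := by
    intro h0
    have := order_kap_sub_kap (𝕜 := 𝕜) h.1 h.2
    rw [h0] at this
    simp at this
  apply mul_right_cancel₀ h3
  linear_combination -h2 - h1

/-- `G' = A G + B` is the rational function `(p - p⁻¹) X_b / (X_b - X_a)`. -/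
theorem affine_identity (hf0 : PowerSeries.coeff 0 f = 1) (hf1 : PowerSeries.coeff 1 f = 1)
    (hp1 : p ≠ 1) (hp2 : p ≠ -1) (a b : Pos m) (i j : 𝕜ˣ) (ε : Ser 𝕜 m)
    (h1 : j = i → ε = 1) (h0 : j ≠ i → ε = 0) :
    let X : Ser 𝕜 m := MvPowerSeries.C (i : 𝕜)⁻¹ * f.subst (kap 𝕜 a)
    let Y : Ser 𝕜 m := MvPowerSeries.C (j : 𝕜)⁻¹ * f.subst (kap 𝕜 b)
    (Y - X) * (-(pairSubst a b (coefSigma p f j i) * ε) +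
        pairSubst a b (coefOne p f i j) * (kap 𝕜 a - kap 𝕜 b)) =
      MvPowerSeries.C ((p : 𝕜) - (p : 𝕜)⁻¹) * Y * (kap 𝕜 a - kap 𝕜 b) := by
  intro X Y
  obtain ⟨s1, s2, s3⟩ := pairSubst_coefSigma hf0 hf1 hp1 hp2 a b j i
  obtain ⟨o1, o2, o3⟩ := pairSubst_coefOne hf0 hp1 hp2 a b i j
  have hD := pairSubst_fdd a b f
  have hP := C_mul_C_inv (m := m) p
  have hi := C_mul_C_inv (m := m) i
  have hj := C_mul_C_inv (m := m) j
  simp only [X, Y]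
  rw [map_sub]
  generalize pairSubst a b (coefSigma p f j i) = A at *
  generalize pairSubst a b (coefOne p f i j) = B at *
  generalize f.subst (kap 𝕜 a) = U at *
  generalize f.subst (kap 𝕜 b) = W at *
  generalize pairSubst a b (fdd f) = D at *
  generalize kap 𝕜 a - kap 𝕜 b = δ at *
  -- The three branches of the coefficients. For j ≠ i one has ε = 0, and only the term without σ_k
  -- contributes.
  by_cases hij : j = i
  · have s := s1 hij.symm
    rw [h1 hij, o1 hij, hij]
    linear_combination -MvPowerSeries.C (i : 𝕜)⁻¹ * A * hD + MvPowerSeries.C (i : 𝕜)⁻¹ * δ * s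
  by_cases hij' : j = p ^ 2 * i
  · have o := o2 hij hij'
    rw [h0 hij]
    have hc := C_sq_mul (m := m) hij'
    have hc' : (MvPowerSeries.C (j : 𝕜)⁻¹ : Ser 𝕜 m) =
        MvPowerSeries.C (p : 𝕜)⁻¹ ^ 2 * MvPowerSeries.C (i : 𝕜)⁻¹ := by
      rw [hij', ← map_pow, ← map_mul]
      push_cast
      rw [mul_inv, inv_pow]
    rw [hc']
    generalize (MvPowerSeries.C (p : 𝕜)⁻¹ : Ser 𝕜 m) = P' at *
    generalize (MvPowerSeries.C (p : 𝕜) : Ser 𝕜 m) = P at *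
    generalize (MvPowerSeries.C (i : 𝕜)⁻¹ : Ser 𝕜 m) = i' at *
    linear_combination -i' * P' * δ * o + i' * B * U * δ * hP - i' * P' * W * δ * hP
  · have o := o3 hij hij'
    rw [h0 hij]
    generalize (MvPowerSeries.C (p : 𝕜)⁻¹ : Ser 𝕜 m) = P' at *
    generalize (MvPowerSeries.C (p : 𝕜) : Ser 𝕜 m) = P at *
    generalize (MvPowerSeries.C (i : 𝕜)⁻¹ : Ser 𝕜 m) = i' at *
    generalize (MvPowerSeries.C (j : 𝕜)⁻¹ : Ser 𝕜 m) = j' at *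
    linear_combination -i' * j' * δ * o + (B * δ * U * i') * hj - (B * δ * W * j') * hi -
      (P' - P) * j' * W * δ * hi

/-- The identity of quadratic terms. -/
theorem quadratic_identity (hf0 : PowerSeries.coeff 0 f = 1) (hf1 : PowerSeries.coeff 1 f = 1)
    (hp1 : p ≠ 1) (hp2 : p ≠ -1) {I : Set 𝕜ˣ} {a b : Pos m} (hab : IsPair a b) (i j : I)
    (ε : Ser 𝕜 m) (h1 : (j : 𝕜ˣ) = i → ε = 1) (h0 : (j : 𝕜ˣ) ≠ i → ε = 0) :
    let X : Ser 𝕜 m := MvPowerSeries.C ((i : 𝕜ˣ) : 𝕜)⁻¹ * f.subst (kap 𝕜 a)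
    let Y : Ser 𝕜 m := MvPowerSeries.C ((j : 𝕜ˣ) : 𝕜)⁻¹ * f.subst (kap 𝕜 b)
    pairSubst a b (coefSigma p f j i) * pairSubst b a (coefSigma p f i j) *
      (Q (arrows p I) i j (kap 𝕜 b) (kap 𝕜 a) * (kap 𝕜 a - kap 𝕜 b) ^ 2 - ε) * (Y - X) ^ 2 =
    (kap 𝕜 a - kap 𝕜 b) ^ 2 *
      ((Y - X) ^ 2 - MvPowerSeries.C ((p : 𝕜) - (p : 𝕜)⁻¹) ^ 2 * X * Y) := by
  intro X Y
  obtain ⟨s1, s2, s3⟩ := pairSubst_coefSigma hf0 hf1 hp1 hp2 a b (j : 𝕜ˣ) i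
  obtain ⟨r1, r2, r3⟩ := pairSubst_coefSigma hf0 hf1 hp1 hp2 b a (i : 𝕜ˣ) j
  have hD := pairSubst_fdd a b f
  rw [pairSubst_fdd_symm hab] at r1 r2
  have hP := C_mul_C_inv (m := m) p
  have hi := C_mul_C_inv (m := m) (i : 𝕜ˣ)
  have hj := C_mul_C_inv (m := m) (j : 𝕜ˣ)
  have hba : kap 𝕜 b - kap 𝕜 a = -(kap 𝕜 a - kap 𝕜 b) := by ring
  simp only [X, Y, Q, hba, arrows]
  rw [map_sub]
  generalize pairSubst a b (coefSigma p f j i) = A at *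
  generalize pairSubst b a (coefSigma p f i j) = A' at *
  generalize f.subst (kap 𝕜 a) = U at *
  generalize f.subst (kap 𝕜 b) = W at *
  generalize pairSubst a b (fdd f) = D at *
  generalize kap 𝕜 a - kap 𝕜 b = δ at *
  -- the common shape: it suffices to compare after removing the factor `i⁻¹ j⁻¹`
  have key : ∀ e : Ser 𝕜 m, ∀ Z, Z = MvPowerSeries.C ((j : 𝕜ˣ) : 𝕜) * U -
      MvPowerSeries.C ((i : 𝕜ˣ) : 𝕜) * W →
      A * A' * (e * δ ^ 2 - ε) * Z ^ 2 =
        δ ^ 2 * (MvPowerSeries.C (p : 𝕜) * MvPowerSeries.C ((j : 𝕜ˣ) : 𝕜) * U -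
          MvPowerSeries.C (p : 𝕜)⁻¹ * MvPowerSeries.C ((i : 𝕜ˣ) : 𝕜) * W) *
        (MvPowerSeries.C (p : 𝕜)⁻¹ * MvPowerSeries.C ((j : 𝕜ˣ) : 𝕜) * U -
          MvPowerSeries.C (p : 𝕜) * MvPowerSeries.C ((i : 𝕜ˣ) : 𝕜) * W) →
      A * A' * (e * δ ^ 2 - ε) * (MvPowerSeries.C ((j : 𝕜ˣ) : 𝕜)⁻¹ * W -
        MvPowerSeries.C ((i : 𝕜ˣ) : 𝕜)⁻¹ * U) ^ 2 =
      δ ^ 2 * ((MvPowerSeries.C ((j : 𝕜ˣ) : 𝕜)⁻¹ * W -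
        MvPowerSeries.C ((i : 𝕜ˣ) : 𝕜)⁻¹ * U) ^ 2 -
        (MvPowerSeries.C (p : 𝕜) - MvPowerSeries.C (p : 𝕜)⁻¹) ^ 2 *
          (MvPowerSeries.C ((i : 𝕜ˣ) : 𝕜)⁻¹ * U) * (MvPowerSeries.C ((j : 𝕜ˣ) : 𝕜)⁻¹ * W)) := by
    -- The underlying factorization is (Y − X)² − (p − p⁻¹)²XY = (pX − p⁻¹Y)(p⁻¹X − pY), in which
    -- multiplying X and Y by ij turns them into jU and iW.
    intro e Z hZ hk
    have hYX : MvPowerSeries.C ((j : 𝕜ˣ) : 𝕜)⁻¹ * W - MvPowerSeries.C ((i : 𝕜ˣ) : 𝕜)⁻¹ * U =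
        -(MvPowerSeries.C ((i : 𝕜ˣ) : 𝕜)⁻¹ * MvPowerSeries.C ((j : 𝕜ˣ) : 𝕜)⁻¹ * Z) := by
      rw [hZ]
      linear_combination -(MvPowerSeries.C ((j : 𝕜ˣ) : 𝕜)⁻¹ * W) * hi +
        (MvPowerSeries.C ((i : 𝕜ˣ) : 𝕜)⁻¹ * U) * hj
    have hXY : (MvPowerSeries.C ((i : 𝕜ˣ) : 𝕜)⁻¹ * U) * (MvPowerSeries.C ((j : 𝕜ˣ) : 𝕜)⁻¹ * W) =
        (MvPowerSeries.C ((i : 𝕜ˣ) : 𝕜)⁻¹ * MvPowerSeries.C ((j : 𝕜ˣ) : 𝕜)⁻¹) ^ 2 *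
          (MvPowerSeries.C ((i : 𝕜ˣ) : 𝕜) * MvPowerSeries.C ((j : 𝕜ˣ) : 𝕜) * U * W) := by
      have : (MvPowerSeries.C ((i : 𝕜ˣ) : 𝕜) : Ser 𝕜 m) * MvPowerSeries.C ((i : 𝕜ˣ) : 𝕜)⁻¹ *
          (MvPowerSeries.C ((j : 𝕜ˣ) : 𝕜) * MvPowerSeries.C ((j : 𝕜ˣ) : 𝕜)⁻¹) = 1 := by
        rw [hi, hj, one_mul]
      linear_combination -(MvPowerSeries.C ((i : 𝕜ˣ) : 𝕜)⁻¹ *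
        MvPowerSeries.C ((j : 𝕜ˣ) : 𝕜)⁻¹ * U * W) * this
    rw [mul_assoc ((MvPowerSeries.C (p : 𝕜) - MvPowerSeries.C (p : 𝕜)⁻¹) ^ 2), hXY, hYX]
    generalize (MvPowerSeries.C ((i : 𝕜ˣ) : 𝕜)⁻¹ : Ser 𝕜 m) *
      MvPowerSeries.C ((j : 𝕜ˣ) : 𝕜)⁻¹ = ν at *
    generalize (MvPowerSeries.C (p : 𝕜)⁻¹ : Ser 𝕜 m) = P' at *
    generalize (MvPowerSeries.C (p : 𝕜) : Ser 𝕜 m) = P at *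
    generalize (MvPowerSeries.C ((i : 𝕜ˣ) : 𝕜) : Ser 𝕜 m) = i' at *
    generalize (MvPowerSeries.C ((j : 𝕜ˣ) : 𝕜) : Ser 𝕜 m) = j' at *
    subst hZ
    linear_combination ν ^ 2 * hk + δ ^ 2 * ν ^ 2 * (j' ^ 2 * U ^ 2 + i' ^ 2 * W ^ 2 -
      2 * i' * j' * U * W) * hP
  refine key _ _ rfl ?_
  by_cases hij : (j : 𝕜ˣ) = i
  · have hij2 : i = j := Subtype.ext hij.symm
    have s := s1 hij.symm
    have r := r1 hij
    rw [h1 hij, if_pos hij2, ← hij]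
    linear_combination -MvPowerSeries.C ((j : 𝕜ˣ) : 𝕜) ^ 2 *
      (A' * D * δ ^ 2 * s + δ ^ 2 * (MvPowerSeries.C (p : 𝕜) * U -
        MvPowerSeries.C (p : 𝕜)⁻¹ * W) * r - A * A' * (D * δ + (U - W)) * hD)
  have hij2 : ¬ i = j := fun h => hij (congrArg Subtype.val h).symm
  have hij3 : (i : 𝕜ˣ) ≠ j := fun h => hij h.symm
  rw [h0 hij, if_neg hij2]
  -- The cases are two arrows, one arrow in either direction, and none. Two arrows do occur when p⁴
  -- = 1, and then Q has degree two.
  by_cases hc1 : (i : 𝕜ˣ) = p ^ 2 * j <;> by_cases hc2 : (j : 𝕜ˣ) = p ^ 2 * i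
  · have s := s2 hij3 hc1
    have r := r2 hij hc2
    have e1 := C_sq_mul (m := m) hc1
    have e2 := C_sq_mul (m := m) hc2
    rw [if_pos hc1, if_pos hc2]
    generalize (MvPowerSeries.C (p : 𝕜)⁻¹ : Ser 𝕜 m) = P' at *
    generalize (MvPowerSeries.C (p : 𝕜) : Ser 𝕜 m) = P at *
    generalize (MvPowerSeries.C ((i : 𝕜ˣ) : 𝕜) : Ser 𝕜 m) = i' at *
    generalize (MvPowerSeries.C ((j : 𝕜ˣ) : 𝕜) : Ser 𝕜 m) = j' at *
    have hz1 : A * (j' * U - i' * W) = j' * P * D := by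
      rw [e1]
      linear_combination j' * P * s - A * j' * U * hP
    have hz2 : A' * (j' * U - i' * W) = -(i' * P * D) := by
      rw [e2]
      linear_combination -i' * P * r + A' * i' * W * hP
    have hF1 : P * j' * U - P' * i' * W = P * j' * (U - W) := by
      rw [e1]
      linear_combination -P * j' * W * hP
    have hF2 : P' * j' * U - P * i' * W = P * i' * (U - W) := by
      rw [e2]
      linear_combination P * i' * U * hP
    rw [hF1, hF2]
    linear_combination -δ ^ 4 * (A' * (j' * U - i' * W)) * hz1 - δ ^ 4 * j' * P * D * hz2 +
      δ ^ 2 * j' * P * i' * P * (D * δ + (U - W)) * hD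
  · have s := s2 hij3 hc1
    have r := r3 hij hc2
    have e1 := C_sq_mul (m := m) hc1
    rw [if_pos hc1, if_neg hc2, e1]
    rw [e1] at r
    generalize (MvPowerSeries.C (p : 𝕜)⁻¹ : Ser 𝕜 m) = P' at *
    generalize (MvPowerSeries.C (p : 𝕜) : Ser 𝕜 m) = P at *
    generalize (MvPowerSeries.C ((j : 𝕜ˣ) : 𝕜) : Ser 𝕜 m) = j' at *
    have hz1 : A * (j' * U - P ^ 2 * j' * W) = j' * P * D := by
      linear_combination j' * P * s - A * j' * U * hP
    have hr : A' * (j' * U - P ^ 2 * j' * W) = P' * j' * U - P * (P ^ 2 * j') * W := by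
      linear_combination -r
    linear_combination δ ^ 3 * (A' * (j' * U - P ^ 2 * j' * W)) * hz1 + δ ^ 3 * j' * P * D * hr +
      δ ^ 2 * j' * P * (P' * j' * U - P * (P ^ 2 * j') * W) * hD +
      δ ^ 2 * (P' * j' * U - P * (P ^ 2 * j') * W) * P * j' * W * hP
  · have s := s3 hij3 hc1
    have r := r2 hij hc2
    have e2 := C_sq_mul (m := m) hc2
    rw [if_neg hc1, if_pos hc2, e2]
    rw [e2] at s
    generalize (MvPowerSeries.C (p : 𝕜)⁻¹ : Ser 𝕜 m) = P' at *
    generalize (MvPowerSeries.C (p : 𝕜) : Ser 𝕜 m) = P at *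
    generalize (MvPowerSeries.C ((i : 𝕜ˣ) : 𝕜) : Ser 𝕜 m) = i' at *
    have hz2 : A' * (P ^ 2 * i' * U - i' * W) = -(i' * P * D) := by
      linear_combination -i' * P * r + A' * i' * W * hP
    linear_combination -δ ^ 3 * (A' * (P ^ 2 * i' * U - i' * W)) * s -
      δ ^ 3 * (P * (P ^ 2 * i') * U - P' * i' * W) * hz2 +
      δ ^ 2 * i' * P * (P * (P ^ 2 * i') * U - P' * i' * W) * hD -
      δ ^ 2 * (P * (P ^ 2 * i') * U - P' * i' * W) * P * i' * U * hP
  · have s := s3 hij3 hc1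
    have r := r3 hij hc2
    rw [if_neg hc1, if_neg hc2]
    generalize (MvPowerSeries.C (p : 𝕜)⁻¹ : Ser 𝕜 m) = P' at *
    generalize (MvPowerSeries.C (p : 𝕜) : Ser 𝕜 m) = P at *
    generalize (MvPowerSeries.C ((i : 𝕜ˣ) : 𝕜) : Ser 𝕜 m) = i' at *
    generalize (MvPowerSeries.C ((j : 𝕜ˣ) : 𝕜) : Ser 𝕜 m) = j' at *
    linear_combination δ ^ 2 * A' * (j' * U - i' * W) * s -
      δ ^ 2 * (P * j' * U - P' * i' * W) * r

end Identities

/-! ### The functions that occur in the relations -/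

section Data

variable {𝕜 : Type*} [Field 𝕜] {p : 𝕜ˣ} {I : Set 𝕜ˣ} (hI : Invariant p I) {m : ℕ}
  (f : PowerSeries 𝕜)

/-- The coefficient of `σ_k` in `T_k`, as a function of the weight of the image of `σ_k`. -/
noncomputable def aFun (a b : Pos m) : Fun 𝕜 (theta hI) m :=
  fun i => pairSubst a b (coefSigma p f (i.1 b) (i.1 a))

/-- The inverse of `aFun`. -/
noncomputable def aInv (a b : Pos m) : Fun 𝕜 (theta hI) m := fun i => (aFun hI f a b i)⁻¹

/-- The term of `T_k` without `σ_k`. -/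
noncomputable def bFun (a b : Pos m) : Fun 𝕜 (theta hI) m :=
  fun i => pairSubst a b (coefOne p f (i.1 a) (i.1 b))

/-- The value of `σ_k²`. -/
noncomputable def eFun (a b : Pos m) : Fun 𝕜 (theta hI) m :=
  fun i => Q (arrows p I) (i.1 a) (i.1 b) (kap 𝕜 b) (kap 𝕜 a)

/-- The error term in the braid relation. -/
noncomputable def rFun (a b c : Pos m) : Fun 𝕜 (theta hI) m :=
  fun i => -((eps a c : Fun 𝕜 (theta hI) m) i *
    QDiff (arrows p I) (i.1 a) (i.1 b) (kap 𝕜 b) (kap 𝕜 a) (kap 𝕜 c))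

/-- The constant function `p - p⁻¹`. -/
noncomputable def qFun : Fun 𝕜 (theta hI) m := algebraMap 𝕜 _ ((p : 𝕜) - (p : 𝕜)⁻¹)

theorem reflFun_aFun (k : Ref m) (a b : Pos m) :
    reflFun k (aFun hI f a b) = aFun hI f (refl k a) (refl k b) :=
  funext fun _ => reflSer_pairSubst k a b _

theorem reflFun_bFun (k : Ref m) (a b : Pos m) :
    reflFun k (bFun hI f a b) = bFun hI f (refl k a) (refl k b) :=
  funext fun _ => reflSer_pairSubst k a b _

theorem map_Q {V : Type*} (h : V → V → ℕ) {A B : Type*} [Ring A] [Ring B] (φ : A →+* B) (i j : V)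
    (a b : A) : φ (Q h i j a b) = Q h i j (φ a) (φ b) := by
  unfold Q
  split_ifs <;> simp

theorem map_QDiff {V : Type*} (h : V → V → ℕ) {A B : Type*} [Ring A] [Ring B] (φ : A →+* B)
    (i j : V) (a b c : A) : φ (QDiff h i j a b c) = QDiff h i j (φ a) (φ b) (φ c) := by
  unfold QDiff
  split_ifs <;> simp

/-- Reversing a − b produces the sign (−1)^{h_{ij} + h_{ji}}, which turns (−1)^{h_{ij}} into
(−1)^{h_{ji}}. It serves to rewrite the difference of the two σ² terms in a braid relation as a
difference of values of the same Q. -/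
theorem Q_symm {V : Type*} (h : V → V → ℕ) {A : Type*} [CommRing A] (i j : V) (a b : A) :
    Q h i j a b = Q h j i b a := by
  unfold Q
  by_cases hij : i = j
  · rw [if_pos hij, if_pos hij.symm]
  · rw [if_neg hij, if_neg (Ne.symm hij), ← neg_sub b a, neg_pow (b - a), ← mul_assoc, ← pow_add,
      add_comm (h j i)]
    congr 1
    have : h i j + (h i j + h j i) = 2 * h i j + h j i := by ring
    rw [this, pow_add, pow_mul]
    simp

variable {f}

theorem aFun_mul_aInv (hf0 : PowerSeries.coeff 0 f = 1) (hf1 : PowerSeries.coeff 1 f = 1)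
    (hp1 : p ≠ 1) (hp2 : p ≠ -1) (a b : Pos m) : aFun hI f a b * aInv hI f a b = 1 := by
  funext i
  refine MvPowerSeries.mul_inv_cancel _ ?_
  rw [aFun, constantCoeff_pairSubst]
  exact constantCoeff_coefSigma_ne_zero hf0 hf1 hp1 hp2 _ _

theorem reflFun_aInv (hf0 : PowerSeries.coeff 0 f = 1) (hf1 : PowerSeries.coeff 1 f = 1)
    (hp1 : p ≠ 1) (hp2 : p ≠ -1) (k : Ref m) (a b : Pos m) :
    reflFun k (aInv hI f a b) = aInv hI f (refl k a) (refl k b) := by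
  have h1 := congrArg (reflFun k) (aFun_mul_aInv hI hf0 hf1 hp1 hp2 a b)
  have h2 := aFun_mul_aInv hI hf0 hf1 hp1 hp2 (refl k a) (refl k b)
  rw [map_mul, map_one, reflFun_aFun] at h1
  linear_combination -(reflFun k (aInv hI f a b)) * h2 + aInv hI f (refl k a) (refl k b) * h1

theorem constantCoeff_C_mul_subst_sub (hf0 : PowerSeries.coeff 0 f = 1) (c d : 𝕜) (a b : Pos m) :
    MvPowerSeries.constantCoeff (MvPowerSeries.C c * f.subst (kap 𝕜 a) -
      MvPowerSeries.C d * f.subst (kap 𝕜 b)) = c - d := by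
  rw [map_sub, map_mul, map_mul, constantCoeff_subst_kap hf0, constantCoeff_subst_kap hf0]
  simp

theorem C_mul_subst_sub_ne_zero (hf0 : PowerSeries.coeff 0 f = 1) {c d : 𝕜} (h : c ≠ d)
    (a b : Pos m) : (MvPowerSeries.C c * f.subst (kap 𝕜 a) -
      MvPowerSeries.C d * f.subst (kap 𝕜 b)) ≠ 0 := by
  intro h0
  have := constantCoeff_C_mul_subst_sub hf0 c d a b
  rw [h0, map_zero] at this
  exact h (sub_eq_zero.1 this.symm)

theorem inv_ne_self (hp1 : p ≠ 1) (hp2 : p ≠ -1) : (p : 𝕜)⁻¹ ≠ p := fun h =>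
  sub_inv_ne_zero hp1 hp2 (sub_eq_zero.2 h.symm)

theorem inv_eq_sq_mul_inv {i j : 𝕜ˣ} : i⁻¹ = p ^ 2 * j⁻¹ ↔ j = p ^ 2 * i := by
  rw [eq_mul_inv_iff_mul_eq, inv_mul_eq_iff_eq_mul, mul_comm]

/-- The symmetry of the coefficients under exchange of `(a, b)` with `(1 - b, 1 - a)`. -/
theorem pairSubst_coefSigma_neg (hf0 : PowerSeries.coeff 0 f = 1)
    (hf1 : PowerSeries.coeff 1 f = 1) (hp1 : p ≠ 1) (hp2 : p ≠ -1)
    (hf : f * PowerSeries.rescale (-1) f = 1) {a b : Pos m} (hab : IsPair a b) (i j : 𝕜ˣ) :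
    pairSubst b.neg a.neg (coefSigma p f j⁻¹ i⁻¹) = pairSubst a b (coefSigma p f i j) := by
  obtain ⟨s1, s2, s3⟩ := pairSubst_coefSigma hf0 hf1 hp1 hp2 b.neg a.neg j⁻¹ i⁻¹
  obtain ⟨r1, r2, r3⟩ := pairSubst_coefSigma hf0 hf1 hp1 hp2 a b i j
  have hD := pairSubst_fdd a b f
  have hD' := pairSubst_fdd b.neg a.neg f
  have ha := subst_neg_kap hf a
  have hb := subst_neg_kap hf b
  have hP := C_mul_C_inv (m := m) p
  have hP2 := C_mul_subst_sub_ne_zero hf0 (inv_ne_self hp1 hp2) a b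
  have hδ : kap 𝕜 a - kap 𝕜 b ≠ 0 := by
    intro h0
    have := order_kap_sub_kap (𝕜 := 𝕜) hab.1 hab.2
    rw [h0] at this
    simp at this
  have hD0 : pairSubst a b (fdd f) ≠ 0 := by
    intro h0
    have := constantCoeff_pairSubst a b (fdd f)
    rw [h0, map_zero, constantCoeff_fdd hf1] at this
    exact zero_ne_one this
  have hU0 : f.subst (kap 𝕜 a) ≠ 0 := left_ne_zero_of_mul_eq_one ha
  have hW0 : f.subst (kap 𝕜 b) ≠ 0 := left_ne_zero_of_mul_eq_one hb
  -- As f(−ϰ) = f(ϰ)⁻¹, the divided difference at (−ϰ_b, −ϰ_a) is the one at (ϰ_a, ϰ_b) divided by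
  -- f(ϰ_a)f(ϰ_b).
  have hDD : pairSubst b.neg a.neg (fdd f) * (f.subst (kap 𝕜 a) * f.subst (kap 𝕜 b)) =
      pairSubst a b (fdd f) := by
    apply mul_right_cancel₀ hδ
    rw [kap_neg a, kap_neg b] at hD'
    rw [kap_neg] at ha hb
    linear_combination f.subst (kap 𝕜 a) * f.subst (kap 𝕜 b) * hD' - hD +
      f.subst (kap 𝕜 a) * hb - f.subst (kap 𝕜 b) * ha
  have hi := C_mul_C_inv (m := m) i
  have hj := C_mul_C_inv (m := m) j
  by_cases hij : j = i
  · have s := s1 (by rw [hij])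
    have r := r1 hij
    apply mul_right_cancel₀ hD0
    rw [r]
    linear_combination -pairSubst b.neg a.neg (coefSigma p f j⁻¹ i⁻¹) * hDD +
      f.subst (kap 𝕜 a) * f.subst (kap 𝕜 b) * s +
      MvPowerSeries.C (p : 𝕜) * f.subst (kap 𝕜 a) * hb -
      MvPowerSeries.C (p : 𝕜)⁻¹ * f.subst (kap 𝕜 b) * ha
  have hij1 : i⁻¹ ≠ j⁻¹ := fun h => hij (inv_injective h).symm
  by_cases hij' : j = p ^ 2 * i
  · have s := s2 hij1 (inv_eq_sq_mul_inv.2 hij')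
    have r := r2 hij hij'
    apply mul_right_cancel₀ hP2
    rw [r]
    linear_combination hDD + f.subst (kap 𝕜 a) * f.subst (kap 𝕜 b) * s -
      pairSubst b.neg a.neg (coefSigma p f j⁻¹ i⁻¹) *
        (MvPowerSeries.C (p : 𝕜)⁻¹ * f.subst (kap 𝕜 a) * hb -
          MvPowerSeries.C (p : 𝕜) * f.subst (kap 𝕜 b) * ha)
  · have s := s3 hij1 (fun h => hij' (inv_eq_sq_mul_inv.1 h))
    have r := r3 hij hij'
    have hne := C_mul_subst_sub_ne_zero hf0 (c := (i : 𝕜)) (d := (j : 𝕜))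
      (fun h => hij (Units.ext h.symm)) a b
    apply mul_right_cancel₀ hne
    rw [r]
    rw [Units.val_inv_eq_inv_val, Units.val_inv_eq_inv_val] at s
    generalize pairSubst b.neg a.neg (coefSigma p f j⁻¹ i⁻¹) = A at *
    generalize (MvPowerSeries.C (p : 𝕜)⁻¹ : Ser 𝕜 m) = P' at *
    generalize (MvPowerSeries.C (p : 𝕜) : Ser 𝕜 m) = P at *
    generalize (MvPowerSeries.C (i : 𝕜)⁻¹ : Ser 𝕜 m) = i' at *
    generalize (MvPowerSeries.C (j : 𝕜)⁻¹ : Ser 𝕜 m) = j' at *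
    generalize (MvPowerSeries.C (i : 𝕜) : Ser 𝕜 m) = i at *
    generalize (MvPowerSeries.C (j : 𝕜) : Ser 𝕜 m) = j at *
    generalize f.subst (kap 𝕜 a) = U at *
    generalize f.subst (kap 𝕜 b) = W at *
    generalize f.subst (kap 𝕜 a.neg) = U' at *
    generalize f.subst (kap 𝕜 b.neg) = W' at *
    linear_combination i * j * U * W * s - A * (i * U * (W * W') * hj + i * U * hb
      - j * W * (U * U') * hi - j * W * ha) + P * (i * U * (W * W') * hj + i * U * hb) -
      P' * (j * W * (U * U') * hi + j * W * ha)

/-- The coefficient depends only on the ratio of X_a and X_b and on the relation between i and j.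
Both are unchanged under (a, b) ↦ (1 − b, 1 − a), since this replaces X_a, X_b by X_b⁻¹, X_a⁻¹. -/
theorem pairSubst_coefOne_neg (hf0 : PowerSeries.coeff 0 f = 1)
    (hp1 : p ≠ 1) (hp2 : p ≠ -1)
    (hf : f * PowerSeries.rescale (-1) f = 1) (a b : Pos m) (i j : 𝕜ˣ) :
    pairSubst b.neg a.neg (coefOne p f j⁻¹ i⁻¹) = pairSubst a b (coefOne p f i j) := by
  obtain ⟨s1, s2, s3⟩ := pairSubst_coefOne hf0 hp1 hp2 b.neg a.neg j⁻¹ i⁻¹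
  obtain ⟨r1, r2, r3⟩ := pairSubst_coefOne hf0 hp1 hp2 a b i j
  have ha := subst_neg_kap hf a
  have hb := subst_neg_kap hf b
  have hP := C_mul_C_inv (m := m) p
  have hP2 := C_mul_subst_sub_ne_zero hf0 (inv_ne_self hp1 hp2).symm a b
  have hi := C_mul_C_inv (m := m) i
  have hj := C_mul_C_inv (m := m) j
  by_cases hij : j = i
  · rw [s1 (by rw [hij]), r1 hij]
  have hij1 : i⁻¹ ≠ j⁻¹ := fun h => hij (inv_injective h).symm
  by_cases hij' : j = p ^ 2 * i
  · have s := s2 hij1 (inv_eq_sq_mul_inv.2 hij')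
    have r := r2 hij hij'
    apply mul_right_cancel₀ hP2
    rw [r]
    generalize pairSubst b.neg a.neg (coefOne p f j⁻¹ i⁻¹) = A at *
    generalize (MvPowerSeries.C (p : 𝕜)⁻¹ : Ser 𝕜 m) = P' at *
    generalize (MvPowerSeries.C (p : 𝕜) : Ser 𝕜 m) = P at *
    generalize f.subst (kap 𝕜 a) = U at *
    generalize f.subst (kap 𝕜 b) = W at *
    generalize f.subst (kap 𝕜 a.neg) = U' at *
    generalize f.subst (kap 𝕜 b.neg) = W' at *
    linear_combination U * W * s - A * (P * U * hb - P' * W * ha) + (P' ^ 2 - 1) * W * ha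
  · have s := s3 hij1 (fun h => hij' (inv_eq_sq_mul_inv.1 h))
    have r := r3 hij hij'
    have hne := C_mul_subst_sub_ne_zero hf0 (c := (j : 𝕜)) (d := (i : 𝕜))
      (fun h => hij (Units.ext h)) a b
    apply mul_right_cancel₀ hne
    rw [r]
    rw [Units.val_inv_eq_inv_val, Units.val_inv_eq_inv_val] at s
    generalize pairSubst b.neg a.neg (coefOne p f j⁻¹ i⁻¹) = A at *
    generalize (MvPowerSeries.C (p : 𝕜)⁻¹ : Ser 𝕜 m) = P' at *
    generalize (MvPowerSeries.C (p : 𝕜) : Ser 𝕜 m) = P at *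
    generalize (MvPowerSeries.C (i : 𝕜)⁻¹ : Ser 𝕜 m) = i' at *
    generalize (MvPowerSeries.C (j : 𝕜)⁻¹ : Ser 𝕜 m) = j' at *
    generalize (MvPowerSeries.C (i : 𝕜) : Ser 𝕜 m) = i at *
    generalize (MvPowerSeries.C (j : 𝕜) : Ser 𝕜 m) = j at *
    generalize f.subst (kap 𝕜 a) = U at *
    generalize f.subst (kap 𝕜 b) = W at *
    generalize f.subst (kap 𝕜 a.neg) = U' at *
    generalize f.subst (kap 𝕜 b.neg) = W' at *
    linear_combination i * j * U * W * s - A * (j * U * (W * W') * hi + j * U * hb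
      - i * W * (U * U') * hj - i * W * ha) + (P' - P) * (i * W * (U * U') * hj + i * W * ha)

theorem aFun_neg (hf0 : PowerSeries.coeff 0 f = 1)
    (hf1 : PowerSeries.coeff 1 f = 1) (hp1 : p ≠ 1) (hp2 : p ≠ -1)
    (hf : f * PowerSeries.rescale (-1) f = 1) {a b : Pos m} (hab : IsPair a b) :
    aFun hI f b.neg a.neg = aFun hI f a b := by
  funext i
  rw [aFun, aFun, Wt.coe_neg, Wt.coe_neg, pairSubst_coefSigma_neg hf0 hf1 hp1 hp2 hf hab]

theorem bFun_neg (hf0 : PowerSeries.coeff 0 f = 1) (hp1 : p ≠ 1) (hp2 : p ≠ -1)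
    (hf : f * PowerSeries.rescale (-1) f = 1) (a b : Pos m) :
    bFun hI f b.neg a.neg = bFun hI f a b := by
  funext i
  rw [bFun, bFun, Wt.coe_neg, Wt.coe_neg, pairSubst_coefOne_neg hf0 hp1 hp2 hf]

end Data

/-! ### The functional equations of the rational function attached to T_k. -/

section RationalData

variable {𝕜 : Type*} [Field 𝕜] {p : 𝕜ˣ} {I : Set 𝕜ˣ} (hI : Invariant p I) {m : ℕ}
  (f : PowerSeries 𝕜)

/-- The rational function `(p - p⁻¹) X_b / (X_b - X_a)`. -/
noncomputable def ratX (a b : Pos m) : Rat 𝕜 (theta hI) m :=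
  toRat 𝕜 (theta hI) m (aFun hI f a b) * ratG a b + toRat 𝕜 (theta hI) m (bFun hI f a b)

variable {f} (hf0 : PowerSeries.coeff 0 f = 1) (hf1 : PowerSeries.coeff 1 f = 1)
  (hp1 : p ≠ 1) (hp2 : p ≠ -1) (hf : f * PowerSeries.rescale (-1) f = 1)

include hf0 hf1 hp1 hp2 hf

omit hp1 hp2 in
-- If the entries agree, the difference is a nonzero scalar times (ϰ_a − ϰ_b) times a divided
-- difference of f with constant term 1. If they differ, the constant term is already nonzero.
theorem xFun_sub_ne_zero {a b : Pos m} (hab : IsPair a b) (i : Wt (theta hI) m) :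
    (xFun hI f b - xFun hI f a) i ≠ 0 := by
  rw [Pi.sub_apply, xFun, xFun, fSer_eq hf0 hf, fSer_eq hf0 hf]
  by_cases hi : i.1 a = i.1 b
  · rw [hi, ← mul_sub, ← neg_sub, ← pairSubst_fdd]
    have hC : (MvPowerSeries.C ((i.1 b : 𝕜ˣ) : 𝕜)⁻¹ : Ser 𝕜 m) ≠ 0 :=
      right_ne_zero_of_mul_eq_one (C_mul_C_inv _)
    refine mul_ne_zero hC (neg_ne_zero.2 (mul_ne_zero ?_ (del_ne_zero hab i)))
    intro h0
    have := constantCoeff_pairSubst a b (fdd f)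
    rw [h0, map_zero, constantCoeff_fdd hf1] at this
    exact zero_ne_one this
  · exact C_mul_subst_sub_ne_zero hf0 (fun h => hi (Subtype.ext (Units.ext
      (inv_injective h.symm)))) b a

omit hp1 hp2 in
theorem eq_of_mul_xFun_sub {a b : Pos m} (hab : IsPair a b) {x y : Rat 𝕜 (theta hI) m}
    (h : (toRat 𝕜 (theta hI) m (xFun hI f b) - toRat 𝕜 (theta hI) m (xFun hI f a)) * x =
      (toRat 𝕜 (theta hI) m (xFun hI f b) - toRat 𝕜 (theta hI) m (xFun hI f a)) * y) :
    x = y := by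
  rw [← map_sub] at h
  exact (isUnit_toRat (xFun_sub_ne_zero hI hf0 hf1 hf hab)).mul_left_cancel h

/-- The case distinctions in the definition of the coefficients disappear here: A G + B is the
single expression (p − p⁻¹) X_b/(X_b − X_a). The later identities for `ratX` need only this closed
form. -/
theorem xFun_sub_mul_ratX {a b : Pos m} (hab : IsPair a b) :
    (toRat 𝕜 (theta hI) m (xFun hI f b) - toRat 𝕜 (theta hI) m (xFun hI f a)) * ratX hI f a b =
      toRat 𝕜 (theta hI) m (qFun hI) * toRat 𝕜 (theta hI) m (xFun hI f b) := by
  apply eq_of_mul_del hab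
  have h1 := ratG_mul_del (𝕜 := 𝕜) (θ := theta hI) hab
  have h2 : (xFun hI f b - xFun hI f a) * (-(aFun hI f a b * eps a b) + bFun hI f a b * del a b) =
      qFun hI * xFun hI f b * del a b := by
    funext i
    have := affine_identity (m := m) hf0 hf1 hp1 hp2 a b (i.1 a) (i.1 b)
      ((eps a b : Fun 𝕜 (theta hI) m) i)
      (fun h => by rw [eps, if_pos (Subtype.ext h.symm)])
      (fun h => by rw [eps, if_neg (fun h' => h (congrArg Subtype.val h').symm)])
    simp only [Pi.sub_apply, Pi.mul_apply, Pi.add_apply, Pi.neg_apply, xFun, fSer_eq hf0 hf]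
    exact this
  replace h2 := congrArg (toRat 𝕜 (theta hI) m) h2
  simp only [map_mul, map_add, map_sub, map_neg] at h2
  rw [ratX]
  linear_combination h2 + (toRat 𝕜 (theta hI) m (xFun hI f b) -
    toRat 𝕜 (theta hI) m (xFun hI f a)) * toRat 𝕜 (theta hI) m (aFun hI f a b) * h1

/-- Clearing the denominator leaves q X_b − q X_a = q (X_b − X_a) with q = p − p⁻¹. The sum is the
linear coefficient in the quadratic relation of T_k. -/
theorem ratX_symm {a b : Pos m} (hab : IsPair a b) :
    ratX hI f a b + ratX hI f b a = toRat 𝕜 (theta hI) m (qFun hI) := by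
  apply eq_of_mul_xFun_sub hI hf0 hf1 hf hab
  have h1 := xFun_sub_mul_ratX hI hf0 hf1 hp1 hp2 hf hab
  have h2 := xFun_sub_mul_ratX hI hf0 hf1 hp1 hp2 hf hab.symm
  linear_combination h1 - h2

/-- The multiplicative analogue of the partial fraction identity for `ratG`; the correction by q
reflects that the sum in `ratX_symm` is q instead of 0. -/
theorem ratX_mul_ratX {a b c : Pos m} (hab : IsPair a b) (hbc : IsPair b c) (hac : IsPair a c) :
    ratX hI f a b * ratX hI f b c =
      ratX hI f a c * (ratX hI f a b + ratX hI f b c - toRat 𝕜 (theta hI) m (qFun hI)) := by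
  apply eq_of_mul_xFun_sub hI hf0 hf1 hf hab
  apply eq_of_mul_xFun_sub hI hf0 hf1 hf hbc
  apply eq_of_mul_xFun_sub hI hf0 hf1 hf hac
  have h1 := xFun_sub_mul_ratX hI hf0 hf1 hp1 hp2 hf hab
  have h2 := xFun_sub_mul_ratX hI hf0 hf1 hp1 hp2 hf hbc
  have h3 := xFun_sub_mul_ratX hI hf0 hf1 hp1 hp2 hf hac
  generalize toRat 𝕜 (theta hI) m (xFun hI f a) = x at *
  generalize toRat 𝕜 (theta hI) m (xFun hI f b) = y at *
  generalize toRat 𝕜 (theta hI) m (xFun hI f c) = z at *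
  generalize toRat 𝕜 (theta hI) m (qFun hI) = q at *
  generalize ratX hI f a b = X at *
  generalize ratX hI f b c = Y at *
  generalize ratX hI f a c = Z at *
  linear_combination (z - x) * (z - y) * Y * h1 + (z - x) * q * y * h2 -
    (z - y) * (y - x) * (X + Y - q) * h3 - q * z * (z - y) * h1 - q * z * (y - x) * h2

/-- The one place where the choice of Q matters: the squares of the intertwiners σ_k − G and T_k −
G' differ by the factor A s_k(A). With denominators cleared this is `quadratic_identity`. -/
theorem aFun_mul_aFun {a b : Pos m} (hab : IsPair a b) :
    toRat 𝕜 (theta hI) m (aFun hI f a b) * toRat 𝕜 (theta hI) m (aFun hI f b a) *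
      (toRat 𝕜 (theta hI) m (eFun hI a b) + ratG a b * ratG b a) =
    1 + ratX hI f a b * ratX hI f b a := by
  apply eq_of_mul_xFun_sub hI hf0 hf1 hf hab
  apply eq_of_mul_xFun_sub hI hf0 hf1 hf hab
  apply eq_of_mul_del hab
  apply eq_of_mul_del hab
  have h1 := ratG_mul_del (𝕜 := 𝕜) (θ := theta hI) hab
  have hs := ratG_symm (𝕜 := 𝕜) (θ := theta hI) hab
  have h2 := xFun_sub_mul_ratX hI hf0 hf1 hp1 hp2 hf hab
  have h3 := xFun_sub_mul_ratX hI hf0 hf1 hp1 hp2 hf hab.symm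
  have h4 : aFun hI f a b * aFun hI f b a * (eFun hI a b * del a b ^ 2 - eps a b) *
      (xFun hI f b - xFun hI f a) ^ 2 = del a b ^ 2 * ((xFun hI f b - xFun hI f a) ^ 2 -
        qFun hI ^ 2 * xFun hI f a * xFun hI f b) := by
    funext i
    have := quadratic_identity (m := m) hf0 hf1 hp1 hp2 hab (i.1 a) (i.1 b)
      ((eps a b : Fun 𝕜 (theta hI) m) i)
      (fun h => by rw [eps, if_pos (Subtype.ext h.symm)])
      (fun h => by rw [eps, if_neg (fun h' => h (congrArg Subtype.val h').symm)])
    simp only [Pi.sub_apply, Pi.mul_apply, Pi.pow_apply, xFun, fSer_eq hf0 hf]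
    exact this
  have h5 : (eps a b : Fun 𝕜 (theta hI) m) ^ 2 = eps a b := by
    funext i
    simp only [eps, Pi.pow_apply]
    split_ifs <;> simp
  replace h4 := congrArg (toRat 𝕜 (theta hI) m) h4
  replace h5 := congrArg (toRat 𝕜 (theta hI) m) h5
  simp only [map_mul, map_sub, map_pow] at h4 h5
  rw [eq_neg_of_add_eq_zero_right hs]
  generalize toRat 𝕜 (theta hI) m (xFun hI f a) = x at *
  generalize toRat 𝕜 (theta hI) m (xFun hI f b) = y at *
  generalize toRat 𝕜 (theta hI) m (qFun hI) = q at *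
  generalize toRat 𝕜 (theta hI) m (aFun hI f a b) = A at *
  generalize toRat 𝕜 (theta hI) m (aFun hI f b a) = A' at *
  generalize toRat 𝕜 (theta hI) m (eFun hI a b) = e at *
  generalize toRat 𝕜 (theta hI) m (eps a b) = ε at *
  generalize toRat 𝕜 (theta hI) m (del a b) = δ at *
  generalize ratX hI f a b = X at *
  generalize ratX hI f b a = Y at *
  generalize (ratG a b : Rat 𝕜 (theta hI) m) = G at *
  linear_combination h4 - A * A' * (y - x) ^ 2 * (G * δ - ε) * h1 - A * A' * (y - x) ^ 2 * h5 -
    δ ^ 2 * (y - x) * Y * h2 + δ ^ 2 * q * y * h3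

omit hf0 hf1 hp1 hp2 hf in
-- Where i_a = i_c, symmetry of Q turns the difference on the right into Q(ϰ_b, ϰ_a) − Q(ϰ_b, ϰ_c),
-- and `QDiff_mul` applies. So the braid error of the σ_k has exactly the shape required by
-- `IsDemazure.braid_affine`.
theorem toRat_rFun {a b c : Pos m} (hac : IsPair a c) :
    toRat 𝕜 (theta hI) m (rFun hI a b c) =
      ratG a c * (toRat 𝕜 (theta hI) m (eFun hI a b) - toRat 𝕜 (theta hI) m (eFun hI b c)) := by
  apply eq_of_mul_del hac
  have h1 := ratG_mul_del (𝕜 := 𝕜) (θ := theta hI) hac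
  have h2 : rFun hI a b c * del a c = -(eps a c * (eFun hI a b - eFun hI b c)) := by
    funext i
    simp only [rFun, eFun, del, Pi.mul_apply, Pi.sub_apply, Pi.neg_apply]
    by_cases hi : i.1 a = i.1 c
    · have h3 := QDiff_mul (arrows p I) (i.1 a) (i.1 b) (kap 𝕜 b) (kap 𝕜 a) (kap 𝕜 c)
      rw [← hi, Q_symm (arrows p I) (i.1 b) (i.1 a)]
      linear_combination -(eps a c : Fun 𝕜 (theta hI) m) i * h3
    · rw [eps, if_neg hi]
      ring
  replace h2 := congrArg (toRat 𝕜 (theta hI) m) h2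
  simp only [map_mul, map_sub, map_neg] at h2
  linear_combination h2 - (toRat 𝕜 (theta hI) m (eFun hI a b) -
    toRat 𝕜 (theta hI) m (eFun hI b c)) * h1

omit hf0 hf1 hp1 hp2 hf in
theorem reflRat_ratX (k : Ref m) {a b : Pos m} (hab : IsPair a b) :
    reflRat k (ratX hI f a b) = ratX hI f (refl k a) (refl k b) := by
  rw [ratX, ratX, map_add, map_mul, reflRat_toRat, reflRat_toRat, reflRat_ratG k hab,
    reflFun_aFun, reflFun_bFun]

end RationalData

/-! ### Families of Demazure operators -/

/-- The assumptions of the theorem on `p` and on the power series `f`. -/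
structure IsAdmissible {𝕜 : Type*} [Field 𝕜] (p : 𝕜ˣ) (f : PowerSeries 𝕜) (m : ℕ) : Prop where
  coeff_zero : PowerSeries.coeff 0 f = 1
  coeff_one : PowerSeries.coeff 1 f = 1
  ne_one : p ≠ 1
  ne_neg_one : p ≠ -1
  flip : 1 < m → f * PowerSeries.rescale (-1) f = 1

/-- Pairs of simple reflections that commute. -/
def IsCommPair {m : ℕ} (k k' : Ref m) : Prop :=
  (1 ≤ k.1 ∧ k.1 + 1 < k'.1) ∨ (k.1 = 0 ∧ 0 < k'.1 ∧ k'.1 ≠ 2)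

section Families

variable {𝕜 : Type*} [Field 𝕜] {p : 𝕜ˣ} {I : Set 𝕜ˣ} {hI : Invariant p I} {m : ℕ}
  {f : PowerSeries 𝕜}

theorem demazure_eq_zero {Γ : Type*} {θ : Γ → Γ} (k : Ref m) {h : Fun 𝕜 θ m}
    (hh : reflFun k h = h) : demazure k h = 0 := by
  apply toRat_injective
  rw [toRat_demazure, hh, sub_self, mul_zero, map_zero]

/-- The reflections of a commuting pair move disjoint sets of positions, except for s_0 and s_1.
These two move the same four positions, and each sends the pair (lo, hi) of the other to (1 − hi, 1
− lo). -/
theorem IsCommPair.refl_cases {k k' : Ref m} (h : IsCommPair k k') :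
    ((refl k k'.lo = k'.lo ∧ refl k k'.hi = k'.hi) ∨
      (refl k k'.lo = k'.hi.neg ∧ refl k k'.hi = k'.lo.neg)) ∧
    ((refl k' k.lo = k.lo ∧ refl k' k.hi = k.hi) ∨
      (refl k' k.lo = k.hi.neg ∧ refl k' k.hi = k.lo.neg)) := by
  have hk := k.2
  have hk' := k'.2
  by_cases h1 : k.1 = 0 ∧ k'.1 = 1
  · have e1 : k'.lo = k.lo.neg := Subtype.ext (by simp only [Ref.lo, Pos.neg]; omega)
    have e2 : k'.hi = k.hi := Subtype.ext (by simp only [Ref.hi]; split_ifs <;> omega)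
    have e3 : k.lo = k'.lo.neg := by rw [e1, Pos.neg_neg]
    refine ⟨Or.inr ⟨?_, ?_⟩, Or.inr ⟨?_, ?_⟩⟩
    · rw [e1, refl_neg, refl_lo, e2]
    · rw [e2, refl_hi, e1, Pos.neg_neg]
    · rw [e3, refl_neg, refl_lo, e2]
    · rw [← e2, refl_hi, e3, Pos.neg_neg]
  · refine ⟨Or.inl ⟨refl_else k ?_, refl_else k ?_⟩,
      Or.inl ⟨refl_else k' ?_, refl_else k' ?_⟩⟩ <;>
    · simp only [IsCommPair] at h
      simp only [ne_eq, Subtype.ext_iff, Ref.lo, Ref.hi, Pos.neg]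
      split_ifs <;> omega

theorem Ref.isPair_lo_hi {k k' : Ref m} (h : k'.lo = k.hi) :
    IsPair k.lo k'.hi ∧ refl k k'.hi = k'.hi ∧ refl k' k.lo = k.lo := by
  have hk := k.2
  have hk' := k'.2
  have h' := congrArg Subtype.val h
  simp only [Ref.lo, Ref.hi] at h'
  refine ⟨?_, refl_else k ?_, refl_else k' ?_⟩ <;>
  · simp only [IsPair, ne_eq, Subtype.ext_iff, Ref.lo, Ref.hi, Pos.neg]
    split_ifs at h' ⊢ <;> omega

variable {R : Type*} [Ring R]

/-- A family of operators that satisfies the relations between the `σ_k` and the functions. -/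
structure IsSigmaFamily (ρ : Fun 𝕜 (theta hI) m →+* R) (S : Ref m → R) : Prop where
  leibniz : ∀ k h, S k * ρ h = ρ (reflFun k h) * S k + ρ (demazure k h)
  sq : ∀ k : Ref m, S k * S k = ρ (eFun hI k.lo k.hi)
  comm : ∀ k k', IsCommPair k k' → S k * S k' = S k' * S k
  braid : ∀ k k' : Ref m, k'.lo = k.hi →
    S k * S k' * S k - S k' * S k * S k' = ρ (rFun hI k.lo k.hi k'.hi)

variable (f) in
/-- A family of operators that satisfies the relations between the `T_k` and the functions. -/
structure IsHeckeFamily (ρ : Fun 𝕜 (theta hI) m →+* R) (T : Ref m → R) : Prop where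
  leibniz : ∀ (k : Ref m) h, T k * ρ h = ρ (reflFun k h) * T k +
    ρ (aFun hI f k.lo k.hi * demazure k h + bFun hI f k.lo k.hi * (h - reflFun k h))
  quad : ∀ k : Ref m, T k * T k = ρ (qFun hI) * T k + 1
  comm : ∀ k k', IsCommPair k k' → T k * T k' = T k' * T k
  braid : ∀ k k' : Ref m, k'.lo = k.hi → T k * T k' * T k = T k' * T k * T k'

variable {ρ : Fun 𝕜 (theta hI) m →+* R}

/-- The ring endomorphism underlying `reflFun`. -/
noncomputable abbrev reflHom {Γ : Type*} {θ : Γ → Γ} (k : Ref m) : Fun 𝕜 θ m →+* Fun 𝕜 θ m :=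
  (reflFun k : Fun 𝕜 θ m →ₐ[𝕜] Fun 𝕜 θ m).toRingHom

theorem IsSigmaFamily.isDemazure {S : Ref m → R} (hS : IsSigmaFamily ρ S) (k : Ref m) :
    IsDemazure (toRat 𝕜 (theta hI) m) ρ (reflHom k) (ratG k.lo k.hi) (demazure k) (S k) where
  diff := toRat_demazure k
  leibniz := hS.leibniz k

theorem IsHeckeFamily.isDemazure {T : Ref m → R} (hT : IsHeckeFamily f ρ T) (k : Ref m) :
    IsDemazure (toRat 𝕜 (theta hI) m) ρ (reflHom k) (ratX hI f k.lo k.hi)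
      (fun h => aFun hI f k.lo k.hi * demazure k h + bFun hI f k.lo k.hi * (h - reflFun k h))
      (T k) where
  diff h := by
    rw [map_add, map_mul, map_mul, toRat_demazure, map_sub, ratX]
    simp only [reflHom, AlgHom.toRingHom_eq_coe, RingHom.coe_coe]
    ring
  leibniz := hT.leibniz k

theorem reflFun_aFun_of_isCommPair (ha : IsAdmissible p f m) {k k' : Ref m}
    (h : (refl k k'.lo = k'.lo ∧ refl k k'.hi = k'.hi) ∨
      (refl k k'.lo = k'.hi.neg ∧ refl k k'.hi = k'.lo.neg)) :
    reflFun k (aFun hI f k'.lo k'.hi) = aFun hI f k'.lo k'.hi := by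
  rw [reflFun_aFun]
  rcases h with h | h
  · rw [h.1, h.2]
  · rw [h.1, h.2, aFun_neg hI ha.coeff_zero ha.coeff_one ha.ne_one ha.ne_neg_one (ha.flip k.2.1)
      k'.isPair]

theorem reflFun_bFun_of_isCommPair (ha : IsAdmissible p f m) {k k' : Ref m}
    (h : (refl k k'.lo = k'.lo ∧ refl k k'.hi = k'.hi) ∨
      (refl k k'.lo = k'.hi.neg ∧ refl k k'.hi = k'.lo.neg)) :
    reflFun k (bFun hI f k'.lo k'.hi) = bFun hI f k'.lo k'.hi := by
  rw [reflFun_bFun]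
  rcases h with h | h
  · rw [h.1, h.2]
  · rw [h.1, h.2, bFun_neg hI ha.coeff_zero ha.ne_one ha.ne_neg_one (ha.flip k.2.1)]

theorem reflFun_aInv_of_isCommPair (ha : IsAdmissible p f m) {k k' : Ref m}
    (h : (refl k k'.lo = k'.lo ∧ refl k k'.hi = k'.hi) ∨
      (refl k k'.lo = k'.hi.neg ∧ refl k k'.hi = k'.lo.neg)) :
    reflFun k (aInv hI f k'.lo k'.hi) = aInv hI f k'.lo k'.hi := by
  have h1 := congrArg (reflFun k) (aFun_mul_aInv hI ha.coeff_zero ha.coeff_one ha.ne_one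
    ha.ne_neg_one k'.lo k'.hi)
  have h2 := aFun_mul_aInv hI ha.coeff_zero ha.coeff_one ha.ne_one ha.ne_neg_one k'.lo k'.hi
  rw [map_mul, map_one, reflFun_aFun_of_isCommPair ha h] at h1
  linear_combination -(reflFun k (aInv hI f k'.lo k'.hi)) * h2 + aInv hI f k'.lo k'.hi * h1

theorem IsSigmaFamily.commute {S : Ref m → R} (hS : IsSigmaFamily ρ S) {k : Ref m}
    {h : Fun 𝕜 (theta hI) m} (hh : reflFun k h = h) : Commute (S k) (ρ h) := by
  have := hS.leibniz k h
  rwa [hh, demazure_eq_zero k hh, map_zero, add_zero] at this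

theorem IsHeckeFamily.commute {T : Ref m → R} (hT : IsHeckeFamily f ρ T) {k : Ref m}
    {h : Fun 𝕜 (theta hI) m} (hh : reflFun k h = h) : Commute (T k) (ρ h) := by
  have := hT.leibniz k h
  rwa [hh, demazure_eq_zero k hh, sub_self, mul_zero, mul_zero, add_zero, map_zero,
    add_zero] at this

theorem commute_affine {F : Type*} [CommRing F] {ρ : F →+* R} {D D' : R} {A B A' B' : F}
    (h : Commute D D') (hA : Commute D' (ρ A)) (hB : Commute D' (ρ B)) (hA' : Commute D (ρ A'))
    (hB' : Commute D (ρ B')) : Commute (ρ A * D + ρ B) (ρ A' * D' + ρ B') := by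
  have hρ : ∀ x y, Commute (ρ x) (ρ y) := fun x y => (Commute.all x y).map ρ
  refine Commute.add_left ?_ ?_
  · exact Commute.add_right
      (((hρ _ _).mul_right hA.symm).mul_left (hA'.mul_right h)) ((hρ _ _).mul_left hB')
  · exact Commute.add_right ((hρ _ _).mul_right hB.symm) (hρ _ _)

theorem reflRat_ratX_lo_hi (k : Ref m) :
    reflRat k (ratX hI f k.lo k.hi) = ratX hI f k.hi k.lo := by
  rw [reflRat_ratX hI k k.isPair, refl_lo, refl_hi]

theorem reflRat_ratG_lo_hi (k : Ref m) :
    reflRat k (ratG k.lo k.hi : Rat 𝕜 (theta hI) m) = ratG k.hi k.lo := by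
  rw [reflRat_ratG k k.isPair, refl_lo, refl_hi]

theorem ratX_lo_hi_symm (ha : IsAdmissible p f m) (k : Ref m) :
    ratX hI f k.lo k.hi + reflRat k (ratX hI f k.lo k.hi) = toRat 𝕜 (theta hI) m (qFun hI) := by
  rw [reflRat_ratX_lo_hi]
  exact ratX_symm hI ha.coeff_zero ha.coeff_one ha.ne_one ha.ne_neg_one (ha.flip k.2.1) k.isPair

theorem ratG_lo_hi_symm (k : Ref m) :
    ratG k.lo k.hi + reflRat k (ratG k.lo k.hi : Rat 𝕜 (theta hI) m) =
      toRat 𝕜 (theta hI) m 0 := by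
  rw [reflRat_ratG_lo_hi, ratG_symm k.isPair, map_zero]

theorem aFun_mul_reflFun_aFun (ha : IsAdmissible p f m) (k : Ref m) :
    toRat 𝕜 (theta hI) m (aFun hI f k.lo k.hi) *
        toRat 𝕜 (theta hI) m (reflHom k (aFun hI f k.lo k.hi)) *
      (toRat 𝕜 (theta hI) m (eFun hI k.lo k.hi) + ratG k.lo k.hi * reflRat k (ratG k.lo k.hi)) =
    toRat 𝕜 (theta hI) m 1 + ratX hI f k.lo k.hi * reflRat k (ratX hI f k.lo k.hi) := by
  have h1 : reflHom k (aFun hI f k.lo k.hi) = aFun hI f k.hi k.lo := by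
    change reflFun k _ = _
    rw [reflFun_aFun, refl_lo, refl_hi]
  rw [h1, reflRat_ratX_lo_hi, reflRat_ratG_lo_hi, map_one]
  exact aFun_mul_aFun hI ha.coeff_zero ha.coeff_one ha.ne_one ha.ne_neg_one (ha.flip k.2.1)
    k.isPair

/-- The operators `T_k = A σ_k + B` satisfy the relations of the affine Hecke algebra. -/
theorem IsSigmaFamily.hecke (ha : IsAdmissible p f m) {S : Ref m → R}
    (hS : IsSigmaFamily ρ S) :
    IsHeckeFamily f ρ fun k => ρ (aFun hI f k.lo k.hi) * S k + ρ (bFun hI f k.lo k.hi) where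
  leibniz k h := ((hS.isDemazure k).affine (aFun hI f k.lo k.hi) (bFun hI f k.lo k.hi)).leibniz h
  quad k := by
    -- For σ_k the data are c = 0 and e = Q; for T_k they are c' = p − p⁻¹ and e' = 1.
    have := (hS.isDemazure k).quad_affine toRat_injective (reflRat_toRat k)
      (c := 0) (e := eFun hI k.lo k.hi) (c' := qFun hI) (e' := 1)
      (A := aFun hI f k.lo k.hi) (B := bFun hI f k.lo k.hi)
      (by rw [hS.sq, map_zero, zero_mul, zero_add])
      (ratG_lo_hi_symm k) (ratX_lo_hi_symm ha k) (aFun_mul_reflFun_aFun ha k)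
    rw [this, map_one]
  comm k k' h := by
    have h1 := h.refl_cases
    exact commute_affine (hS.comm k k' h)
      (hS.commute (reflFun_aFun_of_isCommPair ha h1.2))
      (hS.commute (reflFun_bFun_of_isCommPair ha h1.2))
      (hS.commute (reflFun_aFun_of_isCommPair ha h1.1))
      (hS.commute (reflFun_bFun_of_isCommPair ha h1.1))
  braid k k' h := by
    obtain ⟨h13, h1, h2⟩ := Ref.isPair_lo_hi h
    have h3 : refl k k'.lo = k.lo := by rw [h, refl_hi]
    have h4 : refl k' k.hi = k'.hi := by rw [← h, refl_lo]
    have h5 : refl k' k'.hi = k.hi := by rw [refl_hi, h]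
    have hp := k.isPair
    have hp' := k'.isPair
    -- As e₁' = e₂' = 1, the error term r' = G₁₃'(e₁' − e₂') vanishes, which gives the exact braid
    -- relation of the T_k.
    have := (hS.isDemazure k).braid_affine toRat_injective (reflRat_toRat k) (reflRat_toRat k')
      (hS.isDemazure k') (c := 0) (c' := qFun hI) (e₁ := eFun hI k.lo k.hi)
      (e₂ := eFun hI k'.lo k'.hi) (e₁' := 1) (e₂' := 1) (r := rFun hI k.lo k.hi k'.hi) (r' := 0)
      (A₁ := aFun hI f k.lo k.hi) (A₂ := aFun hI f k'.lo k'.hi) (A₁₃ := aFun hI f k.lo k'.hi)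
      (B₁ := bFun hI f k.lo k.hi) (B₂ := bFun hI f k'.lo k'.hi) (B₁₃ := bFun hI f k.lo k'.hi)
      (G₁₃ := ratG k.lo k'.hi)
      (by rw [hS.sq, map_zero, zero_mul, zero_add]) (by rw [hS.sq, map_zero, zero_mul, zero_add])
      (ratG_lo_hi_symm k) (ratG_lo_hi_symm k')
      (by rw [map_zero, sub_zero]; rw [h] at hp' ⊢; exact ratG_mul_ratG hp hp' h13)
      (by rw [toRat_rFun hI h13, h])
      (by change reflFun k _ = _; rw [reflFun_aFun, h3, h1])
      (by change reflFun k' _ = _; rw [reflFun_aFun, h2, h4])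
      (by change reflFun k _ = _; rw [reflFun_aFun, refl_lo, h1, h])
      (by change reflFun k' _ = _; rw [reflFun_aFun, h2, h5])
      (by change reflFun k _ = _; rw [reflFun_bFun, h3, h1])
      (by change reflFun k' _ = _; rw [reflFun_bFun, h2, h4])
      (by change reflFun k _ = _; rw [reflFun_bFun, refl_lo, h1, h])
      (by change reflFun k' _ = _; rw [reflFun_bFun, h2, h5])
      (by rw [reflRat_ratG k hp', h3, h1])
      (by rw [reflRat_ratG k' hp, h2, h4])
      (ratX_lo_hi_symm ha k) (ratX_lo_hi_symm ha k')
      (by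
        rw [h] at hp' ⊢
        exact ratX_mul_ratX hI ha.coeff_zero ha.coeff_one ha.ne_one ha.ne_neg_one
          (ha.flip k.2.1) hp hp' h13)
      (aFun_mul_reflFun_aFun ha k) (aFun_mul_reflFun_aFun ha k')
      (by rw [sub_self, mul_zero, map_zero]) (hS.braid k k' h)
    rw [map_zero] at this
    exact sub_eq_zero.1 this

/-- The inverse affine transformation D ↦ A⁻¹D − A⁻¹B carries G' = A G + B back to G. -/
theorem affine_ratX (ha : IsAdmissible p f m) (a b : Pos m) :
    toRat 𝕜 (theta hI) m (aInv hI f a b) * ratX hI f a b +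
      toRat 𝕜 (theta hI) m (-(aInv hI f a b * bFun hI f a b)) = ratG a b := by
  have h := congrArg (toRat 𝕜 (theta hI) m) (aFun_mul_aInv hI ha.coeff_zero ha.coeff_one
    ha.ne_one ha.ne_neg_one a b)
  rw [map_mul, map_one] at h
  rw [ratX, map_neg, map_mul]
  linear_combination ratG a b * h

theorem aInv_mul_reflFun_aInv (ha : IsAdmissible p f m) (k : Ref m) :
    toRat 𝕜 (theta hI) m (aInv hI f k.lo k.hi) *
        toRat 𝕜 (theta hI) m (reflHom k (aInv hI f k.lo k.hi)) *
      (toRat 𝕜 (theta hI) m 1 + ratX hI f k.lo k.hi * reflRat k (ratX hI f k.lo k.hi)) =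
    toRat 𝕜 (theta hI) m (eFun hI k.lo k.hi) +
      ratG k.lo k.hi * reflRat k (ratG k.lo k.hi) := by
  rw [← aFun_mul_reflFun_aFun ha]
  have h := aFun_mul_aInv hI ha.coeff_zero ha.coeff_one ha.ne_one ha.ne_neg_one k.lo k.hi
  have h1 := congrArg (toRat 𝕜 (theta hI) m) h
  have h2 := congrArg (toRat 𝕜 (theta hI) m) (congrArg (reflHom k) h)
  simp only [map_mul, map_one] at h1 h2
  linear_combination (toRat 𝕜 (theta hI) m (eFun hI k.lo k.hi) +
    ratG k.lo k.hi * reflRat k (ratG k.lo k.hi)) *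
    (toRat 𝕜 (theta hI) m (reflHom k (aInv hI f k.lo k.hi)) *
      toRat 𝕜 (theta hI) m (reflHom k (aFun hI f k.lo k.hi)) * h1 + h2)

/-- The operators `σ_k = A⁻¹ (T_k - B)` satisfy the relations of the quiver Hecke algebra. -/
theorem IsHeckeFamily.sigma (ha : IsAdmissible p f m) {T : Ref m → R}
    (hT : IsHeckeFamily f ρ T) :
    IsSigmaFamily ρ fun k =>
      ρ (aInv hI f k.lo k.hi) * T k + ρ (-(aInv hI f k.lo k.hi * bFun hI f k.lo k.hi)) where
  leibniz k h := by
    rw [((hT.isDemazure k).affine (aInv hI f k.lo k.hi)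
      (-(aInv hI f k.lo k.hi * bFun hI f k.lo k.hi))).leibniz h]
    have h := aFun_mul_aInv hI ha.coeff_zero ha.coeff_one ha.ne_one ha.ne_neg_one k.lo k.hi
    congr 2
    simp only [reflHom, AlgHom.toRingHom_eq_coe, RingHom.coe_coe]
    linear_combination demazure k _ * h
  sq k := by
    have := (hT.isDemazure k).quad_affine toRat_injective (reflRat_toRat k)
      (c := qFun hI) (e := 1) (c' := 0) (e' := eFun hI k.lo k.hi)
      (A := aInv hI f k.lo k.hi) (B := -(aInv hI f k.lo k.hi * bFun hI f k.lo k.hi))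
      (by rw [hT.quad, map_one])
      (ratX_lo_hi_symm ha k) (by rw [affine_ratX ha, ratG_lo_hi_symm])
      (by rw [affine_ratX ha, aInv_mul_reflFun_aInv ha])
    rw [this, map_zero, zero_mul, zero_add]
  comm k k' h := by
    have h1 := h.refl_cases
    have e1 : reflFun k (-(aInv hI f k'.lo k'.hi * bFun hI f k'.lo k'.hi)) =
        -(aInv hI f k'.lo k'.hi * bFun hI f k'.lo k'.hi) := by
      rw [map_neg, map_mul, reflFun_aInv_of_isCommPair ha h1.1, reflFun_bFun_of_isCommPair ha h1.1]
    have e2 : reflFun k' (-(aInv hI f k.lo k.hi * bFun hI f k.lo k.hi)) =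
        -(aInv hI f k.lo k.hi * bFun hI f k.lo k.hi) := by
      rw [map_neg, map_mul, reflFun_aInv_of_isCommPair ha h1.2, reflFun_bFun_of_isCommPair ha h1.2]
    exact commute_affine (hT.comm k k' h)
      (hT.commute (reflFun_aInv_of_isCommPair ha h1.2)) (hT.commute e2)
      (hT.commute (reflFun_aInv_of_isCommPair ha h1.1)) (hT.commute e1)
  braid k k' h := by
    obtain ⟨h13, h1, h2⟩ := Ref.isPair_lo_hi h
    have h3 : refl k k'.lo = k.lo := by rw [h, refl_hi]
    have h4 : refl k' k.hi = k'.hi := by rw [← h, refl_lo]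
    have h5 : refl k' k'.hi = k.hi := by rw [refl_hi, h]
    have hp := k.isPair
    have hp' := k'.isPair
    have ra : ∀ (k : Ref m) (a b : Pos m), reflHom k (aInv hI f a b) = aInv hI f (refl k a) (refl k b) :=
      reflFun_aInv hI ha.coeff_zero ha.coeff_one ha.ne_one ha.ne_neg_one
    have rb : ∀ (k : Ref m) (a b : Pos m), reflHom k (-(aInv hI f a b * bFun hI f a b)) =
        -(aInv hI f (refl k a) (refl k b) * bFun hI f (refl k a) (refl k b)) := by
      intro k a b
      rw [map_neg, map_mul, ra]
      congr 2
      exact reflFun_bFun hI f k a b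
    -- The transformation backwards: r = 0 for the T_k, and the error term r' = G₁₃(e₁' − e₂') of
    -- the σ_k reappears from the two values of Q.
    refine (hT.isDemazure k).braid_affine toRat_injective (reflRat_toRat k) (reflRat_toRat k')
      (hT.isDemazure k') (c := qFun hI) (c' := 0) (e₁' := eFun hI k.lo k.hi)
      (e₂' := eFun hI k'.lo k'.hi) (e₁ := 1) (e₂ := 1) (r' := rFun hI k.lo k.hi k'.hi) (r := 0)
      (A₁ := aInv hI f k.lo k.hi) (A₂ := aInv hI f k'.lo k'.hi) (A₁₃ := aInv hI f k.lo k'.hi)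
      (B₁ := -(aInv hI f k.lo k.hi * bFun hI f k.lo k.hi))
      (B₂ := -(aInv hI f k'.lo k'.hi * bFun hI f k'.lo k'.hi))
      (B₁₃ := -(aInv hI f k.lo k'.hi * bFun hI f k.lo k'.hi))
      (G₁₃ := ratX hI f k.lo k'.hi)
      (by rw [hT.quad, map_one]) (by rw [hT.quad, map_one])
      (ratX_lo_hi_symm ha k) (ratX_lo_hi_symm ha k')
      ?_ (by rw [sub_self, mul_zero, map_zero])
      (by rw [ra, h3, h1]) (by rw [ra, h2, h4])
      (by rw [ra, refl_lo, h1, h]) (by rw [ra, h2, h5])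
      (by rw [rb, h3, h1]) (by rw [rb, h2, h4])
      (by rw [rb, refl_lo, h1, h]) (by rw [rb, h2, h5])
      (by rw [reflRat_ratX hI k hp', h3, h1])
      (by rw [reflRat_ratX hI k' hp, h2, h4])
      (by rw [affine_ratX ha, ratG_lo_hi_symm]) (by rw [affine_ratX ha, ratG_lo_hi_symm])
      ?_ (by rw [affine_ratX ha, aInv_mul_reflFun_aInv ha])
      (by rw [affine_ratX ha, aInv_mul_reflFun_aInv ha])
      (by rw [affine_ratX ha, toRat_rFun hI h13, h])
      (by rw [hT.braid k k' h, sub_self, map_zero])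
    · rw [h] at hp' ⊢
      exact ratX_mul_ratX hI ha.coeff_zero ha.coeff_one ha.ne_one ha.ne_neg_one
          (ha.flip k.2.1) hp hp' h13
    · rw [affine_ratX ha, affine_ratX ha, affine_ratX ha, map_zero, sub_zero]
      rw [h] at hp' ⊢
      exact ratG_mul_ratG hp hp' h13

end Families

/-! ### The twisted Leibniz rule -/

section Leibniz

variable {𝕜 : Type*} [Field 𝕜] {Γ : Type*} {θ : Γ → Γ} {m : ℕ}

/-- The operator `demazure k` as a linear map. -/
noncomputable def demazureLin (k : Ref m) : Fun 𝕜 θ m →ₗ[𝕜] Fun 𝕜 θ m where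
  toFun := demazure k
  map_add' h h' := by
    apply toRat_injective
    simp only [map_add, toRat_demazure]
    ring
  map_smul' c h := by
    apply toRat_injective
    simp only [Algebra.smul_def, map_mul, toRat_demazure, AlgHom.commutes, RingHom.id_apply]
    ring

theorem IsSmooth.comp_demazure {V : Type*} [AddCommGroup V] [Module 𝕜 V]
    {L : Fun 𝕜 θ m →ₗ[𝕜] V} (hL : IsSmooth L) (k : Ref m) :
    IsSmooth (L.comp (demazureLin k)) := by
  obtain ⟨Ω, n, h⟩ := hL
  -- One more degree, because the divided difference lowers the order by one. The set of weights
  -- stays the same, since the operation acts at each weight separately.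
  refine ⟨Ω, n + 1, fun g hg => h _ fun i hi => ?_⟩
  exact Ideal.mul_mem_left _ _ (divDiff_mem_ordIdeal k (hg i hi))

variable {E : Type*} [Ring E] [Algebra 𝕜 E] (ρ : Fun 𝕜 θ m →ₐ[𝕜] E) (k : Ref m) {G : Rat 𝕜 θ m}
  {d : Fun 𝕜 θ m →ₗ[𝕜] Fun 𝕜 θ m}
  (hd : ∀ h, toRat 𝕜 θ m (d h) = G * (toRat 𝕜 θ m h - toRat 𝕜 θ m (reflFun k h))) (D : E)

include hd in
theorem twisted_mul (h h' : Fun 𝕜 θ m) : d (h * h') = reflFun k h * d h' + d h * h' := by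
  apply toRat_injective
  simp only [map_mul, map_add, hd]
  ring

include hd in
theorem twisted_algebraMap (c : 𝕜) : d (algebraMap 𝕜 _ c) = 0 := by
  apply toRat_injective
  rw [hd, AlgHom.commutes, sub_self, mul_zero, map_zero]

/-- The functions `h` with `D h = s_k(h) D + d(h)`. -/
def leibnizSub : Subalgebra 𝕜 (Fun 𝕜 θ m) where
  carrier := {h | D * ρ h = ρ (reflFun k h) * D + ρ (d h)}
  mul_mem' {h h'} hh hh' := by
    change D * ρ (h * h') = ρ (reflFun k (h * h')) * D + ρ (d (h * h'))
    change D * ρ h = _ at hh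
    change D * ρ h' = _ at hh'
    rw [twisted_mul k hd, map_mul, ← mul_assoc, hh, add_mul, mul_assoc, hh', map_mul, map_mul,
      map_add, map_mul, map_mul]
    noncomm_ring
  add_mem' {h h'} hh hh' := by
    change D * ρ (h + h') = ρ (reflFun k (h + h')) * D + ρ (d (h + h'))
    change D * ρ h = _ at hh
    change D * ρ h' = _ at hh'
    rw [map_add, mul_add, hh, hh', map_add, map_add, map_add, map_add]
    noncomm_ring
  algebraMap_mem' c := by
    change D * ρ (algebraMap 𝕜 _ c) = ρ (reflFun k (algebraMap 𝕜 _ c)) * D +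
      ρ (d (algebraMap 𝕜 _ c))
    rw [twisted_algebraMap k hd, AlgHom.commutes, AlgHom.commutes, AlgHom.commutes, map_zero,
      add_zero, Algebra.commutes]

theorem mem_leibnizSub {h : Fun 𝕜 θ m} :
    h ∈ leibnizSub ρ k hd D ↔ D * ρ h = ρ (reflFun k h) * D + ρ (d h) := Iff.rfl

/-- Multiply the Leibniz rule for h by ρ(s_k(h')) on the left and by ρ(h') on the right. This passes
from X_{1−l} to X_l, which `leibnizSub` alone would not give. -/
theorem leibnizSub_inv {h h' : Fun 𝕜 θ m} (hh : h ∈ leibnizSub ρ k hd D) (h1 : h * h' = 1) :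
    h' ∈ leibnizSub ρ k hd D := by
  rw [mem_leibnizSub] at hh ⊢
  have e0 := twisted_mul k hd h' h
  rw [mul_comm, h1] at e0
  have e1 : d 1 = 0 := by simpa using twisted_algebraMap k hd 1
  have e2 : d h' = -(reflFun k h' * d h * h') := by
    rw [e1] at e0
    linear_combination -h' * e0 - d h' * h1
  have e3 : ρ (reflFun k h') * ρ (reflFun k h) = 1 := by
    rw [← map_mul, ← map_mul, mul_comm, h1, map_one, map_one]
  have e4 : ρ h * ρ h' = 1 := by rw [← map_mul, h1, map_one]
  have e5 := congrArg (fun z => ρ (reflFun k h') * z * ρ h') hh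
  rw [mul_add, add_mul, ← mul_assoc, ← mul_assoc, e3, one_mul, mul_assoc, e4, mul_one] at e5
  rw [e2, map_neg, map_mul, map_mul, e5]
  abel

variable {V : Type*} [AddCommGroup V] [Module 𝕜 V]

/-- If a smooth action and an operator satisfy the Leibniz rule on a set of functions with dense
span, then they satisfy it. -/
theorem leibniz_of_smooth (ρ : Fun 𝕜 θ m →ₐ[𝕜] Module.End 𝕜 V) (hρ : ∀ v, IsSmooth (orbit ρ v))
    (D : Module.End 𝕜 V) (hs : ∀ v, IsSmooth ((orbit ρ v).comp d))
    (hdense : ∀ L : Fun 𝕜 θ m →ₗ[𝕜] V, IsSmooth L → (∀ h ∈ leibnizSub ρ k hd D, L h = 0) →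
      ∀ h, L h = 0) (h : Fun 𝕜 θ m) : D * ρ h = ρ (reflFun k h) * D + ρ (d h) := by
  ext v
  have := hdense (D.comp (orbit ρ v) - ((orbit ρ (D v)).comp (reflFun k).toLinearMap +
    (orbit ρ v).comp d)) (((hρ v).comp D).sub (((hρ (D v)).comp_reflFun k).add (hs v)))
    (fun h hh => by
      have := congrArg (fun z : Module.End 𝕜 V => z v) hh
      exact sub_eq_zero.2 this) h
  exact sub_eq_zero.1 this

end Leibniz

/-! ### Weights and sequences -/

section Sequences

variable {𝕜 : Type u} [Field 𝕜] {p : 𝕜ˣ} {I : Set 𝕜ˣ} {hI : Invariant p I} {m : ℕ}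

theorem card_pos (m : ℕ) : Fintype.card (Pos m) = 2 * m := by
  rw [Fintype.card_of_subtype (Finset.Icc (1 - (m : ℤ)) m) (fun _ => Finset.mem_Icc), Int.card_Icc]
  omega

/-- The weight underlying a sequence. -/
def Seq.wt {Γ : Type u} {θ : Γ → Γ} {ν : Γ →₀ ℕ} (i : Seq θ m ν) : Wt θ m := ⟨i.1, i.2.1⟩

/-- The dimension vector of a weight. -/
noncomputable def Wt.dim (i : Wt (theta hI) m) : DimVec (theta hI) m :=
  ⟨∑ l, Finsupp.single (i.1 l) 1, by
    classical
    constructor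
    · intro v
      simp only [Finsupp.finsetSum_apply, Finsupp.single_apply]
      refine Fintype.sum_equiv ⟨Pos.neg, Pos.neg, Pos.neg_neg, Pos.neg_neg⟩ _ _ fun l => ?_
      congr 1
      rw [Equiv.coe_fn_mk, ← i.2, eq_iff_iff]
      constructor
      · intro h
        rw [h]
        exact Subtype.ext (inv_inv _)
      · intro h
        rw [← h]
        exact Subtype.ext (inv_inv _).symm
    · rw [← Finsupp.sum_finsetSum_index (fun _ => rfl) (fun _ _ _ => rfl)]
      simp [card_pos]⟩

/-- A weight as a sequence. -/
noncomputable def Wt.seq (i : Wt (theta hI) m) : Seq (theta hI) m i.dim.1 := ⟨i.1, i.2, rfl⟩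

theorem Seq.dim_wt {ν : DimVec (theta hI) m} (i : Seq (theta hI) m ν.1) : i.wt.dim = ν :=
  Subtype.ext i.2.2

/-- The dimension vector is determined by the sequence, so ν can be replaced by the dimension vector
of the underlying weight. This avoids transport along equalities between the types `Seq`. -/
theorem Seq.induction {P : ∀ ν : DimVec (theta hI) m, Seq (theta hI) m ν.1 → Prop}
    (h : ∀ i : Wt (theta hI) m, P i.dim i.seq) (ν : DimVec (theta hI) m)
    (i : Seq (theta hI) m ν.1) : P ν i := by
  obtain ⟨i, h1, h2⟩ := i
  have h3 : ν = Wt.dim ⟨i, h1⟩ := Subtype.ext h2.symm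
  subst h3
  exact h ⟨i, h1⟩

theorem Wt.dim_act (k : Ref m) (i : Wt (theta hI) m) : (i.act k).dim = i.dim :=
  Subtype.ext (Equiv.sum_comp (refl k) fun l => Finsupp.single (i.1 l) 1)

theorem Seq.wt_act {Γ : Type u} {θ : Γ → Γ} {ν : Γ →₀ ℕ} (k : Ref m) (i : Seq θ m ν) :
    (i.act k).wt = i.wt.act k := by
  apply Subtype.ext
  simp only [Seq.wt, Seq.act, Wt.act, refl_refl]

theorem Seq.wt_injective {Γ : Type u} {θ : Γ → Γ} {ν : Γ →₀ ℕ} :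
    Function.Injective (Seq.wt : Seq θ m ν → Wt θ m) := by
  rintro ⟨i, _, _⟩ ⟨j, _, _⟩ h
  have := congrArg Subtype.val h
  exact Subtype.ext this

end Sequences

/-! ### The algebra `°R_m` -/

section Algebra

variable {𝕜 : Type u} [Field 𝕜] {Γ : Type u} {θ : Γ → Γ} {h : Γ → Γ → ℕ} {m : ℕ}

theorem inSum_mul (ν : DimVec θ m) (a b : RNu 𝕜 θ h m ν.1) :
    inSum 𝕜 θ h m ν (a * b) = inSum 𝕜 θ h m ν a * inSum 𝕜 θ h m ν b := by
  classical
  rw [inSum, inSum, inSum, ← Unitization.inr_mul]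
  congr 1
  apply Subtype.ext
  exact (Pi.single_mul _ _ _)

theorem inSum_mul_ne {ν μ : DimVec θ m} (hne : ν ≠ μ) (a : RNu 𝕜 θ h m ν.1)
    (b : RNu 𝕜 θ h m μ.1) : inSum 𝕜 θ h m ν a * inSum 𝕜 θ h m μ b = 0 := by
  classical
  rw [inSum, inSum, ← Unitization.inr_mul, ← Unitization.inr_zero 𝕜]
  congr 1
  apply Subtype.ext
  funext κ
  change (Pi.single ν a : ∀ ν : DimVec θ m, RNu 𝕜 θ h m ν.1) κ *
    (Pi.single μ b : ∀ ν : DimVec θ m, RNu 𝕜 θ h m ν.1) κ = 0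
  by_cases hκ : κ = ν
  · subst hκ
    rw [Pi.single_eq_of_ne hne, mul_zero]
  · rw [Pi.single_eq_of_ne hκ, zero_mul]

variable (𝕜 h) in
/-- `inSum` as a linear map. -/
noncomputable def inSumLin (ν : DimVec θ m) : RNu 𝕜 θ h m ν.1 →ₗ[𝕜] RUnit 𝕜 θ h m where
  toFun := inSum 𝕜 θ h m ν
  map_add' a b := by
    classical
    rw [inSum, inSum, inSum, ← Unitization.inr_add]
    congr 1
    apply Subtype.ext
    exact (Pi.single_add _ _ _)
  map_smul' c a := by
    classical
    rw [inSum, inSum, RingHom.id_apply, ← Unitization.inr_smul]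
    congr 1
    apply Subtype.ext
    exact (Pi.single_smul _ _ _)

theorem inSum_rel (ν : DimVec θ m) {a b : FreeAlgebra 𝕜 (RGen θ m ν.1)}
    (hab : RRel 𝕜 θ h m ν.1 a b) :
    inSum 𝕜 θ h m ν (RingQuot.mkAlgHom 𝕜 _ a) = inSum 𝕜 θ h m ν (RingQuot.mkAlgHom 𝕜 _ b) := by
  rw [RingQuot.mkAlgHom_rel 𝕜 hab]

theorem r1_mul_r1_ne {ν μ : DimVec θ m} {i : Seq θ m ν.1} {j : Seq θ m μ.1} (hij : i.wt ≠ j.wt) :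
    r1 𝕜 θ h m ν i * r1 𝕜 θ h m μ j = 0 := by
  by_cases hν : ν = μ
  · subst hν
    rw [r1, r1, ← inSum_mul, ← map_mul, inSum_rel ν (RRel.idem_ne i j (fun h => hij (by rw [h]))),
      map_zero]
    exact map_zero (inSumLin 𝕜 h ν)
  · exact inSum_mul_ne hν _ _

variable (𝕜 h) in
/-- The map from the free algebra to `°R_m` given by the summand with index `ν`. -/
noncomputable def gen (ν : DimVec θ m) : FreeAlgebra 𝕜 (RGen θ m ν.1) →ₙₐ[𝕜] RUnit 𝕜 θ h m :=
  { toFun := fun a => inSum 𝕜 θ h m ν (RingQuot.mkAlgHom 𝕜 _ a)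
    map_smul' := fun c a => by
      rw [map_smul]
      exact map_smul (inSumLin 𝕜 h ν) c _
    map_zero' := by
      rw [map_zero]
      exact map_zero (inSumLin 𝕜 h ν)
    map_add' := fun a b => by
      rw [map_add]
      exact map_add (inSumLin 𝕜 h ν) _ _
    map_mul' := fun a b => by rw [map_mul, inSum_mul] }

theorem gen_rel (ν : DimVec θ m) {a b : FreeAlgebra 𝕜 (RGen θ m ν.1)}
    (hab : RRel 𝕜 θ h m ν.1 a b) : gen 𝕜 h ν a = gen 𝕜 h ν b := inSum_rel ν hab

theorem gen_idem (ν : DimVec θ m) (i : Seq θ m ν.1) : gen 𝕜 h ν (e1 𝕜 i) = r1 𝕜 θ h m ν i := rfl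

end Algebra

/-! ### Functions supported at one weight -/

section AtWt

variable {𝕜 : Type*} [Field 𝕜] {Γ : Type*} {θ : Γ → Γ} {m : ℕ}

open Classical in
/-- The function that vanishes at all weights but one. -/
noncomputable def atWt (w : Wt θ m) (g : Ser 𝕜 m) : Fun 𝕜 θ m :=
  fun i => if i = w then g else 0

theorem atWt_eq [DecidableEq (Wt θ m)] (w : Wt θ m) (g : Ser 𝕜 m) : atWt w g = Pi.single w g := by
  funext i
  rw [Pi.single_apply, atWt]
  congr

theorem atWt_same (w : Wt θ m) (g : Ser 𝕜 m) : atWt w g w = g := by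
  classical
  rw [atWt_eq, Pi.single_eq_same]

theorem atWt_ne {w i : Wt θ m} (hi : i ≠ w) (g : Ser 𝕜 m) : atWt w g i = 0 := by
  classical
  rw [atWt_eq, Pi.single_eq_of_ne hi]

theorem mul_atWt (h : Fun 𝕜 θ m) (w : Wt θ m) (g : Ser 𝕜 m) :
    h * atWt w g = atWt w (h w * g) := by
  funext i
  by_cases hi : i = w
  · subst hi
    rw [Pi.mul_apply, atWt_same, atWt_same]
  · rw [Pi.mul_apply, atWt_ne hi, atWt_ne hi, mul_zero]

theorem atWt_mul_atWt (w : Wt θ m) (g g' : Ser 𝕜 m) :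
    atWt w g * atWt w g' = atWt w (g * g') := by
  rw [mul_atWt, atWt_same]

theorem atWt_mul_atWt_ne {w w' : Wt θ m} (h : w ≠ w') (g g' : Ser 𝕜 m) :
    atWt w g * atWt w' g' = 0 := by
  classical
  rw [mul_atWt, atWt_ne h.symm, zero_mul, atWt_eq, Pi.single_zero]

variable (𝕜) in
/-- `atWt` as a linear map. -/
noncomputable def atWtLin (w : Wt θ m) : Ser 𝕜 m →ₗ[𝕜] Fun 𝕜 θ m where
  toFun := atWt w
  map_add' g g' := by
    classical
    simp only [atWt_eq, Pi.single_add]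
  map_smul' c g := by
    classical
    simp only [atWt_eq, Pi.single_smul, RingHom.id_apply]

theorem reflFun_atWt (k : Ref m) (w : Wt θ m) (g : Ser 𝕜 m) :
    reflFun k (atWt w g) = atWt (w.act k) (reflSer 𝕜 k g) := by
  funext i
  rw [reflFun_apply]
  by_cases hi : i = w.act k
  · subst hi
    rw [Wt.act_act, atWt_same, atWt_same]
  · rw [atWt_ne hi, atWt_ne, map_zero]
    intro h
    exact hi (by rw [← h, Wt.act_act])

theorem divDiff_eq (k : Ref m) {g q : Ser 𝕜 m}
    (h : (kap 𝕜 k.lo - kap 𝕜 k.hi) * q = g - reflSer 𝕜 k g) : divDiff k g = q :=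
  mul_left_cancel₀ (kap_lo_sub_kap_hi_ne_zero k) ((mul_divDiff k g).trans h.symm)

theorem demazure_atWt (k : Ref m) (w : Wt θ m) (g : Ser 𝕜 m) :
    demazure k (atWt w g) = atWt w (-(eps k.lo k.hi : Fun 𝕜 θ m) w * divDiff k g) := by
  funext i
  rw [demazure]
  by_cases hi : i = w
  · subst hi
    rw [atWt_same, atWt_same]
  · rw [atWt_ne hi, atWt_ne hi, divDiff_eq k (q := 0) (by simp), mul_zero]

variable {V : Type*} [AddCommGroup V] [Module 𝕜 V] {ρ : Fun 𝕜 θ m →ₐ[𝕜] Module.End 𝕜 V}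

theorem IsSmooth.exists_sum {v : V} (hv : IsSmooth (orbit ρ v)) :
    ∃ Ω : Finset (Wt θ m), ∑ w ∈ Ω, ρ (atWt w 1) v = v := by
  obtain ⟨Ω, n, h⟩ := hv
  refine ⟨Ω, ?_⟩
  have := h (1 - ∑ w ∈ Ω, atWt w 1) fun i hi => by
    rw [Pi.sub_apply, Finset.sum_apply, Finset.sum_eq_single i]
    · rw [atWt_same, Pi.one_apply, sub_self]
      exact zero_mem _
    · exact fun i' _ hne => atWt_ne hne.symm _
    · exact fun h' => absurd hi h'
  rw [map_sub, sub_eq_zero, map_sum] at this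
  simp only [orbit_apply, map_one, Module.End.one_apply] at this
  exact this.symm

/-- Smoothness makes every vector a finite sum of its weight components, so relations between
operators may be checked after composing with one projection. -/
theorem ext_of_atWt {W : Type*} [AddCommGroup W] [Module 𝕜 W] (hρ : ∀ v, IsSmooth (orbit ρ v))
    {A B : V →ₗ[𝕜] W} (h : ∀ w v, A (ρ (atWt w 1) v) = B (ρ (atWt w 1) v)) : A = B := by
  ext v
  obtain ⟨Ω, hΩ⟩ := (hρ v).exists_sum
  rw [← hΩ, map_sum, map_sum]
  exact Finset.sum_congr rfl fun w _ => h w v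

/-- Operators defined on the images of the projections can be glued. -/
theorem exists_glue (hρ : ∀ v, IsSmooth (orbit ρ v)) (L : Wt θ m → Module.End 𝕜 V) :
    ∃ S : Module.End 𝕜 V, ∀ w, S * ρ (atWt w 1) = L w * ρ (atWt w 1) := by
  have hf : ∀ v, (Function.support fun w => L w (ρ (atWt w 1) v)).Finite := by
    intro v
    obtain ⟨Ω, n, h⟩ := hρ v
    refine Ω.finite_toSet.subset fun w hw => ?_
    by_contra hw'
    apply hw
    have : ρ (atWt w 1) v = 0 := h _ fun i hi => by
      rw [atWt_ne (fun h' => hw' (by rwa [← h']))]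
      exact zero_mem _
    simp only [this, map_zero]
  refine ⟨{ toFun := fun v => ∑ᶠ w, L w (ρ (atWt w 1) v)
            map_add' := fun v v' => by
              simp only [map_add]
              exact finsum_add_distrib (hf v) (hf v')
            map_smul' := fun c v => by
              simp only [map_smul, RingHom.id_apply]
              exact (smul_finsum' c (hf v)).symm }, fun w => ?_⟩
  ext v
  change ∑ᶠ w', L w' (ρ (atWt w' 1) (ρ (atWt w 1) v)) = L w (ρ (atWt w 1) v)
  rw [finsum_eq_single _ w]
  · rw [← Module.End.mul_apply (ρ _), ← map_mul, atWt_mul_atWt, one_mul]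
  · intro w' hw'
    rw [← Module.End.mul_apply (ρ _), ← map_mul, atWt_mul_atWt_ne hw', map_zero,
      LinearMap.zero_apply, map_zero]

end AtWt

/-! ### Actions of `°R_m` -/

section Match

variable {𝕜 : Type*} [Field 𝕜] {Γ : Type*} {θ : Γ → Γ} {m : ℕ} {A E : Type*} [Ring A]
  [Algebra 𝕜 A] [Ring E] [Algebra 𝕜 E]

/-- The pairs of an element of an algebra and a power series that act in the same way on the image
of a projection. -/
def matchSub (Φ : A →ₙₐ[𝕜] E) (ρ : Fun 𝕜 θ m →ₐ[𝕜] E) (w : Wt θ m) (e : A)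
    (he : Φ e = ρ (atWt w 1)) : Subalgebra 𝕜 (A × Ser 𝕜 m) where
  carrier := {x | Φ (x.1 * e) = ρ (atWt w x.2)}
  mul_mem' {x y} hx hy := by
    change Φ (x.1 * y.1 * e) = ρ (atWt w (x.2 * y.2))
    change Φ (x.1 * e) = ρ (atWt w x.2) at hx
    change Φ (y.1 * e) = ρ (atWt w y.2) at hy
    have h1 : ρ (atWt w y.2) = Φ e * ρ (atWt w y.2) := by
      rw [he, ← map_mul, atWt_mul_atWt, one_mul]
    rw [mul_assoc, map_mul Φ, hy, h1, ← mul_assoc, ← map_mul Φ, hx, ← map_mul ρ, atWt_mul_atWt]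
  add_mem' {x y} hx hy := by
    change Φ ((x.1 + y.1) * e) = ρ (atWtLin 𝕜 w (x.2 + y.2))
    change Φ (x.1 * e) = ρ (atWtLin 𝕜 w x.2) at hx
    change Φ (y.1 * e) = ρ (atWtLin 𝕜 w y.2) at hy
    rw [add_mul, map_add, hx, hy, map_add, map_add]
  algebraMap_mem' c := by
    change Φ (algebraMap 𝕜 A c * e) = ρ (atWtLin 𝕜 w (algebraMap 𝕜 _ c))
    rw [← Algebra.smul_def, map_smul, Algebra.algebraMap_eq_smul_one, map_smul, map_smul, he]
    rfl

variable {Φ : A →ₙₐ[𝕜] E} {ρ : Fun 𝕜 θ m →ₐ[𝕜] E} {w : Wt θ m} {e : A}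
  {he : Φ e = ρ (atWt w 1)} {X : Type*} (h : X → X → ℕ) (i j : X) {x y z : A} {a b c : Ser 𝕜 m}

/-- The expression Q is polynomial, so it can be formed inside any subalgebra. This transports the
values of Q from the noncommutative free algebra to power series. -/
theorem Q_mem_matchSub (hx : (x, a) ∈ matchSub Φ ρ w e he) (hy : (y, b) ∈ matchSub Φ ρ w e he) :
    (Q h i j x y, Q h i j a b) ∈ matchSub Φ ρ w e he := by
  have h1 : Q h i j ((x, a) : A × Ser 𝕜 m) (y, b) = (Q h i j x y, Q h i j a b) :=
    Prod.ext (map_Q h (RingHom.fst A (Ser 𝕜 m)) i j _ _)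
      (map_Q h (RingHom.snd A (Ser 𝕜 m)) i j _ _)
  rw [← h1]
  have h2 := map_Q h (matchSub Φ ρ w e he).val.toRingHom i j ⟨_, hx⟩ ⟨_, hy⟩
  rw [show Q h i j ((x, a) : A × Ser 𝕜 m) (y, b) = _ from h2.symm]
  exact Subtype.coe_prop _

theorem QDiff_mem_matchSub (hx : (x, a) ∈ matchSub Φ ρ w e he)
    (hy : (y, b) ∈ matchSub Φ ρ w e he) (hz : (z, c) ∈ matchSub Φ ρ w e he) :
    (QDiff h i j x y z, QDiff h i j a b c) ∈ matchSub Φ ρ w e he := by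
  have h1 : QDiff h i j ((x, a) : A × Ser 𝕜 m) (y, b) (z, c) =
      (QDiff h i j x y z, QDiff h i j a b c) :=
    Prod.ext (map_QDiff h (RingHom.fst A (Ser 𝕜 m)) i j _ _ _)
      (map_QDiff h (RingHom.snd A (Ser 𝕜 m)) i j _ _ _)
  rw [← h1]
  have h2 := map_QDiff h (matchSub Φ ρ w e he).val.toRingHom i j ⟨_, hx⟩ ⟨_, hy⟩ ⟨_, hz⟩
  rw [show QDiff h i j ((x, a) : A × Ser 𝕜 m) (y, b) (z, c) = _ from h2.symm]
  exact Subtype.coe_prop _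

end Match

/-! ### From an action of °R_m to an action of functions and operators σ_k. -/

section RAction

variable {𝕜 : Type u} [Field 𝕜] {p : 𝕜ˣ} {I : Set 𝕜ˣ} {hI : Invariant p I} {m : ℕ}
  {V : Type*} [AddCommGroup V] [Module 𝕜 V]

/-- The action of words in the generators of the summand with index `ν`. -/
noncomputable def act (φ : RUnit 𝕜 (theta hI) (arrows p I) m →ₐ[𝕜] Module.End 𝕜 V)
    (ν : DimVec (theta hI) m) : FreeAlgebra 𝕜 (RGen (theta hI) m ν.1) →ₙₐ[𝕜] Module.End 𝕜 V :=
  (φ : RUnit 𝕜 (theta hI) (arrows p I) m →ₙₐ[𝕜] Module.End 𝕜 V).comp (gen 𝕜 (arrows p I) ν)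

theorem act_apply (φ : RUnit 𝕜 (theta hI) (arrows p I) m →ₐ[𝕜] Module.End 𝕜 V)
    (ν : DimVec (theta hI) m) (x : FreeAlgebra 𝕜 (RGen (theta hI) m ν.1)) :
    act φ ν x = φ (gen 𝕜 (arrows p I) ν x) := rfl

theorem act_rel (φ : RUnit 𝕜 (theta hI) (arrows p I) m →ₐ[𝕜] Module.End 𝕜 V)
    (ν : DimVec (theta hI) m) {x y : FreeAlgebra 𝕜 (RGen (theta hI) m ν.1)}
    (h : RRel 𝕜 (theta hI) (arrows p I) m ν.1 x y) : act φ ν x = act φ ν y := by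
  rw [act_apply, act_apply, gen_rel ν h]

/-- An action of `°R_m` on `V` is given by the smooth action `ρ` of functions and the operators
`σ_k`. -/
structure IsRAction (φ : RUnit 𝕜 (theta hI) (arrows p I) m →ₐ[𝕜] Module.End 𝕜 V)
    (ρ : Fun 𝕜 (theta hI) m →ₐ[𝕜] Module.End 𝕜 V) (S : Ref m → Module.End 𝕜 V) : Prop where
  smooth : ∀ v, IsSmooth (orbit ρ v)
  idem : ∀ (ν : DimVec (theta hI) m) (i : Seq (theta hI) m ν.1),
    act φ ν (e1 𝕜 i) = ρ (atWt i.wt 1)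
  kap : ∀ (ν : DimVec (theta hI) m) (i : Seq (theta hI) m ν.1) (l : Pos m),
    act φ ν (eκ 𝕜 _ m ν.1 l * e1 𝕜 i) = ρ (atWt i.wt (kap 𝕜 l))
  sig : ∀ (ν : DimVec (theta hI) m) (i : Seq (theta hI) m ν.1) (k : Ref m),
    act φ ν (eσ 𝕜 _ m ν.1 k * e1 𝕜 i) = S k * ρ (atWt i.wt 1)

/-- The existence of the action of functions. -/
theorem exists_isRAction (φ : RUnit 𝕜 (theta hI) (arrows p I) m →ₐ[𝕜] Module.End 𝕜 V)
    (h1 : ∀ x : V, x ∈ AddSubgroup.closure {y : V | ∃ (ν : DimVec (theta hI) m)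
      (i : Seq (theta hI) m ν.1), act φ ν (e1 𝕜 i) y = y})
    (h2 : ∀ (ν : DimVec (theta hI) m) (l : Pos m), 1 ≤ l.1 → ∀ x : V, ∃ n : ℕ,
      (act φ ν (eκ 𝕜 _ m ν.1 l) ^ n) x = 0) :
    ∃ ρ S, IsRAction φ ρ S := by
  classical
  let e : Wt (theta hI) m → Module.End 𝕜 V := fun w => act φ w.dim (e1 𝕜 w.seq)
  let κ : Wt (theta hI) m → PPos m → Module.End 𝕜 V := fun w l =>
    act φ w.dim (eκ 𝕜 _ m _ l.1)
  have heν : ∀ (ν : DimVec (theta hI) m) (i : Seq (theta hI) m ν.1),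
      act φ ν (e1 𝕜 i) = e i.wt := Seq.induction fun _ => rfl
  have he : ∀ w, e w * e w = e w := fun w => by
    simp only [e]
    rw [← map_mul, act_rel φ _ (RRel.idem_self w.seq)]
  have hne : ∀ w w', w ≠ w' → e w * e w' = 0 := fun w w' hw => by
    simp only [e]
    rw [act_apply, act_apply, ← map_mul, gen_idem, gen_idem, r1_mul_r1_ne (i := w.seq) (j := w'.seq) hw, map_zero]
  have hsupp : ∀ ν (i : Seq (theta hI) m ν.1) (y : V),
      act φ ν (e1 𝕜 i) y = y → ∀ w, w ≠ i.wt → e w y = 0 := by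
    intro ν i y hy w hw
    rw [← hy, heν, ← Module.End.mul_apply, hne _ _ hw, LinearMap.zero_apply]
  have hfin : ∀ v, {w | e w v ≠ 0}.Finite := by
    intro v
    induction h1 v using AddSubgroup.closure_induction with
    | mem y hy =>
      obtain ⟨ν, i, hy⟩ := hy
      refine (Set.finite_singleton i.wt).subset fun w hw => ?_
      by_contra h
      exact hw (hsupp ν i y hy w h)
    | zero => simp
    | add x y _ _ hx hy =>
      refine (hx.union hy).subset fun w hw => ?_
      by_contra h
      simp only [Set.mem_union, Set.mem_ofPred_eq, not_or, not_not] at h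
      exact hw (by rw [map_add, h.1, h.2, add_zero])
    | neg x _ hx => simpa using hx
  have hsum : ∀ v, ∑ᶠ w, e w v = v := by
    intro v
    induction h1 v using AddSubgroup.closure_induction with
    | mem y hy =>
      obtain ⟨ν, i, hy⟩ := hy
      rw [finsum_eq_single _ i.wt fun w hw => hsupp ν i y hy w hw, ← heν, hy]
    | zero => simp
    | add x y _ _ hx hy =>
      simp only [map_add]
      rw [finsum_add_distrib (hfin x) (hfin y), hx, hy]
    | neg x _ hx =>
      simp only [map_neg]
      rw [finsum_neg_distrib, hx]
  have hc : ∀ w l l', Commute (κ w l) (κ w l') := fun w l l' => by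
    simp only [κ, commute_iff_eq]
    rw [← map_mul, ← map_mul, act_rel φ _ (RRel.kap_comm l.1 l'.1)]
  have hec : ∀ w l, Commute (e w) (κ w l) := fun w l => by
    simp only [κ, e, commute_iff_eq]
    rw [← map_mul, ← map_mul, act_rel φ _ (RRel.kap_idem l.1 w.seq)]
  obtain ⟨ρ, hs, hρ1, hρX⟩ := exists_action e κ he hne hfin hsum hc hec
    (fun w l v => h2 w.dim l.1 l.2 v)
  simp only [← atWt_eq] at hρ1 hρX
  -- The sum of the components of σ_k over all ν need not lie in °R_m, so the operator is glued from
  -- the components weight by weight.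
  have hS0 : ∀ k, ∃ S : Module.End 𝕜 V, ∀ w, S * ρ (atWt w 1) =
      act φ w.dim (eσ 𝕜 _ m _ k) * ρ (atWt w 1) := fun k => exists_glue hs _
  choose S hS using hS0
  refine ⟨ρ, S, hs, Seq.induction fun w => (hρ1 w).symm, Seq.induction fun w l => ?_,
    Seq.induction fun w k => ?_⟩
  · have h3 : ∀ l : PPos m, act φ w.dim (eκ 𝕜 _ m _ l.1 * e1 𝕜 w.seq) =
        ρ (atWt w (TypeD.kap 𝕜 l.1)) := by
      intro l
      rw [map_mul, kap_coe, hρX]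
    by_cases hl : 1 ≤ l.1
    · exact h3 ⟨l, hl⟩
    · have h4 := h3 ⟨l.neg, Pos.one_le_neg.2 hl⟩
      change _ = ρ (atWtLin 𝕜 w (TypeD.kap 𝕜 l.neg)) at h4
      rw [map_mul, act_rel φ _ (RRel.kap_neg l), kap_neg, map_neg, map_neg, map_neg,
        neg_mul, ← map_mul] at h4
      exact neg_injective h4
  · rw [map_mul]
    change _ = S k * ρ (atWt w 1)
    rw [hS, hρ1]

end RAction

/-! ### The relations of °R_m, read as relations between functions and the σ_k. -/

section RFamily

variable {𝕜 : Type u} [Field 𝕜] {p : 𝕜ˣ} {I : Set 𝕜ˣ} {hI : Invariant p I} {m : ℕ}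
  {V : Type*} [AddCommGroup V] [Module 𝕜 V]

theorem divDiff_kap_lo (k : Ref m) : divDiff k (kap 𝕜 k.lo) = 1 :=
  divDiff_eq k (by rw [reflSer_kap, refl_lo, mul_one])

theorem divDiff_kap_hi (k : Ref m) : divDiff k (kap 𝕜 k.hi) = -1 :=
  divDiff_eq k (by rw [reflSer_kap, refl_hi]; ring)

theorem divDiff_kap_neg (k : Ref m) (l : Pos m) :
    divDiff k (kap 𝕜 l.neg) = -divDiff k (kap 𝕜 l) :=
  divDiff_eq k (by
    rw [mul_neg, mul_divDiff, reflSer_kap, reflSer_kap, refl_neg, kap_neg, kap_neg]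
    ring)

theorem divDiff_kap_else (k : Ref m) (l : Pos m)
    (hl : l ≠ k.lo ∧ l ≠ k.hi ∧ l ≠ k.lo.neg ∧ l ≠ k.hi.neg) : divDiff k (kap 𝕜 l) = 0 :=
  divDiff_eq k (by rw [reflSer_kap, refl_else k hl]; ring)

variable {φ : RUnit 𝕜 (theta hI) (arrows p I) m →ₐ[𝕜] Module.End 𝕜 V}
  {ρ : Fun 𝕜 (theta hI) m →ₐ[𝕜] Module.End 𝕜 V} {S : Ref m → Module.End 𝕜 V}

theorem map_smul_atWt (ρ : Fun 𝕜 (theta hI) m →ₐ[𝕜] Module.End 𝕜 V) (ν : DimVec (theta hI) m)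
    (i : Seq (theta hI) m ν.1) (k : Ref m) (c : Ser 𝕜 m) (hc : i.1 k.lo ≠ i.1 k.hi ∨ c = 0) :
    ρ (atWt i.wt (-(eps k.lo k.hi : Fun 𝕜 (theta hI) m) i.wt * c)) = 0 := by
  have : -(eps k.lo k.hi : Fun 𝕜 (theta hI) m) i.wt * c = 0 := by
    rcases hc with hc | hc
    · have h0 : (eps k.lo k.hi : Fun 𝕜 (theta hI) m) i.wt = 0 := if_neg hc
      rw [h0, neg_zero, zero_mul]
    · rw [hc, mul_zero]
  rw [this]
  exact map_zero (ρ.toLinearMap.comp (atWtLin 𝕜 i.wt))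

/-- The mixed relations between σ_k and ϰ_l combine into one formula, since the divided differences
of ϰ_k, ϰ_{s_k(k)} and unmoved variables are 1, −1 and 0. The negated positions follow from ϰ_{1−l}
= −ϰ_l. -/
theorem IsRAction.kap_rel (hφ : IsRAction φ ρ S) (ν : DimVec (theta hI) m)
    (i : Seq (theta hI) m ν.1) (k : Ref m) (l : Pos m) :
    act φ ν ((eσ 𝕜 _ m ν.1 k * eκ 𝕜 _ m ν.1 l - eκ 𝕜 _ m ν.1 (refl k l) * eσ 𝕜 _ m ν.1 k) *
      e1 𝕜 i) =
    ρ (atWt i.wt (-(eps k.lo k.hi : Fun 𝕜 (theta hI) m) i.wt *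
      divDiff k (TypeD.kap 𝕜 l))) := by
  by_cases hi : i.1 k.lo = i.1 k.hi
  swap
  · rw [act_rel φ ν (RRel.sig_kap_ne k i hi l), map_smul_atWt ρ ν i k _ (Or.inl hi), map_zero]
  have heps : (eps k.lo k.hi : Fun 𝕜 (theta hI) m) i.wt = 1 := if_pos hi
  have hneg : ∀ l : Pos m,
      act φ ν ((eσ 𝕜 _ m ν.1 k * eκ 𝕜 _ m ν.1 l - eκ 𝕜 _ m ν.1 (refl k l) * eσ 𝕜 _ m ν.1 k) *
        e1 𝕜 i) =
      ρ (atWt i.wt (-(eps k.lo k.hi : Fun 𝕜 (theta hI) m) i.wt * divDiff k (TypeD.kap 𝕜 l))) →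
      act φ ν ((eσ 𝕜 _ m ν.1 k * eκ 𝕜 _ m ν.1 l.neg -
        eκ 𝕜 _ m ν.1 (refl k l.neg) * eσ 𝕜 _ m ν.1 k) * e1 𝕜 i) =
      ρ (atWt i.wt (-(eps k.lo k.hi : Fun 𝕜 (theta hI) m) i.wt *
        divDiff k (TypeD.kap 𝕜 l.neg))) := by
    intro l hl
    have e1' : ρ (atWt i.wt (-(eps k.lo k.hi : Fun 𝕜 (theta hI) m) i.wt *
        divDiff k (TypeD.kap 𝕜 l.neg))) =
        -ρ (atWt i.wt (-(eps k.lo k.hi : Fun 𝕜 (theta hI) m) i.wt *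
        divDiff k (TypeD.kap 𝕜 l))) := by
      rw [divDiff_kap_neg, mul_neg]
      exact map_neg (ρ.toLinearMap.comp (atWtLin 𝕜 i.wt)) _
    rw [e1', ← hl]
    have k1 := act_rel φ ν (RRel.kap_neg l)
    have k2 := act_rel φ ν (RRel.kap_neg (refl k l))
    rw [map_neg] at k1 k2
    rw [refl_neg]
    simp only [map_mul, map_sub, k1, k2]
    noncomm_ring
  have hlo : act φ ν ((eσ 𝕜 _ m ν.1 k * eκ 𝕜 _ m ν.1 k.lo -
        eκ 𝕜 _ m ν.1 (refl k k.lo) * eσ 𝕜 _ m ν.1 k) * e1 𝕜 i) =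
      ρ (atWt i.wt (-(eps k.lo k.hi : Fun 𝕜 (theta hI) m) i.wt *
        divDiff k (TypeD.kap 𝕜 k.lo))) := by
    rw [refl_lo, act_rel φ ν (RRel.sig_kap_lo k i hi), map_neg, hφ.idem, heps, divDiff_kap_lo,
      mul_one]
    exact (map_neg (ρ.toLinearMap.comp (atWtLin 𝕜 i.wt)) 1).symm
  have hhi : act φ ν ((eσ 𝕜 _ m ν.1 k * eκ 𝕜 _ m ν.1 k.hi -
        eκ 𝕜 _ m ν.1 (refl k k.hi) * eσ 𝕜 _ m ν.1 k) * e1 𝕜 i) =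
      ρ (atWt i.wt (-(eps k.lo k.hi : Fun 𝕜 (theta hI) m) i.wt *
        divDiff k (TypeD.kap 𝕜 k.hi))) := by
    rw [refl_hi, act_rel φ ν (RRel.sig_kap_hi k i hi), hφ.idem, heps, divDiff_kap_hi,
      mul_neg, mul_one, neg_neg]
  by_cases h1 : l = k.lo
  · rw [h1, hlo]
  by_cases h2 : l = k.hi
  · rw [h2, hhi]
  by_cases h3 : l = k.lo.neg
  · rw [h3, hneg _ hlo]
  by_cases h4 : l = k.hi.neg
  · rw [h4, hneg _ hhi]
  have hl : l ≠ k.lo ∧ l ≠ k.hi ∧ l ≠ k.lo.neg ∧ l ≠ k.hi.neg := ⟨h1, h2, h3, h4⟩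
  rw [act_rel φ ν (RRel.sig_kap_else k i l hl), map_smul_atWt ρ ν i k _
    (Or.inr (divDiff_kap_else k l hl)), map_zero]

theorem IsRAction.sig_idem (hφ : IsRAction φ ρ S) (ν : DimVec (theta hI) m)
    (i : Seq (theta hI) m ν.1) (k : Ref m) :
    S k * ρ (atWt i.wt 1) = ρ (atWt (i.wt.act k) 1) * act φ ν (eσ 𝕜 _ m ν.1 k) := by
  rw [← hφ.sig, act_rel φ ν (RRel.sig_idem k i), map_mul, hφ.idem, Seq.wt_act]

theorem Wt.act_injective {Γ : Type*} {θ : Γ → Γ} (k : Ref m) :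
    Function.Injective (Wt.act k : Wt θ m → Wt θ m) := fun i j h => by
  rw [← Wt.act_act k i, h, Wt.act_act]

theorem IsRAction.sig_atWt (hφ : IsRAction φ ρ S) (w : Wt (theta hI) m) (k : Ref m) :
    S k * ρ (atWt w 1) = ρ (atWt (w.act k) 1) * S k := by
  refine ext_of_atWt hφ.smooth fun w' v => ?_
  change (S k * ρ (atWt w 1) * ρ (atWt w' 1)) v = (ρ (atWt (w.act k) 1) * S k * ρ (atWt w' 1)) v
  congr 1
  have h1 : ∀ w : Wt (theta hI) m, S k * ρ (atWt w 1) =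
      ρ (atWt (w.act k) 1) * act φ w.dim (eσ 𝕜 _ m _ k) := fun w => hφ.sig_idem w.dim w.seq k
  rw [mul_assoc, ← map_mul, mul_assoc, h1 w', ← mul_assoc, ← map_mul]
  by_cases hw : w = w'
  · subst hw
    rw [atWt_mul_atWt, atWt_mul_atWt, one_mul, h1]
  · rw [atWt_mul_atWt_ne hw, atWt_mul_atWt_ne fun h => hw (Wt.act_injective k h), map_zero,
      mul_zero, zero_mul]

/-- The glued operator agrees with the component σ_k on vectors of a known weight, in particular on
the image of a word x leading from i to j. The second half says that σ_k x leads from i to s_k j, so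
that the lemma can be iterated along a word. -/
theorem IsRAction.sig_comp (hφ : IsRAction φ ρ S) (ν : DimVec (theta hI) m)
    (i j : Seq (theta hI) m ν.1) (k : Ref m) (x : FreeAlgebra 𝕜 (RGen (theta hI) m ν.1))
    (hx : act φ ν (x * e1 𝕜 i) = act φ ν (e1 𝕜 j * x)) :
    S k * act φ ν (x * e1 𝕜 i) = act φ ν (eσ 𝕜 _ m ν.1 k * x * e1 𝕜 i) ∧
      act φ ν (eσ 𝕜 _ m ν.1 k * x * e1 𝕜 i) = act φ ν (e1 𝕜 (j.act k) * (eσ 𝕜 _ m ν.1 k * x)) := by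
  constructor
  · rw [hx, map_mul, hφ.idem, ← mul_assoc, ← hφ.sig, map_mul, mul_assoc, ← map_mul _ (e1 𝕜 j),
      ← hx, ← map_mul, mul_assoc]
  · rw [mul_assoc, map_mul, hx, ← map_mul, ← mul_assoc, map_mul,
      act_rel φ ν (RRel.sig_idem k j), ← map_mul, mul_assoc]

theorem IsRAction.kap_comp (hφ : IsRAction φ ρ S) (ν : DimVec (theta hI) m)
    (i : Seq (theta hI) m ν.1) (k : Ref m) (l : Pos m) :
    S k * ρ (atWt i.wt (TypeD.kap 𝕜 l)) =
      act φ ν (eσ 𝕜 _ m ν.1 k * eκ 𝕜 _ m ν.1 l * e1 𝕜 i) := by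
  have h1 := (hφ.sig_comp ν i i k (eκ 𝕜 _ m ν.1 l) (act_rel φ ν (RRel.kap_idem l i))).1
  rw [← h1, hφ.kap]

theorem IsRAction.comp_kap (hφ : IsRAction φ ρ S) (ν : DimVec (theta hI) m)
    (i : Seq (theta hI) m ν.1) (k : Ref m) (l : Pos m) :
    ρ (atWt (i.wt.act k) (TypeD.kap 𝕜 l)) * S k =
      act φ ν (eκ 𝕜 _ m ν.1 l * eσ 𝕜 _ m ν.1 k * e1 𝕜 i) := by
  have h2 : ρ (atWt (i.wt.act k) (TypeD.kap 𝕜 l)) =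
      ρ (atWt (i.wt.act k) (TypeD.kap 𝕜 l)) * ρ (atWt (i.wt.act k) 1) := by
    rw [← map_mul, atWt_mul_atWt, mul_one]
  rw [h2, mul_assoc, ← hφ.sig_atWt, ← hφ.sig, act_rel φ ν (RRel.sig_idem k i), ← Seq.wt_act,
    ← hφ.kap, ← map_mul, mul_assoc, ← mul_assoc (e1 𝕜 _) (e1 𝕜 _), map_mul, map_mul _ (_ * _),
    act_rel φ ν (RRel.idem_self _), ← map_mul, ← act_rel φ ν (RRel.sig_idem k i), ← map_mul,
    mul_assoc]

theorem IsRAction.mem_matchSub (hφ : IsRAction φ ρ S) (ν : DimVec (theta hI) m)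
    (i : Seq (theta hI) m ν.1) (l : Pos m) :
    (eκ 𝕜 _ m ν.1 l, TypeD.kap 𝕜 l) ∈ matchSub (act φ ν) ρ i.wt (e1 𝕜 i) (hφ.idem ν i) :=
  hφ.kap ν i l

/-- The Leibniz rule holds on 1_𝐢 and ϰ_l 1_𝐢 by the defining relations, and by density on all
functions. The other relations are checked on each weight space, after `IsRAction.sig_comp` has
turned products of the S k into words. -/
theorem IsRAction.family (hφ : IsRAction φ ρ S) :
    IsSigmaFamily (ρ : Fun 𝕜 (theta hI) m →+* Module.End 𝕜 V) S where
  leibniz k h := by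
    classical
    refine leibniz_of_smooth (d := demazureLin k) k (toRat_demazure k) ρ hφ.smooth (S k)
      (fun v => (hφ.smooth v).comp_demazure k) (fun L hL hLA => hL.eq_zero fun i d => hLA _ ?_) h
    refine single_monomial_mem _ (fun w => ?_) (fun w l => ?_) i d
    · rw [← atWt_eq]
      change S k * ρ (atWt w 1) = ρ (reflFun k (atWt w 1)) * S k + ρ (demazureLin k (atWt w 1))
      have h1 : demazureLin k (atWt w 1 : Fun 𝕜 (theta hI) m) = 0 := by
        change demazure k (atWt w 1) = 0
        rw [demazure_atWt, divDiff_eq k (q := 0) (by simp), mul_zero]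
        exact map_zero (atWtLin 𝕜 w)
      rw [h1, map_zero, add_zero, reflFun_atWt, map_one, hφ.sig_atWt]
    · rw [← atWt_eq, ← kap_coe]
      change S k * ρ (atWt w (TypeD.kap 𝕜 l.1)) = ρ (reflFun k (atWt w (TypeD.kap 𝕜 l.1))) * S k +
        ρ (demazure k (atWt w (TypeD.kap 𝕜 l.1)))
      rw [reflFun_atWt, reflSer_kap, demazure_atWt]
      have h1 := hφ.kap_rel w.dim w.seq k l.1
      rw [sub_mul, map_sub, ← hφ.kap_comp, ← hφ.comp_kap, sub_eq_iff_eq_add'] at h1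
      exact h1
  sq k := by
    refine ext_of_atWt hφ.smooth fun w v => ?_
    change (S k * S k * ρ (atWt w 1)) v = (ρ (eFun hI k.lo k.hi) * ρ (atWt w 1)) v
    congr 1
    have h1 := hφ.sig_comp w.dim w.seq _ k _ (act_rel φ w.dim (RRel.sig_idem k w.seq))
    have h2 : S k * ρ (atWt w 1) = _ := (hφ.sig w.dim w.seq k).symm
    rw [mul_assoc, h2, h1.1, ← pow_two, act_rel φ w.dim (RRel.sig_sq k w.seq), ← map_mul,
      mul_atWt, mul_one]
    exact Q_mem_matchSub (arrows p I) _ _ (hφ.mem_matchSub w.dim w.seq k.hi)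
      (hφ.mem_matchSub w.dim w.seq k.lo)
  comm k k' h := by
    refine ext_of_atWt hφ.smooth fun w v => ?_
    change (S k * S k' * ρ (atWt w 1)) v = (S k' * S k * ρ (atWt w 1)) v
    congr 1
    have h1 := hφ.sig_comp w.dim w.seq _ k _ (act_rel φ w.dim (RRel.sig_idem k' w.seq))
    have h1' := hφ.sig_comp w.dim w.seq _ k' _ (act_rel φ w.dim (RRel.sig_idem k w.seq))
    have h2 : ∀ k, S k * ρ (atWt w 1) = _ := fun k => (hφ.sig w.dim w.seq k).symm
    rw [mul_assoc, mul_assoc, h2, h2, h1.1, h1'.1, map_mul, map_mul _ (_ * _),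
      act_rel φ w.dim (RRel.sig_comm k k' h)]
  braid k k' h := by
    refine ext_of_atWt hφ.smooth fun w v => ?_
    change ((S k * S k' * S k - S k' * S k * S k') * ρ (atWt w 1)) v =
      (ρ (rFun hI k.lo k.hi k'.hi) * ρ (atWt w 1)) v
    congr 1
    have h1 := hφ.sig_comp w.dim w.seq _ k _ (act_rel φ w.dim (RRel.sig_idem k' w.seq))
    have h1' := hφ.sig_comp w.dim w.seq _ k' _ (act_rel φ w.dim (RRel.sig_idem k w.seq))
    have h3 := hφ.sig_comp w.dim w.seq _ k _ h1'.2
    have h3' := hφ.sig_comp w.dim w.seq _ k' _ h1.2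
    have h2 : ∀ k, S k * ρ (atWt w 1) = _ := fun k => (hφ.sig w.dim w.seq k).symm
    -- The sign arises because the defining relation subtracts the two triple products in the
    -- opposite order.
    have h4 : (S k * S k' * S k - S k' * S k * S k') * ρ (atWt w 1) =
        -act φ w.dim ((eσ 𝕜 _ m _ k' * eσ 𝕜 _ m _ k * eσ 𝕜 _ m _ k' -
          eσ 𝕜 _ m _ k * eσ 𝕜 _ m _ k' * eσ 𝕜 _ m _ k) * e1 𝕜 w.seq) := by
      rw [sub_mul, mul_assoc, mul_assoc, mul_assoc, mul_assoc, h2, h2, h1.1, h1'.1, h3.1, h3'.1,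
        sub_mul, map_sub, neg_sub]
      simp only [mul_assoc]
    rw [h4, ← map_mul, mul_atWt, mul_one, rFun]
    by_cases hi : w.1 k.lo = w.1 k'.hi
    · rw [act_rel φ w.dim (RRel.braid_eq k k' h w.seq hi), eps, if_pos hi, one_mul]
      have h5 : act φ w.dim _ = _ := QDiff_mem_matchSub (arrows p I) (w.1 k.lo) (w.1 k.hi)
        (hφ.mem_matchSub w.dim w.seq k.hi) (hφ.mem_matchSub w.dim w.seq k.lo)
        (hφ.mem_matchSub w.dim w.seq k'.hi)
      refine (congrArg Neg.neg h5).trans ?_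
      exact (map_neg (ρ.toLinearMap.comp (atWtLin 𝕜 w)) _).symm
    · rw [act_rel φ w.dim (RRel.braid_ne k k' h w.seq hi), eps, if_neg hi, zero_mul, map_zero, neg_zero, neg_zero]
      exact (map_zero (ρ.toLinearMap.comp (atWtLin 𝕜 w))).symm

end RFamily

/-! ### Words in the generators, acting on the sum of all weight spaces. -/

section Build

variable {𝕜 : Type u} [Field 𝕜] {p : 𝕜ˣ} {I : Set 𝕜ˣ} {hI : Invariant p I} {m : ℕ}
  {V : Type*} [AddCommGroup V] [Module 𝕜 V]

/-- The function with the same value at all weights. -/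
abbrev constFun {Γ : Type*} (θ : Γ → Γ) (g : Ser 𝕜 m) : Fun 𝕜 θ m := fun _ => g

/-- The action of words in the generators on the sum of all weight spaces. -/
noncomputable def wordAct (ρ : Fun 𝕜 (theta hI) m →ₐ[𝕜] Module.End 𝕜 V)
    (S : Ref m → Module.End 𝕜 V) (ν : DimVec (theta hI) m) :
    FreeAlgebra 𝕜 (RGen (theta hI) m ν.1) →ₐ[𝕜] Module.End 𝕜 V :=
  FreeAlgebra.lift 𝕜 fun x => match x with
    | .idem i => ρ (atWt i.wt 1)
    | .kap l => ρ (constFun _ (kap 𝕜 l))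
    | .sig k => S k

section WordAct

variable (ρ : Fun 𝕜 (theta hI) m →ₐ[𝕜] Module.End 𝕜 V) (S : Ref m → Module.End 𝕜 V)
  (ν : DimVec (theta hI) m)

theorem wordAct_idem (i : Seq (theta hI) m ν.1) :
    wordAct ρ S ν (e1 𝕜 i) = ρ (atWt i.wt 1) := FreeAlgebra.lift_ι_apply _ _

theorem wordAct_kap (l : Pos m) :
    wordAct ρ S ν (eκ 𝕜 _ m ν.1 l) = ρ (constFun _ (kap 𝕜 l)) := FreeAlgebra.lift_ι_apply _ _

theorem wordAct_sig (k : Ref m) : wordAct ρ S ν (eσ 𝕜 _ m ν.1 k) = S k :=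
  FreeAlgebra.lift_ι_apply _ _

open Classical in
/-- The projection to the sum of the weight spaces with a given dimension vector. -/
noncomputable def dimProj : Module.End 𝕜 V :=
  ρ fun w => if w.dim = ν then 1 else 0

theorem dimProj_atWt (i : Seq (theta hI) m ν.1) (g : Ser 𝕜 m) :
    ρ (atWt i.wt g) * dimProj ρ ν = ρ (atWt i.wt g) := by
  rw [dimProj, ← map_mul, mul_comm, mul_atWt, if_pos i.dim_wt, one_mul]

theorem dimProj_mul_self : dimProj ρ ν * dimProj ρ ν = dimProj ρ ν := by
  rw [dimProj, ← map_mul]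
  congr 1
  funext w
  rw [Pi.mul_apply]
  split_ifs <;> simp

theorem dimProj_mul_ne {ν μ : DimVec (theta hI) m} (h : ν ≠ μ) :
    dimProj ρ ν * dimProj ρ μ = 0 := by
  rw [dimProj, dimProj, ← map_mul, ← map_zero ρ]
  congr 1
  funext w
  rw [Pi.mul_apply, Pi.zero_apply]
  by_cases h1 : w.dim = ν
  · rw [if_neg fun h2 => h (h1.symm.trans h2), mul_zero]
  · rw [if_neg h1, zero_mul]

theorem sum_idem : wordAct ρ S ν (∑ᶠ i, e1 𝕜 i) = dimProj ρ ν := by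
  classical
  have := finite_seq (θ := theta hI) m ν.1
  have h1 := (wordAct ρ S ν).toLinearMap.toAddMonoidHom.map_finsum
    (f := fun i : Seq (theta hI) m ν.1 => e1 𝕜 i) (Set.toFinite _)
  refine h1.trans ?_
  have h2 : ∀ i : Seq (theta hI) m ν.1,
      (wordAct ρ S ν).toLinearMap.toAddMonoidHom (e1 𝕜 i) = ρ (atWt i.wt 1) := wordAct_idem ρ S ν
  simp only [h2]
  have h3 := ρ.toLinearMap.toAddMonoidHom.map_finsum
    (f := fun i : Seq (theta hI) m ν.1 => atWt i.wt 1) (Set.toFinite _)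
  refine h3.symm.trans ?_
  change ρ _ = ρ _
  congr 1
  have := Fintype.ofFinite (Seq (theta hI) m ν.1)
  rw [finsum_eq_sum_of_fintype]
  funext w
  rw [Finset.sum_apply]
  split_ifs with hw
  · subst hw
    rw [Finset.sum_eq_single w.seq]
    · exact atWt_same w 1
    · intro j _ hj
      exact atWt_ne (fun h => hj (Seq.wt_injective h.symm)) _
    · simp
  · refine Finset.sum_eq_zero fun j _ => atWt_ne (fun h => hw ?_) _
    rw [h, j.dim_wt]

variable {ρ S}

/-- Reflections preserve the dimension vector, so the indicator of ν is an invariant function and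
commutes with σ_k; with the other generators it commutes because functions do. -/
theorem wordAct_comm (hS : IsSigmaFamily (ρ : Fun 𝕜 (theta hI) m →+* Module.End 𝕜 V) S)
    (x : FreeAlgebra 𝕜 (RGen (theta hI) m ν.1)) :
    Commute (wordAct ρ S ν x) (dimProj ρ ν) := by
  induction x with
  | grade0 r =>
    rw [AlgHom.commutes]
    exact Algebra.commutes _ _
  | grade1 x =>
    cases x with
    | idem i =>
      change Commute (wordAct ρ S ν (e1 𝕜 i)) _
      rw [wordAct_idem, dimProj]
      exact (Commute.all _ _).map ρ
    | kap l =>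
      change Commute (wordAct ρ S ν (eκ 𝕜 _ m ν.1 l)) _
      rw [wordAct_kap, dimProj]
      exact (Commute.all _ _).map ρ
    | sig k =>
      change Commute (wordAct ρ S ν (eσ 𝕜 _ m ν.1 k)) _
      rw [wordAct_sig, dimProj]
      classical
      have h1 : reflFun k (fun w : Wt (theta hI) m => if w.dim = ν then (1 : Ser 𝕜 m) else 0) =
          fun w => if w.dim = ν then 1 else 0 := by
        funext w
        rw [reflFun_apply, Wt.dim_act]
        split_ifs <;> simp
      have h2 := hS.leibniz k (fun w : Wt (theta hI) m => if w.dim = ν then (1 : Ser 𝕜 m) else 0)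
      rw [h1, demazure_eq_zero k h1, map_zero, add_zero] at h2
      rw [commute_iff_eq]
      convert h2 <;> rfl
  | mul x y hx hy =>
    rw [map_mul]
    exact hx.mul_left hy
  | add x y hx hy =>
    rw [map_add]
    exact hx.add_left hy

/-- Each relation follows from its counterpart in `IsSigmaFamily`. Only `RRel.one` needs the factor
`dimProj`: on all of V the idempotents of a single ν sum to this projection and not to 1. -/
theorem wordAct_rel (hS : IsSigmaFamily (ρ : Fun 𝕜 (theta hI) m →+* Module.End 𝕜 V) S)
    {x y : FreeAlgebra 𝕜 (RGen (theta hI) m ν.1)}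
    (h : RRel 𝕜 (theta hI) (arrows p I) m ν.1 x y) :
    wordAct ρ S ν x * dimProj ρ ν = wordAct ρ S ν y * dimProj ρ ν := by
  have hcomm : ∀ a b : Fun 𝕜 (theta hI) m, ρ a * ρ b = ρ b * ρ a := fun a b => by
    rw [← map_mul, mul_comm, map_mul]
  have hle : ∀ k h, S k * ρ h = ρ (reflFun k h) * S k + ρ (demazure k h) := hS.leibniz
  have hkap : ∀ (k : Ref m) (l : Pos m) (w : Wt (theta hI) m) (g : Ser 𝕜 m),
      -(eps k.lo k.hi : Fun 𝕜 (theta hI) m) w * divDiff k (kap 𝕜 l) = g →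
      (S k * ρ (constFun _ (kap 𝕜 l)) - ρ (constFun _ (kap 𝕜 (refl k l))) * S k) * ρ (atWt w 1) =
        ρ (atWt w g) := by
    intro k l w g hg
    have h1 : reflFun k (constFun (theta hI) (kap 𝕜 l)) = constFun _ (kap 𝕜 (refl k l)) := by
      funext w
      rw [reflFun_apply, reflSer_kap]
    rw [hle, h1, add_sub_cancel_left, ← map_mul, mul_atWt, mul_one]
    exact congrArg (fun g => ρ (atWt w g)) hg
  have h0 : ∀ w : Wt (theta hI) m, ρ (atWt w 0) = 0 := fun w =>
    map_zero (ρ.toLinearMap.comp (atWtLin 𝕜 w))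
  have hn : ∀ (w : Wt (theta hI) m) g, ρ (atWt w (-g)) = -ρ (atWt w g) := fun w g =>
    map_neg (ρ.toLinearMap.comp (atWtLin 𝕜 w)) g
  cases h with
  | one => rw [sum_idem, dimProj_mul_self, map_one, one_mul]
  | idem_self i => rw [map_mul, wordAct_idem, ← map_mul, atWt_mul_atWt, one_mul]
  | idem_ne i j hij =>
    rw [map_mul, wordAct_idem, wordAct_idem, ← map_mul,
      atWt_mul_atWt_ne fun h => hij (Seq.wt_injective h), map_zero, map_zero]
  | sig_idem k i =>
    rw [map_mul, map_mul, wordAct_idem, wordAct_idem, wordAct_sig, hle, reflFun_atWt, demazure_atWt,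
      divDiff_eq k (q := 0) (by simp), mul_zero, h0, add_zero, map_one, Seq.wt_act]
  | kap_idem l i => rw [map_mul, map_mul, wordAct_idem, wordAct_kap, hcomm]
  | kap_neg l =>
    rw [map_neg, wordAct_kap, wordAct_kap, ← map_neg]
    congr 2
    funext w
    rw [Pi.neg_apply, kap_neg]
  | kap_comm l l' => rw [map_mul, map_mul, wordAct_kap, wordAct_kap, hcomm]
  | sig_sq k i =>
    have h1 := map_Q (arrows p I) (wordAct ρ S ν).toRingHom (i.1 k.lo) (i.1 k.hi)
      (eκ 𝕜 _ m ν.1 k.hi) (eκ 𝕜 _ m ν.1 k.lo)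
    have h2 := map_Q (arrows p I) (ρ : Fun 𝕜 (theta hI) m →+* Module.End 𝕜 V) (i.1 k.lo) (i.1 k.hi)
      (constFun _ (kap 𝕜 k.hi)) (constFun _ (kap 𝕜 k.lo))
    change wordAct ρ S ν _ = Q _ _ _ (wordAct ρ S ν _) (wordAct ρ S ν _) at h1
    change ρ _ = Q _ _ _ (ρ _) (ρ _) at h2
    have h3 : S k * S k = ρ (eFun hI k.lo k.hi) := hS.sq k
    rw [map_mul, map_mul, map_pow, wordAct_idem, wordAct_sig, h1, wordAct_kap, wordAct_kap, ← h2,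
      pow_two, h3, ← map_mul, ← map_mul, mul_atWt, mul_atWt]
    congr 4
    exact (map_Q (arrows p I) (Pi.evalRingHom (fun _ : Wt (theta hI) m => Ser 𝕜 m) i.wt)
      (i.1 k.lo) (i.1 k.hi) (constFun _ (kap 𝕜 k.hi)) (constFun _ (kap 𝕜 k.lo))).symm
  | sig_comm k k' hk => rw [map_mul, map_mul, wordAct_sig, wordAct_sig, hS.comm k k' hk]
  | braid_eq k k' hk i hi =>
    have h1 := map_QDiff (arrows p I) (wordAct ρ S ν).toRingHom (i.1 k.lo) (i.1 k.hi)
      (eκ 𝕜 _ m ν.1 k.hi) (eκ 𝕜 _ m ν.1 k.lo) (eκ 𝕜 _ m ν.1 k'.hi)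
    have h2 := map_QDiff (arrows p I) (ρ : Fun 𝕜 (theta hI) m →+* Module.End 𝕜 V) (i.1 k.lo)
      (i.1 k.hi) (constFun _ (kap 𝕜 k.hi)) (constFun _ (kap 𝕜 k.lo)) (constFun _ (kap 𝕜 k'.hi))
    change wordAct ρ S ν _ = QDiff _ _ _ (wordAct ρ S ν _) (wordAct ρ S ν _)
      (wordAct ρ S ν _) at h1
    change ρ _ = QDiff _ _ _ (ρ _) (ρ _) (ρ _) at h2
    have h3 : S k' * S k * S k' - S k * S k' * S k = -ρ (rFun hI k.lo k.hi k'.hi) := by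
      rw [← neg_sub]
      exact congrArg Neg.neg (hS.braid k k' hk)
    simp only [map_mul, map_sub, wordAct_idem, wordAct_sig]
    rw [h1, wordAct_kap, wordAct_kap, wordAct_kap, ← h2, h3, ← map_neg, ← map_mul, ← map_mul,
      mul_atWt, mul_atWt]
    congr 4
    have h4 : (eps k.lo k'.hi : Fun 𝕜 (theta hI) m) i.wt = 1 := if_pos hi
    rw [Pi.neg_apply, rFun, h4, neg_neg, one_mul]
    exact (map_QDiff (arrows p I) (Pi.evalRingHom (fun _ : Wt (theta hI) m => Ser 𝕜 m) i.wt)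
      (i.1 k.lo) (i.1 k.hi) (constFun _ (kap 𝕜 k.hi)) (constFun _ (kap 𝕜 k.lo))
      (constFun _ (kap 𝕜 k'.hi))).symm
  | braid_ne k k' hk i hi =>
    have h3 : S k' * S k * S k' - S k * S k' * S k = -ρ (rFun hI k.lo k.hi k'.hi) := by
      rw [← neg_sub]
      exact congrArg Neg.neg (hS.braid k k' hk)
    simp only [map_mul, map_sub, wordAct_idem, wordAct_sig]
    have h4 : (eps k.lo k'.hi : Fun 𝕜 (theta hI) m) i.wt = 0 := if_neg hi
    rw [h3, ← map_neg, ← map_mul, mul_atWt, Pi.neg_apply, rFun, h4, zero_mul, neg_zero, neg_zero,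
      zero_mul, h0, map_zero]
  | sig_kap_lo k i hi =>
    have h4 : (eps k.lo k.hi : Fun 𝕜 (theta hI) m) i.wt = 1 := if_pos hi
    have h5 := hkap k k.lo i.wt (-1) (by rw [h4, divDiff_kap_lo, mul_one])
    rw [refl_lo] at h5
    simp only [map_mul, map_sub, map_neg, wordAct_idem, wordAct_sig, wordAct_kap]
    rw [h5, hn]
  | sig_kap_hi k i hi =>
    have h4 : (eps k.lo k.hi : Fun 𝕜 (theta hI) m) i.wt = 1 := if_pos hi
    have h5 := hkap k k.hi i.wt 1 (by rw [h4, divDiff_kap_hi, mul_neg, mul_one, neg_neg])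
    rw [refl_hi] at h5
    simp only [map_mul, map_sub, wordAct_idem, wordAct_sig, wordAct_kap]
    rw [h5]
  | sig_kap_ne k i hi l =>
    have h4 : (eps k.lo k.hi : Fun 𝕜 (theta hI) m) i.wt = 0 := if_neg hi
    have h5 := hkap k l i.wt 0 (by rw [h4, neg_zero, zero_mul])
    simp only [map_mul, map_sub, wordAct_idem, wordAct_sig, wordAct_kap]
    rw [h5, h0, map_zero]
  | sig_kap_else k i l hl =>
    have h5 := hkap k l i.wt 0 (by rw [divDiff_kap_else k l hl, mul_zero])
    simp only [map_mul, map_sub, wordAct_idem, wordAct_sig, wordAct_kap]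
    rw [h5, h0, map_zero]

end WordAct

end Build

/-! ### Actions on the image of an idempotent. -/

section Corner

variable {𝕜 V : Type*} [Field 𝕜] [AddCommGroup V] [Module 𝕜 V]

/-- Operators that commute with an idempotent act on its image, and relations between them need to
hold only there. -/
theorem exists_corner {A : Type*} [Ring A] [Algebra 𝕜 A] (r : A → A → Prop)
    (Φ : A →ₐ[𝕜] Module.End 𝕜 V) (e : Module.End 𝕜 V) (he : e * e = e)
    (hc : ∀ x, Commute (Φ x) e) (hr : ∀ x y, r x y → Φ x * e = Φ y * e) :
    ∃ Ψ : RingQuot r →ₙₐ[𝕜] Module.End 𝕜 V, ∀ x, Ψ (RingQuot.mkAlgHom 𝕜 r x) = Φ x * e := by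
  have hm : ∀ x, ∀ v ∈ LinearMap.range e, Φ x v ∈ LinearMap.range e := by
    rintro x _ ⟨v, rfl⟩
    exact ⟨Φ x v, (LinearMap.congr_fun (hc x) v).symm⟩
  have hid : ∀ v ∈ LinearMap.range e, e v = v := by
    rintro _ ⟨v, rfl⟩
    exact LinearMap.congr_fun he v
  let Φ' : A →ₐ[𝕜] Module.End 𝕜 (LinearMap.range e) :=
    { toFun := fun x => (Φ x).restrict (hm x)
      map_one' := by
        ext v
        simp [LinearMap.restrict_apply]
      map_zero' := by
        ext v
        simp [LinearMap.restrict_apply]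
      map_mul' := fun x y => by
        ext v
        simp [LinearMap.restrict_apply]
      map_add' := fun x y => by
        ext v
        simp [LinearMap.restrict_apply]
      commutes' := fun c => by
        ext v
        simp [LinearMap.restrict_apply] }
  let π : V →ₗ[𝕜] LinearMap.range e := e.rangeRestrict
  let ι : LinearMap.range e →ₗ[𝕜] V := (LinearMap.range e).subtype
  have hπι : ∀ v, π (ι v) = v := fun v => Subtype.ext (hid _ v.2)
  let Λ : RingQuot r →ₐ[𝕜] Module.End 𝕜 (LinearMap.range e) :=
    RingQuot.liftAlgHom 𝕜 ⟨Φ', fun x y h => by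
      ext v
      change Φ x v.1 = Φ y v.1
      have := LinearMap.congr_fun (hr x y h) v.1
      simpa only [Module.End.mul_apply, hid v.1 v.2] using this⟩
  -- Project to the image of e, act there, and include. The unit goes to e, so the map is
  -- multiplicative without being unital.
  refine ⟨{ toFun := fun a => ι.comp ((Λ a).comp π)
            map_smul' := ?_
            map_zero' := ?_
            map_add' := ?_
            map_mul' := ?_ }, fun x => ?_⟩
  · intro c a
    ext v
    simp
  · ext v
    simp
  · intro a b
    ext v
    simp
  · intro a b
    ext v
    simp only [map_mul, LinearMap.comp_apply, Module.End.mul_apply, hπι]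
  · change ι.comp ((Λ _).comp π) = _
    have : Λ (RingQuot.mkAlgHom 𝕜 r x) = Φ' x := RingQuot.liftAlgHom_mkAlgHom_apply _ _ _ x
    rw [this]
    rfl

end Corner

/-! ### Assembling an action of °R_m from its summands. -/

section Build

variable {𝕜 : Type u} [Field 𝕜] {p : 𝕜ˣ} {I : Set 𝕜ˣ} {hI : Invariant p I} {m : ℕ}
  {V : Type*} [AddCommGroup V] [Module 𝕜 V]

/-- Mutually orthogonal actions of the summands give an action of the sum. -/
theorem exists_total {E : Type*} [Ring E] [Algebra 𝕜 E] {Γ : Type u} {θ : Γ → Γ} {h : Γ → Γ → ℕ}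
    (Ψ : ∀ ν : DimVec θ m, RNu 𝕜 θ h m ν.1 →ₙₐ[𝕜] E)
    (hΨ : ∀ ν μ, ν ≠ μ → ∀ a b, Ψ ν a * Ψ μ b = 0) :
    ∃ φ : RUnit 𝕜 θ h m →ₐ[𝕜] E, ∀ ν a, φ (inSum 𝕜 θ h m ν a) = Ψ ν a := by
  classical
  have hs : ∀ a : RTot 𝕜 θ h m, (Function.support fun ν => Ψ ν (a.1 ν)).Finite := fun a =>
    a.2.subset fun ν hν h0 => hν (by change Ψ ν (a.1 ν) = 0; rw [h0, map_zero])
  let Φ : RTot 𝕜 θ h m →ₙₐ[𝕜] E :=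
    { toFun := fun a => ∑ᶠ ν, Ψ ν (a.1 ν)
      map_smul' := fun c a => by
        change ∑ᶠ ν, Ψ ν (c • a.1 ν) = c • ∑ᶠ ν, Ψ ν (a.1 ν)
        rw [smul_finsum' c (hs a)]
        exact finsum_congr fun ν => map_smul _ _ _
      map_zero' := by
        change ∑ᶠ ν, Ψ ν 0 = 0
        simp
      map_add' := fun a b => by
        change ∑ᶠ ν, Ψ ν (a.1 ν + b.1 ν) = _
        rw [← finsum_add_distrib (hs a) (hs b)]
        exact finsum_congr fun ν => map_add _ _ _
      map_mul' := fun a b => by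
        change ∑ᶠ ν, Ψ ν (a.1 ν * b.1 ν) = _
        rw [mul_finsum' _ _ (hs b)]
        refine finsum_congr fun μ => ?_
        rw [finsum_mul' _ _ (hs a), finsum_eq_single _ μ fun ν hν => hΨ ν μ hν _ _, map_mul] }
  refine ⟨Unitization.lift Φ, fun ν a => ?_⟩
  have h1 : ∀ b, Unitization.lift Φ (Unitization.inr b) = Φ b := fun b => by
    rw [← Unitization.lift_symm_apply_apply, Equiv.symm_apply_apply]
  refine (h1 _).trans ?_
  change ∑ᶠ μ, Ψ μ ((Pi.single ν a : ∀ μ : DimVec θ m, RNu 𝕜 θ h m μ.1) μ) = Ψ ν a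
  rw [finsum_eq_single _ ν fun μ hμ => by rw [Pi.single_eq_of_ne hμ, map_zero], Pi.single_eq_same]

/-- The summand °R_ν acts on the part of V with dimension vector ν and by zero on the rest.
Different summands are orthogonal because the projections commute with words and annihilate one
another. -/
theorem exists_of_isSigmaFamily {ρ : Fun 𝕜 (theta hI) m →ₐ[𝕜] Module.End 𝕜 V}
    {S : Ref m → Module.End 𝕜 V} (hρ : ∀ v, IsSmooth (orbit ρ v))
    (hS : IsSigmaFamily (ρ : Fun 𝕜 (theta hI) m →+* Module.End 𝕜 V) S) :
    ∃ φ, IsRAction φ ρ S := by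
  choose Ψ hΨ using fun ν => exists_corner (RRel 𝕜 (theta hI) (arrows p I) m ν.1) (wordAct ρ S ν)
    (dimProj ρ ν) (dimProj_mul_self ρ ν) (wordAct_comm ν hS) fun x y h => wordAct_rel ν hS h
  obtain ⟨φ, hφ⟩ := exists_total Ψ fun ν μ hne a b => by
    obtain ⟨x, rfl⟩ := RingQuot.mkAlgHom_surjective 𝕜 _ a
    obtain ⟨y, rfl⟩ := RingQuot.mkAlgHom_surjective 𝕜 _ b
    rw [hΨ, hΨ, (wordAct_comm μ hS y).eq, mul_assoc, ← mul_assoc (dimProj ρ ν),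
      dimProj_mul_ne ρ hne, zero_mul, mul_zero]
  have hact : ∀ ν x, act φ ν x = wordAct ρ S ν x * dimProj ρ ν := fun ν x =>
    (hφ ν _).trans (hΨ ν x)
  refine ⟨φ, hρ, fun ν i => ?_, fun ν i l => ?_, fun ν i k => ?_⟩
  · rw [hact, wordAct_idem, dimProj_atWt]
  · rw [hact, map_mul, wordAct_idem, wordAct_kap, mul_assoc, dimProj_atWt, ← map_mul, mul_atWt,
      mul_one]
  · rw [hact, map_mul, wordAct_idem, wordAct_sig, mul_assoc, dimProj_atWt]

end Build

/-! ### Words acting on a °R_m-module, and maps between two such modules. -/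

section RAction

variable {𝕜 : Type u} [Field 𝕜] {p : 𝕜ˣ} {I : Set 𝕜ˣ} {hI : Invariant p I} {m : ℕ}
  {V : Type*} [AddCommGroup V] [Module 𝕜 V]
  {φ : RUnit 𝕜 (theta hI) (arrows p I) m →ₐ[𝕜] Module.End 𝕜 V}
  {ρ : Fun 𝕜 (theta hI) m →ₐ[𝕜] Module.End 𝕜 V} {S : Ref m → Module.End 𝕜 V}

theorem IsRAction.act_mul_ne (hφ : IsRAction φ ρ S) {ν : DimVec (theta hI) m}
    {w : Wt (theta hI) m} (hw : w.dim ≠ ν) (x : FreeAlgebra 𝕜 (RGen (theta hI) m ν.1)) :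
    act φ ν x * ρ (atWt w 1) = 0 := by
  have h1 : ρ (atWt w 1) = act φ w.dim (e1 𝕜 w.seq) := (hφ.idem w.dim w.seq).symm
  rw [h1, act_apply, act_apply, ← map_mul]
  exact (congrArg φ (inSum_mul_ne (Ne.symm hw) _ _)).trans (map_zero φ)

/-- The unit of °R_ν is not the unit of the unitization, and `act` is not unital. Hence scalars in
the free algebra need this separate treatment in `IsRAction.act_eq`. -/
theorem IsRAction.act_one (hφ : IsRAction φ ρ S) (ν : DimVec (theta hI) m) :
    act φ ν 1 = dimProj ρ ν := by
  refine ext_of_atWt hφ.smooth fun w v => ?_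
  change (act φ ν 1 * ρ (atWt w 1)) v = (dimProj ρ ν * ρ (atWt w 1)) v
  congr 1
  by_cases hw : w.dim = ν
  · subst hw
    have h1 : ρ (atWt w 1) = act φ w.dim (e1 𝕜 w.seq) := (hφ.idem w.dim w.seq).symm
    have h2 : ρ (atWt w 1) * dimProj ρ w.dim = ρ (atWt w 1) := dimProj_atWt ρ w.dim w.seq 1
    have h3 : dimProj ρ w.dim * ρ (atWt w 1) = ρ (atWt w 1) * dimProj ρ w.dim := by
      rw [dimProj, ← map_mul, ← map_mul, mul_comm]
    rw [h3, h2, h1, ← map_mul, one_mul]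
  · rw [hφ.act_mul_ne hw, dimProj, ← map_mul, mul_atWt, if_neg hw, zero_mul]
    exact (map_zero (ρ.toLinearMap.comp (atWtLin 𝕜 w))).symm

/-- The action of words in the generators. -/
theorem IsRAction.act_eq (hφ : IsRAction φ ρ S) (ν : DimVec (theta hI) m)
    (x : FreeAlgebra 𝕜 (RGen (theta hI) m ν.1)) :
    act φ ν x = wordAct ρ S ν x * dimProj ρ ν := by
  -- It suffices to test on weights with dimension vector ν, since both sides annihilate all other
  -- weight spaces.
  have hext : ∀ (x : FreeAlgebra 𝕜 (RGen (theta hI) m ν.1)) (A : Module.End 𝕜 V),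
      (∀ i : Seq (theta hI) m ν.1, act φ ν x * ρ (atWt i.wt 1) = A * ρ (atWt i.wt 1)) →
      act φ ν x = A * dimProj ρ ν := by
    intro x A hA
    refine ext_of_atWt hφ.smooth fun w v => ?_
    change (act φ ν x * ρ (atWt w 1)) v = (A * dimProj ρ ν * ρ (atWt w 1)) v
    congr 1
    by_cases hw : w.dim = ν
    · subst hw
      have h2 : ρ (atWt w 1) * dimProj ρ w.dim = ρ (atWt w 1) := dimProj_atWt ρ w.dim w.seq 1
      have h3 : dimProj ρ w.dim * ρ (atWt w 1) = ρ (atWt w 1) * dimProj ρ w.dim := by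
        rw [dimProj, ← map_mul, ← map_mul, mul_comm]
      rw [mul_assoc, h3, h2]
      exact hA w.seq
    · rw [hφ.act_mul_ne hw, mul_assoc, ← hφ.act_one, hφ.act_mul_ne hw, mul_zero]
  induction x with
  | grade0 r =>
    rw [AlgHom.commutes, ← hφ.act_one, Algebra.algebraMap_eq_smul_one,
      Algebra.algebraMap_eq_smul_one, map_smul, smul_mul_assoc, one_mul]
  | grade1 x =>
    refine hext _ _ fun i => ?_
    have h0 : act φ ν (FreeAlgebra.ι 𝕜 x) * ρ (atWt i.wt 1) =
        act φ ν (FreeAlgebra.ι 𝕜 x * e1 𝕜 i) := by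
      rw [map_mul, hφ.idem]
    rw [h0]
    cases x with
    | idem j =>
      rw [map_mul, hφ.idem, hφ.idem, wordAct_idem]
    | kap l => rw [hφ.kap, wordAct_kap, ← map_mul, mul_atWt, mul_one]
    | sig k => rw [hφ.sig, wordAct_sig]
  | mul x y hx hy =>
    rw [map_mul, map_mul, hx, hy,
      mul_assoc, ← mul_assoc (dimProj ρ ν), ← (wordAct_comm ν hφ.family y).eq, mul_assoc,
      dimProj_mul_self, ← mul_assoc]
  | add x y hx hy =>
    rw [map_add, map_add, hx, hy, add_mul]

theorem IsRAction.mem_closure (hφ : IsRAction φ ρ S) (x : V) :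
    x ∈ AddSubgroup.closure {y : V | ∃ (ν : DimVec (theta hI) m) (i : Seq (theta hI) m ν.1),
      act φ ν (e1 𝕜 i) y = y} := by
  obtain ⟨Ω, hΩ⟩ := (hφ.smooth x).exists_sum
  rw [← hΩ]
  refine sum_mem fun w _ => AddSubgroup.subset_closure ⟨w.dim, w.seq, ?_⟩
  rw [hφ.idem, ← Module.End.mul_apply]
  have h1 : ρ (atWt w.seq.wt 1) * ρ (atWt w 1) = ρ (atWt w 1) := by
    rw [← map_mul]
    change ρ (atWt w 1 * atWt w 1) = _
    rw [atWt_mul_atWt, one_mul]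
  rw [h1]

/-- The operator is a function without constant term at every weight, so its n-th power has order at
least n everywhere and kills a given vector for large n. -/
theorem IsRAction.nilpotent (hφ : IsRAction φ ρ S) (ν : DimVec (theta hI) m) (l : Pos m) (x : V) :
    ∃ n : ℕ, (act φ ν (eκ 𝕜 _ m ν.1 l) ^ n) x = 0 := by
  classical
  have h1 : act φ ν (eκ 𝕜 _ m ν.1 l) =
      ρ fun w => TypeD.kap 𝕜 l * if w.dim = ν then 1 else 0 := by
    rw [hφ.act_eq, wordAct_kap, dimProj, ← map_mul]
    rfl
  obtain ⟨Ω, n, hn⟩ := hφ.smooth x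
  refine ⟨n, ?_⟩
  rw [h1, ← map_pow]
  refine hn _ fun i _ => ?_
  rw [Pi.pow_apply, mul_pow]
  exact Ideal.mul_mem_right _ _ (pow_mem_ordIdeal (constantCoeff_kap l))

variable {V' : Type*} [AddCommGroup V'] [Module 𝕜 V']
  {φ' : RUnit 𝕜 (theta hI) (arrows p I) m →ₐ[𝕜] Module.End 𝕜 V'}
  {ρ' : Fun 𝕜 (theta hI) m →ₐ[𝕜] Module.End 𝕜 V'} {S' : Ref m → Module.End 𝕜 V'}
  {L : V →ₗ[𝕜] V'}

/-- The elements of an algebra on whose action a linear map commutes. -/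
def intertwineSub {A : Type*} [Ring A] [Algebra 𝕜 A] (Φ : A →ₐ[𝕜] Module.End 𝕜 V)
    (Φ' : A →ₐ[𝕜] Module.End 𝕜 V') (L : V →ₗ[𝕜] V') : Subalgebra 𝕜 A where
  carrier := {a | ∀ v, L (Φ a v) = Φ' a (L v)}
  mul_mem' {a b} ha hb v := by
    rw [map_mul, map_mul, Module.End.mul_apply, ha, hb, Module.End.mul_apply]
  add_mem' {a b} ha hb v := by
    rw [map_add, map_add, LinearMap.add_apply, map_add, ha, hb, LinearMap.add_apply]
  algebraMap_mem' c v := by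
    rw [AlgHom.commutes, AlgHom.commutes, Module.algebraMap_end_apply, Module.algebraMap_end_apply,
      map_smul]

theorem intertwineSub_of_gen {X : Type*} (Φ : FreeAlgebra 𝕜 X →ₐ[𝕜] Module.End 𝕜 V)
    (Φ' : FreeAlgebra 𝕜 X →ₐ[𝕜] Module.End 𝕜 V')
    (h : ∀ x, FreeAlgebra.ι 𝕜 x ∈ intertwineSub Φ Φ' L) (a : FreeAlgebra 𝕜 X) :
    a ∈ intertwineSub Φ Φ' L := by
  induction a with
  | grade0 r => exact Subalgebra.algebraMap_mem _ r
  | grade1 x => exact h x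
  | mul a b ha hb => exact mul_mem ha hb
  | add a b ha hb => exact add_mem ha hb

theorem inr_eq_sum {Γ : Type u} {θ : Γ → Γ} {h : Γ → Γ → ℕ} (a : RTot 𝕜 θ h m) :
    (Unitization.inr a : RUnit 𝕜 θ h m) =
      ∑ ν ∈ Set.Finite.toFinset (a.2 : {ν | a.1 ν ≠ 0}.Finite), inSum 𝕜 θ h m ν (a.1 ν) := by
  classical
  have h1 : a = ∑ ν ∈ Set.Finite.toFinset (a.2 : {ν | a.1 ν ≠ 0}.Finite),
      (⟨Pi.single ν (a.1 ν), by
        refine (Set.finite_singleton ν).subset fun μ hμ => ?_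
        by_contra h0
        exact hμ (by rw [Pi.single_eq_of_ne h0])⟩ : RTot 𝕜 θ h m) := by
    apply Subtype.ext
    rw [AddSubmonoidClass.coe_finsetSum]
    funext μ
    rw [Finset.sum_apply]
    by_cases hμ : a.1 μ = 0
    · rw [hμ]
      refine (Finset.sum_eq_zero fun ν hν => Pi.single_eq_of_ne ?_ _).symm
      rintro rfl
      exact (Set.Finite.mem_toFinset _).1 hν hμ
    · rw [Finset.sum_eq_single μ]
      · exact (Pi.single_eq_same (M := fun ν : DimVec θ m => RNu 𝕜 θ h m ν.1) μ (a.1 μ)).symm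
      · intro ν _ hν
        exact Pi.single_eq_of_ne hν.symm _
      · intro hν
        exact absurd ((Set.Finite.mem_toFinset _).2 hμ) hν
  have h2 := congrArg (Unitization.inrHom (R := 𝕜) (S := 𝕜) (A := RTot 𝕜 θ h m)) h1
  rw [map_sum] at h2
  exact h2

/-- By `IsRAction.act_eq` the component °R_ν acts through ρ, the σ_k and a projection that is itself
in the image of ρ. Elements of °R_m are finite sums of such components. -/
theorem IsRAction.map_of (hφ : IsRAction φ ρ S) (hφ' : IsRAction φ' ρ' S')
    (hρ : ∀ h v, L (ρ h v) = ρ' h (L v)) (hS : ∀ k v, L (S k v) = S' k (L v))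
    (r : RUnit 𝕜 (theta hI) (arrows p I) m) (v : V) : L (φ r v) = φ' r (L v) := by
  have h1 : ∀ ν x, x ∈ intertwineSub (wordAct ρ S ν) (wordAct ρ' S' ν) L := by
    intro ν
    refine intertwineSub_of_gen _ _ fun x v => ?_
    cases x with
    | idem i => rw [wordAct_idem, wordAct_idem, hρ]
    | kap l => rw [wordAct_kap, wordAct_kap, hρ]
    | sig k => rw [wordAct_sig, wordAct_sig, hS]
  have h2 : ∀ ν a, inSum 𝕜 (theta hI) (arrows p I) m ν a ∈ intertwineSub φ φ' L := by
    intro ν a v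
    obtain ⟨x, rfl⟩ := RingQuot.mkAlgHom_surjective 𝕜 _ a
    have h3 : φ (inSum 𝕜 _ _ m ν (RingQuot.mkAlgHom 𝕜 _ x)) = _ := hφ.act_eq ν x
    have h3' : φ' (inSum 𝕜 _ _ m ν (RingQuot.mkAlgHom 𝕜 _ x)) = _ := hφ'.act_eq ν x
    rw [h3, h3', Module.End.mul_apply, Module.End.mul_apply, h1 ν x, dimProj, hρ]
    rfl
  have h3 : r ∈ intertwineSub φ φ' L := by
    induction r using Unitization.ind with
    | inl_add_inr c a =>
      refine add_mem (Subalgebra.algebraMap_mem _ c) ?_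
      rw [inr_eq_sum]
      exact sum_mem fun ν _ => h2 ν _
  exact h3 v

/-- The functions whose action commutes with L form a subalgebra containing 1_𝐢 and ϰ_l 1_𝐢, hence
all monomials. Smoothness on both sides does the rest. -/
theorem IsRAction.map_fun (hφ : IsRAction φ ρ S) (hφ' : IsRAction φ' ρ' S')
    (hL : ∀ r v, L (φ r v) = φ' r (L v)) (h : Fun 𝕜 (theta hI) m) (v : V) :
    L (ρ h v) = ρ' h (L v) := by
  classical
  refine sub_eq_zero.1 ((((hφ.smooth v).comp L).sub (hφ'.smooth (L v))).eq_zero (fun i d => ?_) h)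
  refine sub_eq_zero.2 (single_monomial_mem (intertwineSub ρ ρ' L) (fun w v => ?_)
    (fun w l v => ?_) i d v)
  · have h1 := hφ.idem w.dim w.seq
    have h1' := hφ'.idem w.dim w.seq
    change _ = ρ (atWt w 1) at h1
    change _ = ρ' (atWt w 1) at h1'
    rw [← atWt_eq, ← h1, ← h1', act_apply, act_apply, hL]
  · have h1 := hφ.kap w.dim w.seq l.1
    have h1' := hφ'.kap w.dim w.seq l.1
    change _ = ρ (atWt w _) at h1
    change _ = ρ' (atWt w _) at h1'
    rw [← atWt_eq, ← kap_coe, ← h1, ← h1', act_apply, act_apply, hL]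

theorem IsRAction.map_sig (hφ : IsRAction φ ρ S) (hφ' : IsRAction φ' ρ' S')
    (hL : ∀ r v, L (φ r v) = φ' r (L v)) (k : Ref m) (v : V) :
    L (S k v) = S' k (L v) := by
  refine LinearMap.congr_fun (f := L.comp (S k)) (g := (S' k).comp L)
    (ext_of_atWt hφ.smooth fun w v => ?_) v
  have h1 : _ = S k * ρ (atWt w 1) := hφ.sig w.dim w.seq k
  have h1' : _ = S' k * ρ' (atWt w 1) := hφ'.sig w.dim w.seq k
  change L ((S k * ρ (atWt w 1)) v) = S' k (L (ρ (atWt w 1) v))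
  rw [hφ.map_fun hφ' hL, ← Module.End.mul_apply, ← h1, ← h1', act_apply, act_apply, hL]

end RAction

/-! ### The Demazure operator of T_k and its values on the functions X_l. -/

section HeckeLin

variable {𝕜 : Type*} [Field 𝕜] {p : 𝕜ˣ} {I : Set 𝕜ˣ} (hI : Invariant p I) {m : ℕ}
  (f : PowerSeries 𝕜)

/-- The Demazure operator of the affine Hecke algebra. -/
noncomputable def heckeLin (k : Ref m) : Fun 𝕜 (theta hI) m →ₗ[𝕜] Fun 𝕜 (theta hI) m :=
  (LinearMap.mulLeft 𝕜 (aFun hI f k.lo k.hi)).comp (demazureLin k) +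
    (LinearMap.mulLeft 𝕜 (bFun hI f k.lo k.hi)).comp (LinearMap.id - (reflFun k).toLinearMap)

theorem heckeLin_apply (k : Ref m) (h : Fun 𝕜 (theta hI) m) :
    heckeLin hI f k h =
      aFun hI f k.lo k.hi * demazure k h + bFun hI f k.lo k.hi * (h - reflFun k h) := rfl

theorem toRat_heckeLin (k : Ref m) (h : Fun 𝕜 (theta hI) m) :
    toRat 𝕜 (theta hI) m (heckeLin hI f k h) =
      ratX hI f k.lo k.hi *
        (toRat 𝕜 (theta hI) m h - toRat 𝕜 (theta hI) m (reflFun k h)) := by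
  rw [heckeLin_apply, map_add, map_mul, map_mul, toRat_demazure, map_sub, ratX]
  ring

variable {f}

/-- With G' = q X_{k'}/(X_{k'} − X_k), the product G'(X_k − X_{k'}) is −q X_{k'}, where k' = s_k(k)
and q = p − p⁻¹. The Leibniz rule becomes the Bernstein relation T_k X_k = X_{k'} T_k − q X_{k'}. -/
theorem heckeLin_xFun_lo (ha : IsAdmissible p f m) (k : Ref m) :
    heckeLin hI f k (xFun hI f k.lo) = -(qFun hI * xFun hI f k.hi) := by
  apply toRat_injective
  have h1 := xFun_sub_mul_ratX hI ha.coeff_zero ha.coeff_one ha.ne_one ha.ne_neg_one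
    (ha.flip k.2.1) k.isPair
  rw [toRat_heckeLin, reflFun_xFun hI ha.coeff_zero (ha.flip k.2.1), refl_lo, map_neg, map_mul]
  linear_combination -h1

theorem heckeLin_xFun_hi (ha : IsAdmissible p f m) (k : Ref m) :
    heckeLin hI f k (xFun hI f k.hi) = qFun hI * xFun hI f k.hi := by
  apply toRat_injective
  have h1 := xFun_sub_mul_ratX hI ha.coeff_zero ha.coeff_one ha.ne_one ha.ne_neg_one
    (ha.flip k.2.1) k.isPair
  rw [toRat_heckeLin, reflFun_xFun hI ha.coeff_zero (ha.flip k.2.1), refl_hi, map_mul]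
  linear_combination h1

theorem heckeLin_eq_zero (k : Ref m) {h : Fun 𝕜 (theta hI) m} (hh : reflFun k h = h) :
    heckeLin hI f k h = 0 := by
  rw [heckeLin_apply, demazure_eq_zero k hh, hh, sub_self, mul_zero, mul_zero, add_zero]

theorem IsSmooth.comp_heckeLin {V : Type*} [AddCommGroup V] [Module 𝕜 V]
    {L : Fun 𝕜 (theta hI) m →ₗ[𝕜] V} (hL : IsSmooth L) (k : Ref m) :
    IsSmooth (L.comp (heckeLin hI f k)) := by
  have h1 := (hL.comp_mul (aFun hI f k.lo k.hi)).comp_demazure k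
  have h2 := hL.comp_mul (bFun hI f k.lo k.hi)
  have h3 := h1.add (h2.sub (h2.comp_reflFun k))
  convert h3 using 1
  ext h
  simp [heckeLin, mul_sub]

end HeckeLin

/-! ### Actions of the affine Hecke algebra given by functions and operators T_k. -/

section HAction

variable {𝕜 : Type u} [Field 𝕜] {p : 𝕜ˣ} {I : Set 𝕜ˣ} {hI : Invariant p I} {m : ℕ}
  {f : PowerSeries 𝕜} {V : Type*} [AddCommGroup V] [Module 𝕜 V]

variable (f) in
/-- An action of the affine Hecke algebra on `V` is given by the smooth action `ρ` of functions and
the operators `T_k`. -/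
structure IsHAction (ψ : Hecke p m →ₐ[𝕜] Module.End 𝕜 V)
    (ρ : Fun 𝕜 (theta hI) m →ₐ[𝕜] Module.End 𝕜 V) (T : Ref m → Module.End 𝕜 V) : Prop where
  smooth : ∀ v, IsSmooth (orbit ρ v)
  map_X : ∀ l, ψ (hX p m l) = ρ (xFun hI f l)
  map_hT : ∀ k, ψ (hT p m k) = T k
  family : IsHeckeFamily f (ρ : Fun 𝕜 (theta hI) m →+* Module.End 𝕜 V) T

variable {ψ : Hecke p m →ₐ[𝕜] Module.End 𝕜 V} {ρ : Fun 𝕜 (theta hI) m →ₐ[𝕜] Module.End 𝕜 V}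
  {T : Ref m → Module.End 𝕜 V}

theorem exists_of_isHeckeFamily (ha : IsAdmissible p f m) (hρ : ∀ v, IsSmooth (orbit ρ v))
    (hT : IsHeckeFamily f (ρ : Fun 𝕜 (theta hI) m →+* Module.End 𝕜 V) T) :
    ∃ ψ : Hecke p m →ₐ[𝕜] Module.End 𝕜 V, IsHAction f ψ ρ T := by
  let Φ : FreeAlgebra 𝕜 (HGen m) →ₐ[𝕜] Module.End 𝕜 V := FreeAlgebra.lift 𝕜 fun x => match x with
    | .X l => ρ (xFun hI f l)
    | .T k => T k
  have hX : ∀ l, Φ (eX 𝕜 l) = ρ (xFun hI f l) := fun l => FreeAlgebra.lift_ι_apply _ _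
  have hT' : ∀ k, Φ (eT 𝕜 k) = T k := fun k => FreeAlgebra.lift_ι_apply _ _
  have hq : ∀ k, T k * T k = ((p : 𝕜) - (p : 𝕜)⁻¹) • T k + 1 := by
    intro k
    have h1 : T k * T k = ρ (qFun hI) * T k + 1 := hT.quad k
    rw [h1, qFun, AlgHom.commutes, Algebra.smul_def]
  have hrel : ∀ ⦃x y⦄, HRel p m x y → Φ x = Φ y := by
    intro x y h
    cases h with
    | X_inv l => rw [map_mul, hX, hX, ← map_mul, xFun_mul_xFun_neg hI ha.coeff_zero, map_one, map_one]
    | X_comm l l' => rw [map_mul, map_mul, hX, hX, ← map_mul, ← map_mul, mul_comm]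
    | braid k k' hk => simp only [map_mul, hT', hT.braid k k' hk]
    | T_comm k k' hk =>
      rw [map_mul, map_mul, hT', hT']
      rcases hk with hk | hk
      · exact hT.comm k k' (Or.inl hk)
      -- For k = 0 the defining relation includes the trivial case k' = 0, which `IsCommPair` leaves
      -- out.
      · by_cases h0 : k'.1 = 0
        · rw [show k' = k from Subtype.ext (h0.trans hk.1.symm)]
        · exact hT.comm k k' (Or.inr ⟨hk.1, Nat.pos_of_ne_zero h0, hk.2⟩)
    | quad k =>
      have hp : (p : 𝕜) * (p : 𝕜)⁻¹ = 1 := mul_inv_cancel₀ p.ne_zero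
      rw [map_mul, map_sub, map_add, hT', AlgHom.commutes, AlgHom.commutes, map_zero, sub_mul,
        mul_add, mul_add, hq, ← Algebra.commutes, ← map_mul, hp, map_one, ← Algebra.smul_def,
        ← Algebra.smul_def, sub_smul]
      abel
    -- By the Bernstein relation T X_k T = X_{k'}(T − q)T = X_{k'}(T² − qT) = X_{k'}, with k' =
    -- s_k(k) and q = p − p⁻¹.
    | TXT k =>
      have h1 : T k * ρ (xFun hI f k.lo) = ρ (reflFun k (xFun hI f k.lo)) * T k +
        ρ (heckeLin hI f k (xFun hI f k.lo)) := hT.leibniz k _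
      rw [heckeLin_xFun_lo hI ha, reflFun_xFun hI ha.coeff_zero (ha.flip k.2.1), refl_lo, map_neg,
        mul_comm, map_mul, qFun, AlgHom.commutes] at h1
      rw [map_mul, map_mul, hT', hX, hX, h1, add_mul, mul_assoc, hq, mul_add, mul_one,
        neg_mul, mul_assoc, ← Algebra.smul_def]
      abel
    | TX k l hl =>
      rw [map_mul, map_mul, hT', hX]
      refine hT.commute ?_
      rw [reflFun_xFun hI ha.coeff_zero (ha.flip k.2.1), refl_else k hl]
  exact ⟨RingQuot.liftAlgHom 𝕜 ⟨Φ, hrel⟩, hρ,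
    fun l => (RingQuot.liftAlgHom_mkAlgHom_apply _ _ _ _).trans (hX l),
    fun k => (RingQuot.liftAlgHom_mkAlgHom_apply _ _ _ _).trans (hT' k), hT⟩

/-- Orbits of smooth actions are finite dimensional. -/
theorem finiteDimensional_range_orbit {Γ : Type*} {θ : Γ → Γ}
    {L : Fun 𝕜 θ m →ₗ[𝕜] V} (hL : IsSmooth L) : FiniteDimensional 𝕜 (LinearMap.range L) := by
  classical
  obtain ⟨Ω, n, h⟩ := hL
  let B : Finset (Fun 𝕜 θ m) := (Ω ×ˢ lowExp (PPos m) n).image fun x =>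
    atWt x.1 (MvPowerSeries.monomial x.2 1)
  have h1 : LinearMap.range L ≤ Submodule.span 𝕜 ((B.image L : Finset V) : Set V) := by
    rintro _ ⟨g, rfl⟩
    have h2 := h (g - ∑ x ∈ Ω ×ˢ lowExp (PPos m) n, MvPowerSeries.coeff x.2 (g x.1) •
      atWt x.1 (MvPowerSeries.monomial x.2 1)) fun i hi => by
      have h3 := sub_sum_mem_ordIdeal n (g i)
      rw [Pi.sub_apply, Finset.sum_apply, Finset.sum_product, Finset.sum_eq_single i]
      · convert h3 using 3 with d _
        rw [Pi.smul_apply, atWt_same, MvPowerSeries.smul_eq_C_mul, ← MvPowerSeries.monomial_zero_eq_C_apply,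
          MvPowerSeries.monomial_mul_monomial, zero_add, mul_one]
      · intro j _ hj
        refine Finset.sum_eq_zero fun d _ => ?_
        rw [Pi.smul_apply, atWt_ne hj.symm, smul_zero]
      · exact fun h => absurd hi h
    rw [map_sub, sub_eq_zero] at h2
    rw [h2, map_sum]
    refine sum_mem fun x hx => ?_
    rw [map_smul]
    exact Submodule.smul_mem _ _ (Submodule.subset_span
      (Finset.mem_image_of_mem _ (Finset.mem_image_of_mem _ hx)))
  exact Submodule.finiteDimensional_of_le h1

/-- The orbit of x under all functions is finite dimensional by smoothness and is stable under the
X_l, which are functions. -/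
theorem IsHAction.locallyFinite (hψ : IsHAction f ψ ρ T) (x : V) :
    ∃ N : Submodule 𝕜 V, FiniteDimensional 𝕜 N ∧ x ∈ N ∧
      ∀ l : Pos m, ∀ y ∈ N, ψ (hX p m l) y ∈ N := by
  refine ⟨LinearMap.range (orbit ρ x), finiteDimensional_range_orbit (hψ.smooth x), ⟨1, ?_⟩, ?_⟩
  · rw [orbit_apply, map_one, Module.End.one_apply]
  · rintro l _ ⟨h, rfl⟩
    refine ⟨xFun hI f l * h, ?_⟩
    rw [hψ.map_X, orbit_apply, orbit_apply, map_mul, Module.End.mul_apply]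

/-- If c is not in I, then X_l − c has a nonzero constant term at every weight, because i_l⁻¹ =
i_{1−l} lies in I. So X_l − c is an invertible function and kills no nonzero vector. -/
theorem IsHAction.eigenvalue (hψ : IsHAction f ψ ρ T) (hf0 : PowerSeries.coeff 0 f = 1)
    (l : Pos m) (c : 𝕜) (x : V) (hx : x ≠ 0) (hc : ψ (hX p m l) x = c • x) :
    ∃ z ∈ I, (z : 𝕜) = c := by
  by_contra hcon
  have h1 : ∀ i : Wt (theta hI) m,
      (xFun hI f l i - MvPowerSeries.C c) * (xFun hI f l i - MvPowerSeries.C c)⁻¹ = 1 := by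
    intro i
    refine MvPowerSeries.mul_inv_cancel _ fun h0 => hcon ⟨(i.1 l.neg : 𝕜ˣ), (i.1 l.neg).2, ?_⟩
    rw [map_sub, xFun, map_mul, constantCoeff_fSer hf0, mul_one, MvPowerSeries.constantCoeff_C,
      MvPowerSeries.constantCoeff_C, sub_eq_zero] at h0
    rw [Wt.coe_neg, ← h0]
    simp
  have h2 : ρ (xFun hI f l - algebraMap 𝕜 _ c) x = 0 := by
    rw [map_sub, AlgHom.commutes, LinearMap.sub_apply, ← hψ.map_X, hc, Module.algebraMap_end_apply,
      sub_self]
  have h3 : (xFun hI f l - algebraMap 𝕜 _ c) *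
      (fun i => (xFun hI f l i - MvPowerSeries.C c)⁻¹) = 1 := funext h1
  apply hx
  have h4 := congrArg (fun g => ρ g x) ((mul_comm _ _).trans h3)
  simp only [map_mul, Module.End.mul_apply, h2, map_zero, map_one, Module.End.one_apply] at h4
  exact h4.symm

variable {V' : Type*} [AddCommGroup V'] [Module 𝕜 V'] {ψ' : Hecke p m →ₐ[𝕜] Module.End 𝕜 V'}
  {ρ' : Fun 𝕜 (theta hI) m →ₐ[𝕜] Module.End 𝕜 V'} {T' : Ref m → Module.End 𝕜 V'}
  {L : V →ₗ[𝕜] V'}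

theorem IsHAction.map_of (hψ : IsHAction f ψ ρ T) (hψ' : IsHAction f ψ' ρ' T')
    (hρ : ∀ h v, L (ρ h v) = ρ' h (L v)) (hT : ∀ k v, L (T k v) = T' k (L v))
    (r : Hecke p m) (v : V) : L (ψ r v) = ψ' r (L v) := by
  obtain ⟨x, rfl⟩ := RingQuot.mkAlgHom_surjective 𝕜 _ r
  refine intertwineSub_of_gen (ψ.comp (RingQuot.mkAlgHom 𝕜 _)) (ψ'.comp (RingQuot.mkAlgHom 𝕜 _))
    (fun x v => ?_) x v
  cases x with
  | X l =>
    change L (ψ (hX p m l) v) = ψ' (hX p m l) (L v)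
    rw [hψ.map_X, hψ'.map_X, hρ]
  | T k =>
    change L (ψ (TypeD.hT p m k) v) = ψ' (TypeD.hT p m k) (L v)
    rw [hψ.map_hT, hψ'.map_hT, hT]

theorem IsHAction.map_fun (ha : IsAdmissible p f m) (hψ : IsHAction f ψ ρ T)
    (hψ' : IsHAction f ψ' ρ' T') (hL : ∀ r v, L (ψ r v) = ψ' r (L v))
    (h : Fun 𝕜 (theta hI) m) (v : V) : L (ρ h v) = ρ' h (L v) := by
  refine sub_eq_zero.1 ((((hψ.smooth v).comp L).sub (hψ'.smooth (L v))).eq_zero_of_xFun hI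
    ha.coeff_zero ha.coeff_one (intertwineSub ρ ρ' L) (fun l v => ?_)
    (fun a ha => sub_eq_zero.2 (ha v)) h)
  rw [← hψ.map_X, ← hψ'.map_X, hL]

theorem IsHAction.map_T (hψ : IsHAction f ψ ρ T) (hψ' : IsHAction f ψ' ρ' T')
    (hL : ∀ r v, L (ψ r v) = ψ' r (L v)) (k : Ref m) (v : V) : L (T k v) = T' k (L v) := by
  rw [← hψ.map_hT, ← hψ'.map_hT, hL]

end HAction

/-! ### Simultaneous generalized eigenspaces and their projections. -/

section Decomposition

variable {𝕜 V ι : Type*} [Field 𝕜] [AddCommGroup V] [Module 𝕜 V]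

/-- The projections attached to a direct sum decomposition. -/
theorem exists_projections (W : ι → Submodule 𝕜 V) (hi : iSupIndep W) (hs : iSup W = ⊤) :
    ∃ e : ι → Module.End 𝕜 V, (∀ i v, e i v ∈ W i) ∧ (∀ i, ∀ v ∈ W i, e i v = v) ∧
      (∀ i j, i ≠ j → ∀ v ∈ W i, e j v = 0) ∧ (∀ v, {i | e i v ≠ 0}.Finite) ∧
      ∀ v, ∑ᶠ i, e i v = v := by
  classical
  have hint := DirectSum.isInternal_submodule_of_iSupIndep_of_iSup_eq_top hi hs
  let E := LinearEquiv.ofBijective (DirectSum.coeLinearMap W) hint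
  have hE : ∀ i (v : W i), E.symm v = DirectSum.lof 𝕜 ι (fun i => W i) i v := fun i v => by
    rw [LinearEquiv.symm_apply_eq]
    exact (DirectSum.coeLinearMap_lof W i v).symm
  have hfin : ∀ v, {i | ((E.symm v) i : V) ≠ 0}.Finite := fun v =>
    (Finset.finite_toSet (DFinsupp.support (E.symm v))).subset fun i hi => by
      rw [Finset.mem_coe, DFinsupp.mem_support_toFun]
      intro h0
      exact hi (by rw [h0]; rfl)
  refine ⟨fun i => (W i).subtype.comp ((DirectSum.component 𝕜 ι _ i).comp E.symm.toLinearMap),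
    fun i v => Subtype.coe_prop _, fun i v hv => ?_, fun i j hij v hv => ?_, hfin, fun v => ?_⟩
  · change ((E.symm v) i : V) = v
    rw [hE i ⟨v, hv⟩]
    exact congrArg Subtype.val (DirectSum.component.lof_self 𝕜 (M := fun i => W i) i ⟨v, hv⟩)
  · change ((E.symm v) j : V) = 0
    rw [hE i ⟨v, hv⟩, DirectSum.lof_eq_of, DirectSum.of_eq_of_ne _ _ _ hij.symm]
    rfl
  · change ∑ᶠ i, ((E.symm v) i : V) = v
    conv_rhs => rw [← E.apply_symm_apply v]
    change _ = DirectSum.coeLinearMap W (E.symm v)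
    rw [DirectSum.coeLinearMap_eq_dfinsuppSum, DFinsupp.sum]
    refine finsum_eq_sum_of_support_subset _ fun i hi => ?_
    rw [Finset.mem_coe, DFinsupp.mem_support_toFun]
    intro h0
    exact hi (congrArg Subtype.val h0)

/-- Simultaneous generalized eigenspaces of commuting locally finite operators. -/
theorem iSup_iInf_maxGenEigenspace_of_locallyFinite [IsAlgClosed 𝕜] (A : ι → Module.End 𝕜 V)
    (hA : ∀ i j, Commute (A i) (A j))
    (hlf : ∀ x, ∃ N : Submodule 𝕜 V, FiniteDimensional 𝕜 N ∧ x ∈ N ∧ ∀ i, ∀ y ∈ N, A i y ∈ N) :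
    ⨆ χ : ι → 𝕜, ⨅ i, (A i).maxGenEigenspace (χ i) = ⊤ := by
  rw [eq_top_iff]
  intro x _
  obtain ⟨N, hN, hx, hAN⟩ := hlf x
  -- On the finite dimensional stable subspace N the restrictions have a joint decomposition, since
  -- 𝕜 is algebraically closed. It is then mapped back into V.
  have h1 := Module.End.iSup_iInf_maxGenEigenspace_eq_top_of_iSup_maxGenEigenspace_eq_top_of_commute
    (fun i => (A i).restrict (hAN i))
    (fun i j _ => LinearMap.restrict_commute (hA i j) (hAN i) (hAN j))
    (fun i => Module.End.iSup_maxGenEigenspace_eq_top _)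
  have h2 : (⟨x, hx⟩ : N) ∈ (⊤ : Submodule 𝕜 N) := trivial
  rw [← h1] at h2
  have h3 := Submodule.mem_map_of_mem (f := N.subtype) h2
  rw [Submodule.map_iSup] at h3
  refine (show _ ≤ ⨆ χ : ι → 𝕜, ⨅ i, (A i).maxGenEigenspace (χ i) from iSup_mono fun χ => ?_) h3
  rw [← Submodule.inf_iInf_maxGenEigenspace_of_forall_mapsTo A N hAN]
  exact inf_le_right

end Decomposition

/-! ### The weight decomposition of a Hecke module. -/

section HWeights

variable {𝕜 : Type u} [Field 𝕜] {p : 𝕜ˣ} {I : Set 𝕜ˣ} {hI : Invariant p I} {m : ℕ}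
  {V : Type*} [AddCommGroup V] [Module 𝕜 V]

variable (hI) in
theorem Wt.exists_extend (c : PPos m → I) : ∃ w : Wt (theta hI) m, ∀ l : PPos m, w.1 l.1 = c l := by
  have hθ : ∀ i, theta hI (theta hI i) = i := fun i =>
    Subtype.ext (by rw [theta_coe, theta_coe, inv_inv])
  refine ⟨⟨fun l => if h : 1 ≤ l.1 then c ⟨l, h⟩ else theta hI (c ⟨l.neg, Pos.one_le_neg.2 h⟩),
    fun l => ?_⟩, fun l => dif_pos l.2⟩
  by_cases h : 1 ≤ l.1
  · have h' : ¬1 ≤ l.neg.1 := by simp only [Pos.neg]; omega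
    simp only [dif_pos h, dif_neg h', Pos.neg_neg]
  · simp only [dif_neg h, dif_pos (Pos.one_le_neg.2 h), hθ]

/-- The inverse of `i_l` for the weight `𝐢`. -/
noncomputable def Wt.char (w : Wt (theta hI) m) (l : PPos m) : 𝕜 := ((w.1 l.1 : 𝕜ˣ) : 𝕜)⁻¹

theorem Wt.char_injective : Function.Injective (Wt.char : Wt (theta hI) m → PPos m → 𝕜) := by
  intro w w' h
  by_contra hne
  obtain ⟨l, hl⟩ := Wt.exists_ne hI hne
  refine hl (Subtype.ext (Units.ext ?_))
  exact inv_injective (congrFun h l)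

/-- A nonzero joint generalized eigenspace contains, for each l, an eigenvector of A_l, so χ_l lies
in I. Since I is closed under inversion, the values χ_l⁻¹ are the positive entries of a weight, and
only such χ contribute. -/
theorem iSup_char (A : PPos m → Module.End 𝕜 V)
    (htop : ⨆ χ : PPos m → 𝕜, ⨅ l, (A l).maxGenEigenspace (χ l) = ⊤)
    (hev : ∀ l, ∀ (c : 𝕜) (x : V), x ≠ 0 → A l x = c • x → ∃ z ∈ I, (z : 𝕜) = c) :
    ⨆ w : Wt (theta hI) m, ⨅ l, (A l).maxGenEigenspace (w.char l) = ⊤ := by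
  rw [eq_top_iff, ← htop]
  refine iSup_le fun χ => ?_
  by_cases hb : ⨅ l, (A l).maxGenEigenspace (χ l) = ⊥
  · rw [hb]
    exact bot_le
  have h1 : ∀ l, ∃ z : I, ((z : 𝕜ˣ) : 𝕜)⁻¹ = χ l := by
    intro l
    have h2 : (A l).maxGenEigenspace (χ l) ≠ ⊥ := fun h =>
      hb (le_bot_iff.1 ((iInf_le _ l).trans h.le))
    have h3 : (A l).HasUnifEigenvalue (χ l) ⊤ := h2
    have h4 := (Module.End.hasUnifEigenvalue_iff_hasUnifEigenvalue_one ENat.top_pos).1 h3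
    obtain ⟨x, hx⟩ := Module.End.HasEigenvalue.exists_hasEigenvector h4
    obtain ⟨z, hz, hzc⟩ := hev l (χ l) x hx.2 hx.apply_eq_smul
    refine ⟨theta hI ⟨z, hz⟩, ?_⟩
    rw [theta_coe, ← hzc]
    simp
  choose c hc using h1
  obtain ⟨w, hw⟩ := Wt.exists_extend hI c
  have h5 : χ = w.char := funext fun l => by rw [Wt.char, hw, hc]
  rw [h5]
  exact le_iSup (fun w : Wt (theta hI) m => ⨅ l, (A l).maxGenEigenspace (w.char l)) w

/-- The action of functions such that `X_l` acts by `i_l⁻¹ (1 + ϰ_l)`. -/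
theorem exists_linear_action [DecidableEq (Wt (theta hI) m)] (A : PPos m → Module.End 𝕜 V)
    (hA : ∀ l l', Commute (A l) (A l'))
    (htop : ⨆ w : Wt (theta hI) m, ⨅ l, (A l).maxGenEigenspace (w.char l) = ⊤) :
    ∃ ρ : Fun 𝕜 (theta hI) m →ₐ[𝕜] Module.End 𝕜 V, (∀ v, IsSmooth (orbit ρ v)) ∧
      ∀ w l, A l * ρ (Pi.single w 1) =
        ρ (Pi.single w (MvPowerSeries.C (w.char l) * (1 + MvPowerSeries.X l))) := by
  have hmaps : ∀ (l l' : PPos m) (c : 𝕜), Set.MapsTo (A l) ((A l').maxGenEigenspace c)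
      ((A l').maxGenEigenspace c) := fun l l' c =>
    Module.End.mapsTo_maxGenEigenspace_of_comm (hA l' l) c
  have hind := (Module.End.independent_iInf_maxGenEigenspace_of_forall_mapsTo A hmaps).comp
    (Wt.char_injective (hI := hI) (m := m))
  obtain ⟨e, heW, hW, hWne, hfin, hsum⟩ := exists_projections _ hind htop
  simp only [Function.comp_apply] at heW hW hWne
  have hstable : ∀ (w : Wt (theta hI) m) l, ∀ v ∈ ⨅ l, (A l).maxGenEigenspace (w.char l),
      A l v ∈ ⨅ l, (A l).maxGenEigenspace (w.char l) := fun w l v hv => by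
    rw [Submodule.mem_iInf] at hv ⊢
    exact fun l' => hmaps l l' _ (hv l')
  have hee : ∀ w, e w * e w = e w := fun w => LinearMap.ext fun v => hW w _ (heW w v)
  have hne : ∀ w w', w ≠ w' → e w * e w' = 0 := fun w w' h =>
    LinearMap.ext fun v => hWne w' w h.symm _ (heW w' v)
  have heA : ∀ w l, Commute (e w) (A l) := by
    intro w l
    refine LinearMap.ext fun v => ?_
    have hv : v ∈ ⨆ w : Wt (theta hI) m, ⨅ l, (A l).maxGenEigenspace (w.char l) := by
      rw [htop]; trivial
    induction hv using Submodule.iSup_induction' with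
    | mem w' v hv =>
      change e w (A l v) = A l (e w v)
      by_cases hw : w' = w
      · subst hw
        rw [hW w' v hv, hW w' _ (hstable w' l v hv)]
      · rw [hWne w' w hw v hv, hWne w' w hw _ (hstable w' l v hv), map_zero]
    | zero => rw [map_zero, map_zero]
    | add x y _ _ hx hy => rw [map_add, map_add, hx, hy]
  have hw0 : ∀ (w : Wt (theta hI) m) l, w.char l * ((w.1 l.1 : 𝕜ˣ) : 𝕜) = 1 := fun w l =>
    inv_mul_cancel₀ (Units.ne_zero _)
  -- This is i_l A_l − 1, the operator ϰ_l for f = 1 + ϰ. It is locally nilpotent only on the weight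
  -- space of w, hence the later multiplication by the projection e w.
  let B : Wt (theta hI) m → PPos m → Module.End 𝕜 V := fun w l =>
    (((w.1 l.1 : I) : 𝕜ˣ) : 𝕜) • (A l - w.char l • 1)
  have hBc : ∀ w l l', Commute (B w l) (B w l') := fun w l l' =>
    (((hA l l').sub_left ((Commute.one_left _).smul_left _)).sub_right
      ((Commute.one_right _).smul_right _)).smul_left _ |>.smul_right _
  have heB : ∀ w w' l, Commute (e w) (B w' l) := fun w w' l =>
    ((heA w l).sub_right ((Commute.one_right _).smul_right _)).smul_right _
  obtain ⟨ρ, hs, hρ1, hρX⟩ := exists_action e (fun w l => B w l * e w) hee hne hfin hsum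
    (fun w l l' => ((hBc w l l').mul_left (heB w w l')).mul_right
      ((heB w w l).symm.mul_left (Commute.refl _)))
    (fun w l => (heB w w l).mul_right (Commute.refl _))
    (fun w l v => by
      have h1 := heW w v
      rw [Submodule.mem_iInf] at h1
      obtain ⟨n, hn⟩ := (Module.End.mem_maxGenEigenspace _ _ _).1 (h1 l)
      -- The exponent must be positive so that the corresponding power of the idempotent is the
      -- idempotent itself.
      refine ⟨n + 1, ?_⟩
      have h2 : e w ^ (n + 1) = e w := (show IsIdempotentElem (e w) from hee w).pow_succ_eq n
      rw [(heB w w l).symm.mul_pow, h2, Module.End.mul_apply, smul_pow, LinearMap.smul_apply,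
        pow_succ' (A l - _), Module.End.mul_apply, hn, map_zero, smul_zero])
  refine ⟨ρ, hs, fun w l => ?_⟩
  have h1 : (Pi.single w (MvPowerSeries.C (w.char l) * (1 + MvPowerSeries.X l)) :
      Fun 𝕜 (theta hI) m) = w.char l • (Pi.single w 1 + Pi.single w (MvPowerSeries.X l)) := by
    rw [← Pi.single_add, ← Pi.single_smul, MvPowerSeries.smul_eq_C_mul]
  have h2 : w.char l • B w l = A l - w.char l • 1 := by
    simp only [B]
    rw [smul_smul, hw0, one_smul]
  rw [h1, map_smul, map_add, hρX, hρ1, mul_assoc, hee, smul_add, ← smul_mul_assoc, h2, sub_mul,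
    smul_mul_assoc, one_mul]
  abel

end HWeights

/-! ### Change of variables from 1 + ϰ to f(ϰ). -/

section Twist

variable {𝕜 : Type u} [Field 𝕜] {p : 𝕜ˣ} {I : Set 𝕜ˣ} {hI : Invariant p I} {m : ℕ}
  {f : PowerSeries 𝕜} {V : Type*} [AddCommGroup V] [Module 𝕜 V]

/-- A change of variables turns the action such that `X_l` acts by `i_l⁻¹ (1 + ϰ_l)` into one such
that it acts by `i_l⁻¹ f(ϰ_l)`. -/
theorem exists_xFun_action (hf0 : PowerSeries.coeff 0 f = 1) (hf1 : PowerSeries.coeff 1 f = 1)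
    (A : PPos m → Module.End 𝕜 V) (hA : ∀ l l', Commute (A l) (A l'))
    (htop : ⨆ w : Wt (theta hI) m, ⨅ l, (A l).maxGenEigenspace (w.char l) = ⊤) :
    ∃ ρ : Fun 𝕜 (theta hI) m →ₐ[𝕜] Module.End 𝕜 V, (∀ v, IsSmooth (orbit ρ v)) ∧
      ∀ l : PPos m, A l = ρ (xFun hI f l.1) := by
  classical
  obtain ⟨ρ, hs, hρ⟩ := exists_linear_action A hA htop
  obtain ⟨g, hg0, -, hg⟩ := exists_subst_inv hf0 hf1
  have hX0 : ∀ l : PPos m, MvPowerSeries.constantCoeff (MvPowerSeries.X l : Ser 𝕜 m) = 0 :=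
    fun l => MvPowerSeries.constantCoeff_X l
  have hX : ∀ l : PPos m, PowerSeries.HasSubst (MvPowerSeries.X l : Ser 𝕜 m) := fun l =>
    PowerSeries.HasSubst.of_constantCoeff_zero (hX0 l)
  have ha0 : ∀ l : PPos m,
      MvPowerSeries.constantCoeff (g.subst (MvPowerSeries.X l : Ser 𝕜 m)) = 0 := fun l =>
    PowerSeries.constantCoeff_subst_eq_zero (hX0 l) _ hg0
  have hsub : MvPowerSeries.HasSubst fun l : PPos m => g.subst (MvPowerSeries.X l : Ser 𝕜 m) :=
    MvPowerSeries.hasSubst_of_constantCoeff_zero ha0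
  -- Substituting g(ϰ_l) for ϰ_l, with g inverse to f − 1, turns f(ϰ_l) into 1 + ϰ_l. Composing ρ
  -- with it makes X_l act as required.
  let τ : Ser 𝕜 m →ₐ[𝕜] Ser 𝕜 m := MvPowerSeries.substAlgHom hsub
  have hτf : ∀ l : PPos m, τ (f.subst (MvPowerSeries.X l : Ser 𝕜 m)) = 1 + MvPowerSeries.X l := by
    intro l
    have h1 : τ (f.subst (MvPowerSeries.X l : Ser 𝕜 m)) =
        f.subst (g.subst (MvPowerSeries.X l : Ser 𝕜 m)) := by
      simp only [τ, MvPowerSeries.substAlgHom_apply]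
      refine (MvPowerSeries.subst_comp_subst_apply (hX l).const hsub f).trans ?_
      change MvPowerSeries.subst _ f = MvPowerSeries.subst _ f
      congr 1
      funext _
      exact MvPowerSeries.subst_X hsub l
    rw [h1, ← PowerSeries.subst_comp_subst_apply (PowerSeries.HasSubst.of_constantCoeff_zero' hg0)
      (hX l), hg, PowerSeries.subst_add (hX l), PowerSeries.subst_X (hX l)]
    congr 1
    rw [← PowerSeries.coe_substAlgHom (hX l), map_one]
  let σ : Fun 𝕜 (theta hI) m →ₐ[𝕜] Fun 𝕜 (theta hI) m :=
    AlgHom.pi fun i => τ.comp (Pi.evalAlgHom 𝕜 (fun _ => Ser 𝕜 m) i)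
  have hσ : ∀ w (h : Ser 𝕜 m), σ (atWt w h) = atWt w (τ h) := by
    intro w h
    funext i
    change τ (atWt w h i) = _
    by_cases hi : i = w
    · subst hi
      rw [atWt_same, atWt_same]
    · rw [atWt_ne hi, atWt_ne hi, map_zero]
  have hsm : ∀ v, IsSmooth (orbit (ρ.comp σ) v) := by
    intro v
    obtain ⟨Ω, n, h⟩ := hs v
    refine ⟨Ω, n, fun h' hh' => h _ fun i hi => ?_⟩
    change τ (h' i) ∈ _
    simp only [τ, MvPowerSeries.substAlgHom_apply]
    exact subst_mem_ordIdeal ha0 (hh' i hi)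
  refine ⟨ρ.comp σ, hsm, fun l => ext_of_atWt hsm fun w v => ?_⟩
  change (A l * ρ (σ (atWt w 1))) v = (ρ (σ _) * ρ (σ (atWt w 1))) v
  congr 1
  rw [← map_mul, ← map_mul, mul_atWt, mul_one, hσ, hσ, map_one, atWt_eq, atWt_eq, hρ]
  have h1 : τ (xFun hI f l.1 w) = MvPowerSeries.C (w.char l) * (1 + MvPowerSeries.X l) := by
    rw [xFun, fSer, if_pos l.2, kap_coe, map_mul, hτf]
    congr 1
    exact τ.commutes _
  rw [h1]

end Twist

/-! ### From Hecke modules to functions and operators T_k. -/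

section HExists

variable {𝕜 : Type u} [Field 𝕜] {p : 𝕜ˣ} {I : Set 𝕜ˣ} {hI : Invariant p I} {m : ℕ}
  {f : PowerSeries 𝕜} {V : Type*} [AddCommGroup V] [Module 𝕜 V]

theorem Hecke.rel {x y : FreeAlgebra 𝕜 (HGen m)} (h : HRel p m x y) :
    RingQuot.mkAlgHom 𝕜 (HRel p m) x = RingQuot.mkAlgHom 𝕜 (HRel p m) y :=
  RingQuot.mkAlgHom_rel 𝕜 h

theorem hX_mul_hX_neg (l : Pos m) : hX p m l * hX p m l.neg = 1 := by
  have := Hecke.rel (HRel.X_inv (p := p) l)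
  rwa [map_mul, map_one] at this

theorem hX_comm (l l' : Pos m) : hX p m l * hX p m l' = hX p m l' * hX p m l := by
  have := Hecke.rel (HRel.X_comm (p := p) l l')
  rwa [map_mul, map_mul] at this

theorem hT_quad (k : Ref m) :
    hT p m k * hT p m k = algebraMap 𝕜 _ ((p : 𝕜) - (p : 𝕜)⁻¹) * hT p m k + 1 := by
  have h := Hecke.rel (HRel.quad (p := p) k)
  have hp : algebraMap 𝕜 (Hecke p m) (p : 𝕜) * algebraMap 𝕜 _ (p : 𝕜)⁻¹ = 1 := by
    rw [← map_mul, mul_inv_cancel₀ p.ne_zero, map_one]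
  simp only [map_mul, map_sub, map_add, AlgHom.commutes, map_zero] at h
  change (hT p m k - _) * (hT p m k + _) = 0 at h
  have h2 : hT p m k * algebraMap 𝕜 _ (p : 𝕜)⁻¹ = algebraMap 𝕜 _ (p : 𝕜)⁻¹ * hT p m k :=
    (Algebra.commutes _ _).symm
  rw [sub_mul, mul_add, mul_add, hp, h2] at h
  rw [map_sub, sub_mul, ← sub_eq_zero, ← h]
  abel

/-- The quadratic relation says that T_k is invertible with inverse T_k − (p − p⁻¹). So T_k X_k T_k
= X_{s_k(k)} can be solved for T_k X_k. -/
theorem hT_mul_hX_lo (k : Ref m) :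
    hT p m k * hX p m k.lo =
      hX p m k.hi * (hT p m k - algebraMap 𝕜 _ ((p : 𝕜) - (p : 𝕜)⁻¹)) := by
  have h : hT p m k * hX p m k.lo * hT p m k = hX p m k.hi := by
    have := Hecke.rel (HRel.TXT (p := p) k)
    rwa [map_mul, map_mul] at this
  have h1 : hT p m k * (hT p m k - algebraMap 𝕜 _ ((p : 𝕜) - (p : 𝕜)⁻¹)) = 1 := by
    rw [mul_sub, hT_quad, ← Algebra.commutes, add_sub_cancel_left]
  rw [← h, mul_assoc, h1, mul_one]

theorem hT_mul_hX_hi (k : Ref m) :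
    hT p m k * hX p m k.hi =
      hX p m k.lo * hT p m k + algebraMap 𝕜 _ ((p : 𝕜) - (p : 𝕜)⁻¹) * hX p m k.hi := by
  have h : hT p m k * hX p m k.lo * hT p m k = hX p m k.hi := by
    have := Hecke.rel (HRel.TXT (p := p) k)
    rwa [map_mul, map_mul] at this
  conv_lhs => rw [← h]
  rw [mul_assoc, ← mul_assoc, hT_quad, add_mul, one_mul, mul_assoc, ← mul_assoc (hT p m k), h,
    add_comm]

theorem hT_mul_hX_else (k : Ref m) (l : Pos m)
    (hl : l ≠ k.lo ∧ l ≠ k.hi ∧ l ≠ k.lo.neg ∧ l ≠ k.hi.neg) :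
    hT p m k * hX p m l = hX p m l * hT p m k := by
  have := Hecke.rel (HRel.TX (p := p) k l hl)
  rwa [map_mul, map_mul] at this

/-- Modules of the affine Hecke algebra on which the `X_l` act locally finitely with eigenvalues in
`I` have an action of functions. -/
theorem exists_isHAction [IsAlgClosed 𝕜] (ha : IsAdmissible p f m)
    (ψ : Hecke p m →ₐ[𝕜] Module.End 𝕜 V)
    (hlf : ∀ x : V, ∃ N : Submodule 𝕜 V, FiniteDimensional 𝕜 N ∧ x ∈ N ∧
      ∀ l : Pos m, 1 ≤ l.1 → ∀ y ∈ N, ψ (hX p m l) y ∈ N)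
    (hev : ∀ l : Pos m, 1 ≤ l.1 → ∀ (c : 𝕜) (x : V), x ≠ 0 → ψ (hX p m l) x = c • x →
      ∃ z ∈ I, (z : 𝕜) = c) :
    ∃ (ρ : Fun 𝕜 (theta hI) m →ₐ[𝕜] Module.End 𝕜 V) (T : Ref m → Module.End 𝕜 V),
      IsHAction f ψ ρ T := by
  have hc : ∀ l l' : PPos m, Commute (ψ (hX p m l.1)) (ψ (hX p m l'.1)) := fun l l' => by
    rw [commute_iff_eq, ← map_mul, ← map_mul, hX_comm]
  obtain ⟨ρ, hs, hρ⟩ := exists_xFun_action (hI := hI) ha.coeff_zero ha.coeff_one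
    (fun l : PPos m => ψ (hX p m l.1)) hc
    (iSup_char _ (iSup_iInf_maxGenEigenspace_of_locallyFinite _ hc fun x => by
      obtain ⟨N, h1, h2, h3⟩ := hlf x
      exact ⟨N, h1, h2, fun l => h3 l.1 l.2⟩) fun l => hev l.1 l.2)
  have hX' : ∀ l, ψ (hX p m l) = ρ (xFun hI f l) := by
    intro l
    by_cases hl : 1 ≤ l.1
    · exact hρ ⟨l, hl⟩
    · have h1 : ψ (hX p m l.neg) = ρ (xFun hI f l.neg) := hρ ⟨l.neg, Pos.one_le_neg.2 hl⟩
      have h2 : ψ (hX p m l) * ψ (hX p m l.neg) = 1 := by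
        rw [← map_mul, hX_mul_hX_neg, map_one]
      have h3 : ψ (hX p m l.neg) * ρ (xFun hI f l) = 1 := by
        rw [h1, ← map_mul, mul_comm, xFun_mul_xFun_neg hI ha.coeff_zero, map_one]
      exact left_inv_eq_right_inv h2 h3
  have hq : ∀ x, ρ (qFun hI * x) = algebraMap 𝕜 _ ((p : 𝕜) - (p : 𝕜)⁻¹) * ρ x := fun x => by
    rw [map_mul, qFun, AlgHom.commutes]
  refine ⟨ρ, fun k => ψ (hT p m k), hs, hX', fun k => rfl, fun k h => ?_, fun k => ?_,
    fun k k' h => ?_, fun k k' h => ?_⟩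
  · refine leibniz_of_smooth (d := heckeLin hI f k) k (toRat_heckeLin hI f k) ρ hs (ψ (hT p m k))
      (fun v => (hs v).comp_heckeLin hI k) (fun L hL hLA => hL.eq_zero_of_xFun hI ha.coeff_zero
        ha.coeff_one _ (fun l => ?_) hLA) h
    -- For k = 0 the position `k.lo` is 0, so this speaks of X_0 = X_1⁻¹; the generator X_1 is
    -- reached below through `leibnizSub_inv`.
    have hlo : xFun hI f k.lo ∈ leibnizSub ρ k (toRat_heckeLin hI f k) (ψ (hT p m k)) := by
      rw [mem_leibnizSub, ← hX', ← map_mul, hT_mul_hX_lo, heckeLin_xFun_lo hI ha,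
        reflFun_xFun hI ha.coeff_zero (ha.flip k.2.1), refl_lo, map_neg, hq, ← hX', mul_sub,
        map_sub, map_mul, map_mul, AlgHom.commutes, Algebra.commutes, sub_eq_add_neg]
    have hhi : xFun hI f k.hi ∈ leibnizSub ρ k (toRat_heckeLin hI f k) (ψ (hT p m k)) := by
      rw [mem_leibnizSub, ← hX', ← map_mul, hT_mul_hX_hi, heckeLin_xFun_hi hI ha,
        reflFun_xFun hI ha.coeff_zero (ha.flip k.2.1), refl_hi, hq, ← hX', ← hX',
        map_add, map_mul, map_mul, AlgHom.commutes]
    by_cases h1 : l.1 = k.lo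
    · rw [h1]; exact hlo
    by_cases h2 : l.1 = k.hi
    · rw [h2]; exact hhi
    by_cases h3 : l.1 = k.lo.neg
    · rw [h3]; exact leibnizSub_inv ρ k _ _ hlo (xFun_mul_xFun_neg hI ha.coeff_zero _)
    by_cases h4 : l.1 = k.hi.neg
    · rw [h4]; exact leibnizSub_inv ρ k _ _ hhi (xFun_mul_xFun_neg hI ha.coeff_zero _)
    have hl : l.1 ≠ k.lo ∧ l.1 ≠ k.hi ∧ l.1 ≠ k.lo.neg ∧ l.1 ≠ k.hi.neg := ⟨h1, h2, h3, h4⟩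
    have h5 : reflFun k (xFun hI f l.1) = xFun hI f l.1 := by
      rw [reflFun_xFun hI ha.coeff_zero (ha.flip k.2.1), refl_else k hl]
    rw [mem_leibnizSub, h5, heckeLin_eq_zero hI k h5, map_zero, add_zero, ← hX', ← map_mul,
      hT_mul_hX_else k _ hl, map_mul]
  · change ψ _ * ψ _ = ρ (qFun hI) * ψ _ + 1
    rw [qFun, AlgHom.commutes, ← map_mul, hT_quad, map_add, map_mul, AlgHom.commutes, map_one]
  · have h1 : hT p m k * hT p m k' = hT p m k' * hT p m k := by
      have := Hecke.rel (HRel.T_comm (p := p) k k' (h.imp id fun h => ⟨h.1, h.2.2⟩))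
      rwa [map_mul, map_mul] at this
    change ψ _ * ψ _ = ψ _ * ψ _
    rw [← map_mul, h1, map_mul]
  · have h1 := Hecke.rel (HRel.braid (p := p) k k' h)
    simp only [map_mul] at h1
    change ψ (hT p m k) * ψ (hT p m k') * ψ (hT p m k) = ψ (hT p m k') * ψ (hT p m k) * ψ (hT p m k')
    rw [← map_mul, ← map_mul, ← map_mul, ← map_mul]
    exact congrArg ψ h1

end HExists

/-! ### The formulas for X_l and T_k as finite sums. -/

section Evaluation

variable {𝕜 : Type u} [Field 𝕜] {p : 𝕜ˣ} {I : Set 𝕜ˣ} {hI : Invariant p I} {m : ℕ}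
  {V : Type*} [AddCommGroup V] [Module 𝕜 V]

/-- Smoothness at x kills all but finitely many terms, and the remaining ones are a truncation that
acts on x like the whole series. It connects the sums in `ev1` and `ev2` with ρ. -/
theorem finsum_coeff {Γ : Type*} {θ : Γ → Γ} {ρ : Fun 𝕜 θ m →ₐ[𝕜] Module.End 𝕜 V} {x : V}
    (hx : IsSmooth (orbit ρ x)) (w : Wt θ m) {ι : Type*} [Finite ι] (a : ι → Pos m)
    (g : MvPowerSeries ι 𝕜) :
    ∑ᶠ d : ι →₀ ℕ, MvPowerSeries.coeff d g • ρ (atWt w (d.prod fun t n => kap 𝕜 (a t) ^ n)) x =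
      ρ (atWt w (g.subst fun t => kap 𝕜 (a t))) x := by
  classical
  obtain ⟨Ω, n, h⟩ := hx
  have hs : MvPowerSeries.HasSubst fun t => kap 𝕜 (a t) :=
    MvPowerSeries.hasSubst_of_constantCoeff_zero fun _ => constantCoeff_kap _
  let L : MvPowerSeries ι 𝕜 →ₗ[𝕜] V :=
    (orbit ρ x).comp ((atWtLin 𝕜 w).comp (MvPowerSeries.substAlgHom hs).toLinearMap)
  have hL : ∀ g, L g = ρ (atWt w (g.subst fun t => kap 𝕜 (a t))) x := fun g => by
    change ρ (atWt w (MvPowerSeries.substAlgHom hs g)) x = _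
    rw [MvPowerSeries.substAlgHom_apply]
  have hL0 : ∀ g ∈ ordIdeal 𝕜 ι n, L g = 0 := fun g hg => by
    rw [hL]
    refine h _ fun i _ => ?_
    by_cases hi : i = w
    · subst hi
      rw [atWt_same]
      exact subst_mem_ordIdeal (fun _ => constantCoeff_kap _) hg
    · rw [atWt_ne hi]
      exact zero_mem _
  have hLm : ∀ (d : ι →₀ ℕ) c, L (MvPowerSeries.monomial d c) =
      c • ρ (atWt w (d.prod fun t n => kap 𝕜 (a t) ^ n)) x := fun d c => by
    rw [hL, MvPowerSeries.subst_monomial hs, ← Algebra.smul_def]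
    change orbit ρ x (atWtLin 𝕜 w _) = _
    rw [map_smul, map_smul]
    rfl
  rw [← hL]
  have h1 := hL0 _ (sub_sum_mem_ordIdeal n g)
  rw [map_sub, sub_eq_zero, map_sum] at h1
  rw [h1]
  simp only [← hLm]
  refine finsum_eq_sum_of_support_subset _ fun d hd => ?_
  rw [Finset.mem_coe, mem_lowExp]
  by_contra hdn
  exact hd (hL0 _ (monomial_mem_ordIdeal (not_lt.1 hdn) _))

variable {φ : RUnit 𝕜 (theta hI) (arrows p I) m →ₐ[𝕜] Module.End 𝕜 V}
  {ρ : Fun 𝕜 (theta hI) m →ₐ[𝕜] Module.End 𝕜 V} {S : Ref m → Module.End 𝕜 V}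

theorem IsRAction.rκ_mul (hφ : IsRAction φ ρ S) (ν : DimVec (theta hI) m)
    (i : Seq (theta hI) m ν.1) (l : Pos m) (g : Ser 𝕜 m) :
    φ (rκ 𝕜 (theta hI) (arrows p I) m ν l) * ρ (atWt i.wt g) =
      ρ (atWt i.wt (TypeD.kap 𝕜 l * g)) := by
  have h1 : φ (rκ 𝕜 (theta hI) (arrows p I) m ν l) * ρ (atWt i.wt 1) =
      ρ (atWt i.wt (TypeD.kap 𝕜 l)) := by
    rw [← hφ.kap, map_mul, hφ.idem]
    rfl
  rw [← atWt_mul_atWt, map_mul, ← h1, mul_assoc, ← map_mul, atWt_mul_atWt, one_mul]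

theorem IsRAction.rκ_pow_mul (hφ : IsRAction φ ρ S) (ν : DimVec (theta hI) m)
    (i : Seq (theta hI) m ν.1) (l : Pos m) (g : Ser 𝕜 m) (n : ℕ) :
    φ (rκ 𝕜 (theta hI) (arrows p I) m ν l) ^ n * ρ (atWt i.wt g) =
      ρ (atWt i.wt (TypeD.kap 𝕜 l ^ n * g)) := by
  induction n with
  | zero => rw [pow_zero, pow_zero, one_mul, one_mul]
  | succ n ih => rw [pow_succ', mul_assoc, ih, hφ.rκ_mul, ← mul_assoc, ← pow_succ']

theorem IsRAction.finsum_pow (hφ : IsRAction φ ρ S) (ν : DimVec (theta hI) m)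
    (i : Seq (theta hI) m ν.1) (l : Pos m) (g : PowerSeries 𝕜) {x : V}
    (hx : ρ (atWt i.wt 1) x = x) :
    ∑ᶠ n, φ (PowerSeries.coeff n g • rκ 𝕜 (theta hI) (arrows p I) m ν l ^ n) x =
      ρ (atWt i.wt (g.subst (TypeD.kap 𝕜 l))) x := by
  have h1 := finsum_coeff (hφ.smooth x) i.wt (fun _ : Unit => l) g
  refine Eq.trans ?_ h1
  rw [← finsum_comp_equiv (Finsupp.uniqueLinearEquiv ℕ ℕ ()).toEquiv]
  refine finsum_congr fun d => ?_
  have h2 : (Finsupp.uniqueLinearEquiv ℕ ℕ ()).toEquiv d = d () := rfl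
  have h3 : (d.prod fun t n => TypeD.kap 𝕜 l ^ n) = TypeD.kap 𝕜 l ^ d () := by
    rw [Finsupp.prod_fintype _ _ fun _ => pow_zero _]
    simp
  have h4 : PowerSeries.coeff (d ()) g = MvPowerSeries.coeff d g := by
    rw [PowerSeries.coeff]
    congr
    ext
    simp
  rw [h2, h3, h4, map_smul, LinearMap.smul_apply, map_pow]
  congr 1
  conv_lhs => rw [← hx]
  rw [← Module.End.mul_apply, hφ.rκ_pow_mul, mul_one]

theorem IsRAction.finsum_pow_mul_pow (hφ : IsRAction φ ρ S) (ν : DimVec (theta hI) m)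
    (i : Seq (theta hI) m ν.1) (a b : Pos m) (g : MvPowerSeries (Fin 2) 𝕜) {x : V}
    (hx : ρ (atWt i.wt 1) x = x) :
    ∑ᶠ d : Fin 2 →₀ ℕ, φ (MvPowerSeries.coeff d g •
      (rκ 𝕜 (theta hI) (arrows p I) m ν a ^ d 0 * rκ 𝕜 (theta hI) (arrows p I) m ν b ^ d 1)) x =
      ρ (atWt i.wt (pairSubst a b g)) x := by
  have h1 := finsum_coeff (hφ.smooth x) i.wt ![a, b] g
  have h0 : pairSubst a b g = g.subst fun t => TypeD.kap 𝕜 (![a, b] t) := by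
    rw [pairSubst, MvPowerSeries.substAlgHom_apply]
  rw [h0]
  refine Eq.trans ?_ h1
  refine finsum_congr fun d => ?_
  have h3 : (d.prod fun t n => TypeD.kap 𝕜 (![a, b] t) ^ n) =
      TypeD.kap 𝕜 a ^ d 0 * TypeD.kap 𝕜 b ^ d 1 := by
    rw [Finsupp.prod_fintype _ _ fun _ => pow_zero _, Fin.prod_univ_two]
    rfl
  rw [h3, map_smul, LinearMap.smul_apply, map_mul, map_pow, map_pow]
  congr 1
  conv_lhs => rw [← hx]
  rw [← Module.End.mul_apply, mul_assoc, hφ.rκ_pow_mul, mul_one, hφ.rκ_pow_mul]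

theorem IsRAction.rσ_apply (hφ : IsRAction φ ρ S) (ν : DimVec (theta hI) m)
    (i : Seq (theta hI) m ν.1) (k : Ref m) {x : V} (hx : ρ (atWt i.wt 1) x = x) :
    φ (rσ 𝕜 (theta hI) (arrows p I) m ν k) x = S k x := by
  conv_rhs => rw [← hx]
  rw [← Module.End.mul_apply, ← hφ.sig, map_mul, hφ.idem, Module.End.mul_apply, hx]
  rfl

variable {f : PowerSeries 𝕜} {ψ : Hecke p m →ₐ[𝕜] Module.End 𝕜 V}

/-- The formula for the action of `X_l`. -/
theorem IsRAction.hX_apply {T : Ref m → Module.End 𝕜 V} (hφ : IsRAction φ ρ S)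
    (hψ : IsHAction f ψ ρ T) (ν : DimVec (theta hI) m) (i : Seq (theta hI) m ν.1) (l : Pos m)
    (hl : 1 ≤ l.1) {x : V} (hx : ρ (atWt i.wt 1) x = x) :
    ψ (hX p m l) x = ((i.1 l : 𝕜ˣ) : 𝕜)⁻¹ •
      ∑ᶠ n, φ (PowerSeries.coeff n f • rκ 𝕜 (theta hI) (arrows p I) m ν l ^ n) x := by
  rw [hφ.finsum_pow ν i l f hx, hψ.map_X]
  conv_lhs => rw [← hx]
  rw [← Module.End.mul_apply, ← map_mul, mul_atWt, mul_one, xFun, fSer, if_pos hl,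
    ← MvPowerSeries.smul_eq_C_mul]
  change orbit ρ x (atWtLin 𝕜 i.wt _) = _
  rw [map_smul, map_smul]
  rfl

/-- The formula for the action of `T_k`. -/
theorem IsRAction.hT_apply (hφ : IsRAction φ ρ S)
    (hψ : IsHAction f ψ ρ fun k => ρ (aFun hI f k.lo k.hi) * S k + ρ (bFun hI f k.lo k.hi))
    (ν : DimVec (theta hI) m) (i : Seq (theta hI) m ν.1) (k : Ref m) {x : V}
    (hx : ρ (atWt i.wt 1) x = x) :
    ψ (hT p m k) x =
      ∑ᶠ d : Fin 2 →₀ ℕ, φ (MvPowerSeries.coeff d (coefSigma p f (i.1 k.lo) (i.1 k.hi)) •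
        (rκ 𝕜 (theta hI) (arrows p I) m ν k.lo ^ d 0 *
          rκ 𝕜 (theta hI) (arrows p I) m ν k.hi ^ d 1))
        (φ (rσ 𝕜 (theta hI) (arrows p I) m ν k) x) +
      ∑ᶠ d : Fin 2 →₀ ℕ, φ (MvPowerSeries.coeff d (coefOne p f (i.1 k.lo) (i.1 k.hi)) •
        (rκ 𝕜 (theta hI) (arrows p I) m ν k.lo ^ d 0 *
          rκ 𝕜 (theta hI) (arrows p I) m ν k.hi ^ d 1)) x := by
  -- The coefficient A acts on σ_k x, which has weight s_k 𝐢. There the entries at k and s_k(k) are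
  -- exchanged, and this undoes the exchange in the definition of `aFun`.
  have hS : ρ (atWt (i.wt.act k) 1) (S k x) = S k x := by
    rw [← Module.End.mul_apply, ← hφ.sig_atWt, Module.End.mul_apply, hx]
  have hy : ρ (atWt (i.act k).wt 1) (S k x) = S k x := by rw [Seq.wt_act, hS]
  rw [hφ.rσ_apply ν i k hx, hφ.finsum_pow_mul_pow ν (i.act k) _ _ _ hy,
    hφ.finsum_pow_mul_pow ν i _ _ _ hx, hψ.map_hT, LinearMap.add_apply, Module.End.mul_apply]
  congr 1
  · conv_lhs => rw [← hS]
    rw [← Module.End.mul_apply, ← map_mul, mul_atWt, mul_one, Seq.wt_act, aFun]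
    simp only [Wt.act_lo, Wt.act_hi]
    rfl
  · conv_lhs => rw [← hx]
    rw [← Module.End.mul_apply, ← map_mul, mul_atWt, mul_one]
    rfl

end Evaluation

/-! ### Passing between the two actions on one vector space. -/

section Transfer

variable {𝕜 : Type u} [Field 𝕜] {p : 𝕜ˣ} {I : Set 𝕜ˣ} {hI : Invariant p I} {m : ℕ}
  {f : PowerSeries 𝕜} {V : Type*} [AddCommGroup V] [Module 𝕜 V]

variable (f) in
/-- Actions of `°R_m` and of the affine Hecke algebra on the same space that correspond to each
other. -/
def IsTransfer (φ : RUnit 𝕜 (theta hI) (arrows p I) m →ₐ[𝕜] Module.End 𝕜 V)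
    (ψ : Hecke p m →ₐ[𝕜] Module.End 𝕜 V) : Prop :=
  ∃ ρ S, IsRAction φ ρ S ∧
    IsHAction f ψ ρ fun k => ρ (aFun hI f k.lo k.hi) * S k + ρ (bFun hI f k.lo k.hi)

theorem exists_isTransfer (ha : IsAdmissible p f m)
    (φ : RUnit 𝕜 (theta hI) (arrows p I) m →ₐ[𝕜] Module.End 𝕜 V)
    (h1 : ∀ x : V, x ∈ AddSubgroup.closure {y : V | ∃ (ν : DimVec (theta hI) m)
      (i : Seq (theta hI) m ν.1), act φ ν (e1 𝕜 i) y = y})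
    (h2 : ∀ (ν : DimVec (theta hI) m) (l : Pos m), 1 ≤ l.1 → ∀ x : V, ∃ n : ℕ,
      (act φ ν (eκ 𝕜 _ m ν.1 l) ^ n) x = 0) : ∃ ψ, IsTransfer f φ ψ := by
  obtain ⟨ρ, S, hφ⟩ := exists_isRAction φ h1 h2
  obtain ⟨ψ, hψ⟩ := exists_of_isHeckeFamily ha hφ.smooth (hφ.family.hecke ha)
  exact ⟨ψ, ρ, S, hφ, hψ⟩

/-- The σ_k are obtained as A⁻¹(T_k − B), so that A σ_k + B returns the given T_k. -/
theorem exists_isTransfer_symm [IsAlgClosed 𝕜] (ha : IsAdmissible p f m)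
    (ψ : Hecke p m →ₐ[𝕜] Module.End 𝕜 V)
    (hlf : ∀ x : V, ∃ N : Submodule 𝕜 V, FiniteDimensional 𝕜 N ∧ x ∈ N ∧
      ∀ l : Pos m, 1 ≤ l.1 → ∀ y ∈ N, ψ (hX p m l) y ∈ N)
    (hev : ∀ l : Pos m, 1 ≤ l.1 → ∀ (c : 𝕜) (x : V), x ≠ 0 → ψ (hX p m l) x = c • x →
      ∃ z ∈ I, (z : 𝕜) = c) :
    ∃ φ : RUnit 𝕜 (theta hI) (arrows p I) m →ₐ[𝕜] Module.End 𝕜 V, IsTransfer f φ ψ := by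
  obtain ⟨ρ, T, hψ⟩ := exists_isHAction (hI := hI) ha ψ hlf hev
  obtain ⟨φ, hφ⟩ := exists_of_isSigmaFamily hψ.smooth (hψ.family.sigma ha)
  refine ⟨φ, ρ, _, hφ, ?_⟩
  convert hψ using 1
  funext k
  have h1 := aFun_mul_aInv hI ha.coeff_zero ha.coeff_one ha.ne_one ha.ne_neg_one k.lo k.hi
  simp only [RingHom.coe_coe]
  rw [mul_add, ← mul_assoc, ← map_mul, ← map_mul, mul_neg, ← mul_assoc, h1, map_one, one_mul,
    one_mul, map_neg, neg_add_cancel_right]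

variable {V' : Type*} [AddCommGroup V'] [Module 𝕜 V']
  {φ : RUnit 𝕜 (theta hI) (arrows p I) m →ₐ[𝕜] Module.End 𝕜 V} {ψ : Hecke p m →ₐ[𝕜] Module.End 𝕜 V}
  {φ' : RUnit 𝕜 (theta hI) (arrows p I) m →ₐ[𝕜] Module.End 𝕜 V'}
  {ψ' : Hecke p m →ₐ[𝕜] Module.End 𝕜 V'} {L : V →ₗ[𝕜] V'}

/-- A map of °R_m-modules commutes with the functions and the σ_k, hence with A, B and T_k = A σ_k +
B. Applied to an identity map, this shows that the Hecke action is determined by the action of °R_m.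
-/
theorem IsTransfer.map (h : IsTransfer f φ ψ) (h' : IsTransfer f φ' ψ')
    (hL : ∀ r v, L (φ r v) = φ' r (L v)) (r : Hecke p m) (v : V) : L (ψ r v) = ψ' r (L v) := by
  obtain ⟨ρ, S, hφ, hψ⟩ := h
  obtain ⟨ρ', S', hφ', hψ'⟩ := h'
  have hρ := hφ.map_fun hφ' hL
  have hS := hφ.map_sig hφ' hL
  refine hψ.map_of hψ' hρ (fun k v => ?_) r v
  simp only [LinearMap.add_apply, Module.End.mul_apply, map_add, hρ, hS]

theorem sigma_apply (ha : IsAdmissible p f m) (ρ : Fun 𝕜 (theta hI) m →ₐ[𝕜] Module.End 𝕜 V)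
    (S : Module.End 𝕜 V) (k : Ref m) (v : V) :
    S v = ρ (aInv hI f k.lo k.hi)
        ((ρ (aFun hI f k.lo k.hi) * S + ρ (bFun hI f k.lo k.hi)) v) -
      ρ (aInv hI f k.lo k.hi) (ρ (bFun hI f k.lo k.hi) v) := by
  have h1 := aFun_mul_aInv hI ha.coeff_zero ha.coeff_one ha.ne_one ha.ne_neg_one k.lo k.hi
  rw [LinearMap.add_apply, map_add, add_sub_cancel_right, Module.End.mul_apply,
    ← Module.End.mul_apply, ← map_mul, mul_comm, h1, map_one, Module.End.one_apply]

/-- Polynomials in the X_l are dense, so a map of Hecke modules commutes with all functions; as A is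
invertible, it then commutes with the σ_k. -/
theorem IsTransfer.map_symm (ha : IsAdmissible p f m) (h : IsTransfer f φ ψ)
    (h' : IsTransfer f φ' ψ') (hL : ∀ r v, L (ψ r v) = ψ' r (L v))
    (r : RUnit 𝕜 (theta hI) (arrows p I) m) (v : V) : L (φ r v) = φ' r (L v) := by
  obtain ⟨ρ, S, hφ, hψ⟩ := h
  obtain ⟨ρ', S', hφ', hψ'⟩ := h'
  have hρ := hψ.map_fun ha hψ' hL
  have hT := hψ.map_T hψ' hL
  refine hφ.map_of hφ' hρ (fun k v => ?_) r v
  rw [sigma_apply ha ρ (S k) k v, map_sub, hρ, hρ, hρ, hT]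
  exact (sigma_apply ha ρ' (S' k) k (L v)).symm

end Transfer

/-! ### Modules from actions. -/

section Modules

/-- The space `V` as a module over an algebra that acts on it. -/
def ActOn {𝕜 A V : Type*} [Field 𝕜] [Ring A] [Algebra 𝕜 A] [AddCommGroup V] [Module 𝕜 V]
    (_ : A →ₐ[𝕜] Module.End 𝕜 V) : Type _ := V

variable {𝕜 A V : Type*} [Field 𝕜] [Ring A] [Algebra 𝕜 A] [AddCommGroup V] [Module 𝕜 V]
  (α : A →ₐ[𝕜] Module.End 𝕜 V)

instance : AddCommGroup (ActOn α) := inferInstanceAs (AddCommGroup V)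

noncomputable instance : Module A (ActOn α) := Module.compHom V α.toRingHom

/-- The space `V` as an object of the category of modules over an algebra that acts on it. -/
noncomputable def actObj {𝕜 A : Type*} {V : Type w} [Field 𝕜] [Ring A] [Algebra 𝕜 A]
    [AddCommGroup V] [Module 𝕜 V] (α : A →ₐ[𝕜] Module.End 𝕜 V) : ModuleCat.{w} A :=
  ModuleCat.of A (ActOn α)

end Modules

/-! ### The functor and its equivalence properties. -/

section Functor

variable {𝕜 : Type u} [Field 𝕜] {p : 𝕜ˣ} {I : Set 𝕜ˣ} {hI : Invariant p I} {m : ℕ}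
  {f : PowerSeries 𝕜}

/-- The action of an algebra on a module. -/
noncomputable abbrev actionOf {A : Type*} [Ring A] [Algebra 𝕜 A] (M : ModuleCat.{w} A) :
    A →ₐ[𝕜] Module.End 𝕜 M := Algebra.lsmul 𝕜 𝕜 M

/-- The identity of `V`, as a map to the module with underlying space `V`. -/
noncomputable def toActOn {A : Type*} [Ring A] [Algebra 𝕜 A] {V : Type w} [AddCommGroup V]
    [Module 𝕜 V] (α : A →ₐ[𝕜] Module.End 𝕜 V) : V ≃ₗ[𝕜] actObj α where
  toFun := id
  invFun := id
  map_add' _ _ := rfl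
  map_smul' c v := (LinearMap.congr_fun (α.commutes c) v).symm
  left_inv _ := rfl
  right_inv _ := rfl

theorem symm_smul {A : Type*} [Ring A] [Algebra 𝕜 A] {V : Type w} [AddCommGroup V]
    [Module 𝕜 V] (α : A →ₐ[𝕜] Module.End 𝕜 V) (a : A) (x : actObj α) :
    (toActOn α).symm (a • x) = α a ((toActOn α).symm x) := rfl

theorem isModI_actObj {V : Type w} [AddCommGroup V] [Module 𝕜 V]
    (ψ : Hecke p m →ₐ[𝕜] Module.End 𝕜 V)
    (h1 : ∀ x : V, ∃ N : Submodule 𝕜 V, FiniteDimensional 𝕜 N ∧ x ∈ N ∧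
      ∀ l : Pos m, ∀ y ∈ N, ψ (hX p m l) y ∈ N)
    (h2 : ∀ (l : Pos m) (c : 𝕜) (x : V), x ≠ 0 → ψ (hX p m l) x = c • x → ∃ z ∈ I, (z : 𝕜) = c) :
    IsModI p m I (actObj ψ) := by
  refine And.intro (fun x => ?_) (fun l _ c x hx hc => ?_)
  · obtain ⟨N, h1, h2, h3⟩ := h1 ((toActOn ψ).symm x)
    have h4 : FiniteDimensional 𝕜 (N.comap (toActOn ψ).symm.toLinearMap) := by
      rw [← Submodule.map_equiv_eq_comap_symm]
      infer_instance
    refine Exists.intro (N.comap (toActOn ψ).symm.toLinearMap) ⟨h4, h2, fun l _ y hy => ?_⟩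
    have := h3 l _ hy
    exact this
  · refine h2 l c ((toActOn ψ).symm x) (fun h => hx ?_) ?_
    · exact (LinearEquiv.map_eq_zero_iff _).1 h
    · rw [← symm_smul, hc, map_smul]

theorem exists_transfer (ha : IsAdmissible p f m)
    (M : Mod0.{u, w} 𝕜 (theta hI) (arrows p I) m) :
    ∃ ψ : Hecke p m →ₐ[𝕜] Module.End 𝕜 M.obj, IsTransfer f (actionOf M.obj) ψ := by
  obtain ⟨h1, h2⟩ := M.property
  refine exists_isTransfer ha (actionOf M.obj) h1 fun ν l hl x => ?_
  obtain ⟨n, hn⟩ := h2 ν l hl x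
  refine ⟨n, ?_⟩
  change (actionOf M.obj (rκ 𝕜 (theta hI) (arrows p I) m ν l) ^ n) x = 0
  rw [← map_pow]
  exact hn

/-- The action of the affine Hecke algebra on a module of `°R_m`. -/
noncomputable def heckeAction (ha : IsAdmissible p f m)
    (M : Mod0.{u, w} 𝕜 (theta hI) (arrows p I) m) : Hecke p m →ₐ[𝕜] Module.End 𝕜 M.obj :=
  (exists_transfer ha M).choose

theorem isTransfer_heckeAction (ha : IsAdmissible p f m)
    (M : Mod0.{u, w} 𝕜 (theta hI) (arrows p I) m) :
    IsTransfer f (actionOf M.obj) (heckeAction ha M) := (exists_transfer ha M).choose_spec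

theorem isModI_heckeAction (ha : IsAdmissible p f m)
    (M : Mod0.{u, w} 𝕜 (theta hI) (arrows p I) m) : IsModI p m I (actObj (heckeAction ha M)) := by
  obtain ⟨ρ, S, -, hψ⟩ := isTransfer_heckeAction ha M
  exact isModI_actObj _ hψ.locallyFinite (hψ.eigenvalue ha.coeff_zero)

/-- The functor from modules of `°R_m` to modules of the affine Hecke algebra. -/
noncomputable def heckeFunctor (ha : IsAdmissible p f m) :
    Mod0.{u, w} 𝕜 (theta hI) (arrows p I) m ⥤ ModI.{u, w} p m I where
  obj M := ⟨actObj (heckeAction ha M), isModI_heckeAction ha M⟩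
  map {M N} g := ObjectProperty.homMk (ModuleCat.ofHom
    { toFun := g.hom
      map_add' := map_add g.hom.hom
      map_smul' := fun r x => (isTransfer_heckeAction ha M).map (isTransfer_heckeAction ha N)
        (L := g.hom.hom.restrictScalars 𝕜) (fun r v => map_smul g.hom.hom r v) r x })
  map_id _ := rfl
  map_comp _ _ := rfl

instance (ha : IsAdmissible p f m) : (heckeFunctor.{u, w} (hI := hI) ha).Faithful where
  map_injective {M N} g g' h := by
    apply ObjectProperty.hom_ext
    ext x
    exact congrArg (fun h => h.hom x) h

/-- A Hecke-linear map between the images is, on the unchanged underlying spaces, °R_m-linear by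
`IsTransfer.map_symm`. -/
instance (ha : IsAdmissible p f m) : (heckeFunctor.{u, w} (hI := hI) ha).Full where
  map_surjective {M N} g := by
    let L : M.obj →ₗ[𝕜] N.obj := (toActOn (heckeAction ha N)).symm.toLinearMap.comp
      ((g.hom.hom.restrictScalars 𝕜).comp (toActOn (heckeAction ha M)).toLinearMap)
    have hL : ∀ r v, L (heckeAction ha M r v) = heckeAction ha N r (L v) := fun r v =>
      congrArg (toActOn (heckeAction ha N)).symm (map_smul g.hom.hom r _)
    refine ⟨ObjectProperty.homMk (ModuleCat.ofHom
      { toFun := L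
        map_add' := map_add L
        map_smul' := fun r x => (isTransfer_heckeAction ha M).map_symm ha
          (isTransfer_heckeAction ha N) hL r x }), ?_⟩
    apply ObjectProperty.hom_ext
    ext x
    rfl

/-- An action on a vector space comes from a module. -/
theorem exists_module {A : Type*} [Ring A] [Algebra 𝕜 A] {V : Type w} [AddCommGroup V]
    [Module 𝕜 V] (α : A →ₐ[𝕜] Module.End 𝕜 V) :
    ∃ (M : ModuleCat.{w} A) (E : V ≃ₗ[𝕜] M), ∀ a v, E (α a v) = a • E v :=
  ⟨actObj α, toActOn α, fun _ _ => rfl⟩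

theorem IsRAction.isMod0 {V : Type w} [AddCommGroup V] [Module 𝕜 V]
    {φ : RUnit 𝕜 (theta hI) (arrows p I) m →ₐ[𝕜] Module.End 𝕜 V}
    {ρ : Fun 𝕜 (theta hI) m →ₐ[𝕜] Module.End 𝕜 V} {S : Ref m → Module.End 𝕜 V}
    (hφ : IsRAction φ ρ S) (M : ModuleCat.{w} (RUnit 𝕜 (theta hI) (arrows p I) m))
    (E : V ≃ₗ[𝕜] M) (hE : ∀ a v, E (φ a v) = a • E v) :
    IsMod0 𝕜 (theta hI) (arrows p I) m M := by
  refine And.intro (fun x => ?_) fun ν l _ x => ?_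
  · rw [← E.apply_symm_apply x]
    have hmem := hφ.mem_closure (E.symm x)
    generalize E.symm x = v at hmem ⊢
    induction hmem using AddSubgroup.closure_induction with
    | mem y hy =>
      obtain ⟨ν, i, hy⟩ := hy
      refine AddSubgroup.subset_closure ⟨ν, i, ?_⟩
      rw [← hE]
      exact congrArg E hy
    | zero => rw [map_zero]; exact zero_mem _
    | add y z _ _ hy hz => rw [map_add]; exact add_mem hy hz
    | neg y _ hy => rw [map_neg]; exact neg_mem hy
  · obtain ⟨n, hn⟩ := hφ.nilpotent ν l (E.symm x)
    rw [act_apply, ← map_pow] at hn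
    refine ⟨n, ?_⟩
    have h1 := hE (gen 𝕜 (arrows p I) ν (eκ 𝕜 _ m ν.1 l) ^ n) (E.symm x)
    rw [hn, map_zero, E.apply_symm_apply] at h1
    exact h1.symm

theorem exists_mod0 [IsAlgClosed 𝕜] (ha : IsAdmissible p f m) (N : ModI.{u, w} p m I) :
    ∃ (φ : RUnit 𝕜 (theta hI) (arrows p I) m →ₐ[𝕜] Module.End 𝕜 N.obj)
      (M : Mod0.{u, w} 𝕜 (theta hI) (arrows p I) m) (E : N.obj ≃ₗ[𝕜] M.obj),
      IsTransfer f φ (actionOf N.obj) ∧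
        ∀ (r : RUnit 𝕜 (theta hI) (arrows p I) m) v, E (φ r v) = r • E v := by
  obtain ⟨φ, hφ⟩ := exists_isTransfer_symm (hI := hI) ha (actionOf N.obj)
    N.property.1 N.property.2
  obtain ⟨ρ, S, hφ', -⟩ := id hφ
  obtain ⟨M, E, hE⟩ := exists_module (A := RUnit 𝕜 (theta hI) (arrows p I) m) φ
  exact ⟨φ, ⟨M, hφ'.isMod0 M E hE⟩, E, hφ, hE⟩

/-- The action of °R_m recovered on N gives a module M, and `heckeAction` on M is chosen by
existence only. `IsTransfer.map` identifies it with the original action on N, since both are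
transfers of isomorphic actions of °R_m. -/
theorem exists_hecke_equiv [IsAlgClosed 𝕜] (ha : IsAdmissible p f m) (N : ModI.{u, w} p m I) :
    ∃ M : Mod0.{u, w} 𝕜 (theta hI) (arrows p I) m,
      Nonempty (N.obj ≃ₗ[Hecke p m] actObj (heckeAction ha M)) := by
  obtain ⟨φ, M, E, hφ, hE⟩ := exists_mod0 (hI := hI) ha N
  have h1 : ∀ (r : Hecke p m) (x : N.obj), E (r • x) = heckeAction ha M r (E x) :=
    hφ.map (isTransfer_heckeAction ha M) (L := E.toLinearMap) hE
  exact ⟨M, ⟨{ E.toAddEquiv.trans (toActOn (heckeAction ha M)).toAddEquiv with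
    map_smul' := h1 }⟩⟩

instance [IsAlgClosed 𝕜] (ha : IsAdmissible p f m) :
    (heckeFunctor.{u, w} (hI := hI) ha).EssSurj where
  mem_essImage N := by
    obtain ⟨M, ⟨E⟩⟩ := exists_hecke_equiv (hI := hI) ha N
    exact ⟨M, ⟨ObjectProperty.isoMk _ E.toModuleIso.symm⟩⟩

end Functor

end TypeD

set_option maxHeartbeats 1000000 in
theorem theorem2p6 {𝕜 : Type u} [Field 𝕜] [IsAlgClosed 𝕜] [CharZero 𝕜]
    (p : 𝕜ˣ) (hp1 : p ≠ 1) (hp2 : p ≠ -1)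
    (I : Set 𝕜ˣ) (hI : TypeD.Invariant p I) (hI1 : (1 : 𝕜ˣ) ∉ I) (hI2 : (-1 : 𝕜ˣ) ∉ I)
    (m : ℕ) (hm : 1 ≤ m)
    (f : PowerSeries 𝕜) (hf0 : PowerSeries.coeff 0 f = 1) (hf1 : PowerSeries.coeff 1 f = 1)
    (hf : 1 < m → f * PowerSeries.rescale (-1) f = 1) :
    ∃ (E : TypeD.Mod0.{u, w} 𝕜 (TypeD.theta hI) (TypeD.arrows p I) m ≌ TypeD.ModI.{u, w} p m I)
      (e : ∀ M : TypeD.Mod0.{u, w} 𝕜 (TypeD.theta hI) (TypeD.arrows p I) m,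
        M.obj ≃ₗ[𝕜] (E.functor.obj M).obj),
      -- the identifications `e` of `M` with its image are natural in `M`
      (∀ (M N : TypeD.Mod0.{u, w} 𝕜 (TypeD.theta hI) (TypeD.arrows p I) m) (φ : M ⟶ N) (x : M.obj),
        e N (φ.hom x) = (E.functor.map φ).hom (e M x)) ∧
      ∀ (M : TypeD.Mod0.{u, w} 𝕜 (TypeD.theta hI) (TypeD.arrows p I) m)
        (ν : TypeD.DimVec (TypeD.theta hI) m) (i : TypeD.Seq (TypeD.theta hI) m ν.1) (x : M.obj),
        TypeD.r1 𝕜 (TypeD.theta hI) (TypeD.arrows p I) m ν i • x = x →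
        (∀ l : TypeD.Pos m, 1 ≤ l.1 →
          TypeD.hX p m l • e M x =
            e M (((i.1 l : 𝕜ˣ) : 𝕜)⁻¹ •
              TypeD.ev1 f (TypeD.rκ 𝕜 (TypeD.theta hI) (TypeD.arrows p I) m ν l) x)) ∧
        (∀ k : TypeD.Ref m,
          TypeD.hT p m k • e M x =
            e M (TypeD.ev2 (TypeD.coefSigma p f (i.1 k.lo) (i.1 k.hi))
                  (TypeD.rκ 𝕜 (TypeD.theta hI) (TypeD.arrows p I) m ν k.lo)
                  (TypeD.rκ 𝕜 (TypeD.theta hI) (TypeD.arrows p I) m ν k.hi)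
                  (TypeD.rσ 𝕜 (TypeD.theta hI) (TypeD.arrows p I) m ν k • x) +
                TypeD.ev2 (TypeD.coefOne p f (i.1 k.lo) (i.1 k.hi))
                  (TypeD.rκ 𝕜 (TypeD.theta hI) (TypeD.arrows p I) m ν k.lo)
                  (TypeD.rκ 𝕜 (TypeD.theta hI) (TypeD.arrows p I) m ν k.hi) x)) := by
  have ha : TypeD.IsAdmissible p f m := ⟨hf0, hf1, hp1, hp2, hf⟩
  have : (TypeD.heckeFunctor.{u, w} (hI := hI) ha).IsEquivalence := {}
  refine ⟨(TypeD.heckeFunctor.{u, w} (hI := hI) ha).asEquivalence,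
    -- Objects keep their vector space and morphisms their underlying map, so the identification is
    -- the identity and naturality holds by definition.
    fun M => TypeD.toActOn (TypeD.heckeAction ha M), fun M N g x => rfl, fun M ν i x hx => ?_⟩
  obtain ⟨ρ, S, hφ, hψ⟩ := TypeD.isTransfer_heckeAction ha M
  have hx' : ρ (TypeD.atWt i.wt 1) x = x := by
    rw [← hφ.idem]
    exact hx
  exact ⟨fun l hl => congrArg (TypeD.toActOn (TypeD.heckeAction ha M))
      (hφ.hX_apply hψ ν i l hl hx'),
    fun k => congrArg (TypeD.toActOn (TypeD.heckeAction ha M)) (hφ.hT_apply hψ ν i k hx')⟩
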